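/- **Setting.** Let $d,M\in\mathbb N$, $\lambda\in\mathbb R$, $\mathbb T^d=(\mathbb R/2\pi\mathbb Z)^d$, and let $\kappa_1,\dots,\kappa_M\in\mathbb R^d$ be pairwise different wave vectors. Only parameters $\varepsilon>0$ with $\kappa_m/\varepsilon\in\mathbb Z^d$ for all $m$ are considered ("admissible" $\varepsilon$). Let $a_m^0=a^0_{m,\varepsilon}:\mathbb T^d\to\mathbb C$ ($m=1,\dots,M$, $\varepsilon\le 1$) be smooth profiles whose derivatives of every order are bounded independently of $\varepsilon$. Consider $$\mathrm i\varepsilon\,\partial_t u+\tfrac{\varepsilon^2}{2}\Delta u=\varepsilon\lambda|u|^2u,\qquad u(0,x)=\sum_{m=1}^M a_m^0(x)\,e^{\mathrm i\kappa_m\cdot x/\varepsilon}\qquad(x\in\mathbb T^d).\tag{1}$$ **Resonances.** For a set $K=\{\kappa_1,\dots,\kappa_R\}$ of pairwise different wave vectors put $\omega_r=\frac12|\kappa_r|^2$, and for $\nu=(i,j,k)\in\{1,\dots,R\}^3$ put $\kappa_\nu=\kappa_i-\kappa_j+\kappa_k$, $\omega_\nu=\omega_i-\omega_j+\omega_k$,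 $\omega_\nu^\star=\frac12|\kappa_\nu|^2$, $\delta_\nu=\omega_\nu-\omega_\nu^\star$. The triple $\nu$ is resonant if $\delta_\nu=0$; $\mathcal N=\mathcal N(K)$ denotes the set of nonresonant triples. Let $\widehat K$ be the union of $K$ with all $\kappa_\mu$ for resonant triples $\mu$, all $\kappa_\mu-\kappa_p+\kappa_q$ with $\mu\in\mathcal N$ and $\omega_\mu-\omega_p+\omega_q=\frac12|\kappa_\mu-\kappa_p+\kappa_q|^2$, and all $\kappa_p-\kappa_\mu+\kappa_q$ with $\mu\in\mathcal N$ and $\omega_p-\omega_\mu+\omega_q=\frac12|\kappa_p-\kappa_\mu+\kappa_q|^2$. Let $K_0=\{\kappa_1,\dots,\kappa_M\}$ and $K_{n+1}=\widehat{K_n}$. *Assumption 1 (saturation).* $K_{k_\star+1}=K_{k_\star}$ for some $k_\star\ge0$. Write $K=K_{k_\star}=\{\kappa_1,\dots,\kappa_R\}$, $R\ge M$, $\mathcal N=\mathcal N(K)$. *Assumption 2 (nonresonance).* For all $\nu\in\mathcal N$ and $p,q,r\in\{1,\dots,R\}$ with $q\neq r$: $\ \omega_\nu^\star-\omega_q+\omega_r\ne\frac12|\kappa_\nu-\kappa_q+\kappa_r|^2$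 and $\omega_p-\omega_\nu^\star+\omega_r\neq\frac12|\kappa_p-\kappa_\nu+\kappa_r|^2$. **Modulation functions.** With $$b_\nu=\frac1{\delta_\nu}\,a_i\bar a_ja_k\qquad(\nu=(i,j,k)\in\mathcal N),\tag{2}$$ the functions $a_1,\dots,a_R$ are to solve, for $r=1,\dots,R$, $$\begin{aligned}\partial_t a_r+\kappa_r\cdot\nabla a_r-\tfrac{\mathrm i\varepsilon}2\Delta a_r=&-\mathrm i\lambda\sum_{\substack{i,j,k:\\ \kappa_i-\kappa_j+\kappa_k=\kappa_r}}a_i\bar a_ja_k-2\mathrm i\varepsilon\lambda^2\sum_{\substack{\nu\in\mathcal N,\,p,q:\\ \kappa_\nu-\kappa_p+\kappa_q=\kappa_r,\\ \omega_\nu-\omega_p+\omega_q=\omega_r}}b_\nu\bar a_pa_q\\&-\mathrm i\varepsilon\lambda^2\sum_{\substack{\nu\in\mathcal N,\,p,q:\\ \kappa_p-\kappa_\nu+\kappa_q=\kappa_r,\\ \omega_p-\omega_\nu+\omega_q=\omega_r}}a_p\bar b_\nu a_q,\end{aligned}\tag{3}$$ with $a_r(0,\cdot)=a_r^0$ for $r\le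 M$ and $a_r(0,\cdot)=0$ for $r>M$. The functions $b_\nu^\star$, $\nu\in\mathcal N$, are to solve $$\partial_tb_\nu^\star+\kappa_\nu\cdot\nabla b_\nu^\star-\tfrac{\mathrm i\varepsilon}2\Delta b_\nu^\star=-2\mathrm i\lambda\sum_{r=1}^R|a_r|^2\,b_\nu^\star,\qquad b_\nu^\star(0,\cdot)=-b_\nu(0,\cdot).\tag{4}$$ Solutions are classical solutions on $[0,T]\times\mathbb T^d$. Call $T>0$ an *existence time* if there are $\varepsilon_1>0$ and $B$ such that for every admissible $\varepsilon<\varepsilon_1$ the system (3) with (2) has a solution on $[0,T]$ with $|a_r|\le B$ for all $r$. **Theorem.** Under Assumptions 1 and 2 an existence time exists. For every existence time $T$ there are $\varepsilon_0>0$ and constants $C,B_0,B_1,\dots$ such that for every admissible $\varepsilon\in(0,\varepsilon_0)$ the following holds. 1. The problems (1), (3) with (2), and (4) have unique solutions $u$, $(a_r)$, $b_\nu^\star$ on $[0,T]\times\mathbb T^d$. 2. All $a_r$, $b_\nu$, $b_\nu^\star$ are smooth on $[0,T]\times\mathbb T^d$, with derivatives of order $n$ in $(t,x)$ bounded by $B_n$,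 $n=0,1,2,\dots$ 3. For $\nu=(i,j,k)\in\mathcal N$, the problem $$\partial_t\beta+\kappa_\nu\cdot\nabla\beta-\tfrac{\mathrm i\varepsilon}2\Delta\beta-\tfrac{\mathrm i\delta_\nu}{\varepsilon}\beta=-\tfrac{\mathrm i}{\varepsilon}a_i\bar a_ja_k,\qquad\beta(0,\cdot)=\tfrac1{\delta_\nu}(a_i\bar a_ja_k)(0,\cdot)$$ has a unique solution $\beta$, and $|b_\nu-\beta|\le C\varepsilon$ on $[0,T]\times\mathbb T^d$. 4. With $$u_{\mathrm{MFE}}=\sum_{r=1}^Ra_r\,e^{\mathrm i(\kappa_r\cdot x-\omega_rt)/\varepsilon}+\varepsilon\lambda\sum_{\nu\in\mathcal N}b^\star_\nu\,e^{\mathrm i(\kappa_\nu\cdot x-\omega^\star_\nu t)/\varepsilon}+\varepsilon\lambda\sum_{\nu\in\mathcal N}b_\nu\,e^{\mathrm i(\kappa_\nu\cdot x-\omega_\nu t)/\varepsilon},$$ the error satisfies $\max_{[0,T]\times\mathbb T^d}|u-u_{\mathrm{MFE}}|\le C\varepsilon^2$. -/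

import Mathlib

open Set
open scoped ContDiff

namespace MFE

noncomputable section

/-- The space `ℝ^d` with the Euclidean norm. Functions on the torus `(ℝ/2πℤ)^d` are represented by
functions on `ℝ^d` that are `2π`-periodic in every coordinate. -/
abbrev E (d : ℕ) := EuclideanSpace ℝ (Fin d)

/-! ### Wave vectors, frequencies, resonances -/

/-- The free frequency `|k|²/2` of a wave vector `k`. -/
def freq {d : ℕ} (k : E d) : ℝ := ‖k‖ ^ 2 / 2

/-- `κ_ν = κ_i - κ_j + κ_k`. Triples of indices are represented by the triples of the corresponding
(pairwise different) wave vectors. -/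
def kap {d : ℕ} (ν : E d × E d × E d) : E d := ν.1 - ν.2.1 + ν.2.2

/-- `ω_ν = ω_i - ω_j + ω_k`. -/
def om {d : ℕ} (ν : E d × E d × E d) : ℝ := freq ν.1 - freq ν.2.1 + freq ν.2.2

/-- `ω_ν^⋆ = |κ_ν|²/2`. -/
def omStar {d : ℕ} (ν : E d × E d × E d) : ℝ := freq (kap ν)

/-- `δ_ν = ω_ν - ω_ν^⋆`. -/
def delta {d : ℕ} (ν : E d × E d × E d) : ℝ := om ν - omStar ν

/-- All triples with entries in `K`. -/
def triples {d : ℕ} (K : Finset (E d)) : Finset (E d × E d × E d) := K ×ˢ K ×ˢ K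

open Classical in
/-- The set `𝒩` of nonresonant triples. -/
def nonres {d : ℕ} (K : Finset (E d)) : Finset (E d × E d × E d) :=
  (triples K).filter (fun ν => om ν ≠ omStar ν)

open Classical in
/-- The map `K ↦ K̂`: add the wave vectors of all resonant triples `μ`, and those of all resonant
quintuples `(μ,p,q)` and `(p,μ,q)` with a nonresonant triple `μ`. -/
def augment {d : ℕ} (K : Finset (E d)) : Finset (E d) :=
  K ∪ ((triples K).filter (fun μ => om μ = omStar μ)).image kap
    ∪ ((nonres K ×ˢ K ×ˢ K).filter (fun z =>
        om z.1 - freq z.2.1 + freq z.2.2 = freq (kap z.1 - z.2.1 + z.2.2))).image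
          (fun z => kap z.1 - z.2.1 + z.2.2)
    ∪ ((nonres K ×ˢ K ×ˢ K).filter (fun z =>
        freq z.2.1 - om z.1 + freq z.2.2 = freq (z.2.1 - kap z.1 + z.2.2))).image
          (fun z => z.2.1 - kap z.1 + z.2.2)

open Classical in
/-- The sets `K_n`: `K_0 = {κ_1, …, κ_M}` and `K_{n+1}` is the augmentation of `K_n`. -/
def waveSet {d M : ℕ} (κ : Fin M → E d) (n : ℕ) : Finset (E d) :=
  augment^[n] (Finset.univ.image κ)

/-- The nonresonance condition on the (saturated) set `K` of wave vectors. -/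
def Nonresonance {d : ℕ} (K : Finset (E d)) : Prop :=
  ∀ ν ∈ nonres K, ∀ p ∈ K, ∀ q ∈ K, ∀ r ∈ K, q ≠ r →
    omStar ν - freq q + freq r ≠ freq (kap ν - q + r) ∧
    freq p - omStar ν + freq r ≠ freq (p - kap ν + r)

/-! ### Functions on `[0,T] × 𝕋^d` -/

/-- `2π`-periodicity in every coordinate. -/
def Periodic {d : ℕ} (f : E d → ℂ) : Prop :=
  ∀ (j : Fin d) (x : E d), f (x + EuclideanSpace.single j (2 * Real.pi)) = f x

/-- Regularity of a classical solution on `[0,T] × 𝕋^d`: the function is differentiable in time and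
twice continuously differentiable in space, the spatial derivatives up to order two being jointly
continuous. -/
structure IsClassical {d : ℕ} (T : ℝ) (f : ℝ → E d → ℂ) : Prop where
  periodic : ∀ t ∈ Icc 0 T, Periodic (f t)
  contDiff : ∀ t ∈ Icc 0 T, ContDiff ℝ 2 (f t)
  continuousOn : ∀ n ≤ 2, ContinuousOn (fun z : ℝ × E d => iteratedFDeriv ℝ n (f z.1) z.2)
    (Icc 0 T ×ˢ univ)
  differentiable : ∀ t ∈ Icc 0 T, ∀ x : E d,
    DifferentiableWithinAt ℝ (fun s => f s x) (Icc 0 T) t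

/-- The time derivative `∂_t f (t,x)` on `[0,T]` (one-sided at the end points). -/
def dt {d : ℕ} (T : ℝ) (f : ℝ → E d → ℂ) (t : ℝ) (x : E d) : ℂ :=
  derivWithin (fun s => f s x) (Icc 0 T) t

/-- The spatial Laplacian `Δ_x f (t,x)`. -/
def lap {d : ℕ} (f : ℝ → E d → ℂ) (t : ℝ) (x : E d) : ℂ := Laplacian.laplacian (f t) x

/-- The advected Schrödinger operator `∂_t f + k · ∇_x f - (iε/2) Δ_x f`. -/
def advected {d : ℕ} (T ε : ℝ) (k : E d) (f : ℝ → E d → ℂ) (t : ℝ) (x : E d) : ℂ :=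
  dt T f t x + fderiv ℝ (f t) x k - Complex.I * ε / 2 * lap f t x

/-- `f` is, on `[0,T] × 𝕋^d`, the unique function with property `P`. -/
def IsUniqueOn {d : ℕ} (T : ℝ) (P : (ℝ → E d → ℂ) → Prop) (f : ℝ → E d → ℂ) : Prop :=
  P f ∧ ∀ g, P g → ∀ t ∈ Icc 0 T, ∀ x, g t x = f t x

/-- `f` is smooth on `[0,T] × 𝕋^d`, and its derivatives of order `n` in `(t,x)` are bounded
by `B n`. -/
def SmoothBound {d : ℕ} (T : ℝ) (B : ℕ → ℝ) (f : ℝ → E d → ℂ) : Prop :=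
  ContDiffOn ℝ ∞ (fun z : ℝ × E d => f z.1 z.2) (Icc 0 T ×ˢ univ) ∧
  ∀ n : ℕ, ∀ z ∈ (Icc 0 T ×ˢ univ : Set (ℝ × E d)),
    ‖iteratedFDerivWithin ℝ n (fun z : ℝ × E d => f z.1 z.2) (Icc 0 T ×ˢ univ) z‖ ≤ B n

/-! ### The initial value problem -/

/-- Admissible values of `ε`: positive, with `κ_m / ε ∈ ℤ^d` for all `m`. -/
def Admissible {d M : ℕ} (κ : Fin M → E d) (ε : ℝ) : Prop :=
  0 < ε ∧ ∀ m j, ∃ n : ℤ, κ m j / ε = n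

/-- Smooth periodic initial profiles `a_m^0`, which may depend on `ε`, with derivatives of all orders
bounded independently of `ε`. -/
def SmoothProfiles {d M : ℕ} (κ : Fin M → E d) (a0 : ℝ → Fin M → E d → ℂ) : Prop :=
  (∀ ε, Admissible κ ε → ε ≤ 1 → ∀ m, ContDiff ℝ ∞ (a0 ε m) ∧ Periodic (a0 ε m)) ∧
  ∀ n : ℕ, ∃ B : ℝ, ∀ ε, Admissible κ ε → ε ≤ 1 → ∀ m x,
    ‖iteratedFDeriv ℝ n (a0 ε m) x‖ ≤ B

/-- The oscillatory exponential `exp(i (k·x - w t)/ε)`. -/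
def osc {d : ℕ} (ε : ℝ) (k : E d) (w : ℝ) (t : ℝ) (x : E d) : ℂ :=
  Complex.exp (Complex.I * (((inner ℝ k x - w * t) / ε : ℝ) : ℂ))

/-- `u` is a classical solution on `[0,T] × 𝕋^d` of
`iε ∂_t u + (ε²/2) Δu = ελ |u|² u` with `u(0,x) = ∑_m a_m^0(x) exp(i κ_m·x/ε)`. -/
def SolvesNLS {d M : ℕ} (T ε lam : ℝ) (κ : Fin M → E d) (a0 : Fin M → E d → ℂ)
    (u : ℝ → E d → ℂ) : Prop :=
  IsClassical T u ∧
  (∀ t ∈ Icc 0 T, ∀ x,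
    Complex.I * ε * dt T u t x + (ε : ℂ) ^ 2 / 2 * lap u t x
      = ε * lam * (‖u t x‖ : ℂ) ^ 2 * u t x) ∧
  ∀ x, u 0 x = ∑ m, a0 m x * osc ε (κ m) 0 0 x

/-! ### The modulation functions -/

/-- The product `a_i ā_j a_k` for `ν = (i,j,k)`. The function `a_r` is indexed by the wave
vector `κ_r`. -/
def cubic {d : ℕ} (a : E d → ℝ → E d → ℂ) (ν : E d × E d × E d) (t : ℝ) (x : E d) : ℂ :=
  a ν.1 t x * star (a ν.2.1 t x) * a ν.2.2 t x

/-- `b_ν = δ_ν⁻¹ a_i ā_j a_k`. -/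
def bMod {d : ℕ} (a : E d → ℝ → E d → ℂ) (ν : E d × E d × E d) (t : ℝ) (x : E d) : ℂ :=
  1 / (delta ν : ℂ) * cubic a ν t x

open Classical in
/-- The initial value of `a_r`: it is `a_m^0` if `κ_r = κ_m` for some `m ≤ M` (the `κ_m` being
pairwise different), and zero otherwise. -/
def initMod {d M : ℕ} (κ : Fin M → E d) (a0 : Fin M → E d → ℂ) (r : E d) (x : E d) : ℂ :=
  ∑ m, if κ m = r then a0 m x else 0

open Classical in
/-- The right-hand side of the equation for `a_r`. The sums containing `b_ν` extend over the
quintuples with the wave vector and the frequency of `r`. -/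
def aRHS {d : ℕ} (ε lam : ℝ) (K : Finset (E d)) (a : E d → ℝ → E d → ℂ) (r : E d)
    (t : ℝ) (x : E d) : ℂ :=
  - Complex.I * lam * (∑ ν ∈ triples K, if kap ν = r then cubic a ν t x else 0)
  - 2 * Complex.I * ε * lam ^ 2 *
    (∑ ν ∈ nonres K, ∑ p ∈ K, ∑ q ∈ K,
      if kap ν - p + q = r ∧ om ν - freq p + freq q = freq r
      then bMod a ν t x * star (a p t x) * a q t x else 0)
  - Complex.I * ε * lam ^ 2 *
    (∑ ν ∈ nonres K, ∑ p ∈ K, ∑ q ∈ K,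
      if p - kap ν + q = r ∧ freq p - om ν + freq q = freq r
      then a p t x * star (bMod a ν t x) * a q t x else 0)

/-- The functions `a_r` (`r ∈ K`) are a classical solution on `[0,T] × 𝕋^d` of the system of advected
nonlinear Schrödinger equations. -/
def SolvesA {d M : ℕ} (T ε lam : ℝ) (κ : Fin M → E d) (K : Finset (E d))
    (a0 : Fin M → E d → ℂ) (a : E d → ℝ → E d → ℂ) : Prop :=
  ∀ r ∈ K, IsClassical T (a r) ∧
    (∀ t ∈ Icc 0 T, ∀ x, advected T ε r (a r) t x = aRHS ε lam K a r t x) ∧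
    ∀ x, a r 0 x = initMod κ a0 r x

/-- `bs = b_ν^⋆` is a classical solution of its advected linear Schrödinger equation. -/
def SolvesBStar {d : ℕ} (T ε lam : ℝ) (K : Finset (E d)) (a : E d → ℝ → E d → ℂ)
    (ν : E d × E d × E d) (bs : ℝ → E d → ℂ) : Prop :=
  IsClassical T bs ∧
  (∀ t ∈ Icc 0 T, ∀ x, advected T ε (kap ν) bs t x
    = - Complex.I * lam * (2 * ∑ r ∈ K, (‖a r t x‖ : ℂ) ^ 2) * bs t x) ∧
  ∀ x, bs 0 x = - bMod a ν 0 x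

/-- `β` is a classical solution of the advected linear Schrödinger equation that `b_ν` solves
approximately. -/
def SolvesB {d : ℕ} (T ε : ℝ) (a : E d → ℝ → E d → ℂ) (ν : E d × E d × E d)
    (β : ℝ → E d → ℂ) : Prop :=
  IsClassical T β ∧
  (∀ t ∈ Icc 0 T, ∀ x, advected T ε (kap ν) β t x - Complex.I * delta ν / ε * β t x
    = - (Complex.I / ε) * cubic a ν t x) ∧
  ∀ x, β 0 x = 1 / (delta ν : ℂ) * cubic a ν 0 x

/-- The modulated Fourier expansion. -/
def uMFE {d : ℕ} (ε lam : ℝ) (K : Finset (E d)) (a : E d → ℝ → E d → ℂ)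
    (bs : E d × E d × E d → ℝ → E d → ℂ) (t : ℝ) (x : E d) : ℂ :=
  (∑ r ∈ K, a r t x * osc ε r (freq r) t x)
  + ε * lam * (∑ ν ∈ nonres K, bs ν t x * osc ε (kap ν) (omStar ν) t x)
  + ε * lam * (∑ ν ∈ nonres K, bMod a ν t x * osc ε (kap ν) (om ν) t x)

/-- `T` is an `ε`-independent time of existence for the system of the `a_r`: for all small
admissible `ε` there is a solution on `[0,T]`, and it is bounded by an `ε`-independent constant. -/
def ExistenceTime {d M : ℕ} (lam : ℝ) (κ : Fin M → E d) (K : Finset (E d))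
    (a0 : ℝ → Fin M → E d → ℂ) (T : ℝ) : Prop :=
  ∃ ε₁ > 0, ∃ B : ℝ, ∀ ε, Admissible κ ε → ε < ε₁ →
    ∃ a, SolvesA T ε lam κ K (a0 ε) a ∧ ∀ r ∈ K, ∀ t ∈ Icc 0 T, ∀ x, ‖a r t x‖ ≤ B

end

end MFE

open MFE

/-! The argument takes place in the Wiener algebra `W` of absolutely summable Fourier coefficients,
a commutative Banach star algebra acting as an algebra of functions through the evaluations `W.val`.
Each free evolution generated by k·∇ - (iε/2)Δ, possibly with an additional constant phase,
multiplies every coefficient by a unimodular number (`rot`), hence is an isometry of `W`. In the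
interaction picture (`vf`, `Sol`) the equations for a_r, b_ν^⋆, β and u therefore become ordinary
differential equations with vector fields that are Lipschitz on balls. One Gronwall argument,
`exists_solution_near`, or `exists_sol_near` in the original variables, produces an exact solution
next to any good approximate solution; it yields existence, continuation and the final error bound
alike.

Regularity is a separate matter. Truncated polynomial weights satisfy tame product estimates
(`TameWeight.nrm_mul_le`, `exists_tame_pev`), so rapid decay of the coefficients survives as long as
the unweighted norm stays bounded (`urap_of_sol_of_le`). The equations then convert decay into
uniform bounds for all derivatives in time and space (`DCi.of_sol`, `DCi.exists_smoothBound`).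
Uniqueness among classical solutions is an L² energy estimate (`eq_zero_of_advected`), since
transport and iΔ do not contribute to the derivative of the energy.

A short existence time comes from taking the initial data, constant in time, as approximate
solution. For an arbitrary existence time only sup-norm bounds are given, which the Schrödinger
groups do not preserve, whereas bounds in `W` are needed. The bridge is the system with ε = 0, where
the free evolution is a translation and thus an isometry for the sup norm: there a sup bound
propagates to all pure derivatives (`exists_pdn_sol_le`), and these control the norm of `W`
(`norm_le_of_pdn`). A continuity argument (`exists_uniform_sol`) keeps the transport solution within
O(ε) of the given solution up to time T, and uniform bounds in `W` follow.

For the error, the expansion is inserted into the equation (`residual_eq`). Resonant triples and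
resonant quintuples cancel against the right-hand sides of (3). Nonresonant triples cancel against
the term of size 1/ε that the linear operator produces on b_ν. The diagonal quintuples of b_ν^⋆
cancel against (4). What remains is O(ε²), or of size ε but oscillating with a frequency off the
dispersion relation. The latter terms are removed by corrections of size ε² (`rem_mode`), as in a
normal form. Since b_ν^⋆ = -b_ν initially, the expansion has exactly the initial value of u, and
Gronwall gives the error O(ε²) in `W`, hence uniformly (`exists_nls_near`). The statement on β is
the analogous fact for a linear equation with fast rotation: one further term of the asymptotic
expansion is constructed explicitly (`exists_quasistationary`). -/

open Set
open scoped ContDiff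
open MFE

namespace MFE

open MeasureTheory Filter Topology

noncomputable section

variable {d : ℕ}

/-! ### Periodic functions and the torus -/

/-- The point of the unit torus represented by `x`. -/
def toTorus (x : E d) : UnitAddTorus (Fin d) := fun j => ((x j / (2 * Real.pi) : ℝ) : UnitAddCircle)

/-- A representative of a point of the unit torus. -/
def ofTorus (y : UnitAddTorus (Fin d)) : E d :=
  WithLp.toLp 2 fun j => 2 * Real.pi * (AddCircle.equivIco 1 0 (y j) : ℝ)

/-- The normalised Haar measure of the unit torus. -/
def haarTorus (d : ℕ) : Measure (UnitAddTorus (Fin d)) :=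
  Measure.pi fun _ => AddCircle.haarAddCircle

instance : IsProbabilityMeasure (haarTorus d) := by
  unfold haarTorus; infer_instance

instance : (haarTorus d).IsAddHaarMeasure := by
  unfold haarTorus; infer_instance

lemma toTorus_ofTorus (y : UnitAddTorus (Fin d)) : toTorus (ofTorus y) = y := by
  funext j
  have hpi : (2 * Real.pi) ≠ 0 := by positivity
  simp only [toTorus, ofTorus]
  rw [mul_div_cancel_left₀ _ hpi]
  exact (AddCircle.equivIco (1 : ℝ) 0).symm_apply_apply (y j)

lemma toTorus_add (x h : E d) : toTorus (x + h) = toTorus x + toTorus h := by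
  funext j
  simp [toTorus, add_div]

/-- Since the section `ofTorus` is discontinuous, continuity on the torus cannot be read off through
it; a quotient map allows continuity to be tested after pulling back to `E d`. -/
lemma isOpenQuotientMap_toTorus : IsOpenQuotientMap (toTorus : E d → UnitAddTorus (Fin d)) := by
  have hpi : (2 * Real.pi) ≠ 0 := by positivity
  have h1 : IsOpenQuotientMap (fun (x : Fin d → ℝ) (j : Fin d) => ((x j : ℝ) : UnitAddCircle)) :=
    IsOpenQuotientMap.piMap (fun _ => QuotientAddGroup.isOpenQuotientMap_mk)
  have h2 : IsOpenQuotientMap (fun x : E d => fun j : Fin d => x j / (2 * Real.pi)) := by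
    have h3 := (Homeomorph.piCongrRight (fun _ : Fin d =>
      Homeomorph.mulRight₀ ((2 * Real.pi)⁻¹) (inv_ne_zero hpi))).isOpenQuotientMap
    have h4 := (EuclideanSpace.equiv (Fin d) ℝ).toHomeomorph.isOpenQuotientMap
    have := h3.comp h4
    convert this using 1
    funext x j
    exact div_eq_mul_inv (x j) (2 * Real.pi)
  exact h1.comp h2

lemma single_add_single (j : Fin d) (s t : ℝ) :
    (EuclideanSpace.single j (s + t) : E d)
      = EuclideanSpace.single j s + EuclideanSpace.single j t := by
  ext i
  by_cases h : i = j <;> simp [h]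

lemma Periodic.add_zsmul {f : E d → ℂ} (hf : Periodic f) (j : Fin d) (n : ℤ) (x : E d) :
    f (x + EuclideanSpace.single j ((n : ℝ) * (2 * Real.pi))) = f x := by
  have key : Function.Periodic (fun s : ℝ => f (x + EuclideanSpace.single j s)) (2 * Real.pi) := by
    intro s
    simp only
    rw [single_add_single, ← add_assoc]
    exact hf j _
  have := key.int_mul n 0
  have h0 : (EuclideanSpace.single j (0 : ℝ) : E d) = 0 := by ext i; simp
  simpa [h0] using this

lemma Periodic.add_lattice {f : E d → ℂ} (hf : Periodic f) (n : Fin d → ℤ) (x : E d) :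
    f (x + WithLp.toLp 2 fun j => (n j : ℝ) * (2 * Real.pi)) = f x := by
  have key : ∀ s : Finset (Fin d),
      f (x + ∑ j ∈ s, EuclideanSpace.single j ((n j : ℝ) * (2 * Real.pi))) = f x := by
    intro s
    induction s using Finset.cons_induction with
    | empty => simp
    | cons j s hj ih =>
      rw [Finset.sum_cons, add_comm (EuclideanSpace.single _ _), ← add_assoc, hf.add_zsmul, ih]
  rw [← key Finset.univ]
  congr 2
  ext i
  simp [Finset.sum_apply]

lemma Periodic.eq_of_toTorus {f : E d → ℂ} (hf : Periodic f) {x x' : E d}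
    (h : toTorus x = toTorus x') : f x = f x' := by
  have hpi : (2 * Real.pi) ≠ 0 := by positivity
  have h1 : ∀ j, ∃ n : ℤ, x' j = x j + n * (2 * Real.pi) := by
    intro j
    have := congrFun h j
    simp only [toTorus] at this
    rw [← sub_eq_zero, ← AddCircle.coe_sub, AddCircle.coe_eq_zero_iff] at this
    obtain ⟨n, hn⟩ := this
    refine ⟨-n, ?_⟩
    have h2 : x j - x' j = n * (2 * Real.pi) := by
      rw [← sub_div, eq_div_iff hpi] at hn
      simpa using hn.symm
    push_cast
    linarith
  choose n hn using h1
  rw [← hf.add_lattice n x]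
  congr 1
  ext j
  simp [hn]

lemma Periodic.ofTorus_toTorus {f : E d → ℂ} (hf : Periodic f) (x : E d) :
    f (ofTorus (toTorus x)) = f x :=
  hf.eq_of_toTorus (toTorus_ofTorus _)

/-- The function on the torus induced by a continuous periodic function. -/
lemma Periodic.continuous_ofTorus {f : E d → ℂ} (hf : Periodic f) (hc : Continuous f) :
    Continuous fun y => f (ofTorus y) := by
  rw [isOpenQuotientMap_toTorus.isQuotientMap.continuous_iff]
  have : (fun y => f (ofTorus y)) ∘ toTorus = f := by
    funext x; exact hf.ofTorus_toTorus x
  rw [this]; exact hc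

lemma Periodic.bounded {f : E d → ℂ} (hf : Periodic f) (hc : Continuous f) :
    ∃ C, ∀ x, ‖f x‖ ≤ C := by
  obtain ⟨C, hC⟩ := isCompact_univ.exists_bound_of_continuousOn
    (hf.continuous_ofTorus hc).continuousOn
  exact ⟨C, fun x => by rw [← hf.ofTorus_toTorus x]; exact hC _ (mem_univ _)⟩

lemma Periodic.integrable {f : E d → ℂ} (hf : Periodic f) (hc : Continuous f) :
    Integrable (fun y => f (ofTorus y)) (haarTorus d) :=
  (hf.continuous_ofTorus hc).integrable_of_hasCompactSupport (HasCompactSupport.of_compactSpace _)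

/-- The mean value of a periodic function. -/
def avg (f : E d → ℂ) : ℂ := ∫ y, f (ofTorus y) ∂haarTorus d

lemma Periodic.comp_add {f : E d → ℂ} (hf : Periodic f) (h : E d) :
    Periodic fun x => f (x + h) := by
  intro j x
  simp only
  rw [add_right_comm]; exact hf j _

lemma Periodic.avg_add {f : E d → ℂ} (hf : Periodic f) (h : E d) :
    avg (fun x => f (x + h)) = avg f := by
  unfold avg
  rw [← integral_add_right_eq_self (fun y => f (ofTorus y)) (toTorus h)]
  congr 1
  funext y
  apply hf.eq_of_toTorus
  rw [toTorus_add, toTorus_ofTorus, toTorus_ofTorus]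

lemma Periodic.fderiv {f : E d → ℂ} (hf : Periodic f) (v : E d) :
    Periodic fun x => fderiv ℝ f x v := by
  intro j x
  have : f = fun x => f (x + EuclideanSpace.single j (2 * Real.pi)) := by
    funext x; exact (hf j x).symm
  simp only
  conv_rhs => rw [this]
  rw [fderiv_comp_add_right]

/-- By invariance of Haar measure the mean of f(· + sv) does not depend on s; differentiate under
the integral at s = 0. Applied to products, this is integration by parts on the torus. -/
lemma Periodic.avg_fderiv {f : E d → ℂ} (hf : Periodic f) (hc : ContDiff ℝ 1 f) (v : E d) :
    avg (fun x => _root_.fderiv ℝ f x v) = 0 := by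
  obtain ⟨C, hC⟩ := (hf.fderiv v).bounded ((hc.continuous_fderiv one_ne_zero).clm_apply
    continuous_const)
  have hd : ∀ (x : E d) (s : ℝ),
      HasDerivAt (fun s : ℝ => f (x + s • v)) (_root_.fderiv ℝ f (x + s • v) v) s := by
    intro x s
    have h1 := (hc.differentiable one_ne_zero (x + s • v)).hasFDerivAt
    have h2 : HasDerivAt (fun s : ℝ => x + s • v) v s := by
      simpa using ((hasDerivAt_id s).smul_const v).const_add x
    exact h1.comp_hasDerivAt s h2
  have key := hasDerivAt_integral_of_dominated_loc_of_deriv_le (μ := haarTorus d)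
    (F := fun (s : ℝ) y => f (ofTorus y + s • v))
    (F' := fun s y => _root_.fderiv ℝ f (ofTorus y + s • v) v) (x₀ := (0 : ℝ)) (s := univ)
    (bound := fun _ => C) univ_mem
    (Eventually.of_forall fun s => ((hf.comp_add (s • v)).integrable
      (by have := hc.continuous; fun_prop)).aestronglyMeasurable)
    ((hf.comp_add ((0 : ℝ) • v)).integrable (by have := hc.continuous; fun_prop))
    (((hf.fderiv v).comp_add ((0 : ℝ) • v)).integrable (by
      have := (hc.continuous_fderiv one_ne_zero); fun_prop)).aestronglyMeasurable
    (Eventually.of_forall fun y s _ => hC _) (integrable_const _)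
    (Eventually.of_forall fun y s _ => hd _ _)
  have h2 : (fun s : ℝ => ∫ y, f (ofTorus y + s • v) ∂haarTorus d) = fun _ => avg f := by
    funext s; exact hf.avg_add (s • v)
  rw [h2] at key
  have := key.2.unique (hasDerivAt_const (0 : ℝ) (avg f))
  simpa [avg] using this

/-! ### Exponentials and Fourier coefficients -/

/-- The exponential `exp(i n·x)`. -/
def ex (n : Fin d → ℤ) (x : E d) : ℂ :=
  Complex.exp (Complex.I * ((∑ j, (n j : ℝ) * x j : ℝ) : ℂ))

lemma mFourier_toTorus (n : Fin d → ℤ) (x : E d) :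
    UnitAddTorus.mFourier n (toTorus x) = ex n x := by
  have hpi : (Real.pi : ℂ) ≠ 0 := by exact_mod_cast Real.pi_ne_zero
  simp only [UnitAddTorus.mFourier, ContinuousMap.coe_mk, toTorus, fourier_coe_apply, ex]
  rw [← Complex.exp_sum]
  congr 1
  push_cast
  rw [Finset.mul_sum]
  refine Finset.sum_congr rfl fun j _ => ?_
  field_simp

lemma ex_eq_mFourier (n : Fin d → ℤ) : ex n = fun x => UnitAddTorus.mFourier n (toTorus x) := by
  funext x; rw [mFourier_toTorus]

lemma norm_ex (n : Fin d → ℤ) (x : E d) : ‖ex n x‖ = 1 := by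
  rw [ex, mul_comm]; exact Complex.norm_exp_ofReal_mul_I _

lemma ex_add (m n : Fin d → ℤ) (x : E d) : ex (m + n) x = ex m x * ex n x := by
  rw [← mFourier_toTorus, UnitAddTorus.mFourier_add, mFourier_toTorus, mFourier_toTorus]

lemma ex_neg (n : Fin d → ℤ) (x : E d) : ex (-n) x = star (ex n x) := by
  rw [← mFourier_toTorus, UnitAddTorus.mFourier_neg, mFourier_toTorus]; rfl

@[simp] lemma ex_zero (x : E d) : ex 0 x = 1 := by simp [ex]

lemma ex_add_right (n : Fin d → ℤ) (x y : E d) : ex n (x + y) = ex n x * ex n y := by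
  simp only [ex, ← Complex.exp_add]
  congr 1
  push_cast
  simp only [PiLp.add_apply, Complex.ofReal_add]
  rw [← mul_add, ← Finset.sum_add_distrib]
  congr 1
  refine Finset.sum_congr rfl fun j _ => by ring

lemma periodic_ex (n : Fin d → ℤ) : Periodic (ex n) := by
  intro j x
  rw [ex_add_right]
  have : ex n (EuclideanSpace.single j (2 * Real.pi)) = 1 := by
    rw [ex, Complex.exp_eq_one_iff]
    refine ⟨n j, ?_⟩
    rw [Finset.sum_eq_single j]
    · simp; ring
    · intro b _ hb; simp [hb]
    · simp
  rw [this, mul_one]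

/-- The linear form `h ↦ i n·h`. -/
def iform (n : Fin d → ℤ) : E d →L[ℝ] ℂ :=
  ∑ j, (Complex.I * (n j : ℂ)) • (Complex.ofRealCLM.comp (EuclideanSpace.proj (𝕜 := ℝ) j))

lemma iform_apply (n : Fin d → ℤ) (h : E d) : iform n h = Complex.I * ∑ j, (n j : ℂ) * (h j : ℂ) := by
  simp [iform, Finset.mul_sum, mul_assoc]

lemma ex_eq_exp_iform (n : Fin d → ℤ) : ex n = fun x => Complex.exp (iform n x) := by
  funext y; rw [ex, iform_apply]; congr 2; push_cast; rfl

lemma contDiff_ex (n : Fin d → ℤ) {k : WithTop ℕ∞} : ContDiff ℝ k (ex n) := by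
  rw [ex_eq_exp_iform]
  exact (iform n).contDiff.cexp

lemma hasFDerivAt_ex (n : Fin d → ℤ) (x : E d) : HasFDerivAt (ex n) (ex n x • iform n) x := by
  have h1 : HasFDerivAt (fun x : E d => iform n x) (iform n) x := (iform n).hasFDerivAt
  rw [ex_eq_exp_iform]
  exact h1.cexp

/-- Fourier coefficients of a periodic function. -/
def fcoeff (f : E d → ℂ) (n : Fin d → ℤ) : ℂ :=
  UnitAddTorus.mFourierCoeff (fun y => f (ofTorus y)) n

lemma fcoeff_eq_avg (f : E d → ℂ) (n : Fin d → ℤ) : fcoeff f n = avg (fun x => ex (-n) x * f x) := by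
  unfold fcoeff UnitAddTorus.mFourierCoeff avg
  simp only [ex_eq_mFourier, toTorus_ofTorus, smul_eq_mul]
  rfl

lemma norm_avg_le {f : E d → ℂ} {C : ℝ} (h : ∀ x, ‖f x‖ ≤ C) : ‖avg f‖ ≤ C := by
  have := norm_integral_le_of_norm_le_const (μ := haarTorus d) (f := fun y => f (ofTorus y))
    (C := C) (Eventually.of_forall fun y => h _)
  simpa [avg] using this

lemma norm_fcoeff_le {f : E d → ℂ} {C : ℝ} (h : ∀ x, ‖f x‖ ≤ C) (n : Fin d → ℤ) :
    ‖fcoeff f n‖ ≤ C := by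
  rw [fcoeff_eq_avg]
  exact norm_avg_le fun x => by rw [norm_mul, norm_ex, one_mul]; exact h x

/-- If some n_j is nonzero, `ex n` is a nonzero multiple of its own j-th derivative, which has mean
zero. -/
lemma avg_ex (n : Fin d → ℤ) : avg (ex n) = if n = 0 then 1 else 0 := by
  split_ifs with h
  · subst h; simp [avg]
  · obtain ⟨j, hj⟩ := Function.ne_iff.1 h
    have h1 := (periodic_ex n).avg_fderiv (contDiff_ex n) (EuclideanSpace.single j 1)
    have h2 : (fun x => _root_.fderiv ℝ (ex n) x (EuclideanSpace.single j 1))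
        = fun x => ex n x * (Complex.I * n j) := by
      funext x
      rw [(hasFDerivAt_ex n x).fderiv]
      simp only [_root_.smul_apply, smul_eq_mul, iform_apply]
      rw [Finset.sum_eq_single j] <;> simp +contextual
    rw [h2] at h1
    unfold avg at h1
    rw [integral_mul_const] at h1
    have h3 : (Complex.I * (n j : ℂ)) ≠ 0 := by simpa using hj
    exact (mul_eq_zero.1 h1).resolve_right h3

/-- Integration by parts: the derivative of the product of `ex (-n)` and f has mean zero. -/
lemma fcoeff_fderiv {f : E d → ℂ} (hf : Periodic f) (hc : ContDiff ℝ 1 f) (j : Fin d)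
    (n : Fin d → ℤ) :
    fcoeff (fun x => _root_.fderiv ℝ f x (EuclideanSpace.single j 1)) n
      = Complex.I * n j * fcoeff f n := by
  have hp : Periodic fun x => ex (-n) x * f x := fun i x => by
    simp only [periodic_ex (-n) i x, hf i x]
  have h1 := hp.avg_fderiv ((contDiff_ex (-n)).mul hc) (EuclideanSpace.single j 1)
  have h2 : (fun x => _root_.fderiv ℝ (fun x => ex (-n) x * f x) x (EuclideanSpace.single j 1))
      = fun x => ex (-n) x * _root_.fderiv ℝ f x (EuclideanSpace.single j 1)
        + -(Complex.I * n j) * (ex (-n) x * f x) := by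
    funext x
    have h3 := (hasFDerivAt_ex (-n) x).mul (hc.differentiable one_ne_zero x).hasFDerivAt
    have h4 : iform (-n) (EuclideanSpace.single j (1 : ℝ)) = -(Complex.I * n j) := by
      rw [iform_apply, Finset.sum_eq_single j] <;> simp +contextual
    have h5 := congrArg (fun l => l (EuclideanSpace.single j (1 : ℝ))) h3.fderiv
    refine h5.trans ?_
    simp only [_root_.add_apply, _root_.smul_apply, h4, smul_eq_mul]
    ring
  rw [h2] at h1
  have hpd : Periodic fun x => ex (-n) x * _root_.fderiv ℝ f x (EuclideanSpace.single j 1) :=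
    fun i x => by simp only [periodic_ex (-n) i x, hf.fderiv _ i x]
  have hcont := (contDiff_ex (d := d) (-n) (k := 1)).continuous
  have hcf := hc.continuous
  have hcd := hc.continuous_fderiv one_ne_zero
  unfold avg at h1
  rw [integral_add (hpd.integrable (by fun_prop)) ((hp.integrable (by fun_prop)).const_mul _),
    integral_const_mul] at h1
  rw [fcoeff_eq_avg, fcoeff_eq_avg]
  unfold avg
  linear_combination h1

lemma hasSum_fcoeff {f : E d → ℂ} (hf : Periodic f) (hc : Continuous f)
    (h : Summable (fcoeff f)) (x : E d) : HasSum (fun n => fcoeff f n * ex n x) (f x) := by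
  have := UnitAddTorus.hasSum_mFourier_series_apply_of_summable
    (f := ⟨fun y => f (ofTorus y), hf.continuous_ofTorus hc⟩) h (toTorus x)
  simpa [mFourier_toTorus, hf.ofTorus_toTorus, fcoeff] using! this

/-- Absolute summability permits termwise integration, and orthogonality leaves one term. This makes
an element of `W` determined by its values. -/
lemma fcoeff_of_hasSum {c : (Fin d → ℤ) → ℂ} (hc : Summable fun n => ‖c n‖) {f : E d → ℂ}
    (hf : ∀ x, HasSum (fun n => c n * ex n x) (f x)) (n : Fin d → ℤ) : fcoeff f n = c n := by
  have hcont : ∀ m : Fin d → ℤ, Continuous fun x : E d => ex (-n) x * (c m * ex m x) := fun m => by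
    have h1 := (contDiff_ex (d := d) (-n) (k := 1)).continuous
    have h2 := (contDiff_ex (d := d) m (k := 1)).continuous
    fun_prop
  have hper : ∀ m : Fin d → ℤ, Periodic fun x : E d => ex (-n) x * (c m * ex m x) :=
    fun m i x => by simp only [periodic_ex _ i x]
  have h1 : HasSum (fun m => ∫ y, ex (-n) (ofTorus y) * (c m * ex m (ofTorus y)) ∂haarTorus d)
      (∫ y, ∑' m, ex (-n) (ofTorus y) * (c m * ex m (ofTorus y)) ∂haarTorus d) := by
    apply hasSum_integral_of_summable_integral_norm
    · intro m; exact (hper m).integrable (hcont m)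
    · simpa [norm_ex] using hc
  have h2 : ∀ m, ∫ y, ex (-n) (ofTorus y) * (c m * ex m (ofTorus y)) ∂haarTorus d
      = if m = n then c n else 0 := by
    intro m
    have : ∀ y : UnitAddTorus (Fin d), ex (-n) (ofTorus y) * (c m * ex m (ofTorus y))
        = c m * ex (m - n) (ofTorus y) := by
      intro y; rw [sub_eq_add_neg, ex_add]; ring
    simp only [this]
    rw [integral_const_mul]
    have h3 := avg_ex (m - n)
    unfold avg at h3
    rw [h3]
    by_cases hmn : m = n
    · simp [hmn]
    · simp [hmn, sub_eq_zero]
  simp only [h2] at h1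
  have h4 : ∀ y, ∑' m, ex (-n) (ofTorus y) * (c m * ex m (ofTorus y))
      = ex (-n) (ofTorus y) * f (ofTorus y) := fun y => ((hf _).mul_left _).tsum_eq
  simp only [h4] at h1
  rw [fcoeff_eq_avg]
  exact h1.unique (hasSum_ite_eq n (c n))

/-! ### The Wiener algebra -/

/-- The Wiener algebra: absolutely summable families of Fourier coefficients. -/
def W (d : ℕ) : Type := lp (fun _ : Fin d → ℤ => ℂ) 1

namespace W

instance : NormedAddCommGroup (W d) :=
  inferInstanceAs (NormedAddCommGroup (lp (fun _ : Fin d → ℤ => ℂ) 1))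

instance : NormedSpace ℂ (W d) :=
  inferInstanceAs (NormedSpace ℂ (lp (fun _ : Fin d → ℤ => ℂ) 1))

instance : CompleteSpace (W d) :=
  inferInstanceAs (CompleteSpace (lp (fun _ : Fin d → ℤ => ℂ) 1))

instance : FunLike (W d) (Fin d → ℤ) ℂ :=
  ⟨fun c n => c.1 n, fun _ _ h => Subtype.ext h⟩

@[ext] lemma ext {c e : W d} (h : ∀ n, c n = e n) : c = e := DFunLike.ext _ _ h

lemma summable_norm (c : W d) : Summable fun n => ‖c n‖ := by
  simpa using! (lp.memℓp c).summable (by simp)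

lemma norm_def (c : W d) : ‖c‖ = ∑' n, ‖c n‖ := by
  simpa using! lp.norm_eq_tsum_rpow (p := 1) (by simp) c

/-- The element with given coefficients. -/
def mk (f : (Fin d → ℤ) → ℂ) (hf : Summable fun n => ‖f n‖) : W d :=
  ⟨f, memℓp_gen (by simpa using hf)⟩

@[simp] lemma mk_apply (f : (Fin d → ℤ) → ℂ) (hf) (n) : mk f hf n = f n := rfl
@[simp] lemma add_apply (c e : W d) (n) : (c + e) n = c n + e n := rfl
@[simp] lemma sub_apply (c e : W d) (n) : (c - e) n = c n - e n := rfl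
@[simp] lemma zero_apply (n) : (0 : W d) n = 0 := rfl
@[simp] lemma smul_apply (z : ℂ) (c : W d) (n) : (z • c) n = z * c n := rfl

/-- The coefficient functional. -/
def coord (n : Fin d → ℤ) : W d →+ ℂ where
  toFun c := c n
  map_zero' := rfl
  map_add' _ _ := rfl

@[simp] lemma sum_apply {ι : Type*} (s : Finset ι) (f : ι → W d) (n) :
    (∑ i ∈ s, f i) n = ∑ i ∈ s, f i n := map_sum (coord n) f s

lemma norm_apply_le (c : W d) (n) : ‖c n‖ ≤ ‖c‖ := by
  rw [norm_def]; exact (summable_norm c).le_tsum n fun _ _ => norm_nonneg _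

lemma norm_le_of_le {c : W d} {u : (Fin d → ℤ) → ℝ} (hu : Summable u) (h : ∀ n, ‖c n‖ ≤ u n) :
    ‖c‖ ≤ ∑' n, u n := by
  rw [norm_def]; exact (summable_norm c).tsum_le_tsum h hu

lemma summable_ex (c : W d) (x : E d) : Summable fun n => ‖c n * ex n x‖ := by
  simpa [norm_ex] using summable_norm c

/-- The value at `x` of the Fourier series. -/
def val (x : E d) (c : W d) : ℂ := ∑' n, c n * ex n x

lemma hasSum_val (x : E d) (c : W d) : HasSum (fun n => c n * ex n x) (val x c) :=
  (summable_ex c x).of_norm.hasSum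

lemma apply_eq_fcoeff (c : W d) (n) : c n = fcoeff (fun x => val x c) n :=
  (fcoeff_of_hasSum (summable_norm c) (fun x => hasSum_val x c) n).symm

/-- The coefficients are recovered from the values by integration. Identities in `W` can thus be
verified pointwise in ℂ, which spares all manipulation of multiple convolution series. -/
lemma ext_val {c e : W d} (h : ∀ x, val x c = val x e) : c = e := by
  ext n; rw [apply_eq_fcoeff, apply_eq_fcoeff]; simp only [h]

lemma norm_apply_le_of_val {c : W d} {C : ℝ} (h : ∀ x, ‖val x c‖ ≤ C) (n) : ‖c n‖ ≤ C := by
  rw [apply_eq_fcoeff]; exact norm_fcoeff_le h n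

lemma norm_val_le (x : E d) (c : W d) : ‖val x c‖ ≤ ‖c‖ := by
  rw [norm_def]
  refine (norm_tsum_le_tsum_norm (summable_ex c x)).trans_eq ?_
  simp [norm_ex]

/-- The change of indices in a convolution. -/
def convEquiv (d : ℕ) : (Fin d → ℤ) × (Fin d → ℤ) ≃ (Fin d → ℤ) × (Fin d → ℤ) where
  toFun z := (z.2, z.1 - z.2)
  invFun z := (z.1 + z.2, z.1)
  left_inv z := by simp
  right_inv z := by simp

lemma summable_conv (c e : W d) :
    Summable fun z : (Fin d → ℤ) × (Fin d → ℤ) => ‖c z.2 * e (z.1 - z.2)‖ :=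
  (convEquiv d).summable_iff.2 (Summable.mul_norm (summable_norm c) (summable_norm e))

instance : Mul (W d) where
  mul c e := mk (fun n => ∑' m, c m * e (n - m)) (by
    have h := (summable_conv c e)
    refine Summable.of_nonneg_of_le (fun _ => norm_nonneg _) (fun n => ?_) h.prod
    exact norm_tsum_le_tsum_norm (h.prod_factor n))

lemma mul_apply (c e : W d) (n) : (c * e) n = ∑' m, c m * e (n - m) := rfl

lemma norm_mul_le' (c e : W d) : ‖c * e‖ ≤ ‖c‖ * ‖e‖ := by
  have h := summable_conv c e
  have h1 : ‖c‖ * ‖e‖ = ∑' z : (Fin d → ℤ) × (Fin d → ℤ), ‖c z.2 * e (z.1 - z.2)‖ := by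
    rw [norm_def c, norm_def e, tsum_mul_tsum_of_summable_norm
      (by simpa using summable_norm c) (by simpa using summable_norm e),
      ← (convEquiv d).tsum_eq]
    simp [convEquiv]
  rw [h1, h.tsum_prod, norm_def]
  refine Summable.tsum_le_tsum (fun n => ?_) (summable_norm _) h.prod
  exact norm_tsum_le_tsum_norm (h.prod_factor n)

/-- The Cauchy product of two absolutely convergent series, summed along the fibres of constant
total index, which `convEquiv` makes the first coordinate. -/
lemma val_mul (x : E d) (c e : W d) : val x (c * e) = val x c * val x e := by
  have h1 := tsum_mul_tsum_of_summable_norm (summable_ex c x) (summable_ex e x)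
  rw [← (convEquiv d).tsum_eq] at h1
  have h2 : ∀ z : (Fin d → ℤ) × (Fin d → ℤ), c (convEquiv d z).1 * ex (convEquiv d z).1 x *
      (e (convEquiv d z).2 * ex (convEquiv d z).2 x) = c z.2 * e (z.1 - z.2) * ex z.1 x := by
    intro z
    have : ex z.1 x = ex z.2 x * ex (z.1 - z.2) x := by rw [← ex_add]; congr 1; abel
    rw [this]; simp only [convEquiv, Equiv.coe_fn_mk]; ring
  simp only [h2] at h1
  have h3 : Summable fun z : (Fin d → ℤ) × (Fin d → ℤ) => c z.2 * e (z.1 - z.2) * ex z.1 x := by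
    refine Summable.of_norm ?_
    simpa [norm_ex] using summable_conv c e
  rw [h3.tsum_prod] at h1
  unfold val at *
  rw [h1]
  refine tsum_congr fun n => ?_
  simp only [tsum_mul_right, mul_apply]

/-- The Fourier monomial `exp(i n·x)`. -/
def mono (n : Fin d → ℤ) : W d := mk (fun m => if m = n then 1 else 0)
  (summable_of_ne_finset_zero (s := {n}) (fun m hm => by simp at hm; simp [hm]))

lemma mono_apply (n m : Fin d → ℤ) : mono n m = if m = n then 1 else 0 := rfl

@[simp] lemma val_mono (x : E d) (n : Fin d → ℤ) : val x (mono n) = ex n x := by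
  unfold val
  rw [tsum_eq_single n]
  · simp [mono_apply]
  · intro m hm; simp [mono_apply, hm]

@[simp] lemma norm_mono (n : Fin d → ℤ) : ‖mono n‖ = 1 := by
  rw [norm_def, tsum_eq_single n]
  · simp [mono_apply]
  · intro m hm; simp [mono_apply, hm]

instance : One (W d) := ⟨mono 0⟩

lemma one_def : (1 : W d) = mono 0 := rfl

@[simp] lemma val_one (x : E d) : val x 1 = 1 := by simp [one_def]

lemma val_add (x : E d) (c e : W d) : val x (c + e) = val x c + val x e := by
  unfold val
  rw [← (summable_ex c x).of_norm.tsum_add (summable_ex e x).of_norm]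
  simp [add_mul]

lemma val_smul (x : E d) (z : ℂ) (c : W d) : val x (z • c) = z * val x c := by
  unfold val
  rw [← tsum_mul_left]
  simp [mul_assoc]

@[simp] lemma val_zero (x : E d) : val x 0 = 0 := by simp [val]

/-- Evaluations separate points and respect sums and products, so the ring axioms are inherited from
ℂ. -/
instance : NormedCommRing (W d) where
  left_distrib a b c := ext_val fun x => by simp only [val_mul, val_add]; ring
  right_distrib a b c := ext_val fun x => by simp only [val_mul, val_add]; ring
  zero_mul a := ext_val fun x => by simp [val_mul]
  mul_zero a := ext_val fun x => by simp [val_mul]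
  mul_assoc a b c := ext_val fun x => by simp only [val_mul]; ring
  one_mul a := ext_val fun x => by simp [val_mul]
  mul_one a := ext_val fun x => by simp [val_mul]
  mul_comm a b := ext_val fun x => by simp only [val_mul]; ring
  norm_mul_le := norm_mul_le'
  dist_eq a b := by rw [dist_eq_norm, ← norm_neg]; congr 1; abel

instance : NormOneClass (W d) := ⟨norm_mono 0⟩

instance : NormedAlgebra ℂ (W d) where
  toAlgebra := Algebra.ofModule
    (fun r a b => ext_val fun x => by simp only [val_mul, val_smul]; ring)
    (fun r a b => ext_val fun x => by simp only [val_mul, val_smul]; ring)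
  norm_smul_le r a := norm_smul_le r a

instance : NormedAlgebra ℝ (W d) := NormedAlgebra.restrictScalars ℝ ℂ (W d)

instance : IsScalarTower ℝ ℂ (W d) := ⟨fun a b c => mul_smul (a : ℂ) b c⟩

@[simp] lemma real_smul_apply (r : ℝ) (c : W d) (n) : (r • c) n = (r : ℂ) * c n := rfl

instance : Star (W d) :=
  ⟨fun c => mk (fun n => star (c (-n))) (by
    simpa using! (Equiv.neg (Fin d → ℤ)).summable_iff.2 (summable_norm c))⟩

@[simp] lemma star_apply (c : W d) (n) : (star c) n = star (c (-n)) := rfl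

@[simp] lemma norm_star (c : W d) : ‖star c‖ = ‖c‖ := by
  rw [norm_def, norm_def, ← (Equiv.neg (Fin d → ℤ)).tsum_eq]
  simp

lemma val_star (x : E d) (c : W d) : val x (star c) = star (val x c) := by
  unfold val
  rw [tsum_star, ← (Equiv.neg (Fin d → ℤ)).tsum_eq]
  refine tsum_congr fun n => ?_
  simp [ex_neg, mul_comm]

instance : StarRing (W d) where
  star_involutive a := by ext n; simp
  star_mul a b := ext_val fun x => by simp only [val_star, val_mul, star_mul]
  star_add a b := by ext n; simp

instance : StarModule ℂ (W d) := ⟨fun r a => by ext n; simp⟩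

instance : NormedStarGroup (W d) := ⟨fun c => (norm_star c).le⟩

/-- Evaluation at a point as an algebra homomorphism. -/
def ev (x : E d) : W d →ₐ[ℂ] ℂ where
  toFun := val x
  map_one' := val_one x
  map_mul' := val_mul x
  map_zero' := val_zero x
  map_add' := val_add x
  commutes' r := by rw [Algebra.algebraMap_eq_smul_one, val_smul, val_one]; simp

@[simp] lemma ev_apply (x : E d) (c : W d) : ev x c = val x c := rfl

lemma val_sub (x : E d) (c e : W d) : val x (c - e) = val x c - val x e := map_sub (ev x) c e
lemma val_neg (x : E d) (c : W d) : val x (-c) = -val x c := map_neg (ev x) c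
lemma val_sum {ι : Type*} (x : E d) (s : Finset ι) (c : ι → W d) :
    val x (∑ i ∈ s, c i) = ∑ i ∈ s, val x (c i) := map_sum (ev x) c s

lemma mono_add (m n : Fin d → ℤ) : mono (m + n) = mono m * mono n :=
  ext_val fun x => by simp [val_mul, ex_add]

lemma star_mono (n : Fin d → ℤ) : star (mono n) = mono (-n) :=
  ext_val fun x => by simp only [val_star, val_mono, ex_neg]

lemma mul_mono_apply (c : W d) (m n : Fin d → ℤ) : (c * mono m) n = c (n - m) := by
  rw [mul_apply, tsum_eq_single (n - m)]
  · simp [mono_apply]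
  · intro k hk
    rw [mono_apply, if_neg, mul_zero]
    intro h; apply hk; rw [← h]; abel

/-- Evaluation at a point as a continuous linear map. -/
def evL (x : E d) : W d →L[ℂ] ℂ :=
  (ev x).toLinearMap.mkContinuous 1 fun c => by simpa using norm_val_le x c

/-- The coefficient as a continuous linear map. -/
def coordL (n : Fin d → ℤ) : W d →L[ℂ] ℂ :=
  LinearMap.mkContinuous { toFun := fun c => c n, map_add' := fun _ _ => rfl,
                           map_smul' := fun _ _ => rfl } 1 fun c => by
    simpa using! norm_apply_le c n

end W

/-! ### Uniqueness of classical solutions -/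

lemma fderiv_fderiv_apply {f : E d → ℂ} (hf : ContDiff ℝ 2 f) (e x h : E d) :
    fderiv ℝ (fun y => fderiv ℝ f y e) x h = fderiv ℝ (fderiv ℝ f) x h e := by
  have h1 : DifferentiableAt ℝ (fderiv ℝ f) x :=
    ((hf.fderiv_right (m := 1) (by norm_num)).differentiable one_ne_zero) x
  have := (h1.hasFDerivAt.clm_apply (hasFDerivAt_const e x)).fderiv
  rw [this]; simp

lemma laplacian_eq_sum {f : E d → ℂ} (hf : ContDiff ℝ 2 f) (x : E d) :
    Laplacian.laplacian f x = ∑ j, fderiv ℝ (fun y => fderiv ℝ f y (EuclideanSpace.single j 1)) x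
      (EuclideanSpace.single j 1) := by
  rw [congrFun (InnerProductSpace.laplacian_eq_iteratedFDeriv_orthonormalBasis f
    (EuclideanSpace.basisFun (Fin d) ℝ)) x]
  refine Finset.sum_congr rfl fun j _ => ?_
  rw [fderiv_fderiv_apply hf, iteratedFDeriv_two_apply]
  simp

lemma Periodic.laplacian {f : E d → ℂ} (hf : Periodic f) (hc : ContDiff ℝ 2 f) :
    Periodic (Laplacian.laplacian f) := by
  intro j x
  rw [laplacian_eq_sum hc, laplacian_eq_sum hc]
  exact Finset.sum_congr rfl fun i _ => (hf.fderiv _).fderiv _ j x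

lemma continuous_laplacian {f : E d → ℂ} (hc : ContDiff ℝ 2 f) :
    Continuous (Laplacian.laplacian f) := by
  have : Laplacian.laplacian f = fun x => ∑ j, fderiv ℝ (fun y => fderiv ℝ f y
    (EuclideanSpace.single j 1)) x (EuclideanSpace.single j 1) :=
    funext fun x => laplacian_eq_sum hc x
  rw [this]
  refine continuous_finsetSum _ fun j _ => ?_
  have h1 : ContDiff ℝ 1 fun y => fderiv ℝ f y (EuclideanSpace.single j 1) :=
    (hc.fderiv_right (m := 1) (by norm_num)).clm_apply contDiff_const
  exact (h1.continuous_fderiv one_ne_zero).clm_apply continuous_const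

lemma Periodic.mul {f g : E d → ℂ} (hf : Periodic f) (hg : Periodic g) :
    Periodic fun x => f x * g x := fun j x => by simp only [hf j x, hg j x]

lemma Periodic.star {f : E d → ℂ} (hf : Periodic f) :
    Periodic fun x => star (f x) := fun j x => by simp only [hf j x]

lemma fderiv_star_mul {f g : E d → ℂ} (hf : ContDiff ℝ 1 f) (hg : ContDiff ℝ 1 g) (x v : E d) :
    fderiv ℝ (fun x => star (f x) * g x) x v
      = star (fderiv ℝ f x v) * g x + star (f x) * fderiv ℝ g x v := by
  have h1 := (hf.differentiable one_ne_zero x).hasFDerivAt.star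
  have h2 := (hg.differentiable one_ne_zero x).hasFDerivAt
  refine (congrArg (fun l => l v) (h1.mul h2).fderiv).trans ?_
  simp
  ring

lemma contDiff_star_mul {f g : E d → ℂ} {n : WithTop ℕ∞} (hf : ContDiff ℝ n f)
    (hg : ContDiff ℝ n g) : ContDiff ℝ n (fun x => star (f x) * g x) :=
  (Complex.conjCLE.contDiff.comp hf).mul hg

/-- Twice the real part is the derivative of |f|² in the direction v, which has mean zero. -/
lemma re_avg_transport {f : E d → ℂ} (hf : Periodic f) (hc : ContDiff ℝ 1 f) (v : E d) :
    (avg fun x => star (f x) * fderiv ℝ f x v).re = 0 := by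
  have h1 := (hf.star.mul hf).avg_fderiv (contDiff_star_mul hc hc) v
  simp only [fderiv_star_mul hc hc] at h1
  have hcf := hc.continuous
  have hcd := (hc.continuous_fderiv one_ne_zero).clm_apply (continuous_const (y := v))
  have hi1 := ((hf.fderiv v).star.mul hf).integrable (by fun_prop)
  have hi2 := (hf.star.mul (hf.fderiv v)).integrable (by fun_prop)
  unfold avg at *
  rw [integral_add hi1 hi2] at h1
  have h2 : ∫ y, star (fderiv ℝ f (ofTorus y) v) * f (ofTorus y) ∂haarTorus d
      = star (∫ y, star (f (ofTorus y)) * fderiv ℝ f (ofTorus y) v ∂haarTorus d) := by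
    have := integral_conj (μ := haarTorus d)
      (f := fun y => star (f (ofTorus y)) * fderiv ℝ f (ofTorus y) v)
    refine Eq.trans ?_ this
    congr 1; funext y; simp [mul_comm]
  rw [h2] at h1
  have := congrArg Complex.re h1
  simp at this
  simpa using this

/-- Integration by parts in each coordinate turns the mean into minus the mean of |∂_j f|², a real
number. -/
lemma im_avg_laplacian {f : E d → ℂ} (hf : Periodic f) (hc : ContDiff ℝ 2 f) :
    (avg fun x => star (f x) * Laplacian.laplacian f x).im = 0 := by
  have hc1 : ContDiff ℝ 1 f := hc.of_le (by norm_num)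
  have hcf := hc.continuous
  set D : Fin d → E d → ℂ := fun j x => fderiv ℝ f x (EuclideanSpace.single j 1)
  have hDp : ∀ j, Periodic (D j) := fun j => hf.fderiv _
  have hDc : ∀ j, ContDiff ℝ 1 (D j) := fun j =>
    (hc.fderiv_right (m := 1) (by norm_num)).clm_apply contDiff_const
  have hj : ∀ j, (avg fun x => star (f x) *
      fderiv ℝ (D j) x (EuclideanSpace.single j 1)).im = 0 := by
    intro j
    have h1 := (hf.star.mul (hDp j)).avg_fderiv (contDiff_star_mul hc1 (hDc j))
      (EuclideanSpace.single j 1)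
    simp only [fderiv_star_mul hc1 (hDc j)] at h1
    have c1 := (hDc j).continuous
    have c2 := ((hDc j).continuous_fderiv one_ne_zero).clm_apply
      (continuous_const (y := (EuclideanSpace.single j (1 : ℝ))))
    have hi1 := ((hDp j).star.mul (hDp j)).integrable (by fun_prop)
    have hi2 := (hf.star.mul ((hDp j).fderiv (EuclideanSpace.single j 1))).integrable
      (by fun_prop)
    unfold avg at *
    rw [integral_add hi1 hi2] at h1
    have h2 : (∫ y, star (D j (ofTorus y)) * D j (ofTorus y) ∂haarTorus d).im = 0 := by
      have : ∀ y, star (D j (ofTorus y)) * D j (ofTorus y)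
          = ((‖D j (ofTorus y)‖ ^ 2 : ℝ) : ℂ) := fun y => by
        rw [Complex.star_def, Complex.conj_mul', Complex.ofReal_pow]
      simp only [this]
      exact (congrArg Complex.im (integral_ofReal (𝕜 := ℂ))).trans (Complex.ofReal_im _)
    have h3 := congrArg Complex.im h1
    rw [Complex.add_im] at h3
    change (∫ y, star (D j (ofTorus y)) * D j (ofTorus y) ∂haarTorus d).im + _ = _ at h3
    rw [h2, zero_add] at h3
    exact h3
  have hsum : (avg fun x => star (f x) * Laplacian.laplacian f x)
      = ∑ j, avg fun x => star (f x) * fderiv ℝ (D j) x (EuclideanSpace.single j 1) := by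
    unfold avg
    rw [← integral_finsetSum]
    · congr 1; funext y
      change star (f (ofTorus y)) * Laplacian.laplacian f (ofTorus y) = _
      rw [laplacian_eq_sum hc, Finset.mul_sum]
    · intro j _
      have c2 := ((hDc j).continuous_fderiv one_ne_zero).clm_apply
        (continuous_const (y := (EuclideanSpace.single j (1 : ℝ))))
      exact (hf.star.mul ((hDp j).fderiv (EuclideanSpace.single j 1))).integrable (by fun_prop)
  rw [hsum, Complex.im_sum]
  exact Finset.sum_eq_zero fun j _ => hj j

/-- A compact set containing all representatives `ofTorus y`. -/
lemma exists_compact_ofTorus (d : ℕ) : ∃ S : Set (E d), IsCompact S ∧ ∀ y, ofTorus y ∈ S := by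
  refine ⟨(WithLp.toLp 2) '' (Set.pi univ fun _ : Fin d => Icc (0 : ℝ) (2 * Real.pi)), ?_, ?_⟩
  · exact (isCompact_univ_pi fun _ => isCompact_Icc).image (PiLp.continuous_toLp 2 _)
  · intro y
    refine ⟨_, ?_, rfl⟩
    intro j _
    have h := (AddCircle.equivIco (1 : ℝ) 0 (y j)).2
    have hpi := Real.pi_pos
    simp only [mem_Ico, zero_add] at h
    constructor
    · have := h.1; positivity
    · nlinarith [h.2]

namespace IsClassical

variable {T : ℝ} {f : ℝ → E d → ℂ}

lemma hasDerivAt (hf : IsClassical T f) {t : ℝ} (ht : t ∈ Ioo 0 T) (x : E d) :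
    HasDerivAt (fun s => f s x) (dt T f t x) t :=
  ((hf.differentiable t (Ioo_subset_Icc_self ht) x).hasDerivWithinAt).hasDerivAt
    (Icc_mem_nhds ht.1 ht.2)

/-- `IsClassical` provides continuity on the noncompact set [0,T] × `E d`; the representatives of
torus points lie in a compact cube, where continuity gives bounds. -/
lemma exists_bound (hf : IsClassical T f) (v : E d) : ∃ C, ∀ t ∈ Icc 0 T, ∀ y,
    ‖f t (ofTorus y)‖ ≤ C ∧ ‖fderiv ℝ (f t) (ofTorus y) v‖ ≤ C ∧ ‖lap f t (ofTorus y)‖ ≤ C := by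
  obtain ⟨S, hS, hmem⟩ := exists_compact_ofTorus d
  have hb : ∀ n ≤ 2, ∃ C, ∀ t ∈ Icc 0 T, ∀ x ∈ S, ‖iteratedFDeriv ℝ n (f t) x‖ ≤ C := by
    intro n hn
    obtain ⟨C, hC⟩ := (isCompact_Icc.prod hS).exists_bound_of_continuousOn
      ((hf.continuousOn n hn).mono (prod_mono_right (subset_univ _)))
    exact ⟨C, fun t ht x hx => hC (t, x) ⟨ht, hx⟩⟩
  obtain ⟨C0, h0⟩ := hb 0 (by norm_num)
  obtain ⟨C1, h1⟩ := hb 1 (by norm_num)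
  obtain ⟨C2, h2⟩ := hb 2 le_rfl
  refine ⟨max C0 (max (C1 * ‖v‖) (d * C2)), fun t ht y => ⟨?_, ?_, ?_⟩⟩
  · have := h0 t ht _ (hmem y)
    rw [norm_iteratedFDeriv_zero] at this
    exact this.trans (le_max_left _ _)
  · have := h1 t ht _ (hmem y)
    rw [norm_iteratedFDeriv_one] at this
    exact (((fderiv ℝ (f t) (ofTorus y)).le_opNorm v).trans
      (mul_le_mul_of_nonneg_right this (norm_nonneg _))).trans
      ((le_max_left _ _).trans (le_max_right _ _))
  · have h := h2 t ht _ (hmem y)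
    refine le_trans ?_ ((le_max_right _ _).trans (le_max_right _ _))
    unfold lap
    rw [congrFun (InnerProductSpace.laplacian_eq_iteratedFDeriv_orthonormalBasis (f t)
      (EuclideanSpace.basisFun (Fin d) ℝ)) _]
    refine (norm_sum_le _ _).trans ?_
    have : (d : ℝ) * C2 = ∑ _j : Fin d, C2 := by simp
    rw [this]
    refine Finset.sum_le_sum fun j _ => ?_
    refine ((iteratedFDeriv ℝ 2 (f t) (ofTorus y)).le_opNorm _).trans ?_
    simp [Fin.prod_univ_two]
    exact h

end IsClassical

lemma dt_eq_of_advected {T ε : ℝ} {k : E d} {f : ℝ → E d → ℂ} {t : ℝ} {x : E d} {z : ℂ}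
    (h : advected T ε k f t x = z) :
    dt T f t x = z - fderiv ℝ (f t) x k + Complex.I * ε / 2 * lap f t x := by
  rw [← h, advected]; ring

/-- L² energy method: in the time derivative of the sum of the squared L² norms, transport has zero
real part and the Laplacian enters with an imaginary factor, so only the term with g survives. It is
at most a multiple of the energy, which vanishes initially. -/
theorem eq_zero_of_advected {ι : Type*} [Fintype ι] {T ε C : ℝ} (k : ι → E d)
    (w g : ι → ℝ → E d → ℂ) (hw : ∀ i, IsClassical T (w i))
    (heq : ∀ i, ∀ t ∈ Icc 0 T, ∀ x, advected T ε (k i) (w i) t x = g i t x)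
    (hg : ∀ i, ∀ t ∈ Icc 0 T, Continuous (g i t))
    (hbd : ∀ i, ∀ t ∈ Icc 0 T, ∀ x, ‖g i t x‖ ≤ C * ∑ j, ‖w j t x‖)
    (h0 : ∀ i x, w i 0 x = 0) : ∀ i, ∀ t ∈ Icc 0 T, ∀ x, w i t x = 0 := by
  choose B hB using fun i => (hw i).exists_bound (k i)
  -- Periodicity of g is not assumed: it follows from the equation, as g is the advected operator
  -- applied to a periodic function.
  have hgp : ∀ i, ∀ t ∈ Icc 0 T, Periodic (g i t) := by
    intro i t ht j x
    rw [← heq i t ht, ← heq i t ht]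
    unfold advected
    congr 2
    · unfold dt
      apply derivWithin_congr
      · intro s hs; exact (hw i).periodic s hs j x
      · exact (hw i).periodic t ht j x
    · exact ((hw i).periodic t ht).fderiv _ j x
    · exact ((hw i).periodic t ht).laplacian ((hw i).contDiff t ht) j x
  set F : ℝ → UnitAddTorus (Fin d) → ℝ := fun t y => ∑ i, ‖w i t (ofTorus y)‖ ^ 2
  set F' : ℝ → UnitAddTorus (Fin d) → ℝ := fun t y =>
    ∑ i, 2 * (star (w i t (ofTorus y)) * dt T (w i) t (ofTorus y)).re
  set H : ℝ → ℝ := fun t => ∫ y, F t y ∂haarTorus d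
  have hwc : ∀ i, ∀ t ∈ Icc 0 T, Continuous fun y => w i t (ofTorus y) := fun i t ht =>
    ((hw i).periodic t ht).continuous_ofTorus ((hw i).contDiff t ht).continuous
  have hFc : ∀ t ∈ Icc 0 T, Continuous (F t) := fun t ht =>
    continuous_finsetSum _ fun i _ => (hwc i t ht).norm.pow 2
  have hFi : ∀ t ∈ Icc 0 T, Integrable (F t) (haarTorus d) := fun t ht =>
    (hFc t ht).integrable_of_hasCompactSupport (HasCompactSupport.of_compactSpace _)
  have hfc : ∀ i, ∀ t ∈ Icc 0 T, Continuous fun x => fderiv ℝ (w i t) x (k i) := fun i t ht =>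
    (((hw i).contDiff t ht).continuous_fderiv two_ne_zero).clm_apply continuous_const
  have hlc : ∀ i, ∀ t ∈ Icc 0 T, Continuous (Laplacian.laplacian (w i t)) := fun i t ht =>
    continuous_laplacian ((hw i).contDiff t ht)
  have hdt : ∀ i, ∀ t ∈ Icc 0 T, ∀ x, dt T (w i) t x = g i t x - fderiv ℝ (w i t) x (k i)
      + Complex.I * ε / 2 * lap (w i) t x := fun i t ht x => dt_eq_of_advected (heq i t ht x)
  have hdc : ∀ i, ∀ t ∈ Icc 0 T, Continuous fun y => dt T (w i) t (ofTorus y) := by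
    intro i t ht
    simp only [hdt i t ht, lap]
    have h1 := (hgp i t ht).continuous_ofTorus (hg i t ht)
    have h2 := (((hw i).periodic t ht).fderiv (k i)).continuous_ofTorus (hfc i t ht)
    have h3 := (((hw i).periodic t ht).laplacian ((hw i).contDiff t ht)).continuous_ofTorus
      (hlc i t ht)
    exact (h1.sub h2).add (continuous_const.mul h3)
  have hF'c : ∀ t ∈ Icc 0 T, Continuous (F' t) := by
    intro t ht
    refine continuous_finsetSum _ fun i _ => continuous_const.mul ?_
    exact Complex.continuous_re.comp ((continuous_star.comp (hwc i t ht)).mul (hdc i t ht))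
  have hB0 : ∀ i, 0 < T → 0 ≤ B i := fun i hT =>
    (norm_nonneg _).trans (hB i 0 ⟨le_rfl, hT.le⟩ 0).1
  -- a uniform bound for the time derivatives
  obtain ⟨M, hM⟩ : ∃ M, ∀ t ∈ Icc 0 T, ∀ y, |F' t y| ≤ M := by
    refine ⟨∑ i, 2 * (B i * (|C| * ∑ j, B j + B i + |ε| / 2 * B i)), fun t ht y => ?_⟩
    refine (Finset.abs_sum_le_sum_abs _ _).trans (Finset.sum_le_sum fun i _ => ?_)
    rw [abs_mul, abs_two]
    refine mul_le_mul_of_nonneg_left ((Complex.abs_re_le_norm _).trans ?_) zero_le_two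
    rw [norm_mul, norm_star]
    obtain ⟨b1, b2, b3⟩ := hB i t ht y
    refine mul_le_mul b1 ?_ (norm_nonneg _) ((norm_nonneg _).trans b1)
    rw [hdt i t ht]
    refine (norm_add_le _ _).trans (add_le_add ((norm_sub_le _ _).trans (add_le_add ?_ b2)) ?_)
    · refine (hbd i t ht _).trans ?_
      refine mul_le_mul (le_abs_self C) (Finset.sum_le_sum fun j _ => (hB j t ht y).1)
        (Finset.sum_nonneg fun j _ => norm_nonneg _) (abs_nonneg _)
    · rw [norm_mul]
      refine mul_le_mul (le_of_eq ?_) b3 (norm_nonneg _) (by positivity)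
      simp
  have hderiv : ∀ t ∈ Ioo 0 T, HasDerivAt H (∫ y, F' t y ∂haarTorus d) t := by
    intro t ht
    refine (hasDerivAt_integral_of_dominated_loc_of_deriv_le (s := Ioo 0 T)
      (bound := fun _ => M) (Ioo_mem_nhds ht.1 ht.2) ?_ (hFi t (Ioo_subset_Icc_self ht))
      ((hF'c t (Ioo_subset_Icc_self ht)).aestronglyMeasurable) ?_ (integrable_const _) ?_).2
    · filter_upwards [Ioo_mem_nhds ht.1 ht.2] with s hs
      exact (hFc s (Ioo_subset_Icc_self hs)).aestronglyMeasurable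
    · exact Eventually.of_forall fun y s hs => hM s (Ioo_subset_Icc_self hs) y
    · refine Eventually.of_forall fun y s hs => ?_
      refine HasDerivAt.fun_sum fun i _ => ?_
      have h1 := ((hw i).hasDerivAt hs (ofTorus y))
      have h2 := h1.norm_sq
      exact h2.congr_deriv (by rw [Complex.inner, mul_comm (dt _ _ _ _)]; rfl)
  have hHc : ContinuousOn H (Icc 0 T) := by
    intro t ht
    refine continuousWithinAt_of_dominated (bound := fun _ => ∑ i, B i ^ 2) ?_ ?_
      (integrable_const _) ?_
    · filter_upwards [self_mem_nhdsWithin] with s hs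
      exact (hFc s hs).aestronglyMeasurable
    · filter_upwards [self_mem_nhdsWithin] with s hs
      refine Eventually.of_forall fun y => ?_
      rw [Real.norm_eq_abs, abs_of_nonneg (Finset.sum_nonneg fun i _ => by positivity)]
      exact Finset.sum_le_sum fun i _ => pow_le_pow_left₀ (norm_nonneg _) (hB i s hs y).1 2
    · refine Eventually.of_forall fun y => ?_
      exact tendsto_finsetSum _ fun i _ =>
        ((hw i).differentiable t ht _).continuousWithinAt.norm.pow 2
  set Λ : ℝ := 2 * (|C| * Fintype.card ι)
  have hle : ∀ t ∈ Icc 0 T, ∫ y, F' t y ∂haarTorus d ≤ Λ * H t := by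
    intro t ht
    have hsplit : ∀ i, ∫ y, 2 * (star (w i t (ofTorus y)) * dt T (w i) t (ofTorus y)).re ∂haarTorus d
        = ∫ y, 2 * (star (w i t (ofTorus y)) * g i t (ofTorus y)).re ∂haarTorus d := by
      intro i
      have hp := (hw i).periodic t ht
      have hc := (hw i).contDiff t ht
      have hcc := hc.continuous
      have hc1 : ContDiff ℝ 1 (w i t) := hc.of_le (by norm_num)
      have c1 := hg i t ht
      have c2 := hfc i t ht
      have c3 := hlc i t ht
      have i1 := (hp.star.mul (hgp i t ht)).integrable (by fun_prop)
      have i2 := (hp.star.mul (hp.fderiv (k i))).integrable (by fun_prop)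
      have i3 := (hp.star.mul (hp.laplacian hc)).integrable (by fun_prop)
      have e1 := re_avg_transport hp hc1 (k i)
      have e2 := im_avg_laplacian hp hc
      unfold avg at e1 e2
      rw [integral_const_mul, integral_const_mul]
      congr 1
      have r := fun (φ : UnitAddTorus (Fin d) → ℂ) (hφ : Integrable φ (haarTorus d)) =>
        integral_re hφ
      simp only [RCLike.re_eq_complex_re] at r
      have hfun : (fun y => star (w i t (ofTorus y)) * dt T (w i) t (ofTorus y))
          = fun y => star (w i t (ofTorus y)) * g i t (ofTorus y)
            - star (w i t (ofTorus y)) * fderiv ℝ (w i t) (ofTorus y) (k i)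
            + Complex.I * ε / 2 * (star (w i t (ofTorus y))
              * Laplacian.laplacian (w i t) (ofTorus y)) := by
        funext y
        rw [hdt i t ht, lap]; ring
      have hint : Integrable (fun y => star (w i t (ofTorus y)) * dt T (w i) t (ofTorus y))
          (haarTorus d) := by
        rw [hfun]; exact (i1.sub i2).add (i3.const_mul _)
      have i12 : Integrable (fun y => star (w i t (ofTorus y)) * g i t (ofTorus y)
          - star (w i t (ofTorus y)) * fderiv ℝ (w i t) (ofTorus y) (k i)) (haarTorus d) :=
        i1.sub i2
      rw [r _ hint, r _ i1, hfun, integral_add i12 (i3.const_mul _), integral_sub i1 i2,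
        integral_const_mul, Complex.add_re, Complex.sub_re, e1]
      have e3 : ∀ z : ℂ, z.im = 0 → (Complex.I * ε / 2 * z).re = 0 := by
        intro z hz
        have : Complex.I * ε / 2 * z = ((ε / 2 : ℝ) : ℂ) * (Complex.I * z) := by push_cast; ring
        rw [this, Complex.re_ofReal_mul]; simp [hz]
      rw [e3 _ e2]; ring
    have hint1 : ∀ i, Integrable (fun y => 2 * (star (w i t (ofTorus y))
        * dt T (w i) t (ofTorus y)).re) (haarTorus d) := fun i =>
      Continuous.integrable_of_hasCompactSupport (continuous_const.mul (Complex.continuous_re.comp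
        ((continuous_star.comp (hwc i t ht)).mul (hdc i t ht))))
        (HasCompactSupport.of_compactSpace _)
    have hint2 : ∀ i, Integrable (fun y => 2 * (star (w i t (ofTorus y))
        * g i t (ofTorus y)).re) (haarTorus d) := fun i =>
      Continuous.integrable_of_hasCompactSupport (continuous_const.mul (Complex.continuous_re.comp
        ((continuous_star.comp (hwc i t ht)).mul
          ((hgp i t ht).continuous_ofTorus (hg i t ht)))))
        (HasCompactSupport.of_compactSpace _)
    simp only [F', H]
    rw [integral_finsetSum _ fun i _ => hint1 i, Finset.sum_congr rfl fun i _ => hsplit i,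
      ← integral_finsetSum _ fun i _ => hint2 i, ← integral_const_mul]
    refine integral_mono (integrable_finsetSum _ fun i _ => hint2 i) ((hFi t ht).const_mul _)
      fun y => ?_
    simp only [F, Λ]
    rw [← Finset.mul_sum, mul_assoc]
    refine mul_le_mul_of_nonneg_left ?_ zero_le_two
    calc ∑ i, (star (w i t (ofTorus y)) * g i t (ofTorus y)).re
        ≤ ∑ i, ‖w i t (ofTorus y)‖ * (|C| * ∑ j, ‖w j t (ofTorus y)‖) := by
          refine Finset.sum_le_sum fun i _ => (Complex.re_le_norm _).trans ?_
          rw [norm_mul, norm_star]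
          refine mul_le_mul_of_nonneg_left ((hbd i t ht _).trans ?_) (norm_nonneg _)
          exact mul_le_mul_of_nonneg_right (le_abs_self C)
            (Finset.sum_nonneg fun j _ => norm_nonneg _)
      _ = |C| * (∑ i, ‖w i t (ofTorus y)‖) ^ 2 := by rw [← Finset.sum_mul]; ring
      _ ≤ |C| * (Fintype.card ι * ∑ i, ‖w i t (ofTorus y)‖ ^ 2) := by
          refine mul_le_mul_of_nonneg_left ?_ (abs_nonneg _)
          simpa using sq_sum_le_card_mul_sum_sq (s := Finset.univ)
            (f := fun i => ‖w i t (ofTorus y)‖)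
      _ = |C| * Fintype.card ι * ∑ i, ‖w i t (ofTorus y)‖ ^ 2 := by ring
  -- Gronwall with an integrating factor, so that differentiability of the energy is needed only in
  -- the open interval.
  have hanti : AntitoneOn (fun t => H t * Real.exp (-Λ * t)) (Icc 0 T) := by
    have hd : ∀ t ∈ Ioo 0 T, HasDerivAt (fun t => H t * Real.exp (-Λ * t))
        ((∫ y, F' t y ∂haarTorus d) * Real.exp (-Λ * t)
          + H t * (Real.exp (-Λ * t) * (-Λ))) t := by
      intro t ht
      have h2 : HasDerivAt (fun t => Real.exp (-Λ * t)) (Real.exp (-Λ * t) * (-Λ)) t := by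
        have := ((hasDerivAt_id t).const_mul (-Λ)).exp
        simpa using this
      exact (hderiv t ht).mul h2
    refine antitoneOn_of_deriv_nonpos (convex_Icc 0 T) ?_ ?_ ?_
    · exact hHc.mul (by fun_prop)
    · rw [interior_Icc]
      intro t ht
      exact (hd t ht).differentiableAt.differentiableWithinAt
    · rw [interior_Icc]
      intro t ht
      rw [(hd t ht).deriv]
      have := hle t (Ioo_subset_Icc_self ht)
      have he := Real.exp_pos (-Λ * t)
      nlinarith
  intro i t ht x
  have hT : 0 ≤ T := ht.1.trans ht.2
  have hH0 : H 0 = 0 := by simp [H, F, h0]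
  have h1 := hanti ⟨le_rfl, hT⟩ ht ht.1
  simp only [hH0, zero_mul] at h1
  have h2 : H t ≤ 0 := by
    have he := Real.exp_pos (-Λ * t)
    by_contra h; push Not at h
    nlinarith [mul_pos h he]
  have hFn : ∀ y, 0 ≤ F t y := fun y => Finset.sum_nonneg fun i _ => by positivity
  have h3 : H t = 0 := le_antisymm h2 (integral_nonneg hFn)
  -- A continuous nonnegative function with zero integral vanishes everywhere, because Haar measure
  -- charges open sets.
  have h4 : F t = 0 := by
    have := (integral_eq_zero_iff_of_nonneg hFn (hFi t ht)).1 h3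
    exact (Continuous.ae_eq_iff_eq (haarTorus d) (hFc t ht) continuous_const).1 this
  have h5 := congrFun h4 (toTorus x)
  simp only [F, Pi.zero_apply] at h5
  have h6 := (Finset.sum_eq_zero_iff_of_nonneg fun i _ => by positivity).1 h5 i (Finset.mem_univ i)
  rw [((hw i).periodic t ht).ofTorus_toTorus] at h6
  simpa using h6

end

end MFE
open Set
open scoped ContDiff
open MFE

namespace MFE

open MeasureTheory Filter Topology

noncomputable section

/-! ### Ordinary differential equations in Banach spaces -/

section ODE

variable {X : Type*} [NormedAddCommGroup X] [NormedSpace ℝ X]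

/-- A cruder form without division by K, which also covers K = 0; it rests on 1 - exp(-s) ≤ s. -/
lemma gronwallBound_le {δ K ε t : ℝ} (hK : 0 ≤ K) (hε : 0 ≤ ε) :
    gronwallBound δ K ε t ≤ (δ + ε * t) * Real.exp (K * t) := by
  rcases eq_or_lt_of_le hK with h | h
  · subst h; simp [gronwallBound_K0]
  · rw [gronwallBound_of_K_ne_0 h.ne', add_mul]
    refine add_le_add le_rfl ?_
    have h1 : Real.exp (K * t) - 1 ≤ K * t * Real.exp (K * t) := by
      have h2 := Real.add_one_le_exp (-(K * t))
      have h3 : Real.exp (-(K * t)) * Real.exp (K * t) = 1 := by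
        rw [← Real.exp_add]; simp
      nlinarith [Real.exp_pos (K * t)]
    calc ε / K * (Real.exp (K * t) - 1) ≤ ε / K * (K * t * Real.exp (K * t)) := by
          gcongr
      _ = ε * t * Real.exp (K * t) := by field_simp

lemma norm_le_of_deriv {f f' : ℝ → X} {K ε δ T : ℝ} (hK : 0 ≤ K) (hε : 0 ≤ ε)
    (hf : ∀ t ∈ Icc 0 T, HasDerivWithinAt f (f' t) (Icc 0 T) t) (h0 : ‖f 0‖ ≤ δ)
    (hbd : ∀ t ∈ Icc 0 T, ‖f' t‖ ≤ K * ‖f t‖ + ε) :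
    ∀ t ∈ Icc 0 T, ‖f t‖ ≤ (δ + ε * t) * Real.exp (K * t) := by
  intro t ht
  have h := norm_le_gronwallBound_of_norm_deriv_right_le
    (fun s hs => (hf s hs).continuousWithinAt)
    (fun s hs => ((hf s ⟨hs.1, hs.2.le⟩).mono_of_mem_nhdsWithin
      (Icc_mem_nhdsGE_of_mem hs))) h0 (fun s hs => hbd s ⟨hs.1, hs.2.le⟩) t ht
  rw [sub_zero] at h
  exact h.trans (gronwallBound_le hK hε)

/-- The radial retraction onto the ball of radius `R`. -/
def ret (R : ℝ) (x : X) : X := (R / max R ‖x‖) • x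

lemma ret_eq {R : ℝ} (hR : 0 < R) {x : X} (hx : ‖x‖ ≤ R) : ret R x = x := by
  rw [ret, max_eq_left hx, div_self hR.ne', one_smul]

lemma norm_ret_le {R : ℝ} (hR : 0 < R) (x : X) : ‖ret R x‖ ≤ R := by
  have h : 0 < max R ‖x‖ := lt_max_of_lt_left hR
  rw [ret, norm_smul, Real.norm_of_nonneg (by positivity), div_mul_eq_mul_div, div_le_iff₀ h]
  exact mul_le_mul_of_nonneg_left (le_max_right _ _) hR.le

/-- One contribution comes from the difference of the points, one from the difference of the scaling
factors. The resulting constant 2 holds in every normed space and reappears as the rate 2Λ in later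
exponentials. -/
lemma norm_ret_sub_le {R : ℝ} (hR : 0 < R) (x y : X) : ‖ret R x - ret R y‖ ≤ 2 * ‖x - y‖ := by
  have hx : 0 < max R ‖x‖ := lt_max_of_lt_left hR
  have hy : 0 < max R ‖y‖ := lt_max_of_lt_left hR
  have e : ret R x - ret R y = (R / max R ‖x‖) • (x - y)
      + (R / max R ‖x‖ - R / max R ‖y‖) • y := by
    simp only [ret, smul_sub, sub_smul]; abel
  rw [e, two_mul]
  refine (norm_add_le _ _).trans (add_le_add ?_ ?_)
  · rw [norm_smul, Real.norm_of_nonneg (by positivity)]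
    refine mul_le_of_le_one_left (norm_nonneg _) ?_
    rw [div_le_one hx]; exact le_max_left _ _
  · rw [norm_smul]
    have h1 : R / max R ‖x‖ - R / max R ‖y‖
        = (R / max R ‖x‖) * ((max R ‖y‖ - max R ‖x‖) / max R ‖y‖) := by
      field_simp
    rw [h1, norm_mul, Real.norm_of_nonneg (by positivity : 0 ≤ R / max R ‖x‖), norm_div,
      Real.norm_of_nonneg hy.le]
    have h2 : R / max R ‖x‖ ≤ 1 := by rw [div_le_one hx]; exact le_max_left _ _
    have h3 : ‖max R ‖y‖ - max R ‖x‖‖ ≤ ‖x - y‖ := by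
      rw [Real.norm_eq_abs]
      refine (abs_max_sub_max_le_max R ‖y‖ R ‖x‖).trans ?_
      rw [sub_self, abs_zero, max_eq_right (abs_nonneg _), norm_sub_rev]
      exact abs_norm_sub_norm_le _ _
    have h4 : ‖y‖ / max R ‖y‖ ≤ 1 := by rw [div_le_one hy]; exact le_max_right _ _
    calc R / max R ‖x‖ * (‖max R ‖y‖ - max R ‖x‖‖ / max R ‖y‖) * ‖y‖
        = R / max R ‖x‖ * ‖max R ‖y‖ - max R ‖x‖‖ * (‖y‖ / max R ‖y‖) := by ring
      _ ≤ 1 * ‖x - y‖ * 1 := by gcongr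
      _ = ‖x - y‖ := by ring

variable [CompleteSpace X]

/-- After composition with the retraction the vector field is globally Lipschitz and bounded, so the
solution cannot blow up and lives on all of [0,T]. It solves the original equation wherever its norm
is at most R. -/
lemma exists_cutoff_solution {T R Λ : ℝ} (hT : 0 ≤ T) (hR : 0 < R) {f : ℝ → X → X} (x0 : X)
    (hc : ∀ x, ContinuousOn (fun t => f t x) (Icc 0 T))
    (hL : ∀ t ∈ Icc 0 T, ∀ x y, ‖x‖ ≤ R → ‖y‖ ≤ R → ‖f t x - f t y‖ ≤ Λ * ‖x - y‖) :
    ∃ u : ℝ → X, u 0 = x0 ∧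
      ∀ t ∈ Icc 0 T, HasDerivWithinAt u (f t (ret R (u t))) (Icc 0 T) t := by
  obtain ⟨M, hM⟩ := isCompact_Icc.exists_bound_of_continuousOn (hc 0)
  have hLb : ∀ t ∈ Icc 0 T, ∀ x, ‖f t (ret R x)‖ ≤ M + |Λ| * R := by
    intro t ht x
    have h1 := hL t ht (ret R x) 0 (norm_ret_le hR x) (by simpa using hR.le)
    have h2 := norm_le_norm_add_norm_sub (f t 0) (f t (ret R x))
    rw [sub_zero] at h1
    have h3 : Λ * ‖ret R x‖ ≤ |Λ| * R :=
      mul_le_mul (le_abs_self _) (norm_ret_le hR x) (norm_nonneg _) (abs_nonneg _)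
    rw [norm_sub_rev] at h2
    linarith [hM t ht]
  have hM0 : 0 ≤ M + |Λ| * R := (norm_nonneg _).trans (hLb 0 ⟨le_rfl, hT⟩ 0)
  -- The Picard–Lindelöf ball has radius sup |f| · T, so it is not left before time T and no
  -- smallness of T is required.
  have hpl : IsPicardLindelof (fun t x => f t (ret R x)) (tmin := 0) (tmax := T)
      ⟨0, le_rfl, hT⟩ x0 ((M + |Λ| * R) * T).toNNReal 0 (M + |Λ| * R).toNNReal
      (2 * |Λ|).toNNReal := by
    refine ⟨fun t ht => ?_, fun x _ => hc _, fun t ht x _ => ?_, ?_⟩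
    · refine LipschitzOnWith.of_dist_le_mul fun x _ y _ => ?_
      rw [dist_eq_norm, dist_eq_norm, Real.coe_toNNReal _ (by positivity)]
      refine (hL t ht _ _ (norm_ret_le hR x) (norm_ret_le hR y)).trans ?_
      have h1 := norm_ret_sub_le hR x y
      have h2 := le_abs_self Λ
      nlinarith [norm_nonneg (ret R x - ret R y), abs_nonneg Λ]
    · rw [Real.coe_toNNReal _ hM0]; exact hLb t ht x
    · rw [Real.coe_toNNReal _ hM0, Real.coe_toNNReal _ (by positivity)]
      simp [hT]
  exact hpl.exists_eq_forall_mem_Icc_hasDerivWithinAt₀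

/-- Solve the equation cut off at R + ρ and compare with v by Gronwall. The resulting distance is at
most ρ, so the solution never reaches the region where the cutoff acts. -/
theorem exists_solution_near {T R ρ Λ δ δ₀ : ℝ} (hT : 0 ≤ T) (hρ : 0 < ρ) (hΛ : 0 ≤ Λ)
    {f : ℝ → X → X} {v v' : ℝ → X} {x0 : X}
    (hv : ∀ t ∈ Icc 0 T, HasDerivWithinAt v (v' t) (Icc 0 T) t)
    (hR : ∀ t ∈ Icc 0 T, ‖v t‖ ≤ R)
    (hd : ∀ t ∈ Icc 0 T, ‖v' t - f t (v t)‖ ≤ δ)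
    (h0 : ‖x0 - v 0‖ ≤ δ₀)
    (hc : ∀ x, ContinuousOn (fun t => f t x) (Icc 0 T))
    (hL : ∀ t ∈ Icc 0 T, ∀ x y, ‖x‖ ≤ R + ρ → ‖y‖ ≤ R + ρ → ‖f t x - f t y‖ ≤ Λ * ‖x - y‖)
    (hsmall : (δ₀ + δ * T) * Real.exp (2 * Λ * T) ≤ ρ) :
    ∃ u : ℝ → X, u 0 = x0 ∧
      ∀ t ∈ Icc 0 T, HasDerivWithinAt u (f t (u t)) (Icc 0 T) t ∧
        ‖u t - v t‖ ≤ (δ₀ + δ * T) * Real.exp (2 * Λ * T) := by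
  have h0T : (0 : ℝ) ∈ Icc 0 T := ⟨le_rfl, hT⟩
  have hR0 : 0 ≤ R := (norm_nonneg _).trans (hR 0 h0T)
  have hδ : 0 ≤ δ := (norm_nonneg _).trans (hd 0 h0T)
  have hδ₀ : 0 ≤ δ₀ := (norm_nonneg _).trans h0
  have hRρ : 0 < R + ρ := by positivity
  obtain ⟨u, hu0, hu⟩ := exists_cutoff_solution hT hRρ x0 hc hL
  have hle : ∀ t ∈ Icc 0 T, ‖u t - v t‖ ≤ (δ₀ + δ * T) * Real.exp (2 * Λ * T) := by
    intro t ht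
    have := norm_le_of_deriv (f := fun t => u t - v t) (K := 2 * Λ) (ε := δ) (δ := δ₀)
      (by positivity) hδ (fun s hs => (hu s hs).sub (hv s hs)) (by simpa [hu0] using h0) ?_ t ht
    · refine this.trans ?_
      have ht2 := ht.2
      gcongr
    · intro s hs
      -- The retraction fixes v, so it can be inserted at no cost, and its Lipschitz constant 2
      -- applies to the difference.
      have hvR : ret (R + ρ) (v s) = v s := ret_eq hRρ (by linarith [hR s hs])
      have h1 := hL s hs _ _ (norm_ret_le hRρ (u s)) (norm_ret_le hRρ (v s))
      have h2 := norm_ret_sub_le hRρ (u s) (v s)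
      rw [hvR] at h1 h2
      have h3 : f s (ret (R + ρ) (u s)) - v' s
          = (f s (ret (R + ρ) (u s)) - f s (v s)) - (v' s - f s (v s)) := by abel
      rw [h3]
      refine (norm_sub_le _ _).trans (add_le_add (h1.trans ?_) (hd s hs))
      nlinarith
  refine ⟨u, hu0, fun t ht => ⟨?_, hle t ht⟩⟩
  have h1 : ‖u t‖ ≤ R + ρ := by
    have h2 := norm_le_norm_add_norm_sub (v t) (u t)
    rw [norm_sub_rev] at h2
    linarith [hle t ht, hR t ht]
  have := hu t ht
  rwa [ret_eq hRρ h1] at this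

end ODE

/-! ### Rapidly decreasing coefficients and Fourier multipliers -/

/-- The weight `1 + |n|`. -/
def wt (n : Fin d → ℤ) : ℝ := 1 + ‖n‖

lemma one_le_wt (n : Fin d → ℤ) : 1 ≤ wt n := by unfold wt; linarith [norm_nonneg n]

lemma wt_pos (n : Fin d → ℤ) : 0 < wt n := zero_lt_one.trans_le (one_le_wt n)

lemma wt_add_le (m n : Fin d → ℤ) : wt (m + n) ≤ wt m * wt n := by
  unfold wt
  nlinarith [norm_add_le m n, norm_nonneg m, norm_nonneg n]

@[simp] lemma wt_neg (n : Fin d → ℤ) : wt (-n) = wt n := by simp [wt]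

lemma summable_int_inv_sq : Summable fun k : ℤ => ((1 + |(k : ℝ)|) ^ 2)⁻¹ := by
  have h : Summable fun k : ℕ => ((1 + |((k : ℤ) : ℝ)|) ^ 2)⁻¹ := by
    have := (summable_nat_add_iff 1).2 (Real.summable_nat_pow_inv.2 (by norm_num : 1 < 2))
    refine this.congr fun k => ?_
    have : |((k : ℤ) : ℝ)| = k := by simp
    rw [this]; push_cast; ring
  refine Summable.of_nat_of_neg h (h.congr fun k => ?_)
  simp

lemma summable_prod_inv_sq (d : ℕ) :
    Summable fun n : Fin d → ℤ => ∏ j, ((1 + |(n j : ℝ)|) ^ 2)⁻¹ := by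
  induction d with
  | zero => exact Summable.of_finite
  | succ d ih =>
    rw [← (Fin.consEquiv fun _ : Fin (d + 1) => ℤ).summable_iff]
    have := summable_int_inv_sq.mul_of_nonneg ih (fun _ => by positivity)
      (fun _ => Finset.prod_nonneg fun _ _ => by positivity)
    refine this.congr fun z => ?_
    simp [Fin.prod_univ_succ, mul_comm]

/-- The weight dominates each 1 + |n_j|, which reduces the claim to a product of one-dimensional
series. -/
lemma summable_wt : Summable fun n : Fin d → ℤ => (wt n ^ (2 * d))⁻¹ := by
  refine Summable.of_nonneg_of_le (fun n => by have := wt_pos n; positivity) (fun n => ?_)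
    (summable_prod_inv_sq d)
  rw [Finset.prod_inv_distrib]
  refine inv_anti₀ (Finset.prod_pos fun j _ => by positivity) ?_
  have : wt n ^ (2 * d) = ∏ _j : Fin d, wt n ^ 2 := by
    rw [Finset.prod_const, ← pow_mul]; simp
  rw [this]
  refine Finset.prod_le_prod (fun j _ => by positivity) fun j _ => ?_
  have h : |(n j : ℝ)| ≤ ‖n‖ := by
    have := norm_le_pi_norm n j
    rwa [Int.norm_eq_abs] at this
  unfold wt
  gcongr

/-- Uniformly rapidly decreasing families. -/
def URap {α : Type*} (c : α → W d) : Prop :=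
  ∀ s : ℕ, ∃ C : ℝ, ∀ a n, wt n ^ s * ‖c a n‖ ≤ C

/-- Families of multipliers of uniform polynomial growth. -/
def Gr {α : Type*} (m : α → (Fin d → ℤ) → ℂ) : Prop :=
  ∃ (C : ℝ) (k : ℕ), ∀ a n, ‖m a n‖ ≤ C * wt n ^ k

/-- A Fourier multiplier (zero if the result is not summable). -/
def sy (m : (Fin d → ℤ) → ℂ) (c : W d) : W d :=
  open Classical in if h : Summable fun n => ‖m n * c n‖ then W.mk _ h else 0

lemma le_of_wt_pow {f : ℝ} {n : Fin d → ℤ} {C : ℝ} (h : wt n ^ (2 * d) * f ≤ C) :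
    f ≤ C * (wt n ^ (2 * d))⁻¹ := by
  have := wt_pos n
  rw [← div_eq_mul_inv, le_div_iff₀ (by positivity), mul_comm]
  exact h

namespace URap

variable {α β : Type*} {c e : α → W d}

lemma comp (hc : URap c) (f : β → α) : URap fun b => c (f b) :=
  fun s => (hc s).imp fun _ h b n => h (f b) n

lemma exists_nonneg (hc : URap c) (s : ℕ) : ∃ C : ℝ, 0 ≤ C ∧ ∀ a n, wt n ^ s * ‖c a n‖ ≤ C := by
  obtain ⟨C, hC⟩ := hc s
  exact ⟨|C|, abs_nonneg _, fun a n => (hC a n).trans (le_abs_self _)⟩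

/-- Sacrificing 2d powers of the weight turns a sup bound into a summable majorant common to the
whole family; dominated convergence later relies on it. -/
lemma exists_summable (hc : URap c) (s : ℕ) :
    ∃ u : (Fin d → ℤ) → ℝ, Summable u ∧ ∀ a n, wt n ^ s * ‖c a n‖ ≤ u n := by
  obtain ⟨C, hC⟩ := hc (2 * d + s)
  refine ⟨fun n => C * (wt n ^ (2 * d))⁻¹, summable_wt.mul_left C, fun a n => ?_⟩
  apply le_of_wt_pow
  rw [← mul_assoc, ← pow_add]; exact hC a n

lemma exists_summable' (hc : URap c) :
    ∃ u : (Fin d → ℤ) → ℝ, Summable u ∧ ∀ a n, ‖c a n‖ ≤ u n := by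
  simpa using hc.exists_summable 0

lemma norm_le (hc : URap c) : ∃ C : ℝ, 0 ≤ C ∧ ∀ a, ‖c a‖ ≤ C := by
  obtain ⟨u, hu, h⟩ := hc.exists_summable'
  exact ⟨|∑' n, u n|, abs_nonneg _, fun a => (W.norm_le_of_le hu (h a)).trans (le_abs_self _)⟩

lemma add (hc : URap c) (he : URap e) : URap fun a => c a + e a := by
  intro s
  obtain ⟨C, hC⟩ := hc s
  obtain ⟨D, hD⟩ := he s
  refine ⟨C + D, fun a n => ?_⟩
  have := wt_pos n
  calc wt n ^ s * ‖(c a + e a) n‖ ≤ wt n ^ s * (‖c a n‖ + ‖e a n‖) := by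
        gcongr; exact norm_add_le _ _
    _ ≤ C + D := by rw [mul_add]; exact add_le_add (hC a n) (hD a n)

lemma zero : URap (fun _ : α => (0 : W d)) := fun s => ⟨0, fun a n => by simp⟩

lemma sum {ι : Type*} (s : Finset ι) {f : ι → α → W d} (h : ∀ i ∈ s, URap (f i)) :
    URap fun a => ∑ i ∈ s, f i a := by
  classical
  induction s using Finset.induction_on with
  | empty => simpa using zero
  | insert i s hi ih =>
    simp only [Finset.sum_insert hi]
    exact (h i (Finset.mem_insert_self i s)).add
      (ih fun j hj => h j (Finset.mem_insert_of_mem hj))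

lemma smul (hc : URap c) {z : α → ℂ} {B : ℝ} (hz : ∀ a, ‖z a‖ ≤ B) : URap fun a => z a • c a := by
  intro s
  obtain ⟨C, hC0, hC⟩ := hc.exists_nonneg s
  refine ⟨B * C, fun a n => ?_⟩
  have h1 : wt n ^ s * ‖(z a • c a) n‖ = ‖z a‖ * (wt n ^ s * ‖c a n‖) := by
    rw [W.smul_apply, norm_mul]; ring
  rw [h1]
  exact mul_le_mul (hz a) (hC a n) (by have := wt_pos n; positivity) ((norm_nonneg _).trans (hz a))

lemma const_smul (hc : URap c) (z : ℂ) : URap fun a => z • c a := hc.smul (fun _ => le_refl ‖z‖)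

lemma neg (hc : URap c) : URap fun a => - c a := by
  simpa using hc.const_smul (-1)

lemma sub (hc : URap c) (he : URap e) : URap fun a => c a - e a := by
  simpa [sub_eq_add_neg] using hc.add he.neg

lemma star (hc : URap c) : URap fun a => star (c a) := by
  intro s
  obtain ⟨C, hC⟩ := hc s
  exact ⟨C, fun a n => by simpa using hC a (-n)⟩

/-- The weight is submultiplicative, so its power can be distributed over the two factors of the
convolution. -/
lemma mul (hc : URap c) (he : URap e) : URap fun a => c a * e a := by
  intro s
  obtain ⟨u, hu, hu'⟩ := hc.exists_summable s
  obtain ⟨D, hD0, hD⟩ := he.exists_nonneg s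
  refine ⟨(∑' m, u m) * D, fun a n => ?_⟩
  have hle : ∀ m, wt n ^ s * ‖c a m * e a (n - m)‖ ≤ u m * D := by
    intro m
    have h1 : wt n ≤ wt m * wt (n - m) := by
      have := wt_add_le m (n - m); rwa [add_sub_cancel] at this
    have p1 := wt_pos n
    have p2 := wt_pos m
    have p3 := wt_pos (n - m)
    calc wt n ^ s * ‖c a m * e a (n - m)‖
        ≤ (wt m * wt (n - m)) ^ s * (‖c a m‖ * ‖e a (n - m)‖) := by
          rw [norm_mul]; gcongr
      _ = (wt m ^ s * ‖c a m‖) * (wt (n - m) ^ s * ‖e a (n - m)‖) := by ring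
      _ ≤ u m * D := mul_le_mul (hu' a m) (hD a _) (by positivity)
          ((by positivity : 0 ≤ wt m ^ s * ‖c a m‖).trans (hu' a m))
  have hs : Summable fun m => ‖c a m * e a (n - m)‖ := (W.summable_conv (c a) (e a)).prod_factor n
  rw [W.mul_apply, ← tsum_mul_right]
  calc wt n ^ s * ‖∑' m, c a m * e a (n - m)‖
      ≤ wt n ^ s * ∑' m, ‖c a m * e a (n - m)‖ := by
        have := wt_pos n
        gcongr; exact norm_tsum_le_tsum_norm hs
    _ = ∑' m, wt n ^ s * ‖c a m * e a (n - m)‖ := by rw [tsum_mul_left]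
    _ ≤ ∑' m, u m * D := (hs.mul_left _).tsum_le_tsum hle (hu.mul_right D)

lemma mul_symbol (hc : URap c) {m : α → (Fin d → ℤ) → ℂ} (hm : Gr m) (s : ℕ) :
    ∃ C : ℝ, ∀ a n, wt n ^ s * ‖m a n * c a n‖ ≤ C := by
  obtain ⟨B, k, hB⟩ := hm
  obtain ⟨C, hC0, hC⟩ := hc.exists_nonneg (s + k)
  refine ⟨|B| * C, fun a n => ?_⟩
  have := wt_pos n
  calc wt n ^ s * ‖m a n * c a n‖ ≤ wt n ^ s * ((|B| * wt n ^ k) * ‖c a n‖) := by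
        rw [norm_mul]; gcongr
        exact (hB a n).trans (by gcongr; exact le_abs_self B)
    _ = |B| * (wt n ^ (s + k) * ‖c a n‖) := by rw [pow_add]; ring
    _ ≤ |B| * C := by gcongr; exact hC a n

lemma sy_apply (hc : URap c) {m : α → (Fin d → ℤ) → ℂ} (hm : Gr m) (a : α) (n : Fin d → ℤ) :
    sy (m a) (c a) n = m a n * c a n := by
  obtain ⟨C, hC⟩ := hc.mul_symbol hm (2 * d)
  have h : Summable fun n => ‖m a n * c a n‖ :=
    Summable.of_nonneg_of_le (fun _ => norm_nonneg _) (fun n => le_of_wt_pow (hC a n))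
      (summable_wt.mul_left C)
  rw [sy, dif_pos h]; rfl

lemma sy (hc : URap c) {m : α → (Fin d → ℤ) → ℂ} (hm : Gr m) : URap fun a => sy (m a) (c a) := by
  intro s
  obtain ⟨C, hC⟩ := hc.mul_symbol hm s
  exact ⟨C, fun a n => by rw [hc.sy_apply hm]; exact hC a n⟩

end URap

/-- Rapidly decreasing coefficients. -/
abbrev Rap (c : W d) : Prop := URap fun _ : Unit => c

lemma URap.rap {α : Type*} {c : α → W d} (hc : URap c) (a : α) : Rap (c a) := hc.comp fun _ => a

lemma rap_mono (n : Fin d → ℤ) : Rap (W.mono n) := by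
  intro s
  refine ⟨wt n ^ s, fun _ m => ?_⟩
  have := wt_pos n
  rw [W.mono_apply]
  split_ifs with h
  · simp [h]
  · simp; positivity

/-- Polynomial growth of a single multiplier. -/
abbrev Gr1 (m : (Fin d → ℤ) → ℂ) : Prop := Gr fun _ : Unit => m

lemma Gr.gr1 {α : Type*} {m : α → (Fin d → ℤ) → ℂ} (hm : Gr m) (a : α) : Gr1 (m a) := by
  obtain ⟨C, k, h⟩ := hm; exact ⟨C, k, fun _ n => h a n⟩

lemma Gr1.gr {α : Type*} {m : (Fin d → ℤ) → ℂ} (hm : Gr1 m) : Gr fun _ : α => m := by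
  obtain ⟨C, k, h⟩ := hm; exact ⟨C, k, fun _ n => h () n⟩

lemma Rap.sy_apply {c : W d} (hc : Rap c) {m : (Fin d → ℤ) → ℂ} (hm : Gr1 m) (n : Fin d → ℤ) :
    sy m c n = m n * c n := URap.sy_apply hc hm () n

lemma gr_coord (j : Fin d) : Gr1 fun n : Fin d → ℤ => Complex.I * (n j : ℂ) := by
  refine ⟨1, 1, fun _ n => ?_⟩
  have := norm_le_pi_norm n j
  rw [Int.norm_eq_abs] at this
  simp only [norm_mul, Complex.norm_I, one_mul, pow_one, Complex.norm_intCast]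
  unfold wt; linarith

lemma Gr.add {α : Type*} {m m' : α → (Fin d → ℤ) → ℂ} (h : Gr m) (h' : Gr m') :
    Gr fun a n => m a n + m' a n := by
  obtain ⟨C, k, h⟩ := h
  obtain ⟨C', k', h'⟩ := h'
  refine ⟨|C| + |C'|, k + k', fun a n => (norm_add_le _ _).trans ?_⟩
  have h1 := one_le_wt n
  rw [add_mul]
  refine add_le_add ((h a n).trans ?_) ((h' a n).trans ?_)
  · refine mul_le_mul (le_abs_self _) (pow_le_pow_right₀ h1 (by lia)) (by positivity)
      (abs_nonneg _)
  · refine mul_le_mul (le_abs_self _) (pow_le_pow_right₀ h1 (by lia)) (by positivity)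
      (abs_nonneg _)

lemma Gr.mul {α : Type*} {m m' : α → (Fin d → ℤ) → ℂ} (h : Gr m) (h' : Gr m') :
    Gr fun a n => m a n * m' a n := by
  obtain ⟨C, k, h⟩ := h
  obtain ⟨C', k', h'⟩ := h'
  refine ⟨C * C', k + k', fun a n => ?_⟩
  rw [norm_mul]
  refine (mul_le_mul (h a n) (h' a n) (norm_nonneg _) ((norm_nonneg _).trans (h a n))).trans_eq ?_
  ring

lemma Gr.const {α : Type*} {z : α → ℂ} {B : ℝ} (hz : ∀ a, ‖z a‖ ≤ B) :
    Gr fun (a : α) (_ : Fin d → ℤ) => z a := ⟨B, 0, fun a n => by simpa using hz a⟩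

lemma Gr.sum {α ι : Type*} (s : Finset ι) {m : ι → α → (Fin d → ℤ) → ℂ} (h : ∀ i ∈ s, Gr (m i)) :
    Gr fun a n => ∑ i ∈ s, m i a n := by
  classical
  induction s using Finset.induction_on with
  | empty => exact ⟨0, 0, fun a n => by simp⟩
  | insert i s hi ih =>
    simp only [Finset.sum_insert hi]
    exact (h i (Finset.mem_insert_self i s)).add
      (ih fun j hj => h j (Finset.mem_insert_of_mem hj))

/-! ### Convergence and derivatives from coefficients -/

/-- Dominated convergence for the counting measure. -/
lemma W.tendsto_of_coord {α : Type*} {l : Filter α} {F : α → W d} {c : W d}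
    {u : (Fin d → ℤ) → ℝ} (hu : Summable u) (h : ∀ n, Tendsto (fun a => F a n) l (𝓝 (c n)))
    (hb : ∀ᶠ a in l, ∀ n, ‖F a n‖ ≤ u n) : Tendsto F l (𝓝 c) := by
  rw [tendsto_iff_norm_sub_tendsto_zero]
  have h1 : Tendsto (fun a => ∑' n, ‖F a n - c n‖) l (𝓝 (∑' _ : Fin d → ℤ, (0 : ℝ))) := by
    refine tendsto_tsum_of_dominated_convergence (bound := fun n => u n + ‖c n‖)
      (hu.add c.summable_norm) (fun n => ?_) ?_
    · have := (h n).sub_const (c n)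
      rw [sub_self] at this
      simpa using this.norm
    · filter_upwards [hb] with a ha n
      rw [norm_norm]
      exact (norm_sub_le _ _).trans (add_le_add (ha n) le_rfl)
  rw [tsum_zero] at h1
  refine h1.congr fun a => ?_
  rw [W.norm_def]; rfl

lemma W.continuousOn_of_coord {S : Set ℝ} {c : ℝ → W d} {u : (Fin d → ℤ) → ℝ} (hu : Summable u)
    (h : ∀ n, ContinuousOn (fun t => c t n) S) (hb : ∀ t ∈ S, ∀ n, ‖c t n‖ ≤ u n) :
    ContinuousOn c S := fun t ht =>
  W.tendsto_of_coord hu (fun n => h n t ht) (eventually_nhdsWithin_of_forall hb)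

/-- By the mean value inequality a majorant of the derivatives also dominates the difference
quotients, so coefficientwise differentiability lifts to `W`. -/
lemma W.hasDerivWithinAt_of_coord {S : Set ℝ} (hS : Convex ℝ S) {c c' : ℝ → W d}
    {u : (Fin d → ℤ) → ℝ} (hu : Summable u)
    (h : ∀ n, ∀ t ∈ S, HasDerivWithinAt (fun t => c t n) (c' t n) S t)
    (hb : ∀ t ∈ S, ∀ n, ‖c' t n‖ ≤ u n) :
    ∀ t ∈ S, HasDerivWithinAt c (c' t) S t := by
  intro t ht
  rw [hasDerivWithinAt_iff_tendsto_slope]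
  refine W.tendsto_of_coord hu (fun n => ?_) ?_
  · have := h n t ht
    rw [hasDerivWithinAt_iff_tendsto_slope] at this
    exact this
  · filter_upwards [self_mem_nhdsWithin] with s hs n
    have h1 := hS.norm_image_sub_le_of_norm_hasDerivWithin_le (fun x hx => h n x hx)
      (fun x hx => hb x hx n) ht hs.1
    have h2 : (slope c t s) n = ((s - t : ℝ) : ℂ)⁻¹ * (c s n - c t n) := by
      rw [slope_def_module, W.real_smul_apply]; simp
    have h3 : 0 < ‖s - t‖ := norm_pos_iff.2 (sub_ne_zero.2 hs.2)
    rw [h2, norm_mul, norm_inv, Complex.norm_real, inv_mul_le_iff₀ h3, mul_comm]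
    exact h1

/-! ### Unimodular multipliers -/

/-- The multiplier with symbol `exp(i θ(n) t)`. -/
def rot (θ : (Fin d → ℤ) → ℝ) (t : ℝ) (c : W d) : W d :=
  W.mk (fun n => Complex.exp (((θ n * t : ℝ) : ℂ) * Complex.I) * c n) (by
    simpa only [norm_mul, Complex.norm_exp_ofReal_mul_I, one_mul] using c.summable_norm)

section rot

variable (θ : (Fin d → ℤ) → ℝ) (t : ℝ)

lemma rot_apply (c : W d) (n) :
    rot θ t c n = Complex.exp (((θ n * t : ℝ) : ℂ) * Complex.I) * c n := rfl

lemma norm_rot_apply (c : W d) (n) : ‖rot θ t c n‖ = ‖c n‖ := by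
  rw [rot_apply, norm_mul, Complex.norm_exp_ofReal_mul_I, one_mul]

@[simp] lemma norm_rot (c : W d) : ‖rot θ t c‖ = ‖c‖ := by
  simp only [W.norm_def, norm_rot_apply]

lemma rot_sub (c e : W d) : rot θ t (c - e) = rot θ t c - rot θ t e := by
  ext n; simp [rot_apply, mul_sub]

@[simp] lemma rot_zero (c : W d) : rot θ 0 c = c := by ext n; simp [rot_apply]

lemma rot_neg_rot (c : W d) : rot θ (-t) (rot θ t c) = c := by
  ext n
  rw [rot_apply, rot_apply, ← mul_assoc, ← Complex.exp_add]
  push_cast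
  ring_nf
  simp

lemma continuous_rot (c : W d) : Continuous fun t => rot θ t c := by
  rw [continuous_iff_continuousAt]
  intro s
  refine W.tendsto_of_coord c.summable_norm (fun n => ?_)
    (Eventually.of_forall fun t n => (norm_rot_apply θ t c n).le)
  have : Continuous fun t => rot θ t c n := by
    simp only [rot_apply]; fun_prop
  exact this.tendsto s

/-- Only strong continuity of the group is available; isometry handles the increment of c, strong
continuity the rotation of the fixed vector c(s). -/
lemma continuousOn_rot {S : Set ℝ} {c : ℝ → W d} {σ : ℝ → ℝ} (hσ : ContinuousOn σ S)
    (hc : ContinuousOn c S) : ContinuousOn (fun t => rot θ (σ t) (c t)) S := by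
  intro s hs
  have h1 : Tendsto (fun t => rot θ (σ t) (c s)) (𝓝[S] s) (𝓝 (rot θ (σ s) (c s))) :=
    ((continuous_rot θ (c s)).tendsto (σ s)).comp (hσ s hs)
  have h2 : Tendsto (fun t => rot θ (σ t) (c t - c s)) (𝓝[S] s) (𝓝 0) := by
    rw [tendsto_zero_iff_norm_tendsto_zero]
    simp only [norm_rot]
    have := hc s hs
    rwa [ContinuousWithinAt, tendsto_iff_norm_sub_tendsto_zero] at this
  have h3 := h2.add h1
  rw [zero_add] at h3
  refine h3.congr fun t => ?_
  rw [rot_sub]; abel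

end rot

lemma summable_wmul {w : (Fin d → ℤ) → ℝ} {N : ℝ} (hw : ∀ n, |w n| ≤ N) (c : W d) :
    Summable fun n => ‖(w n : ℂ) * c n‖ := by
  refine Summable.of_nonneg_of_le (fun _ => norm_nonneg _) (fun n => ?_)
    (c.summable_norm.mul_left N)
  rw [norm_mul, Complex.norm_real]
  exact mul_le_mul_of_nonneg_right (hw n) (norm_nonneg _)

/-- Multiplication of the coefficients by a bounded weight. -/
def wmul (w : (Fin d → ℤ) → ℝ) {N : ℝ} (hw : ∀ n, |w n| ≤ N) : W d →L[ℝ] W d :=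
  LinearMap.mkContinuous
    { toFun := fun c => W.mk (fun n => (w n : ℂ) * c n) (summable_wmul hw c)
      map_add' := fun c e => by ext n; simp [mul_add]
      map_smul' := fun r c => by ext n; simp; ring } N fun c => by
    change ‖W.mk _ (summable_wmul hw c)‖ ≤ _
    rw [W.norm_def, W.norm_def, ← tsum_mul_left]
    refine Summable.tsum_le_tsum (fun n => ?_) (W.summable_norm _) (c.summable_norm.mul_left N)
    rw [W.mk_apply, norm_mul, Complex.norm_real]
    exact mul_le_mul_of_nonneg_right (hw n) (norm_nonneg _)

lemma wmul_apply (w : (Fin d → ℤ) → ℝ) {N : ℝ} (hw : ∀ n, |w n| ≤ N) (c : W d) (n) :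
    wmul w hw c n = (w n : ℂ) * c n := rfl

/-! ### Polynomial nonlinearities -/

/-- Polynomials in the unknowns `x_i`, one coefficient function, and their conjugates. -/
abbrev Pol (ι : Type*) := MvPolynomial (Option ι × Bool) ℂ

/-- The arguments of a polynomial nonlinearity: the coefficient `h`, the unknowns `x`, and their
conjugates. -/
def vals {ι A : Type*} [Star A] (h : A) (x : ι → A) (s : Option ι × Bool) : A :=
  let z := s.1.elim h x
  if s.2 then star z else z

/-- Evaluation of a polynomial nonlinearity. -/
def pev {ι A : Type*} [CommRing A] [Algebra ℂ A] [Star A] (p : Pol ι) (h : A) (x : ι → A) : A :=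
  MvPolynomial.aeval (vals h x) p

/-- The variable `x_i`. -/
def pv {ι : Type*} (i : ι) : Pol ι := MvPolynomial.X (some i, false)
/-- The variable `x̄_i`. -/
def pvc {ι : Type*} (i : ι) : Pol ι := MvPolynomial.X (some i, true)
/-- The coefficient `h`. -/
def ph {ι : Type*} : Pol ι := MvPolynomial.X (none, false)

section algebra

variable {ι A : Type*} [CommRing A] [Algebra ℂ A] [Star A] (h : A) (x : ι → A)

@[simp] lemma pev_pv (i : ι) : pev (pv i) h x = x i := by simp [pev, pv, vals]
@[simp] lemma pev_pvc (i : ι) : pev (pvc i) h x = star (x i) := by simp [pev, pvc, vals]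
@[simp] lemma pev_ph : pev (ph : Pol ι) h x = h := by simp [pev, ph, vals]
@[simp] lemma pev_add (p q : Pol ι) : pev (p + q) h x = pev p h x + pev q h x := map_add _ _ _
@[simp] lemma pev_sub (p q : Pol ι) : pev (p - q) h x = pev p h x - pev q h x := map_sub _ _ _
@[simp] lemma pev_neg (p : Pol ι) : pev (-p) h x = -pev p h x := map_neg _ _
@[simp] lemma pev_mul (p q : Pol ι) : pev (p * q) h x = pev p h x * pev q h x := map_mul _ _ _
@[simp] lemma pev_smul (z : ℂ) (p : Pol ι) : pev (z • p) h x = z • pev p h x := map_smul _ _ _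
@[simp] lemma pev_zero : pev (0 : Pol ι) h x = 0 := map_zero _
@[simp] lemma pev_sum {β : Type*} (s : Finset β) (p : β → Pol ι) :
    pev (∑ b ∈ s, p b) h x = ∑ b ∈ s, pev (p b) h x := map_sum _ _ _

end algebra

lemma val_pev {ι : Type*} (y : E d) (p : Pol ι) (h : W d) (x : ι → W d) :
    W.val y (pev p h x) = pev p (W.val y h) (fun i => W.val y (x i)) := by
  have h1 : (fun s => W.ev y (vals h x s)) = vals (W.val y h) (fun i => W.val y (x i)) := by
    funext s
    rcases s with ⟨_ | i, _ | _⟩ <;> simp [vals, W.val_star]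
  change W.ev y (MvPolynomial.aeval (vals h x) p) = _
  rw [pev, ← h1]
  have := MvPolynomial.comp_aeval_apply (W.ev y) (f := vals h x) (p := p)
  exact this

/-- A class of functions closed under the algebra operations is closed under polynomials. -/
lemma pev_closed {ι A α : Type*} [CommRing A] [Algebra ℂ A] [StarRing A] {Q : (α → A) → Prop}
    (hconst : ∀ z : ℂ, Q fun _ => algebraMap ℂ A z) (hadd : ∀ f g, Q f → Q g → Q fun a => f a + g a)
    (hmul : ∀ f g, Q f → Q g → Q fun a => f a * g a) (hstar : ∀ f, Q f → Q fun a => star (f a))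
    (p : Pol ι) {h : α → A} {x : α → ι → A} (hh : Q h) (hx : ∀ i, Q fun a => x a i) :
    Q fun a => pev p (h a) (x a) := by
  induction p using MvPolynomial.induction_on with
  | C z => simpa [pev] using hconst z
  | add p q hp hq => simpa using hadd _ _ hp hq
  | mul_X p s hp =>
    have hs : Q fun a => vals (h a) (x a) s := by
      rcases s with ⟨_ | i, _ | _⟩
      · simpa [vals] using hh
      · simpa [vals] using hstar _ hh
      · simpa [vals] using hx i
      · simpa [vals] using hstar _ (hx i)
    have := hmul _ _ hp hs
    simpa [pev] using this

/-! ### Lipschitz bounds for polynomial nonlinearities on balls. -/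

section lipschitz

variable {ι A : Type*} [NormedCommRing A] [StarRing A] [NormedStarGroup A]

lemma norm_vals_le {h : A} {x : ι → A} {R : ℝ} (hh : ‖h‖ ≤ R) (hx : ∀ i, ‖x i‖ ≤ R) (s) :
    ‖vals h x s‖ ≤ R := by
  rcases s with ⟨_ | i, _ | _⟩ <;> simp [vals, hh, hx]

lemma norm_vals_sub_le {h h' : A} {x x' : ι → A} {D : ℝ} (hh : ‖h - h'‖ ≤ D)
    (hx : ∀ i, ‖x i - x' i‖ ≤ D) (s) : ‖vals h x s - vals h' x' s‖ ≤ D := by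
  rcases s with ⟨_ | i, _ | _⟩ <;> simp [vals, hh, hx, ← star_sub]

-- Induction on the polynomial. The size bound is carried along because the product rule for
-- differences needs it.
variable (A) in
lemma exists_lipschitz_pev [NormOneClass A] [NormedAlgebra ℂ A] (p : Pol ι) (R : ℝ) : ∃ L : ℝ, 0 ≤ L ∧
    ∀ (h h' : A) (x x' : ι → A), ‖h‖ ≤ R → ‖h'‖ ≤ R → (∀ i, ‖x i‖ ≤ R) → (∀ i, ‖x' i‖ ≤ R) →
      ‖pev p h x‖ ≤ L ∧ ∀ D : ℝ, ‖h - h'‖ ≤ D → (∀ i, ‖x i - x' i‖ ≤ D) →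
        ‖pev p h x - pev p h' x'‖ ≤ L * D := by
  induction p using MvPolynomial.induction_on with
  | C z =>
    refine ⟨‖z‖, norm_nonneg _, fun h h' x x' _ _ _ _ => ⟨?_, fun D hD _ => ?_⟩⟩
    · simp [pev, norm_algebraMap']
    · have : 0 ≤ D := (norm_nonneg _).trans hD
      simp [pev]; positivity
  | add p q hp hq =>
    obtain ⟨L, hL, hp⟩ := hp
    obtain ⟨L', hL', hq⟩ := hq
    refine ⟨L + L', by positivity, fun h h' x x' a b c e => ⟨?_, fun D hD hD' => ?_⟩⟩
    · rw [pev_add]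
      exact (norm_add_le _ _).trans (add_le_add (hp h h' x x' a b c e).1 (hq h h' x x' a b c e).1)
    · rw [pev_add, pev_add, add_sub_add_comm, add_mul]
      exact (norm_add_le _ _).trans (add_le_add ((hp h h' x x' a b c e).2 D hD hD')
        ((hq h h' x x' a b c e).2 D hD hD'))
  | mul_X p s hp =>
    obtain ⟨L, hL, hp⟩ := hp
    refine ⟨L * |R| + L, by positivity, fun h h' x x' a b c e => ⟨?_, fun D hD hD' => ?_⟩⟩
    · have h1 : pev (p * MvPolynomial.X s) h x = pev p h x * vals h x s := by simp [pev]
      rw [h1]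
      refine (norm_mul_le _ _).trans ?_
      have h2 := (norm_vals_le a c s).trans (le_abs_self R)
      have h3 := (hp h h' x x' a b c e).1
      nlinarith [norm_nonneg (pev p h x), norm_nonneg (vals h x s), abs_nonneg R]
    · have h1 : pev (p * MvPolynomial.X s) h x - pev (p * MvPolynomial.X s) h' x'
          = (pev p h x - pev p h' x') * vals h x s
            + pev p h' x' * (vals h x s - vals h' x' s) := by
        simp [pev]; ring
      rw [h1]
      refine (norm_add_le _ _).trans ?_
      rw [add_mul]
      refine add_le_add ((norm_mul_le _ _).trans ?_) ((norm_mul_le _ _).trans ?_)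
      · have h2 := (norm_vals_le a c s).trans (le_abs_self R)
        have h3 := (hp h h' x x' a b c e).2 D hD hD'
        calc _ ≤ (L * D) * |R| := mul_le_mul h3 h2 (norm_nonneg _) ((norm_nonneg _).trans h3)
          _ = L * |R| * D := by ring
      · exact mul_le_mul (hp h' h x' x b a e c).1 (norm_vals_sub_le hD hD' s) (norm_nonneg _) hL

end lipschitz

lemma URap.algebraMap {α : Type*} (z : ℂ) : URap fun _ : α => algebraMap ℂ (W d) z := by
  have := ((rap_mono (0 : Fin d → ℤ)).comp (fun _ : α => ())).const_smul z
  simpa [Algebra.algebraMap_eq_smul_one, W.one_def] using this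

lemma URap.pev {α ι : Type*} (p : Pol ι) {h : α → W d} {x : α → ι → W d} (hh : URap h)
    (hx : ∀ i, URap fun a => x a i) : URap fun a => pev p (h a) (x a) :=
  pev_closed (Q := URap) (fun z => URap.algebraMap z) (fun _ _ => URap.add) (fun _ _ => URap.mul)
    (fun _ => URap.star) p hh hx

lemma continuousOn_pev {ι : Type*} (p : Pol ι) {S : Set ℝ} {h : ℝ → W d} {x : ℝ → ι → W d}
    (hh : ContinuousOn h S) (hx : ∀ i, ContinuousOn (fun t => x t i) S) :
    ContinuousOn (fun t => pev p (h t) (x t)) S :=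
  pev_closed (Q := fun f => ContinuousOn f S) (fun _ => continuousOn_const)
    (fun _ _ hf hg => hf.add hg) (fun _ _ hf hg => hf.mul hg)
    (fun _ hf => hf.star) p hh hx

lemma continuous_pev {ι : Type*} (p : Pol ι) {Y : Type*} [TopologicalSpace Y] {h : Y → ℂ}
    {x : Y → ι → ℂ} (hh : Continuous h) (hx : ∀ i, Continuous (fun t => x t i)) :
    Continuous (fun t => pev p (h t) (x t)) :=
  pev_closed (Q := fun f => Continuous f) (fun _ => continuous_const)
    (fun _ _ hf hg => hf.add hg) (fun _ _ hf hg => hf.mul hg)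
    (fun _ hf => hf.star) p hh hx

/-! ### Weighted norms and tame estimates -/

/-- Bounded weights that are subadditive up to the factor `K`. -/
structure TameWeight (K N : ℝ) (w : (Fin d → ℤ) → ℝ) : Prop where
  nonneg : ∀ n, 0 ≤ w n
  le : ∀ n, w n ≤ N
  zero_le : w 0 ≤ 1
  add_le : ∀ m n, w (m + n) ≤ K * (w m + w n)
  neg : ∀ n, w (-n) = w n

namespace TameWeight

variable {K N : ℝ} {w : (Fin d → ℤ) → ℝ}

lemma abs_le (hw : TameWeight K N w) (n) : |w n| ≤ N := by
  rw [abs_of_nonneg (hw.nonneg n)]; exact hw.le n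

/-- The weighted norm. -/
def nrm (hw : TameWeight K N w) (c : W d) : ℝ := ‖wmul w hw.abs_le c‖

variable (hw : TameWeight K N w)

lemma nrm_nonneg (c : W d) : 0 ≤ hw.nrm c := norm_nonneg _

lemma nrm_eq (c : W d) : hw.nrm c = ∑' n, w n * ‖c n‖ := by
  rw [nrm, W.norm_def]
  refine tsum_congr fun n => ?_
  rw [wmul_apply, norm_mul, Complex.norm_real, Real.norm_of_nonneg (hw.nonneg n)]

lemma nrm_add_le (c e : W d) : hw.nrm (c + e) ≤ hw.nrm c + hw.nrm e := by
  unfold nrm; rw [map_add]; exact norm_add_le _ _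

lemma nrm_star (c : W d) : hw.nrm (star c) = hw.nrm c := by
  rw [nrm_eq, nrm_eq, ← (Equiv.neg (Fin d → ℤ)).tsum_eq]
  refine tsum_congr fun n => ?_
  simp [hw.neg]

lemma nrm_algebraMap_le (z : ℂ) : hw.nrm (algebraMap ℂ (W d) z) ≤ ‖z‖ := by
  rw [nrm_eq, tsum_eq_single 0]
  · rw [Algebra.algebraMap_eq_smul_one, W.smul_apply, W.one_def, W.mono_apply]
    simp only [if_true, mul_one]
    exact mul_le_of_le_one_left (norm_nonneg _) hw.zero_le
  · intro n hn
    rw [Algebra.algebraMap_eq_smul_one, W.smul_apply, W.one_def, W.mono_apply]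
    simp [hn]

/-- Subadditivity places the weight on one factor at a time, while the other factor is measured in
the unweighted norm. A submultiplicative estimate would lose this linearity in the weighted norms.
-/
lemma nrm_mul_le (c e : W d) : hw.nrm (c * e) ≤ K * (hw.nrm c * ‖e‖ + ‖c‖ * hw.nrm e) := by
  have h := W.summable_conv c e
  have hwc : Summable fun n => w n * ‖c n‖ := by
    have := summable_wmul hw.abs_le c
    refine this.congr fun n => ?_
    rw [norm_mul, Complex.norm_real, Real.norm_of_nonneg (hw.nonneg n)]
  have hwe : Summable fun n => w n * ‖e n‖ := by
    have := summable_wmul hw.abs_le e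
    refine this.congr fun n => ?_
    rw [norm_mul, Complex.norm_real, Real.norm_of_nonneg (hw.nonneg n)]
  have nc : ∀ n, 0 ≤ w n * ‖c n‖ := fun n => mul_nonneg (hw.nonneg n) (norm_nonneg _)
  have ne : ∀ n, 0 ≤ w n * ‖e n‖ := fun n => mul_nonneg (hw.nonneg n) (norm_nonneg _)
  have s1 : Summable fun z : (Fin d → ℤ) × (Fin d → ℤ) => (w z.1 * ‖c z.1‖) * ‖e z.2‖ :=
    hwc.mul_of_nonneg e.summable_norm nc fun _ => norm_nonneg _
  have s2 : Summable fun z : (Fin d → ℤ) × (Fin d → ℤ) => ‖c z.1‖ * (w z.2 * ‖e z.2‖) :=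
    c.summable_norm.mul_of_nonneg hwe (fun _ => norm_nonneg _) ne
  have s3 := (s1.add s2).mul_left K
  have s4 := (W.convEquiv d).summable_iff.2 s3
  have t1 : hw.nrm c * ‖e‖ = ∑' z : (Fin d → ℤ) × (Fin d → ℤ), (w z.1 * ‖c z.1‖) * ‖e z.2‖ := by
    rw [nrm_eq, W.norm_def]; exact hwc.tsum_mul_tsum e.summable_norm s1
  have t2 : ‖c‖ * hw.nrm e = ∑' z : (Fin d → ℤ) × (Fin d → ℤ), ‖c z.1‖ * (w z.2 * ‖e z.2‖) := by
    rw [nrm_eq, W.norm_def]; exact c.summable_norm.tsum_mul_tsum hwe s2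
  rw [t1, t2, ← s1.tsum_add s2, ← tsum_mul_left, ← (W.convEquiv d).tsum_eq, nrm_eq]
  have s5 : Summable fun z : (Fin d → ℤ) × (Fin d → ℤ) => w z.1 * ‖c z.2 * e (z.1 - z.2)‖ := by
    refine Summable.of_nonneg_of_le (fun z => mul_nonneg (hw.nonneg _) (norm_nonneg _))
      (fun z => ?_) s4
    have := hw.add_le z.2 (z.1 - z.2)
    rw [add_sub_cancel] at this
    have h1 := mul_le_mul_of_nonneg_right this (norm_nonneg (c z.2 * e (z.1 - z.2)))
    refine h1.trans_eq ?_
    simp only [W.convEquiv, Equiv.coe_fn_mk, Function.comp, norm_mul]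
    ring
  have hle : ∀ z : (Fin d → ℤ) × (Fin d → ℤ), w z.1 * ‖c z.2 * e (z.1 - z.2)‖
      ≤ K * ((w (W.convEquiv d z).1 * ‖c (W.convEquiv d z).1‖) * ‖e (W.convEquiv d z).2‖
        + ‖c (W.convEquiv d z).1‖ * (w (W.convEquiv d z).2 * ‖e (W.convEquiv d z).2‖)) := by
    intro z
    have := hw.add_le z.2 (z.1 - z.2)
    rw [add_sub_cancel] at this
    have h1 := mul_le_mul_of_nonneg_right this (norm_nonneg (c z.2 * e (z.1 - z.2)))
    refine h1.trans_eq ?_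
    simp only [W.convEquiv, Equiv.coe_fn_mk, norm_mul]
    ring
  refine le_trans ?_ (s5.tsum_le_tsum hle s4)
  rw [s5.tsum_prod]
  have h6 : Summable fun n => w n * ‖(c * e) n‖ := by
    have := summable_wmul hw.abs_le (c * e)
    refine this.congr fun n => ?_
    rw [norm_mul, Complex.norm_real, Real.norm_of_nonneg (hw.nonneg n)]
  refine h6.tsum_le_tsum (fun n => ?_) s5.prod
  simp only [tsum_mul_left]
  exact mul_le_mul_of_nonneg_left (norm_tsum_le_tsum_norm (h.prod_factor n)) (hw.nonneg n)

lemma nrm_rot (θ : (Fin d → ℤ) → ℝ) (t : ℝ) (c : W d) : hw.nrm (rot θ t c) = hw.nrm c := by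
  simp only [nrm_eq, norm_rot_apply]

lemma le_of_nrm_le {c : W d} {C : ℝ} (h : hw.nrm c ≤ C) (n) : w n * ‖c n‖ ≤ C := by
  refine le_trans ?_ h
  have := W.norm_apply_le (wmul w hw.abs_le c) n
  rwa [wmul_apply, norm_mul, Complex.norm_real, Real.norm_of_nonneg (hw.nonneg n)] at this

lemma nrm_le_of_le {c : W d} {u : (Fin d → ℤ) → ℝ} (hu : Summable u)
    (h : ∀ n, w n * ‖c n‖ ≤ u n) : hw.nrm c ≤ ∑' n, u n := by
  refine W.norm_le_of_le hu fun n => ?_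
  rw [wmul_apply, norm_mul, Complex.norm_real, Real.norm_of_nonneg (hw.nonneg n)]
  exact h n

end TameWeight

/-- The constant depends on the unweighted bound R but not on the weight or its truncation, and the
estimate is affine in the weighted norm D. Weighted norms of solutions therefore obey a linear
Gronwall inequality and cannot blow up before the plain norm does. -/
lemma exists_tame_pev {ι : Type*} (p : Pol ι) (R K : ℝ) (hK : 0 ≤ K) : ∃ L : ℝ, 0 ≤ L ∧
    ∀ (N : ℝ) (w : (Fin d → ℤ) → ℝ) (hw : TameWeight K N w) (h : W d) (x : ι → W d) (D : ℝ),
      ‖h‖ ≤ R → (∀ i, ‖x i‖ ≤ R) → hw.nrm h ≤ D → (∀ i, hw.nrm (x i) ≤ D) →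
        hw.nrm (pev p h x) ≤ L * (1 + D) := by
  induction p using MvPolynomial.induction_on with
  | C z =>
    refine ⟨‖z‖, norm_nonneg _, fun N w hw h x D _ _ hD _ => ?_⟩
    have : 0 ≤ D := (hw.nrm_nonneg _).trans hD
    have h1 := hw.nrm_algebraMap_le z
    have h2 : pev (MvPolynomial.C z) h x = algebraMap ℂ (W d) z := by simp [pev]
    rw [h2]
    nlinarith [norm_nonneg z]
  | add p q hp hq =>
    obtain ⟨L, hL, hp⟩ := hp
    obtain ⟨L', hL', hq⟩ := hq
    refine ⟨L + L', by positivity, fun N w hw h x D a b c e => ?_⟩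
    rw [pev_add, add_mul]
    exact (hw.nrm_add_le _ _).trans (add_le_add (hp N w hw h x D a b c e) (hq N w hw h x D a b c e))
  | mul_X p s hp =>
    obtain ⟨L, hL, hp⟩ := hp
    obtain ⟨L', hL', hl⟩ := exists_lipschitz_pev (W d) p R
    refine ⟨K * (L * |R| + L'), by positivity, fun N w hw h x D a b c e => ?_⟩
    have h1 : pev (p * MvPolynomial.X s) h x = pev p h x * vals h x s := by simp [pev]
    rw [h1]
    refine (hw.nrm_mul_le _ _).trans ?_
    rw [mul_assoc]
    refine mul_le_mul_of_nonneg_left ?_ hK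
    have h2 := (norm_vals_le a b s).trans (le_abs_self R)
    have h3 := (hl h h x x a a b b).1
    have h4 := hp N w hw h x D a b c e
    have hD : 0 ≤ D := (hw.nrm_nonneg _).trans c
    have h5 : hw.nrm (vals h x s) ≤ D := by
      rcases s with ⟨_ | i, _ | _⟩ <;> simp [vals, hw.nrm_star, c, e]
    have e1 : hw.nrm (pev p h x) * ‖vals h x s‖ ≤ L * (1 + D) * |R| :=
      mul_le_mul h4 h2 (norm_nonneg _) (by positivity)
    have e2 : ‖pev p h x‖ * hw.nrm (vals h x s) ≤ L' * D :=
      mul_le_mul h3 h5 (hw.nrm_nonneg _) hL'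
    nlinarith

/-- The truncated polynomial weights are tame, uniformly in the truncation. -/
lemma tameWeight_min (s : ℕ) {N : ℝ} (hN : 1 ≤ N) :
    TameWeight (2 ^ s) N fun n : Fin d → ℤ => min (wt n ^ s) N where
  nonneg n := le_min (by have := wt_pos n; positivity) (by linarith)
  le n := min_le_right _ _
  zero_le := (min_le_left _ _).trans (by simp [wt])
  neg n := by simp
  add_le m n := by
    have hm := wt_pos m
    have hn := wt_pos n
    have h0 : ∀ k : Fin d → ℤ, 0 ≤ min (wt k ^ s) N := fun k =>
      le_min (by have := wt_pos k; positivity) (by linarith)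
    have h1 : wt (m + n) ≤ wt m + wt n := by
      unfold wt; linarith [norm_add_le m n]
    have h2 : (1 : ℝ) ≤ 2 ^ s := one_le_pow₀ (by norm_num)
    -- The weight of a sum is at most twice the larger weight; truncation at N respects this since N
    -- ≤ 2^s N.
    have key : ∀ a b : Fin d → ℤ, wt (m + n) ≤ 2 * wt a →
        min (wt (m + n) ^ s) N ≤ 2 ^ s * (min (wt a ^ s) N + min (wt b ^ s) N) := by
      intro a b hab
      have h3 : min (wt (m + n) ^ s) N ≤ 2 ^ s * min (wt a ^ s) N := by
        rcases le_total (wt a ^ s) N with h | h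
        · rw [min_eq_left h, ← mul_pow]
          exact (min_le_left _ _).trans (pow_le_pow_left₀ (wt_pos _).le hab s)
        · rw [min_eq_right h]
          exact (min_le_right _ _).trans (by nlinarith)
      nlinarith [h0 b]
    rcases le_total (wt m) (wt n) with h | h
    · rw [add_comm (min (wt m ^ s) N)]; exact key n m (by linarith)
    · exact key m n (by linarith)

/-! ### Semilinear systems in the interaction picture -/

section system

variable {ι : Type*}

/-- The free evolution of all components. -/
def rotv (θ : ι → (Fin d → ℤ) → ℝ) (t : ℝ) (x : ι → W d) : ι → W d := fun i => rot (θ i) t (x i)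

/-- The polynomial nonlinearity. -/
def nl (P : ι → Pol ι) (h : W d) (x : ι → W d) : ι → W d := fun i => pev (P i) h x

/-- The vector field of a semilinear system in the interaction picture. -/
def vf (θ : ι → (Fin d → ℤ) → ℝ) (P : ι → Pol ι) (h : ℝ → W d) (t : ℝ) (x : ι → W d) : ι → W d :=
  rotv θ t (nl P (h t) (rotv θ (-t) x))

lemma rotv_apply (θ : ι → (Fin d → ℤ) → ℝ) (t : ℝ) (x : ι → W d) (i : ι) :
    rotv θ t x i = rot (θ i) t (x i) := rfl

lemma vf_apply (θ : ι → (Fin d → ℤ) → ℝ) (P : ι → Pol ι) (h : ℝ → W d) (t : ℝ) (x : ι → W d)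
    (i : ι) : vf θ P h t x i = rot (θ i) t (pev (P i) (h t) (rotv θ (-t) x)) := rfl

lemma continuousOn_vf (θ : ι → (Fin d → ℤ) → ℝ) (P : ι → Pol ι) {h : ℝ → W d} {S : Set ℝ}
    (hh : ContinuousOn h S) {x : ℝ → ι → W d} (hx : ContinuousOn x S) :
    ContinuousOn (fun t => vf θ P h t (x t)) S := by
  refine continuousOn_pi.2 fun i => ?_
  refine continuousOn_rot (θ i) (σ := fun t => t) continuousOn_id ?_
  refine continuousOn_pev (P i) hh fun j => ?_
  exact continuousOn_rot (θ j) (σ := fun t => -t) continuousOn_id.neg (continuousOn_pi.1 hx j)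

lemma rotv_sub (θ : ι → (Fin d → ℤ) → ℝ) (t : ℝ) (x y : ι → W d) :
    rotv θ t (x - y) = rotv θ t x - rotv θ t y := by
  funext i; simp [rotv_apply, rot_sub]

variable [Fintype ι]

@[simp] lemma norm_rotv (θ : ι → (Fin d → ℤ) → ℝ) (t : ℝ) (x : ι → W d) : ‖rotv θ t x‖ = ‖x‖ := by
  refine le_antisymm ((pi_norm_le_iff_of_nonneg (norm_nonneg _)).2 fun i => ?_)
    ((pi_norm_le_iff_of_nonneg (norm_nonneg _)).2 fun i => ?_)
  · rw [rotv_apply, norm_rot]; exact norm_le_pi_norm x i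
  · rw [← norm_rot (θ i) t (x i)]; exact norm_le_pi_norm (rotv θ t x) i

/-- Bounds and Lipschitz estimates for the nonlinearity on balls. -/
lemma exists_lipschitz_nl (P : ι → Pol ι) (R : ℝ) : ∃ L : ℝ, 0 ≤ L ∧
    ∀ (h h' : W d) (x x' : ι → W d), ‖h‖ ≤ R → ‖h'‖ ≤ R → ‖x‖ ≤ R → ‖x'‖ ≤ R →
      ‖nl P h x‖ ≤ L ∧ ‖nl P h x - nl P h' x'‖ ≤ L * (‖h - h'‖ + ‖x - x'‖) := by
  choose L hL hp using fun i => exists_lipschitz_pev (W d) (P i) R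
  have hL' : ∀ i, L i ≤ ∑ j, L j := fun i =>
    Finset.single_le_sum (fun j _ => hL j) (Finset.mem_univ i)
  have h0 : 0 ≤ ∑ j, L j := Finset.sum_nonneg fun j _ => hL j
  refine ⟨∑ i, L i, h0, fun h h' x x' a b c e => ⟨?_, ?_⟩⟩
  · refine (pi_norm_le_iff_of_nonneg h0).2 fun i => ?_
    exact ((hp i h h' x x' a b (fun j => (norm_le_pi_norm x j).trans c)
      fun j => (norm_le_pi_norm x' j).trans e).1).trans (hL' i)
  · refine (pi_norm_le_iff_of_nonneg (by positivity)).2 fun i => ?_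
    refine ((hp i h h' x x' a b (fun j => (norm_le_pi_norm x j).trans c)
      fun j => (norm_le_pi_norm x' j).trans e).2 (‖h - h'‖ + ‖x - x'‖) ?_ ?_).trans ?_
    · linarith [norm_nonneg (x - x')]
    · intro j
      have := norm_le_pi_norm (x - x') j
      simp only [Pi.sub_apply] at this
      linarith [norm_nonneg (h - h')]
    · exact mul_le_mul_of_nonneg_right (hL' i) (by positivity)

lemma exists_lipschitz_vf (P : ι → Pol ι) (R : ℝ) : ∃ L : ℝ, 0 ≤ L ∧
    ∀ (θ : ι → (Fin d → ℤ) → ℝ) (h : ℝ → W d) (t : ℝ) (x x' : ι → W d),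
      ‖h t‖ ≤ R → ‖x‖ ≤ R → ‖x'‖ ≤ R →
      ‖vf θ P h t x‖ ≤ L ∧ ‖vf θ P h t x - vf θ P h t x'‖ ≤ L * ‖x - x'‖ := by
  obtain ⟨L, hL, hp⟩ := exists_lipschitz_nl (d := d) P R
  refine ⟨L, hL, fun θ h t x x' a c e => ?_⟩
  have := hp (h t) (h t) (rotv θ (-t) x) (rotv θ (-t) x') a a (by simpa using c) (by simpa using e)
  refine ⟨by simpa [vf] using this.1, ?_⟩
  have h2 := this.2
  rw [sub_self, norm_zero, zero_add, ← rotv_sub, norm_rotv] at h2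
  rw [vf, vf, ← rotv_sub, norm_rotv]
  exact h2

/-- `ψ` is a solution of the semilinear system in the interaction picture. -/
def Sol (T : ℝ) (θ : ι → (Fin d → ℤ) → ℝ) (P : ι → Pol ι) (h : ℝ → W d) (ψ : ℝ → ι → W d) : Prop :=
  ∀ t ∈ Icc 0 T, HasDerivWithinAt ψ (vf θ P h t (ψ t)) (Icc 0 T) t

lemma Sol.continuousOn {T : ℝ} {θ : ι → (Fin d → ℤ) → ℝ} {P : ι → Pol ι} {h : ℝ → W d}
    {ψ : ℝ → ι → W d} (hψ : Sol T θ P h ψ) : ContinuousOn ψ (Icc 0 T) :=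
  fun t ht => (hψ t ht).continuousWithinAt

/-- Rapid decrease of the Fourier coefficients persists, with uniform constants. -/
theorem urap_of_sol_of_le {α : Type*} {T R : ℝ} {Tf : α → ℝ} (hTf : ∀ a, Tf a ≤ T)
    {θ : α → ι → (Fin d → ℤ) → ℝ} {P : ι → Pol ι}
    {h : α → ℝ → W d} {ψ : α → ℝ → ι → W d} (hψ : ∀ a, Sol (Tf a) (θ a) P (h a) (ψ a))
    (hR : ∀ a, ∀ t ∈ Icc 0 (Tf a), ‖ψ a t‖ ≤ R)
    (hh : URap fun z : {z : α × ℝ // z.2 ∈ Icc 0 (Tf z.1)} => h z.1.1 z.1.2)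
    (h0 : ∀ i, URap fun a => ψ a 0 i) (i : ι) :
    URap fun z : {z : α × ℝ // z.2 ∈ Icc 0 (Tf z.1)} => ψ z.1.1 z.1.2 i := by
  intro s
  obtain ⟨H, hH0, hH⟩ := hh.norm_le
  obtain ⟨uh, huh, huh'⟩ := hh.exists_summable s
  choose u0 hu0 hu0' using fun i => (h0 i).exists_summable s
  choose L hL hLp using fun i => exists_tame_pev (d := d) (P i) (max R H) (2 ^ s) (by positivity)
  set L' := ∑ i, L i
  have hLL' : ∀ i, L i ≤ L' := fun i => Finset.single_le_sum (fun j _ => hL j) (Finset.mem_univ i)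
  have hL'0 : 0 ≤ L' := Finset.sum_nonneg fun j _ => hL j
  set S0 := ∑ i, |∑' n, u0 i n|
  set Sh := |∑' n, uh n|
  have hS0 : 0 ≤ S0 := Finset.sum_nonneg fun _ _ => abs_nonneg _
  have hSh : 0 ≤ Sh := abs_nonneg _
  refine ⟨(S0 + L' * (1 + Sh) * T) * Real.exp (L' * T), ?_⟩
  rintro ⟨⟨a, t⟩, ht⟩ n
  replace ht : t ∈ Icc 0 (Tf a) := ht
  -- The truncation level is adapted to the index n under consideration: the truncated weight equals
  -- the full weight there, while all constants are independent of N. Truncation makes the weighted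
  -- norm finite and differentiable along the solution a priori.
  set N := max 1 (wt n ^ s)
  have hw := tameWeight_min (d := d) s (le_max_left 1 (wt n ^ s))
  have hmin : ∀ m : Fin d → ℤ, min (wt m ^ s) N ≤ wt m ^ s := fun m => min_le_left _ _
  set f : ℝ → ι → W d := fun t i => wmul _ hw.abs_le (ψ a t i)
  have hf : ∀ t ∈ Icc 0 (Tf a), HasDerivWithinAt f
      (fun i => wmul _ hw.abs_le (vf (θ a) P (h a) t (ψ a t) i)) (Icc 0 (Tf a)) t := by
    intro t ht
    refine hasDerivWithinAt_pi.2 fun i => ?_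
    have h1 := hasDerivWithinAt_pi.1 (hψ a t ht) i
    exact (wmul _ hw.abs_le).hasFDerivAt.comp_hasDerivWithinAt t h1
  have key := norm_le_of_deriv (K := L') (ε := L' * (1 + Sh)) (δ := S0) hL'0 (by positivity) hf
    ?_ ?_ t ht
  · have h1 : hw.nrm (ψ a t i) ≤ (S0 + L' * (1 + Sh) * T) * Real.exp (L' * T) := by
      refine (norm_le_pi_norm (f t) i).trans (key.trans ?_)
      have := ht.2.trans (hTf a)
      have hT := ht.1.trans this
      gcongr
    have h2 := hw.le_of_nrm_le h1 n
    rwa [min_eq_left (le_max_right _ _)] at h2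
  · refine (pi_norm_le_iff_of_nonneg (by positivity)).2 fun i => ?_
    have h1 : hw.nrm (ψ a 0 i) ≤ ∑' n, u0 i n := by
      refine hw.nrm_le_of_le (hu0 i) fun m => le_trans ?_ (hu0' i a m)
      exact mul_le_mul_of_nonneg_right (hmin m) (norm_nonneg _)
    exact h1.trans ((le_abs_self _).trans (Finset.single_le_sum (f := fun i => |∑' n, u0 i n|)
      (fun j _ => abs_nonneg _) (Finset.mem_univ i)))
  · intro r hr
    have hfn : 0 ≤ ‖f r‖ := norm_nonneg _
    refine (pi_norm_le_iff_of_nonneg (by positivity)).2 fun i => ?_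
    have e1 : hw.nrm (h a r) ≤ Sh := by
      refine (hw.nrm_le_of_le huh fun m => le_trans ?_ (huh' ⟨(a, r), hr⟩ m)).trans (le_abs_self _)
      exact mul_le_mul_of_nonneg_right (hmin m) (norm_nonneg _)
    have e2 := hLp i N _ hw (h a r) (rotv (θ a) (-r) (ψ a r)) (Sh + ‖f r‖)
      ((hH ⟨(a, r), hr⟩).trans (le_max_right _ _))
      (fun j => by
        rw [rotv_apply, norm_rot]
        exact ((norm_le_pi_norm _ j).trans (hR a r hr)).trans (le_max_left _ _))
      (by linarith)
      (fun j => by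
        rw [rotv_apply, hw.nrm_rot]
        have := norm_le_pi_norm (f r) j
        have h3 : hw.nrm (ψ a r j) = ‖f r j‖ := rfl
        have h4 : 0 ≤ Sh := abs_nonneg _
        linarith)
    have e3 : ‖wmul _ hw.abs_le (vf (θ a) P (h a) r (ψ a r) i)‖
        = hw.nrm (pev (P i) (h a r) (rotv (θ a) (-r) (ψ a r))) := by
      rw [vf_apply]; exact hw.nrm_rot _ _ _
    rw [e3]
    refine e2.trans ?_
    have h4 : 0 ≤ Sh := abs_nonneg _
    have := mul_le_mul_of_nonneg_right (hLL' i) (by positivity : 0 ≤ 1 + (Sh + ‖f r‖))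
    linarith

/-- The case of a fixed time interval. -/
theorem urap_of_sol {α : Type*} {T R : ℝ} {θ : α → ι → (Fin d → ℤ) → ℝ} {P : ι → Pol ι}
    {h : α → ℝ → W d} {ψ : α → ℝ → ι → W d} (hψ : ∀ a, Sol T (θ a) P (h a) (ψ a))
    (hR : ∀ a, ∀ t ∈ Icc 0 T, ‖ψ a t‖ ≤ R)
    (hh : URap fun z : α × Icc 0 T => h z.1 z.2) (h0 : ∀ i, URap fun a => ψ a 0 i) (i : ι) :
    URap fun z : α × Icc 0 T => ψ z.1 z.2 i :=
  (urap_of_sol_of_le (fun _ => le_refl T) hψ hR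
    (hh.comp fun z : {z : α × ℝ // z.2 ∈ Icc 0 T} => (z.1.1, ⟨z.1.2, z.2⟩)) h0 i).comp
    fun z : α × Icc 0 T => ⟨(z.1, z.2), z.2.2⟩

end system

/-! ### Uniformly smooth families -/

/-- Families of curves in the Wiener algebra that are `k` times differentiable in time, all
derivatives being uniformly rapidly decreasing. -/
def DC {α : Type*} (T : ℝ) : ℕ → (α → ℝ → W d) → Prop
  | 0, c => URap (fun z : α × Icc 0 T => c z.1 z.2) ∧ ∀ a, ContinuousOn (c a) (Icc 0 T)
  | k + 1, c => URap (fun z : α × Icc 0 T => c z.1 z.2) ∧ ∃ c', DC T k c' ∧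
      ∀ a, ∀ t ∈ Icc 0 T, HasDerivWithinAt (c a) (c' a t) (Icc 0 T) t

namespace DC

variable {α β : Type*} {T : ℝ} {k : ℕ} {c e : α → ℝ → W d}

lemma urap (hc : DC T k c) : URap (fun z : α × Icc 0 T => c z.1 z.2) := by
  cases k with
  | zero => exact hc.1
  | succ k => exact hc.1

lemma continuousOn (hc : DC T k c) (a : α) : ContinuousOn (c a) (Icc 0 T) := by
  cases k with
  | zero => exact hc.2 a
  | succ k =>
    obtain ⟨_, c', _, h⟩ := hc
    exact fun t ht => (h a t ht).continuousWithinAt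

lemma rap (hc : DC T k c) (a : α) {t : ℝ} (ht : t ∈ Icc 0 T) : Rap (c a t) :=
  hc.urap.rap (a, ⟨t, ht⟩)

lemma norm_le (hc : DC T k c) : ∃ C : ℝ, 0 ≤ C ∧ ∀ a, ∀ t ∈ Icc 0 T, ‖c a t‖ ≤ C := by
  obtain ⟨C, h0, h⟩ := hc.urap.norm_le
  exact ⟨C, h0, fun a t ht => h (a, ⟨t, ht⟩)⟩

lemma of_succ : ∀ {k : ℕ} {c : α → ℝ → W d}, DC T (k + 1) c → DC T k c
  | 0, _, hc => ⟨hc.1, fun a => hc.continuousOn a⟩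
  | _ + 1, _, ⟨h1, c', h2, h3⟩ => ⟨h1, c', of_succ h2, h3⟩

lemma congr (hc : DC T k c) (h : ∀ a, ∀ t ∈ Icc 0 T, e a t = c a t) : DC T k e := by
  have hu : URap (fun z : α × Icc 0 T => e z.1 z.2) := by
    have : (fun z : α × Icc 0 T => e z.1 z.2) = fun z : α × Icc 0 T => c z.1 z.2 := by
      funext z; exact h z.1 z.2 z.2.2
    rw [this]; exact hc.urap
  cases k with
  | zero => exact ⟨hu, fun a => (hc.2 a).congr (h a)⟩
  | succ k =>
    obtain ⟨_, c', h2, h3⟩ := hc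
    exact ⟨hu, c', h2, fun a t ht => (h3 a t ht).congr (h a) (h a t ht)⟩

lemma comp : ∀ {k : ℕ} {c : α → ℝ → W d}, DC T k c → ∀ f : β → α, DC T k fun b => c (f b)
  | 0, _, hc, f => ⟨hc.1.comp fun z : β × Icc 0 T => (f z.1, z.2), fun b => hc.2 (f b)⟩
  | _ + 1, _, ⟨h1, c', h2, h3⟩, f =>
    ⟨h1.comp fun z : β × Icc 0 T => (f z.1, z.2), fun b => c' (f b), comp h2 f,
      fun b => h3 (f b)⟩

lemma const {c : α → W d} (hc : URap c) : DC T k fun a (_ : ℝ) => c a := by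
  have hu : ∀ {c : α → W d}, URap c → URap (fun z : α × Icc 0 T => c z.1) :=
    fun h => h.comp fun z : α × Icc 0 T => z.1
  induction k generalizing c with
  | zero => exact ⟨hu hc, fun a => continuousOn_const⟩
  | succ k ih => exact ⟨hu hc, fun _ _ => 0, ih URap.zero, fun a t _ => hasDerivWithinAt_const t _ _⟩

lemma add : ∀ {k : ℕ} {c e : α → ℝ → W d}, DC T k c → DC T k e → DC T k fun a t => c a t + e a t
  | 0, _, _, hc, he => ⟨hc.1.add he.1, fun a => (hc.2 a).add (he.2 a)⟩
  | _ + 1, _, _, ⟨h1, c', h2, h3⟩, ⟨g1, e', g2, g3⟩ =>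
    ⟨h1.add g1, fun a t => c' a t + e' a t, add h2 g2, fun a t ht => (h3 a t ht).add (g3 a t ht)⟩

lemma mul : ∀ {k : ℕ} {c e : α → ℝ → W d}, DC T k c → DC T k e → DC T k fun a t => c a t * e a t
  | 0, _, _, hc, he => ⟨hc.1.mul he.1, fun a => (hc.2 a).mul (he.2 a)⟩
  | _ + 1, _, _, hc, he => by
    obtain ⟨h1, c', h2, h3⟩ := id hc
    obtain ⟨g1, e', g2, g3⟩ := id he
    exact ⟨h1.mul g1, fun a t => c' a t * _ + _ * e' a t, (mul h2 he.of_succ).add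
      (mul hc.of_succ g2), fun a t ht => (h3 a t ht).mul (g3 a t ht)⟩

lemma star : ∀ {k : ℕ} {c : α → ℝ → W d}, DC T k c → DC T k fun a t => star (c a t)
  | 0, _, hc => ⟨hc.1.star, fun a => (hc.2 a).star⟩
  | _ + 1, _, ⟨h1, c', h2, h3⟩ =>
    ⟨h1.star, fun a t => Star.star (c' a t), star h2, fun a t ht => by
      have hL : HasDerivWithinAt (fun t => Star.star _) _ (Icc 0 T) t := (h3 a t ht).star
      exact hL⟩

lemma smul : ∀ {k : ℕ} {c : α → ℝ → W d}, DC T k c → ∀ {z : α → ℂ} {B : ℝ}, (∀ a, ‖z a‖ ≤ B) →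
    DC T k fun a t => z a • c a t
  | 0, _, hc, z, _, hz => ⟨hc.1.smul (z := fun y : α × Icc 0 T => z y.1) fun y => hz y.1,
      fun a => (hc.2 a).const_smul (z a)⟩
  | _ + 1, _, ⟨h1, c', h2, h3⟩, z, _, hz =>
    ⟨h1.smul (z := fun y : α × Icc 0 T => z y.1) fun y => hz y.1, fun a t => z a • c' a t,
      smul h2 hz, fun a t ht => (h3 a t ht).const_smul (z a)⟩

lemma const_smul (hc : DC T k c) (z : ℂ) : DC T k fun a t => z • c a t :=
  hc.smul (fun _ => le_refl ‖z‖)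

lemma sum {ι : Type*} (s : Finset ι) {f : ι → α → ℝ → W d} (h : ∀ i ∈ s, DC T k (f i)) :
    DC T k fun a t => ∑ i ∈ s, f i a t := by
  classical
  induction s using Finset.induction_on with
  | empty => simpa using const (T := T) (k := k) (URap.zero (α := α))
  | insert i s hi ih =>
    simp only [Finset.sum_insert hi]
    exact (h i (Finset.mem_insert_self i s)).add
      (ih fun j hj => h j (Finset.mem_insert_of_mem hj))

lemma pev {ι : Type*} (p : Pol ι) {h : α → ℝ → W d} {x : α → ℝ → ι → W d} (hh : DC T k h)
    (hx : ∀ i, DC T k fun a t => x a t i) : DC T k fun a t => pev p (h a t) (x a t) := by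
  have := pev_closed (A := W d) (α := α × ℝ) (Q := fun f => DC T k fun a t => f (a, t))
    (fun z => const (URap.algebraMap z)) (fun _ _ hf hg => hf.add hg) (fun _ _ hf hg => hf.mul hg)
    (fun _ hf => hf.star) p (h := fun z => h z.1 z.2) (x := fun z => x z.1 z.2) hh hx
  exact this

lemma hasDerivWithinAt_sy {m : (Fin d → ℤ) → ℂ} (hm : Gr1 m) {c c' : ℝ → W d}
    (hc : ∀ t ∈ Icc 0 T, Rap (c t)) (hc' : URap fun t : Icc 0 T => c' t)
    (h : ∀ n, ∀ t ∈ Icc 0 T, HasDerivWithinAt (fun t => c t n) (c' t n) (Icc 0 T) t) :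
    ∀ t ∈ Icc 0 T, HasDerivWithinAt (fun t => sy m (c t)) (sy m (c' t)) (Icc 0 T) t := by
  obtain ⟨u, hu, hu'⟩ := (hc'.sy (Gr1.gr hm)).exists_summable'
  refine W.hasDerivWithinAt_of_coord (convex_Icc 0 T) hu (fun n t ht => ?_)
    fun t ht n => hu' ⟨t, ht⟩ n
  have e2 := (hc'.rap ⟨t, ht⟩).sy_apply hm n
  simp only at e2
  rw [e2]
  exact ((h n t ht).const_mul (m n)).congr (fun s hs => (hc s hs).sy_apply hm n)
    ((hc t ht).sy_apply hm n)

lemma hasDerivWithinAt_coord {c : ℝ → W d} {e : W d} {S : Set ℝ} {t : ℝ}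
    (h : HasDerivWithinAt c e S t) (n : Fin d → ℤ) : HasDerivWithinAt (fun t => c t n) (e n) S t :=
  ((W.coordL n).restrictScalars ℝ).hasFDerivAt.comp_hasDerivWithinAt t h

lemma sy : ∀ {k : ℕ} {c : α → ℝ → W d}, DC T k c → ∀ {m : α → (Fin d → ℤ) → ℂ}, Gr m →
    DC T k fun a t => sy (m a) (c a t)
  | 0, c, hc, m, hm => by
    have hm' : Gr fun (z : α × Icc 0 T) => m z.1 := by
      obtain ⟨C, k, h⟩ := hm; exact ⟨C, k, fun z n => h z.1 n⟩
    have hu := hc.1.sy hm'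
    refine ⟨hu, fun a => ?_⟩
    obtain ⟨u, hs, hu'⟩ := hu.exists_summable'
    refine W.continuousOn_of_coord hs (fun n => ?_) fun t ht n => hu' (a, ⟨t, ht⟩) n
    have h1 : ContinuousOn (fun t => m a n * c a t n) (Icc 0 T) :=
      continuousOn_const.mul ((W.coordL n).continuous.comp_continuousOn (hc.2 a))
    exact h1.congr fun t ht => (hc.rap a ht).sy_apply (hm.gr1 a) n
  | k + 1, c, ⟨h1, c', h2, h3⟩, m, hm => by
    have hm' : Gr fun (z : α × Icc 0 T) => m z.1 := by
      obtain ⟨C, k, h⟩ := hm; exact ⟨C, k, fun z n => h z.1 n⟩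
    refine ⟨h1.sy hm', fun a t => MFE.sy (m a) (c' a t), sy h2 hm, fun a => ?_⟩
    exact hasDerivWithinAt_sy (hm.gr1 a) (fun t ht => h1.rap (a, ⟨t, ht⟩))
      (h2.urap.comp fun t : Icc 0 T => (a, t))
      (fun n t ht => hasDerivWithinAt_coord (h3 a t ht) n)

lemma neg (hc : DC T k c) : DC T k fun a t => -c a t := by
  simpa using hc.const_smul (-1)

lemma sub (hc : DC T k c) (he : DC T k e) : DC T k fun a t => c a t - e a t := by
  simpa [sub_eq_add_neg] using hc.add he.neg

end DC

/-- Uniformly smooth families of curves. -/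
def DCi {α : Type*} (T : ℝ) (c : α → ℝ → W d) : Prop := ∀ k, DC T k c

/-- The hypothesis gives a possibly different derivative for each order; on a nondegenerate interval
derivatives are unique, so one of them serves all orders. -/
lemma DCi.exists_deriv {α : Type*} {T : ℝ} (hT : 0 < T) {c : α → ℝ → W d} (hc : DCi T c) :
    ∃ c', DCi T c' ∧ ∀ a, ∀ t ∈ Icc 0 T, HasDerivWithinAt (c a) (c' a t) (Icc 0 T) t := by
  obtain ⟨_, c', _, h⟩ := hc 1
  refine ⟨c', fun k => ?_, h⟩
  obtain ⟨_, e, h1, h2⟩ := hc (k + 1)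
  refine h1.congr fun a t ht => ?_
  exact (uniqueDiffOn_Icc hT t ht).eq_deriv _ (h a t ht) (h2 a t ht)

/-- Solutions of semilinear systems are uniformly smooth, and solve the system in the original
variables. -/
theorem DCi.of_sol {α ι : Type*} [Fintype ι] {T R : ℝ} {θ : α → ι → (Fin d → ℤ) → ℝ}
    {P : ι → Pol ι} {h : α → ℝ → W d} {ψ : α → ℝ → ι → W d}
    (hψ : ∀ a, Sol T (θ a) P (h a) (ψ a)) (hR : ∀ a, ∀ t ∈ Icc 0 T, ‖ψ a t‖ ≤ R)
    (hh : DCi T h) (h0 : ∀ i, URap fun a => ψ a 0 i)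
    (hθ : ∀ i, Gr fun a n => (Complex.I * (θ a i n : ℂ))) :
    (∀ i, DCi T fun a t => rotv (θ a) (-t) (ψ a t) i) ∧
    ∀ a i, ∀ t ∈ Icc 0 T, HasDerivWithinAt (fun t => rotv (θ a) (-t) (ψ a t) i)
      (pev (P i) (h a t) (rotv (θ a) (-t) (ψ a t))
        - sy (fun n => Complex.I * (θ a i n : ℂ)) (rotv (θ a) (-t) (ψ a t) i)) (Icc 0 T) t := by
  have hu : ∀ i, URap fun z : α × Icc 0 T => rotv (θ z.1) (-(z.2 : ℝ)) (ψ z.1 z.2) i := by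
    intro i s
    obtain ⟨C, hC⟩ := urap_of_sol hψ hR (hh 0).urap h0 i s
    exact ⟨C, fun z n => by
      simp only [rotv_apply, norm_rot_apply]; exact hC z n⟩
  have hcont : ∀ a i, ContinuousOn (fun t => rotv (θ a) (-t) (ψ a t) i) (Icc 0 T) := fun a i =>
    continuousOn_rot _ (σ := fun t => -t) continuousOn_id.neg
      (continuousOn_pi.1 (hψ a).continuousOn i)
  have hD0 : ∀ i, DC T 0 fun a t => rotv (θ a) (-t) (ψ a t) i := fun i => ⟨hu i, fun a => hcont a i⟩
  have hrhs : ∀ k, (∀ i, DC T k fun a t => rotv (θ a) (-t) (ψ a t) i) → ∀ i, DC T k fun a t =>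
      pev (P i) (h a t) (rotv (θ a) (-t) (ψ a t))
        - sy (fun n => Complex.I * (θ a i n : ℂ)) (rotv (θ a) (-t) (ψ a t) i) := fun k hk i =>
    (DC.pev (P i) (hh k) hk).sub ((hk i).sy (hθ i))
  have hder : ∀ a i, ∀ t ∈ Icc 0 T, HasDerivWithinAt (fun t => rotv (θ a) (-t) (ψ a t) i)
      (pev (P i) (h a t) (rotv (θ a) (-t) (ψ a t))
        - sy (fun n => Complex.I * (θ a i n : ℂ)) (rotv (θ a) (-t) (ψ a t) i)) (Icc 0 T) t := by
    intro a i
    -- The symbol need not be bounded, so the product rule is applied to each coefficient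
    -- separately; the uniform decay of the right-hand side then makes the result a derivative in
    -- `W`.
    obtain ⟨u, hs, hu'⟩ := (hrhs 0 hD0 i).urap.exists_summable'
    refine W.hasDerivWithinAt_of_coord (convex_Icc 0 T) hs (fun n t ht => ?_)
      fun t ht n => hu' (a, ⟨t, ht⟩) n
    have h1 := DC.hasDerivWithinAt_coord (hasDerivWithinAt_pi.1 (hψ a t ht) i) n
    have h2 : HasDerivAt (fun t : ℝ => Complex.exp (((θ a i n * -t : ℝ) : ℂ) * Complex.I))
        (Complex.exp (((θ a i n * -t : ℝ) : ℂ) * Complex.I) * (-(θ a i n : ℂ) * Complex.I)) t := by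
      have h3 : HasDerivAt (fun t : ℝ => ((θ a i n * -t : ℝ) : ℂ) * Complex.I)
          (-(θ a i n : ℂ) * Complex.I) t := by
        have h4 : HasDerivAt (fun t : ℝ => θ a i n * -t) (-θ a i n) t := by
          simpa using (hasDerivAt_neg t).const_mul (θ a i n)
        simpa using (h4.ofReal_comp).mul_const Complex.I
      exact h3.cexp
    have h5 := h2.hasDerivWithinAt.mul h1
    have e1 : (fun t => rotv (θ a) (-t) (ψ a t) i n)
        = fun t => Complex.exp (((θ a i n * -t : ℝ) : ℂ) * Complex.I) * ψ a t i n := by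
      funext t; rw [rotv_apply, rot_apply]
    rw [e1]
    refine h5.congr_deriv ?_
    rw [W.sub_apply, ((hD0 i).rap a ht).sy_apply ((hθ i).gr1 a), rotv_apply, rot_apply, vf_apply,
      rot_apply, ← mul_assoc (Complex.exp _) (Complex.exp _), ← Complex.exp_add]
    have e2 : ((θ a i n * -t : ℝ) : ℂ) * Complex.I + ((θ a i n * t : ℝ) : ℂ) * Complex.I = 0 := by
      push_cast; ring
    rw [e2, Complex.exp_zero]
    ring
  refine ⟨fun i k => ?_, hder⟩
  -- Bootstrap in time: the equation expresses the derivative through polynomials and multipliers of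
  -- the solution, both of which preserve `DC T k`.
  have : ∀ i, DC T k fun a t => rotv (θ a) (-t) (ψ a t) i := by
    clear i
    induction k with
    | zero => exact hD0
    | succ k ih => exact fun i => ⟨hu i, _, hrhs k ih i, fun a t ht => hder a i t ht⟩
  exact this i

/-! ### Functions represented by rapidly decaying coefficients -/

/-- The coefficients of the partial derivative. -/
def pd (j : Fin d) (c : W d) : W d := sy (fun n => Complex.I * (n j : ℂ)) c

lemma rap_pd {c : W d} (hc : Rap c) (j : Fin d) : Rap (pd j c) := URap.sy hc (gr_coord j)

lemma pd_apply {c : W d} (hc : Rap c) (j : Fin d) (n) : pd j c n = Complex.I * (n j : ℂ) * c n :=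
  hc.sy_apply (gr_coord j) n

lemma dc_pd {α : Type*} {T : ℝ} {k : ℕ} {c : α → ℝ → W d} (hc : DC T k c) (j : Fin d) :
    DC T k fun a t => pd j (c a t) := DC.sy hc (Gr1.gr (gr_coord j))

lemma W.periodic_val (c : W d) : Periodic fun x => W.val x c := fun j x => by
  unfold W.val
  exact tsum_congr fun n => by rw [periodic_ex n j x]

/-- The `j`-th coordinate form, multiplied by a complex number. -/
def coordForm (j : Fin d) : ℂ →L[ℝ] (E d →L[ℝ] ℂ) :=
  ContinuousLinearMap.smulRightL ℝ (E d) ℂ (EuclideanSpace.proj j : E d →L[ℝ] ℝ)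

lemma coordForm_apply (j : Fin d) (z : ℂ) (h : E d) : coordForm j z h = (h j : ℂ) * z := by
  simp [coordForm]

lemma norm_iform_le (n : Fin d → ℤ) : ‖iform n‖ ≤ d * wt n := by
  refine ContinuousLinearMap.opNorm_le_bound _ (by have := wt_pos n; positivity) fun h => ?_
  rw [iform_apply, norm_mul, Complex.norm_I, one_mul]
  calc ‖∑ j, (n j : ℂ) * (h j : ℂ)‖ ≤ ∑ j : Fin d, wt n * ‖h‖ := by
        refine norm_sum_le_of_le _ fun j _ => ?_
        rw [norm_mul]
        refine mul_le_mul ?_ ?_ (norm_nonneg _) (wt_pos n).le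
        · rw [Complex.norm_intCast, ← Int.norm_eq_abs]
          have := norm_le_pi_norm n j
          unfold wt; linarith
        · rw [Complex.norm_real]; exact PiLp.norm_apply_le h j
    _ = d * wt n * ‖h‖ := by simp [mul_assoc]

lemma Rap.norm_smul_iform_le {c : W d} {u : (Fin d → ℤ) → ℝ}
    (hb : ∀ n, wt n ^ 1 * ‖c n‖ ≤ u n) (n) (y : E d) :
    ‖c n • (ex n y • iform n)‖ ≤ d * u n := by
  rw [norm_smul, norm_smul, norm_ex, one_mul]
  calc ‖c n‖ * ‖iform n‖ ≤ ‖c n‖ * (d * wt n) := by gcongr; exact norm_iform_le n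
    _ = d * (wt n ^ 1 * ‖c n‖) := by ring
    _ ≤ d * u n := by gcongr; exact hb n

lemma Rap.tsum_smul_iform {c : W d} (hc : Rap c) (x : E d)
    (hs : Summable fun n => c n • (ex n x • iform n)) :
    ∑' n, c n • (ex n x • iform n) = ∑ j, coordForm j (W.val x (pd j c)) := by
  ext v
  have h1 : HasSum (fun n => c n * (ex n x * iform n v)) ((∑' n, c n • (ex n x • iform n)) v) :=
    hs.hasSum.mapL (ContinuousLinearMap.apply ℝ ℂ v)
  have h2 : HasSum (fun n => ∑ j, (v j : ℂ) * (pd j c n * ex n x))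
      (∑ j, (v j : ℂ) * W.val x (pd j c)) :=
    hasSum_sum fun j _ => (W.hasSum_val x (pd j c)).mul_left _
  have h3 : (∑ j, coordForm j (W.val x (pd j c))) v = ∑ j, (v j : ℂ) * W.val x (pd j c) := by
    rw [sum_apply]
    exact Finset.sum_congr rfl fun j _ => coordForm_apply _ _ _
  have h4 : (fun n => c n * (ex n x * iform n v))
      = fun n => ∑ j, (v j : ℂ) * (pd j c n * ex n x) := by
    funext n
    rw [iform_apply]
    simp only [Finset.mul_sum]
    refine Finset.sum_congr rfl fun j _ => ?_
    rw [pd_apply hc]; ring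
  rw [h3]
  rw [h4] at h1
  exact h1.unique h2

lemma Rap.hasFDerivAt_val {c : W d} (hc : Rap c) (x : E d) :
    HasFDerivAt (fun y => W.val y c) (∑ j, coordForm j (W.val x (pd j c))) x := by
  obtain ⟨u, hu, hb⟩ := URap.exists_summable hc 1
  have hle := Rap.norm_smul_iform_le (hb ())
  rw [← hc.tsum_smul_iform x (Summable.of_norm_bounded (hu.mul_left (d : ℝ)) fun n => hle n x)]
  exact hasFDerivAt_tsum (𝕜 := ℝ) (x₀ := 0) (hu.mul_left (d : ℝ))
      (fun n y => (hasFDerivAt_ex n y).const_mul (c n)) hle (W.summable_ex c 0).of_norm x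

lemma Rap.fderiv_val {c : W d} (hc : Rap c) (x : E d) :
    fderiv ℝ (fun y => W.val y c) x = ∑ j, coordForm j (W.val x (pd j c)) :=
  (hc.hasFDerivAt_val x).fderiv

lemma Rap.fderiv_val_single {c : W d} (hc : Rap c) (x : E d) (j : Fin d) :
    fderiv ℝ (fun y => W.val y c) x (EuclideanSpace.single j 1) = W.val x (pd j c) := by
  rw [hc.fderiv_val, sum_apply]
  simp only [coordForm_apply]
  rw [Finset.sum_eq_single j] <;> simp +contextual

lemma Rap.continuous_val {c : W d} (hc : Rap c) : Continuous fun y => W.val y c :=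
  continuous_iff_continuousAt.2 fun x => (hc.hasFDerivAt_val x).continuousAt

/-! ### Joint regularity -/

/-- The spatial form as a form on space-time. -/
def coordFormST (j : Fin d) : ℂ →L[ℝ] (ℝ × E d →L[ℝ] ℂ) :=
  ContinuousLinearMap.smulRightL ℝ (ℝ × E d) ℂ
    ((EuclideanSpace.proj j : E d →L[ℝ] ℝ).comp (ContinuousLinearMap.snd ℝ ℝ (E d)))

/-- The temporal form on space-time. -/
def timeFormST (d : ℕ) : ℂ →L[ℝ] (ℝ × E d →L[ℝ] ℂ) :=
  ContinuousLinearMap.smulRightL ℝ (ℝ × E d) ℂ (ContinuousLinearMap.fst ℝ ℝ (E d))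

lemma coordFormST_apply (j : Fin d) (z : ℂ) (h : ℝ × E d) :
    coordFormST j z h = (h.2 j : ℂ) * z := by simp [coordFormST]

lemma timeFormST_apply (z : ℂ) (h : ℝ × E d) : timeFormST d z h = (h.1 : ℂ) * z := by
  simp [timeFormST]

/-- The curve is split into its value at time t, the linear term (s - t)c' and a remainder o(s - t)
in `W`. The remainder is small uniformly in space because the norm of `W` dominates the sup norm. -/
lemma hasFDerivWithinAt_val {T : ℝ} {c : ℝ → W d} {c' : W d} {t : ℝ} (hc : Rap (c t))
    (hc' : Rap c') (h : HasDerivWithinAt c c' (Icc 0 T) t) (x : E d) :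
    HasFDerivWithinAt (fun z : ℝ × E d => W.val z.2 (c z.1))
      (timeFormST d (W.val x c') + ∑ j, coordFormST j (W.val x (pd j (c t))))
      (Icc 0 T ×ˢ univ) (t, x) := by
  have e1 : HasFDerivWithinAt (fun z : ℝ × E d => W.val z.2 (c t))
      (∑ j, coordFormST j (W.val x (pd j (c t)))) (Icc 0 T ×ˢ univ) (t, x) := by
    have := (hc.hasFDerivAt_val x).comp_hasFDerivWithinAt (t, x)
      (f := Prod.snd)
      (hasFDerivWithinAt_snd (𝕜 := ℝ) (p := (t, x)) (s := Icc (0:ℝ) T ×ˢ (univ : Set (E d))))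
    refine this.congr_fderiv (ContinuousLinearMap.ext fun v => ?_)
    rw [ContinuousLinearMap.comp_apply, sum_apply, sum_apply]
    exact Finset.sum_congr rfl fun j _ => by rw [coordForm_apply, coordFormST_apply]; rfl
  have e2 : HasFDerivWithinAt (fun z : ℝ × E d => ((z.1 - t : ℝ) : ℂ) * W.val z.2 c')
      (timeFormST d (W.val x c')) (Icc 0 T ×ˢ univ) (t, x) := by
    have h1 : HasFDerivWithinAt (fun z : ℝ × E d => ((z.1 - t : ℝ) : ℂ))
        (Complex.ofRealCLM.comp (ContinuousLinearMap.fst ℝ ℝ (E d))) (Icc 0 T ×ˢ univ) (t, x) :=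
      Complex.ofRealCLM.hasFDerivAt.comp_hasFDerivWithinAt (t, x)
        (hasFDerivWithinAt_fst.sub_const t)
    have h2 := (hc'.hasFDerivAt_val x).comp_hasFDerivWithinAt (t, x)
      (f := Prod.snd)
      (hasFDerivWithinAt_snd (𝕜 := ℝ) (p := (t, x)) (s := Icc (0:ℝ) T ×ˢ (univ : Set (E d))))
    refine (h1.mul h2).congr_fderiv (ContinuousLinearMap.ext fun v => ?_)
    simp [timeFormST_apply, mul_comm]
  have e3 : HasFDerivWithinAt
      (fun z : ℝ × E d => W.val z.2 (c z.1 - c t - (z.1 - t) • c'))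
      (0 : ℝ × E d →L[ℝ] ℂ) (Icc 0 T ×ˢ univ) (t, x) := by
    rw [hasFDerivWithinAt_iff_isLittleO]
    have h1 : (fun s => c s - c t - (s - t) • c') =o[𝓝[Icc 0 T] t] fun s => s - t :=
      hasDerivWithinAt_iff_isLittleO.1 h
    have h2 : Tendsto (Prod.fst : ℝ × E d → ℝ) (𝓝[Icc 0 T ×ˢ univ] (t, x)) (𝓝[Icc 0 T] t) :=
      tendsto_nhdsWithin_iff.2 ⟨(continuous_fst.tendsto (t, x)).mono_left nhdsWithin_le_nhds,
        eventually_mem_nhdsWithin.mono fun z hz => hz.1⟩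
    have h3 := h1.comp_tendsto h2
    refine Asymptotics.IsLittleO.trans_isBigO (g := fun z : ℝ × E d => z.1 - t) ?_ ?_
    · refine Asymptotics.IsBigO.trans_isLittleO (Asymptotics.isBigO_of_le _ fun z => ?_) h3
      simp only [sub_self, zero_smul, zero_apply, Function.comp]
      simp only [W.val_zero, sub_zero]
      exact W.norm_val_le _ _
    · refine Asymptotics.isBigO_of_le _ fun z => ?_
      exact norm_fst_le (z - (t, x))
  refine ((e3.add e2).add e1).congr_of_eventuallyEq ?_ ?_ |>.congr_fderiv ?_
  · refine Eventually.of_forall fun z => ?_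
    have : (z.1 - t) • c' = ((z.1 - t : ℝ) : ℂ) • c' := rfl
    simp only [Pi.add_apply, W.val_sub, this, W.val_smul]; ring
  · simp [W.val_zero]
  · rw [zero_add]

section joint

variable {α : Type*} {T : ℝ}

/-- The space-time derivative is a fixed linear expression in the values of c' and of the `pd j` of
c, which belong to families of the same kind. This closes the induction on the order with bounds
common to the family. -/
lemma exists_smoothBound_aux (hT : 0 < T) (n : ℕ) : ∀ {c : α → ℝ → W d}, DCi T c →
    (∀ a, ContDiffOn ℝ n (fun z : ℝ × E d => W.val z.2 (c a z.1)) (Icc 0 T ×ˢ univ)) ∧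
    ∃ B : ℝ, 0 ≤ B ∧ ∀ a, ∀ z ∈ (Icc 0 T ×ˢ univ : Set (ℝ × E d)),
      ‖iteratedFDerivWithin ℝ n (fun z : ℝ × E d => W.val z.2 (c a z.1)) (Icc 0 T ×ˢ univ) z‖
        ≤ B := by
  have hS : UniqueDiffOn ℝ (Icc 0 T ×ˢ univ : Set (ℝ × E d)) :=
    (uniqueDiffOn_Icc hT).prod uniqueDiffOn_univ
  induction n with
  | zero =>
    intro c hc
    obtain ⟨c', hc', hd⟩ := hc.exists_deriv hT
    refine ⟨fun a => contDiffOn_zero.2 fun z hz => ?_, ?_⟩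
    · exact (hasFDerivWithinAt_val ((hc 0).rap a hz.1) ((hc' 0).rap a hz.1) (hd a z.1 hz.1)
        z.2).continuousWithinAt
    · obtain ⟨C, hC, h⟩ := (hc 0).norm_le
      refine ⟨C, hC, fun a z hz => ?_⟩
      rw [norm_iteratedFDerivWithin_zero]
      exact (W.norm_val_le _ _).trans (h a z.1 hz.1)
  | succ n ih =>
    intro c hc
    obtain ⟨c', hc', hd⟩ := hc.exists_deriv hT
    have hp : ∀ j, DCi T fun a t => pd j (c a t) := fun j k => dc_pd (hc k) j
    have hder := fun a z (hz : z ∈ (Icc 0 T ×ˢ univ : Set (ℝ × E d))) =>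
      (hasFDerivWithinAt_val ((hc 0).rap a hz.1) ((hc' 0).rap a hz.1) (hd a z.1 hz.1) z.2)
    have hf : ∀ a, ∀ z ∈ (Icc 0 T ×ˢ univ : Set (ℝ × E d)),
        fderivWithin ℝ (fun z : ℝ × E d => W.val z.2 (c a z.1)) (Icc 0 T ×ˢ univ) z
          = timeFormST d (W.val z.2 (c' a z.1))
            + ∑ j, coordFormST j (W.val z.2 (pd j (c a z.1))) := fun a z hz =>
      (hder a z hz).fderivWithin (hS z hz)
    obtain ⟨h1, B, hB0, hB⟩ := ih hc'
    choose h2 B' hB0' hB' using fun j => ih (hp j)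
    have c1 : ∀ a, ContDiffOn ℝ n (fun z : ℝ × E d => timeFormST d (W.val z.2 (c' a z.1)))
        (Icc 0 T ×ˢ univ) := fun a => (timeFormST d).contDiff.comp_contDiffOn (h1 a)
    have c2 : ∀ a j, ContDiffOn ℝ n (fun z : ℝ × E d => coordFormST j (W.val z.2 (pd j (c a z.1))))
        (Icc 0 T ×ˢ univ) := fun a j => (coordFormST j).contDiff.comp_contDiffOn (h2 j a)
    have c3 : ∀ a, ContDiffOn ℝ n
        (fun z : ℝ × E d => ∑ j, coordFormST j (W.val z.2 (pd j (c a z.1))))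
        (Icc 0 T ×ˢ univ) := fun a => ContDiffOn.sum fun j _ => c2 a j
    refine ⟨fun a => ?_, ‖timeFormST d‖ * B + ∑ j : Fin d, ‖coordFormST j‖ * B' j, ?_,
      fun a z hz => ?_⟩
    · push_cast
      refine contDiffOn_succ_of_fderivWithin (fun z hz => (hder a z hz).differentiableWithinAt)
        (by simp) ?_
      exact ((c1 a).add (c3 a)).congr (hf a)
    · have h0 : ∀ j, 0 ≤ ‖coordFormST (d := d) j‖ * B' j := fun j =>
        mul_nonneg (norm_nonneg (coordFormST j)) (hB0' j)
      have h0' : 0 ≤ ‖timeFormST d‖ * B := mul_nonneg (norm_nonneg (timeFormST d)) hB0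
      exact add_nonneg h0' (Finset.sum_nonneg fun j _ => h0 j)
    · rw [← norm_iteratedFDerivWithin_fderivWithin hS hz, iteratedFDerivWithin_congr (hf a) hz,
        fun_iteratedFDerivWithin_add_apply (c1 a z hz) (c3 a z hz) hS hz]
      refine (norm_add_le _ _).trans (add_le_add ?_ ?_)
      · refine ((timeFormST d).norm_iteratedFDerivWithin_comp_left (h1 a z hz) hS hz
          (le_refl _)).trans ?_
        gcongr; exact hB a z hz
      · rw [iteratedFDerivWithin_fun_sum_apply hS hz (fun j _ => c2 a j z hz)]
        refine norm_sum_le_of_le _ fun j _ => ?_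
        refine ((coordFormST j).norm_iteratedFDerivWithin_comp_left (h2 j a z hz) hS hz
          (le_refl _)).trans ?_
        gcongr; exact hB' j a z hz

/-- A family of functions with uniformly rapidly decaying coefficients is uniformly smooth. -/
theorem DCi.exists_smoothBound (hT : 0 < T) {c : α → ℝ → W d} (hc : DCi T c) :
    ∃ B : ℕ → ℝ, ∀ a, SmoothBound T B fun t x => W.val x (c a t) := by
  choose h1 B hB0 hB using fun n => exists_smoothBound_aux hT n hc
  exact ⟨B, fun a => ⟨contDiffOn_infty.2 fun n => h1 n a, fun n => hB n a⟩⟩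

end joint

lemma Rap.contDiff_val {c : W d} (hc : Rap c) (n : ℕ) : ContDiff ℝ n fun x => W.val x c := by
  have h := (exists_smoothBound_aux one_pos n
    (c := fun (_ : Unit) (_ : ℝ) => c) fun k => DC.const hc).1 ()
  rw [← contDiffOn_univ]
  exact h.comp (g := fun z : ℝ × E d => W.val z.2 c) (f := fun x : E d => ((0 : ℝ), x))
    (contDiff_prodMk_right 0).contDiffOn
    fun x _ => ⟨⟨le_rfl, zero_le_one⟩, mem_univ _⟩

lemma Rap.laplacian_val {c : W d} (hc : Rap c) (x : E d) :
    Laplacian.laplacian (fun y => W.val y c) x = ∑ j, W.val x (pd j (pd j c)) := by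
  rw [laplacian_eq_sum (hc.contDiff_val 2)]
  refine Finset.sum_congr rfl fun j _ => ?_
  have : (fun y => fderiv ℝ (fun y => W.val y c) y (EuclideanSpace.single j 1))
      = fun y => W.val y (pd j c) := funext fun y => hc.fderiv_val_single y j
  rw [this, (rap_pd hc j).fderiv_val_single]

/-- The first derivative is a linear image of functions of the same type, so induction on n peels
off one derivative on the right. Joint continuity in (t,x) of the purely spatial derivatives is what
`IsClassical` demands. -/
lemma continuousOn_iteratedFDeriv_val {T : ℝ} (hT : 0 < T) (n : ℕ) : ∀ {c : ℝ → W d},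
    DCi T (fun _ : Unit => c) → ContinuousOn
      (fun z : ℝ × E d => iteratedFDeriv ℝ n (fun x => W.val x (c z.1)) z.2)
      (Icc 0 T ×ˢ univ) := by
  induction n with
  | zero =>
    intro c hc
    have h := ((exists_smoothBound_aux hT 0 hc).1 ()).continuousOn
    simp only [iteratedFDeriv_zero_eq_comp]
    exact (continuousMultilinearCurryFin0 ℝ (E d) ℂ).symm.continuous.comp_continuousOn h
  | succ n ih =>
    intro c hc
    have hp : ∀ j, DCi T fun (_ : Unit) t => pd j (c t) := fun j k => dc_pd (hc k) j
    have hC : ∀ j : Fin d, Continuous fun m : ContinuousMultilinearMap ℝ (fun _ : Fin n => E d) ℂ =>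
        (coordForm j).compContinuousMultilinearMap m := fun j =>
      (ContinuousLinearMap.compContinuousMultilinearMapL ℝ (fun _ : Fin n => E d) ℂ
        (E d →L[ℝ] ℂ) (coordForm j)).continuous
    have h0 : ∀ j : Fin d, ContinuousOn (fun z : ℝ × E d =>
        (coordForm j).compContinuousMultilinearMap
          (iteratedFDeriv ℝ n (fun x => W.val x (pd j (c z.1))) z.2)) (Icc 0 T ×ˢ univ) :=
      fun j => by
        have h := ih (c := fun t => pd j (c t)) (hp j)
        exact (hC j).comp_continuousOn h
    have h1 : ContinuousOn (fun z : ℝ × E d => ∑ j,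
        (coordForm j).compContinuousMultilinearMap
          (iteratedFDeriv ℝ n (fun x => W.val x (pd j (c z.1))) z.2)) (Icc 0 T ×ˢ univ) :=
      haveI : ContinuousAdd (ContinuousMultilinearMap ℝ (fun _ : Fin n => E d) (E d →L[ℝ] ℂ)) :=
        ContinuousMultilinearMap.instIsTopologicalAddGroup.toContinuousAdd
      continuousOn_finsetSum _ fun j _ => h0 j
    have hL : Continuous fun m => (continuousMultilinearCurryRightEquiv' ℝ n (E d) ℂ).symm m :=
      LinearIsometryEquiv.continuous _
    refine (hL.comp_continuousOn h1).congr fun z hz => ?_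
    have hr := (hc 0).rap () hz.1
    rw [iteratedFDeriv_succ_eq_comp_right]
    simp only [Function.comp]
    congr 1
    have : fderiv ℝ (fun y => W.val y (c z.1))
        = fun x => ∑ j, coordForm j (W.val x (pd j (c z.1))) := funext hr.fderiv_val
    have hcd : ∀ j, ContDiff ℝ n fun x => W.val x (pd j (c z.1)) := fun j =>
      (rap_pd hr j).contDiff_val n
    have hcd' : ∀ j, ContDiffAt ℝ n (fun x => coordForm j (W.val x (pd j (c z.1)))) z.2 := fun j =>
      ((coordForm j).contDiff.comp (hcd j)).contDiffAt
    rw [this, iteratedFDeriv_fun_sum_apply fun j _ => hcd' j]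
    exact Finset.sum_congr rfl fun j _ =>
      (coordForm j).iteratedFDeriv_comp_left (hcd j).contDiffAt le_rfl

lemma hasDerivWithinAt_val {c : ℝ → W d} {e : W d} {S : Set ℝ} {t : ℝ}
    (h : HasDerivWithinAt c e S t) (x : E d) :
    HasDerivWithinAt (fun s => W.val x (c s)) (W.val x e) S t :=
  ((W.evL x).restrictScalars ℝ).hasFDerivAt.comp_hasDerivWithinAt t h

theorem DCi.isClassical {T : ℝ} (hT : 0 < T) {c : ℝ → W d} (hc : DCi T fun _ : Unit => c) :
    IsClassical T fun t x => W.val x (c t) where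
  periodic t _ := W.periodic_val (c t)
  contDiff t ht := ((hc 0).rap () ht).contDiff_val 2
  continuousOn n _ := continuousOn_iteratedFDeriv_val hT n hc
  differentiable t ht x := by
    obtain ⟨c', _, h⟩ := hc.exists_deriv hT
    exact (hasDerivWithinAt_val (h () t ht) x).differentiableWithinAt

/-- The symbol of `k · ∇ - (iε/2) Δ`, divided by `i`. -/
def adv (ε : ℝ) (k : E d) (n : Fin d → ℤ) : ℝ := ∑ j, (k j * n j + ε / 2 * (n j : ℝ) ^ 2)

lemma gr_adv {α : Type*} (k : E d) {ε : α → ℝ} {R : ℝ} (hR : ∀ a, |ε a| ≤ R) :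
    Gr fun a n => (Complex.I * (adv (ε a) k n : ℂ)) := by
  have h : ∀ j : Fin d, Gr fun (a : α) (n : Fin d → ℤ) =>
      (k j : ℂ) * (Complex.I * (n j : ℂ))
        + (-Complex.I * (ε a / 2 : ℂ)) * ((Complex.I * (n j : ℂ)) * (Complex.I * (n j : ℂ))) := by
    intro j
    have hg : Gr fun (a : α) (n : Fin d → ℤ) => Complex.I * (n j : ℂ) := Gr1.gr (gr_coord j)
    refine ((Gr.const (z := fun _ => (k j : ℂ)) fun _ => le_rfl).mul hg).add
      ((Gr.const (B := R) fun a => ?_).mul (hg.mul hg))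
    have := hR a
    have h0 := abs_nonneg (ε a)
    simp only [norm_mul, norm_neg, Complex.norm_I, one_mul, norm_div, Complex.norm_real,
      Real.norm_eq_abs, Complex.norm_ofNat]
    linarith
  convert Gr.sum Finset.univ fun j _ => h j using 3 with a n
  unfold adv
  push_cast
  rw [Finset.mul_sum]
  refine Finset.sum_congr rfl fun j _ => ?_
  linear_combination (Complex.I * (ε a / 2 : ℂ) * (n j : ℂ) ^ 2) * Complex.I_sq

lemma sy_adv {c : W d} (hc : Rap c) (ε : ℝ) (k : E d) :
    sy (fun n => Complex.I * (adv ε k n : ℂ)) c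
      = ∑ j, (k j : ℂ) • pd j c - (Complex.I * ε / 2) • ∑ j, pd j (pd j c) := by
  ext n
  have hg : Gr1 fun n => Complex.I * (adv ε k n : ℂ) := gr_adv k fun _ => le_rfl
  rw [hc.sy_apply hg, W.sub_apply, W.sum_apply, W.smul_apply, W.sum_apply, Finset.mul_sum,
    ← Finset.sum_sub_distrib]
  unfold adv
  push_cast
  rw [Finset.mul_sum, Finset.sum_mul]
  refine Finset.sum_congr rfl fun j _ => ?_
  rw [W.smul_apply, pd_apply (rap_pd hc j), pd_apply hc]
  linear_combination (Complex.I * (ε / 2 : ℂ) * (n j : ℂ) ^ 2 * c n) * Complex.I_sq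

lemma dt_val {T : ℝ} (hT : 0 < T) {c : ℝ → W d} {e : W d} {t : ℝ} (ht : t ∈ Icc 0 T)
    (h : HasDerivWithinAt c e (Icc 0 T) t) (x : E d) :
    dt T (fun t x => W.val x (c t)) t x = W.val x e :=
  (hasDerivWithinAt_val h x).derivWithin (uniqueDiffOn_Icc hT t ht)

/-- The advected operator in terms of the coefficients. -/
theorem advected_val {T : ℝ} (hT : 0 < T) {c : ℝ → W d} {e : W d} {t : ℝ} (ht : t ∈ Icc 0 T)
    (hc : Rap (c t)) (h : HasDerivWithinAt c e (Icc 0 T) t) (ε : ℝ) (k : E d) (x : E d) :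
    advected T ε k (fun t x => W.val x (c t)) t x
      = W.val x (e + sy (fun n => Complex.I * (adv ε k n : ℂ)) (c t)) := by
  unfold advected lap
  rw [dt_val hT ht h, hc.fderiv_val, hc.laplacian_val, sy_adv hc, W.val_add, W.val_sub, W.val_sum,
    W.val_smul, W.val_sum, sum_apply]
  simp only [coordForm_apply, W.val_smul]
  ring

/-! ### Coefficients of smooth periodic functions -/

/-- The iterated partial derivative in the direction `j`. -/
def itd (j : Fin d) (f : E d → ℂ) : ℕ → E d → ℂ
  | 0 => f
  | s + 1 => fun x => fderiv ℝ (itd j f s) x (EuclideanSpace.single j 1)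

lemma itd_eq {f : E d → ℂ} (hf : ContDiff ℝ ∞ f) (j : Fin d) : ∀ s : ℕ,
    itd j f s = fun x => iteratedFDeriv ℝ s f x fun _ => EuclideanSpace.single j 1
  | 0 => by funext x; simp [itd]
  | s + 1 => by
    funext x
    have hd : DifferentiableAt ℝ (iteratedFDeriv ℝ s f) x :=
      (hf.differentiable_iteratedFDeriv (by exact_mod_cast WithTop.coe_lt_top s)) x
    rw [itd, itd_eq hf j s, iteratedFDeriv_succ_apply_left]
    have := (hd.hasFDerivAt.continuousMultilinear_apply_const
      fun _ => EuclideanSpace.single j (1 : ℝ)).fderiv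
    change fderiv ℝ (fun x => iteratedFDeriv ℝ s f x fun _ => EuclideanSpace.single j 1) x _ = _
    rw [this]; rfl

lemma contDiff_itd {f : E d → ℂ} (hf : ContDiff ℝ ∞ f) (j : Fin d) : ∀ s : ℕ,
    ContDiff ℝ ∞ (itd j f s)
  | 0 => hf
  | s + 1 => ((contDiff_itd hf j s).fderiv_right (m := ∞) (by simp)).clm_apply contDiff_const

lemma periodic_itd {f : E d → ℂ} (hp : Periodic f) (j : Fin d) : ∀ s : ℕ, Periodic (itd j f s)
  | 0 => hp
  | s + 1 => (periodic_itd hp j s).fderiv _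

lemma fcoeff_itd {f : E d → ℂ} (hf : ContDiff ℝ ∞ f) (hp : Periodic f) (j : Fin d)
    (n : Fin d → ℤ) : ∀ s : ℕ, fcoeff (itd j f s) n = (Complex.I * n j) ^ s * fcoeff f n
  | 0 => by simp [itd]
  | s + 1 => by
    rw [itd, fcoeff_fderiv (periodic_itd hp j s) ((contDiff_itd hf j s).of_le (by simp)),
      fcoeff_itd hf hp j n s]
    ring

/-- The weight is measured by the maximum norm, so one component carries it. Hence pure derivatives
in the coordinate directions suffice to control decay. -/
lemma wt_pow_le (n : Fin d → ℤ) (s : ℕ) : wt n ^ s ≤ 2 ^ s * (1 + ∑ j, |(n j : ℝ)| ^ s) := by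
  unfold wt
  have h0 : 0 ≤ ∑ j, |(n j : ℝ)| ^ s := Finset.sum_nonneg fun j _ => by positivity
  rcases le_total ‖n‖ 1 with h | h
  · calc (1 + ‖n‖) ^ s ≤ 2 ^ s := by gcongr; linarith
      _ ≤ _ := le_mul_of_one_le_right (by positivity) (by linarith)
  · obtain ⟨j, hj⟩ : ∃ j, ‖n‖ ≤ |(n j : ℝ)| := by
      by_contra! hlt
      refine lt_irrefl ‖n‖ ((pi_norm_lt_iff (by linarith)).2 fun j => ?_)
      rw [Int.norm_eq_abs]; exact hlt j
    have h1 : |(n j : ℝ)| ^ s ≤ ∑ j, |(n j : ℝ)| ^ s :=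
      Finset.single_le_sum (f := fun j => |(n j : ℝ)| ^ s) (fun i _ => by positivity)
        (Finset.mem_univ j)
    calc (1 + ‖n‖) ^ s ≤ (2 * |(n j : ℝ)|) ^ s := by gcongr; linarith
      _ = 2 ^ s * |(n j : ℝ)| ^ s := mul_pow _ _ _
      _ ≤ _ := by gcongr; linarith

lemma wt_pow_mul_le_of_itd {f : E d → ℂ} (hf : ContDiff ℝ ∞ f) (hp : Periodic f) {s : ℕ}
    {B₀ B : ℝ} (h0 : ∀ x, ‖f x‖ ≤ B₀) (hB : ∀ j x, ‖itd j f s x‖ ≤ B) (n : Fin d → ℤ) :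
    wt n ^ s * ‖fcoeff f n‖ ≤ 2 ^ s * (B₀ + d * B) := by
  calc wt n ^ s * ‖fcoeff f n‖ ≤ 2 ^ s * (1 + ∑ j, |(n j : ℝ)| ^ s) * ‖fcoeff f n‖ := by
        gcongr; exact wt_pow_le n s
    _ = 2 ^ s * (‖fcoeff f n‖ + ∑ j, ‖fcoeff (itd j f s) n‖) := by
        rw [mul_assoc, add_mul, one_mul, Finset.sum_mul]
        congr 2
        refine Finset.sum_congr rfl fun j _ => ?_
        rw [fcoeff_itd hf hp, norm_mul, norm_pow, norm_mul, Complex.norm_I, one_mul,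
          Complex.norm_intCast]
    _ ≤ 2 ^ s * (B₀ + ∑ _j : Fin d, B) := by
        gcongr with j
        · exact norm_fcoeff_le h0 n
        · exact norm_fcoeff_le (hB j) n
    _ = _ := by simp

/-- Uniformly smooth families of periodic functions have uniformly rapidly decaying
coefficients. -/
theorem exists_coeff {α : Type*} {f : α → E d → ℂ} (hf : ∀ a, ContDiff ℝ ∞ (f a))
    (hp : ∀ a, Periodic (f a)) (hB : ∀ n : ℕ, ∃ B : ℝ, ∀ a x, ‖iteratedFDeriv ℝ n (f a) x‖ ≤ B) :
    ∃ c : α → W d, URap c ∧ ∀ a x, W.val x (c a) = f a x := by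
  choose B hB using hB
  have h0 : ∀ a x, ‖f a x‖ ≤ B 0 := fun a x => by
    have := hB 0 a x
    rwa [norm_iteratedFDeriv_zero] at this
  have hs : ∀ s j a x, ‖itd j (f a) s x‖ ≤ B s := fun s j a x => by
    rw [itd_eq (hf a)]
    refine (ContinuousMultilinearMap.le_opNorm _ _).trans ?_
    simpa using hB s a x
  have key : ∀ s a n, wt n ^ s * ‖fcoeff (f a) n‖ ≤ 2 ^ s * (B 0 + d * B s) := fun s a n =>
    wt_pow_mul_le_of_itd (hf a) (hp a) (h0 a) (fun j => hs s j a) n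
  have hsum : ∀ a, Summable fun n => ‖fcoeff (f a) n‖ := fun a =>
    Summable.of_nonneg_of_le (fun _ => norm_nonneg _) (fun n => le_of_wt_pow (key (2 * d) a n))
      (summable_wt.mul_left _)
  refine ⟨fun a => W.mk (fcoeff (f a)) (hsum a), fun s => ⟨_, key s⟩, fun a x => ?_⟩
  exact (W.hasSum_val x _).unique
    (hasSum_fcoeff (hp a) (hf a).continuous (hsum a).of_norm x)

/-! ### Uniqueness for semilinear systems -/

lemma IsClassical.exists_norm_le {T : ℝ} {f : ℝ → E d → ℂ} (hf : IsClassical T f) :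
    ∃ C, ∀ t ∈ Icc 0 T, ∀ x, ‖f t x‖ ≤ C := by
  obtain ⟨C, hC⟩ := hf.exists_bound 0
  exact ⟨C, fun t ht x => by
    rw [← (hf.periodic t ht).ofTorus_toTorus x]; exact (hC t ht _).1⟩

lemma IsClassical.continuous {T : ℝ} {f : ℝ → E d → ℂ} (hf : IsClassical T f) {t : ℝ}
    (ht : t ∈ Icc 0 T) : Continuous (f t) := (hf.contDiff t ht).continuous

lemma IsClassical.sub {T : ℝ} {f g : ℝ → E d → ℂ} (hf : IsClassical T f) (hg : IsClassical T g) :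
    IsClassical T fun t x => f t x - g t x where
  periodic t ht j x := by simp only [hf.periodic t ht j x, hg.periodic t ht j x]
  contDiff t ht := (hf.contDiff t ht).sub (hg.contDiff t ht)
  continuousOn n hn := by
    refine ((hf.continuousOn n hn).sub (hg.continuousOn n hn)).congr fun z hz => ?_
    have hn' : (n : WithTop ℕ∞) ≤ 2 := by exact_mod_cast hn
    exact iteratedFDeriv_sub_apply (((hf.contDiff z.1 hz.1).of_le hn').contDiffAt)
      (((hg.contDiff z.1 hz.1).of_le hn').contDiffAt)
  differentiable t ht x := (hf.differentiable t ht x).sub (hg.differentiable t ht x)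

lemma advected_sub {T ε : ℝ} {k : E d} {f g : ℝ → E d → ℂ} (hT : 0 < T) (hf : IsClassical T f)
    (hg : IsClassical T g) {t : ℝ} (ht : t ∈ Icc 0 T) (x : E d) :
    advected T ε k (fun t x => f t x - g t x) t x = advected T ε k f t x - advected T ε k g t x := by
  have hu := uniqueDiffOn_Icc hT t ht
  have h1 : dt T (fun t x => f t x - g t x) t x = dt T f t x - dt T g t x :=
    derivWithin_fun_sub (hf.differentiable t ht x) (hg.differentiable t ht x)
  have h2 : fderiv ℝ (fun x => f t x - g t x) x = fderiv ℝ (f t) x - fderiv ℝ (g t) x :=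
    fderiv_fun_sub ((hf.contDiff t ht).differentiable two_ne_zero x)
      ((hg.contDiff t ht).differentiable two_ne_zero x)
  have h3 : lap (fun t x => f t x - g t x) t x = lap f t x - lap g t x :=
    (hf.contDiff t ht).contDiffAt.laplacian_sub (hg.contDiff t ht).contDiffAt
  unfold advected
  rw [h1, h2, h3, sub_apply]
  ring

/-- Classical solutions of semilinear systems are unique. -/
theorem unique_of_pev {ι : Type*} [Fintype ι] {T ε H : ℝ} (hT : 0 < T) (k : ι → E d)
    (P : ι → Pol ι) {h : ℝ → E d → ℂ} (hh : ∀ t ∈ Icc 0 T, Continuous (h t))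
    (hH : ∀ t ∈ Icc 0 T, ∀ x, ‖h t x‖ ≤ H) {w w' : ι → ℝ → E d → ℂ}
    (hw : ∀ i, IsClassical T (w i)) (hw' : ∀ i, IsClassical T (w' i))
    (heq : ∀ i, ∀ t ∈ Icc 0 T, ∀ x, advected T ε (k i) (w i) t x
      = pev (P i) (h t x) fun j => w j t x)
    (heq' : ∀ i, ∀ t ∈ Icc 0 T, ∀ x, advected T ε (k i) (w' i) t x
      = pev (P i) (h t x) fun j => w' j t x)
    (h0 : ∀ i x, w i 0 x = w' i 0 x) : ∀ i, ∀ t ∈ Icc 0 T, ∀ x, w i t x = w' i t x := by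
  choose C hC using fun i => (hw i).exists_norm_le
  choose C' hC' using fun i => (hw' i).exists_norm_le
  set R := |H| + ∑ i, (|C i| + |C' i|)
  have hsum : ∀ i, |C i| + |C' i| ≤ ∑ i, (|C i| + |C' i|) := fun i =>
    Finset.single_le_sum (f := fun i => |C i| + |C' i|) (fun j _ => by positivity)
      (Finset.mem_univ i)
  have hs0 : 0 ≤ ∑ i, (|C i| + |C' i|) := Finset.sum_nonneg fun j _ => by positivity
  have bh : ∀ t ∈ Icc 0 T, ∀ x, ‖h t x‖ ≤ R := fun t ht x => by
    have := hH t ht x; have := le_abs_self H; simp only [R]; linarith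
  have bw : ∀ i, ∀ t ∈ Icc 0 T, ∀ x, ‖w i t x‖ ≤ R := fun i t ht x => by
    have := hC i t ht x; have := le_abs_self (C i); have := hsum i
    have := abs_nonneg H; have := abs_nonneg (C' i); simp only [R]; linarith
  have bw' : ∀ i, ∀ t ∈ Icc 0 T, ∀ x, ‖w' i t x‖ ≤ R := fun i t ht x => by
    have := hC' i t ht x; have := le_abs_self (C' i); have := hsum i
    have := abs_nonneg H; have := abs_nonneg (C i); simp only [R]; linarith
  choose L hL hp using fun i => exists_lipschitz_pev ℂ (P i) R
  have key := eq_zero_of_advected (C := ∑ i, L i) k (fun i t x => w i t x - w' i t x)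
    (fun i t x => pev (P i) (h t x) (fun j => w j t x) - pev (P i) (h t x) fun j => w' j t x)
    (fun i => (hw i).sub (hw' i))
    (fun i t ht x => by rw [advected_sub hT (hw i) (hw' i) ht, heq i t ht x, heq' i t ht x])
    (fun i t ht => (continuous_pev (P i) (hh t ht) fun j => (hw j).continuous ht).sub
      (continuous_pev (P i) (hh t ht) fun j => (hw' j).continuous ht))
    (fun i t ht x => by
      have hD : 0 ≤ ∑ j, ‖w j t x - w' j t x‖ := Finset.sum_nonneg fun j _ => norm_nonneg _
      refine ((hp i _ _ _ _ (bh t ht x) (bh t ht x) (fun j => bw j t ht x)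
        fun j => bw' j t ht x).2 _ (by simpa using hD) fun j =>
          Finset.single_le_sum (f := fun j => ‖w j t x - w' j t x‖) (fun j _ => norm_nonneg _)
            (Finset.mem_univ j)).trans ?_
      gcongr
      exact Finset.single_le_sum (fun j _ => hL j) (Finset.mem_univ i))
    (fun i x => by rw [h0, sub_self])
  exact fun i t ht x => sub_eq_zero.1 (key i t ht x)

/-! ### Existence near approximate solutions -/

/-- Passage to the interaction picture for a curve that need not solve the equation. Rapid decay of
c and c' supplies the summable majorant that the possibly unbounded symbol would otherwise destroy.
-/
lemma hasDerivWithinAt_rot {T : ℝ} {θ : (Fin d → ℤ) → ℝ}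
    (hθ : Gr1 fun n => (Complex.I * (θ n : ℂ))) {c c' : ℝ → W d}
    (hc : URap fun t : Icc 0 T => c t) (hc' : URap fun t : Icc 0 T => c' t)
    (h : ∀ t ∈ Icc 0 T, HasDerivWithinAt c (c' t) (Icc 0 T) t) :
    ∀ t ∈ Icc 0 T, HasDerivWithinAt (fun t => rot θ t (c t))
      (rot θ t (c' t + sy (fun n => Complex.I * (θ n : ℂ)) (c t))) (Icc 0 T) t := by
  have hS := hc'.add (hc.sy (m := fun _ n => Complex.I * (θ n : ℂ)) hθ.gr)
  obtain ⟨u, hu, hb⟩ := hS.exists_summable'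
  refine W.hasDerivWithinAt_of_coord (convex_Icc 0 T) hu (fun n t ht => ?_) fun t ht n => by
    rw [norm_rot_apply]; exact hb ⟨t, ht⟩ n
  have h1 := DC.hasDerivWithinAt_coord (h t ht) n
  have h2 : HasDerivAt (fun t : ℝ => Complex.exp (((θ n * t : ℝ) : ℂ) * Complex.I))
      (Complex.exp (((θ n * t : ℝ) : ℂ) * Complex.I) * ((θ n : ℂ) * Complex.I)) t := by
    have h3 : HasDerivAt (fun t : ℝ => ((θ n * t : ℝ) : ℂ) * Complex.I)
        ((θ n : ℂ) * Complex.I) t := by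
      have h4 : HasDerivAt (fun t : ℝ => θ n * t) (θ n) t := by
        simpa using (hasDerivAt_id t).const_mul (θ n)
      simpa using (h4.ofReal_comp).mul_const Complex.I
    exact h3.cexp
  refine (h2.hasDerivWithinAt.mul h1).congr_deriv ?_
  rw [rot_apply, W.add_apply, Rap.sy_apply (hc.rap ⟨t, ht⟩) hθ]
  ring

/-- Near an approximate solution of a semilinear system there is an exact solution. -/
theorem exists_sol_near {ι : Type*} [Fintype ι] {T R ρ Λ δ δ₀ : ℝ} (hT : 0 ≤ T) (hρ : 0 < ρ)
    (hΛ : 0 ≤ Λ) (hδ : 0 ≤ δ) (hδ₀ : 0 ≤ δ₀) {θ : ι → (Fin d → ℤ) → ℝ} {P : ι → Pol ι} {h : ℝ → W d}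
    {v v' : ℝ → ι → W d}
    {x0 : ι → W d} (hθ : ∀ i, Gr1 fun n => (Complex.I * (θ i n : ℂ)))
    (hv : ∀ i, URap fun t : Icc 0 T => v t i) (hv' : ∀ i, URap fun t : Icc 0 T => v' t i)
    (hder : ∀ i, ∀ t ∈ Icc 0 T, HasDerivWithinAt (fun t => v t i) (v' t i) (Icc 0 T) t)
    (hh : ContinuousOn h (Icc 0 T)) (hR : ∀ i, ∀ t ∈ Icc 0 T, ‖v t i‖ ≤ R) (hR0 : 0 ≤ R)
    (hd : ∀ i, ∀ t ∈ Icc 0 T,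
      ‖v' t i + sy (fun n => Complex.I * (θ i n : ℂ)) (v t i) - pev (P i) (h t) (v t)‖ ≤ δ)
    (h0 : ∀ i, ‖x0 i - v 0 i‖ ≤ δ₀)
    (hL : ∀ t ∈ Icc 0 T, ∀ x y : ι → W d, ‖x‖ ≤ R + ρ → ‖y‖ ≤ R + ρ →
      ‖nl P (h t) x - nl P (h t) y‖ ≤ Λ * ‖x - y‖)
    (hsmall : (δ₀ + δ * T) * Real.exp (2 * Λ * T) ≤ ρ) :
    ∃ ψ : ℝ → ι → W d, ψ 0 = x0 ∧ Sol T θ P h ψ ∧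
      ∀ t ∈ Icc 0 T, ‖rotv θ (-t) (ψ t) - v t‖ ≤ (δ₀ + δ * T) * Real.exp (2 * Λ * T) := by
  have hback : ∀ t (x : ι → W d), rotv θ (-t) (rotv θ t x) = x := fun t x => by
    funext i; rw [rotv_apply, rotv_apply, rot_neg_rot]
  -- In the interaction picture the defect of v is the rotated defect in the original variables, so
  -- it has the same norm, and the Lipschitz constant is also unchanged.
  obtain ⟨ψ, h1, h2⟩ := exists_solution_near (f := vf θ P h) (v := fun t => rotv θ t (v t))
    (v' := fun t => rotv θ t fun i => v' t i + sy (fun n => Complex.I * (θ i n : ℂ)) (v t i))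
    (x0 := x0) (R := R) (δ := δ) (δ₀ := δ₀) hT hρ hΛ
    (fun t ht => hasDerivWithinAt_pi.2 fun i =>
      hasDerivWithinAt_rot (hθ i) (hv i) (hv' i) (hder i) t ht)
    (fun t ht => by
      rw [norm_rotv]
      exact (pi_norm_le_iff_of_nonneg hR0).2 fun i => hR i t ht)
    (fun t ht => by
      rw [vf, hback, ← rotv_sub, norm_rotv]
      exact (pi_norm_le_iff_of_nonneg hδ).2 fun i => hd i t ht)
    ((pi_norm_le_iff_of_nonneg hδ₀).2 fun i => by
      have : rotv θ 0 (v 0) i = v 0 i := by rw [rotv_apply, rot_zero]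
      rw [Pi.sub_apply, this]; exact h0 i)
    (fun x => continuousOn_vf θ P hh continuousOn_const)
    (fun t ht x y hx hy => by
      rw [vf, vf, ← rotv_sub, norm_rotv, ← norm_rotv θ (-t) (x - y), rotv_sub]
      exact hL t ht _ _ (by rwa [norm_rotv]) (by rwa [norm_rotv]))
    hsmall
  refine ⟨ψ, h1, fun t ht => (h2 t ht).1, fun t ht => ?_⟩
  have := (h2 t ht).2
  rwa [← norm_rotv θ (-t), rotv_sub, hback] at this

/-! ### Classical solutions from solutions in the Wiener algebra -/

/-- The original variables of a solution in the interaction picture. -/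
def orig {ι : Type*} (θ : ι → (Fin d → ℤ) → ℝ) (ψ : ℝ → ι → W d) (i : ι) (t : ℝ) : W d :=
  rotv θ (-t) (ψ t) i

lemma orig_zero {ι : Type*} (θ : ι → (Fin d → ℤ) → ℝ) (ψ : ℝ → ι → W d) (i : ι) :
    orig θ ψ i 0 = ψ 0 i := by
  rw [orig, neg_zero, rotv_apply, rot_zero]

lemma norm_orig_le {ι : Type*} [Fintype ι] {θ : ι → (Fin d → ℤ) → ℝ} {ψ : ℝ → ι → W d} {t R : ℝ}
    (h : ‖ψ t‖ ≤ R) (i : ι) : ‖orig θ ψ i t‖ ≤ R := by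
  rw [orig, rotv_apply, norm_rot]; exact (norm_le_pi_norm _ i).trans h

section family

variable {α ι : Type*} [Fintype ι] {T R : ℝ} {θ : α → ι → (Fin d → ℤ) → ℝ}
    {P : ι → Pol ι} {h : α → ℝ → W d} {ψ : α → ℝ → ι → W d}

lemma dci_orig (hψ : ∀ a, Sol T (θ a) P (h a) (ψ a)) (hR : ∀ a, ∀ t ∈ Icc 0 T, ‖ψ a t‖ ≤ R)
    (hh : DCi T h) (h0 : ∀ i, URap fun a => ψ a 0 i)
    (hθ : ∀ i, Gr fun a n => (Complex.I * (θ a i n : ℂ))) (i : ι) :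
    DCi T fun a t => orig (θ a) (ψ a) i t := (DCi.of_sol hψ hR hh h0 hθ).1 i

lemma hasDerivWithinAt_orig (hψ : ∀ a, Sol T (θ a) P (h a) (ψ a))
    (hR : ∀ a, ∀ t ∈ Icc 0 T, ‖ψ a t‖ ≤ R)
    (hh : DCi T h) (h0 : ∀ i, URap fun a => ψ a 0 i)
    (hθ : ∀ i, Gr fun a n => (Complex.I * (θ a i n : ℂ))) (a : α) (i : ι) {t : ℝ}
    (ht : t ∈ Icc 0 T) : HasDerivWithinAt (orig (θ a) (ψ a) i)
      (pev (P i) (h a t) (fun j => orig (θ a) (ψ a) j t)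
        - sy (fun n => Complex.I * (θ a i n : ℂ)) (orig (θ a) (ψ a) i t)) (Icc 0 T) t :=
  (DCi.of_sol hψ hR hh h0 hθ).2 a i t ht

end family

/-- The symbol of the advected operator with a constant shift of the frequency. -/
def advs (ε : ℝ) (k : E d) (σ : ℝ) (n : Fin d → ℤ) : ℝ := adv ε k n + σ

lemma gr_advs {α : Type*} (k : E d) (σ : α → ℝ) {ε : α → ℝ} {R S : ℝ} (hR : ∀ a, |ε a| ≤ R)
    (hS : ∀ a, |σ a| ≤ S) : Gr fun a n => (Complex.I * (advs (ε a) k (σ a) n : ℂ)) := by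
  have h1 := (gr_adv k hR).add (Gr.const (d := d) (z := fun a => Complex.I * (σ a : ℂ)) (B := S)
    fun a => by
      rw [norm_mul, Complex.norm_I, one_mul, Complex.norm_real]; exact hS a)
  convert h1 using 3 with a n
  unfold advs; push_cast; ring

lemma sy_advs {c : W d} (hc : Rap c) (ε : ℝ) (k : E d) (σ : ℝ) :
    sy (fun n => Complex.I * (advs ε k σ n : ℂ)) c
      = sy (fun n => Complex.I * (adv ε k n : ℂ)) c + (Complex.I * σ) • c := by
  ext n
  have g1 : Gr1 fun n : Fin d → ℤ => Complex.I * (advs ε k σ n : ℂ) :=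
    gr_advs k (fun _ => σ) (fun _ => le_rfl) fun _ => le_rfl
  have g2 : Gr1 fun n : Fin d → ℤ => Complex.I * (adv ε k n : ℂ) := gr_adv k fun _ => le_rfl
  rw [W.add_apply, W.smul_apply, hc.sy_apply g1, hc.sy_apply g2]
  unfold advs; push_cast; ring

/-- Solutions in the Wiener algebra solve the partial differential equations. -/
lemma advected_orig {ι : Type*} [Fintype ι] {T R : ℝ} (hT : 0 < T) {ε : ℝ} {k : ι → E d} {σ : ι → ℝ}
    {P : ι → Pol ι} {h : ℝ → W d} {ψ : ℝ → ι → W d}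
    (hψ : Sol T (fun i => advs ε (k i) (σ i)) P h ψ) (hR : ∀ t ∈ Icc 0 T, ‖ψ t‖ ≤ R)
    (hh : DCi T fun _ : Unit => h) (h0 : ∀ i, Rap (ψ 0 i)) (i : ι) :
    IsClassical T (fun t x => W.val x (orig (fun i => advs ε (k i) (σ i)) ψ i t)) ∧
    ∀ t ∈ Icc 0 T, ∀ x,
      advected T ε (k i) (fun t x => W.val x (orig (fun i => advs ε (k i) (σ i)) ψ i t)) t x
      = pev (P i) (W.val x (h t)) (fun j => W.val x (orig (fun i => advs ε (k i) (σ i)) ψ j t))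
        - Complex.I * σ i * W.val x (orig (fun i => advs ε (k i) (σ i)) ψ i t) := by
  have hθ : ∀ i, Gr fun (_ : Unit) n => (Complex.I * (advs ε (k i) (σ i) n : ℂ)) := fun i =>
    gr_advs (k i) (fun _ => σ i) (fun _ => le_rfl) fun _ => le_rfl
  have hD := dci_orig (fun _ : Unit => hψ) (fun _ => hR) hh h0 hθ
  refine ⟨(hD i).isClassical hT, fun t ht x => ?_⟩
  have hd := hasDerivWithinAt_orig (fun _ : Unit => hψ) (fun _ => hR) hh h0 hθ () i ht
  have hr := (hD i 0).rap () ht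
  rw [advected_val hT ht hr hd, sy_advs hr, W.val_add, W.val_sub, W.val_add, W.val_smul, val_pev]
  ring

/-! ### The system of modulation functions as a polynomial system -/

section algebra

variable {A : Type*} [CommRing A] [Algebra ℂ A] [StarRing A]

open Classical in
/-- Extension by zero of a family indexed by the wave vectors in `K`. -/
def extz {A : Type*} [Zero A] (K : Finset (E d)) (x : K → A) (e : E d) : A :=
  if h : e ∈ K then x ⟨e, h⟩ else 0

lemma extz_of_mem {A : Type*} [Zero A] {K : Finset (E d)} (x : K → A) {e : E d} (h : e ∈ K) :
    extz K x e = x ⟨e, h⟩ := by rw [extz, dif_pos h]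

/-- The product `x_i x̄_j x_k`. -/
def cub (x : E d → A) (ν : E d × E d × E d) : A := x ν.1 * star (x ν.2.1) * x ν.2.2

/-- The product `δ_ν⁻¹ x_i x̄_j x_k`. -/
def cubd (x : E d → A) (ν : E d × E d × E d) : A := (1 / (delta ν : ℂ)) • cub x ν

open Classical in
/-- The right-hand side of the system for the modulation functions in a general algebra. -/
def rhsA (lam : ℝ) (K : Finset (E d)) (h : A) (x : E d → A) (r : E d) : A :=
  (- Complex.I * lam) • (∑ ν ∈ triples K, if kap ν = r then cub x ν else 0)
  - (2 * Complex.I * lam ^ 2) • (h *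
    (∑ ν ∈ nonres K, ∑ p ∈ K, ∑ q ∈ K,
      if kap ν - p + q = r ∧ om ν - freq p + freq q = freq r
      then cubd x ν * star (x p) * x q else 0))
  - (Complex.I * lam ^ 2) • (h *
    (∑ ν ∈ nonres K, ∑ p ∈ K, ∑ q ∈ K,
      if p - kap ν + q = r ∧ freq p - om ν + freq q = freq r
      then x p * star (cubd x ν) * x q else 0))

lemma mem_triples {K : Finset (E d)} {ν : E d × E d × E d} :
    ν ∈ triples K ↔ ν.1 ∈ K ∧ ν.2.1 ∈ K ∧ ν.2.2 ∈ K := by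
  simp [triples]

lemma mem_nonres {K : Finset (E d)} {ν : E d × E d × E d} :
    ν ∈ nonres K ↔ ν ∈ triples K ∧ om ν ≠ omStar ν := by
  simp [nonres]

lemma delta_ne_zero {K : Finset (E d)} {ν : E d × E d × E d} (h : ν ∈ nonres K) : delta ν ≠ 0 :=
  sub_ne_zero.2 (mem_nonres.1 h).2

lemma cub_congr {A : Type*} [CommRing A] [StarRing A] {K : Finset (E d)} {x y : E d → A} (h : ∀ e ∈ K, x e = y e)
    {ν : E d × E d × E d} (hν : ν ∈ triples K) : cub x ν = cub y ν := by
  obtain ⟨h1, h2, h3⟩ := mem_triples.1 hν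
  rw [cub, cub, h _ h1, h _ h2, h _ h3]

lemma cubd_congr {K : Finset (E d)} {x y : E d → A} (h : ∀ e ∈ K, x e = y e)
    {ν : E d × E d × E d} (hν : ν ∈ nonres K) : cubd x ν = cubd y ν := by
  rw [cubd, cubd, cub_congr h (mem_nonres.1 hν).1]

/-- Only indices in K enter. This reconciles functions defined for all wave vectors with unknowns
indexed by K and extended by zero. -/
lemma rhsA_congr {lam : ℝ} {K : Finset (E d)} {x y : E d → A} (hxy : ∀ e ∈ K, x e = y e) (h : A)
    (r : E d) : rhsA lam K h x r = rhsA lam K h y r := by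
  unfold rhsA
  congr 1
  · congr 1
    · congr 1
      refine Finset.sum_congr rfl fun ν hν => ?_
      rw [cub_congr hxy hν]
    · congr 2
      refine Finset.sum_congr rfl fun ν hν => Finset.sum_congr rfl fun p hp =>
        Finset.sum_congr rfl fun q hq => ?_
      rw [cubd_congr hxy hν, hxy p hp, hxy q hq]
  · congr 2
    refine Finset.sum_congr rfl fun ν hν => Finset.sum_congr rfl fun p hp =>
      Finset.sum_congr rfl fun q hq => ?_
    rw [cubd_congr hxy hν, hxy p hp, hxy q hq]

/-- The variables and their conjugates, indexed by all wave vectors. -/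
def pvz (K : Finset (E d)) (e : E d) : Pol K := extz K pv e
def pvcz (K : Finset (E d)) (e : E d) : Pol K := extz K pvc e

lemma pev_pvz (K : Finset (E d)) (e : E d) (h : A) (x : K → A) :
    pev (pvz K e) h x = extz K x e := by
  unfold pvz extz; split_ifs <;> simp

lemma pev_pvcz (K : Finset (E d)) (e : E d) (h : A) (x : K → A) :
    pev (pvcz K e) h x = star (extz K x e) := by
  unfold pvcz extz; split_ifs <;> simp

/-- The product `x_i x̄_j x_k` and its conjugate as polynomials. -/
def pcub (K : Finset (E d)) (ν : E d × E d × E d) : Pol K :=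
  pvz K ν.1 * pvcz K ν.2.1 * pvz K ν.2.2
def pcubc (K : Finset (E d)) (ν : E d × E d × E d) : Pol K :=
  pvcz K ν.1 * pvz K ν.2.1 * pvcz K ν.2.2

lemma pev_pcub (K : Finset (E d)) (ν : E d × E d × E d) (h : A) (x : K → A) :
    pev (pcub K ν) h x = cub (extz K x) ν := by
  simp [pcub, cub, pev_pvz, pev_pvcz]

lemma pev_pcubc (K : Finset (E d)) (ν : E d × E d × E d) (h : A) (x : K → A) :
    pev (pcubc K ν) h x = star (cub (extz K x) ν) := by
  simp [pcubc, cub, pev_pvz, pev_pvcz]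

lemma star_cubd [StarModule ℂ A] (x : E d → A) (ν : E d × E d × E d) :
    star (cubd x ν) = (1 / (delta ν : ℂ)) • star (cub x ν) := by
  rw [cubd, star_smul]
  congr 1
  simp

open Classical in
/-- The polynomial nonlinearity of the system for the modulation functions. -/
def aPol (lam : ℝ) (K : Finset (E d)) (r : K) : Pol K :=
  (- Complex.I * lam) • (∑ ν ∈ triples K, if kap ν = r then pcub K ν else 0)
  - (2 * Complex.I * lam ^ 2) • (ph *
    (∑ ν ∈ nonres K, ∑ p ∈ K, ∑ q ∈ K,
      if kap ν - p + q = r ∧ om ν - freq p + freq q = freq (r : E d)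
      then ((1 / (delta ν : ℂ)) • pcub K ν) * pvcz K p * pvz K q else 0))
  - (Complex.I * lam ^ 2) • (ph *
    (∑ ν ∈ nonres K, ∑ p ∈ K, ∑ q ∈ K,
      if p - kap ν + q = r ∧ freq p - om ν + freq q = freq (r : E d)
      then pvz K p * ((1 / (delta ν : ℂ)) • pcubc K ν) * pvz K q else 0))

lemma pev_ite {ι : Type*} (c : Prop) [Decidable c] (p : Pol ι) (h : A) (x : ι → A) :
    pev (if c then p else 0) h x = if c then pev p h x else 0 := by
  split_ifs <;> simp

lemma pev_aPol [StarModule ℂ A] (lam : ℝ) (K : Finset (E d)) (r : K) (h : A) (x : K → A) :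
    pev (aPol lam K r) h x = rhsA lam K h (extz K x) r := by
  simp only [aPol, rhsA, pev_sub, pev_smul, pev_sum, pev_mul, pev_ph, pev_ite, pev_pcub, pev_pcubc,
    pev_pvz, pev_pvcz, star_cubd]
  rfl

end algebra

lemma rhsA_eq_aRHS (ε lam : ℝ) (K : Finset (E d)) (a : E d → ℝ → E d → ℂ) (r : E d) (t : ℝ)
    (x : E d) : rhsA lam K (ε : ℂ) (fun e => a e t x) r = aRHS ε lam K a r t x := by
  have h1 : ∀ ν, cub (fun e => a e t x) ν = cubic a ν t x := fun ν => rfl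
  have h2 : ∀ ν, cubd (fun e => a e t x) ν = bMod a ν t x := fun ν => rfl
  simp only [rhsA, aRHS, h1, h2, smul_eq_mul]
  ring

lemma val_cub (y : E d) (c : E d → W d) (ν : E d × E d × E d) :
    W.val y (cub c ν) = cub (fun e => W.val y (c e)) ν := by
  simp only [cub, W.val_mul, W.val_star]

lemma val_cubd (y : E d) (c : E d → W d) (ν : E d × E d × E d) :
    W.val y (cubd c ν) = cubd (fun e => W.val y (c e)) ν := by
  rw [cubd, W.val_smul, val_cub]; rfl

/-! ### Uniqueness and restriction -/

lemma IsClassical.mono {T τ : ℝ} (h : τ ≤ T) {f : ℝ → E d → ℂ} (hf : IsClassical T f) :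
    IsClassical τ f := by
  have hs : Icc 0 τ ⊆ Icc 0 T := Icc_subset_Icc_right h
  exact ⟨fun t ht => hf.1 t (hs ht), fun t ht => hf.2 t (hs ht),
    fun n hn => (hf.3 n hn).mono (prod_mono hs le_rfl), fun t ht x => (hf.4 t (hs ht) x).mono hs⟩

lemma advected_mono {T τ ε : ℝ} (hτ : 0 < τ) (h : τ ≤ T) {f : ℝ → E d → ℂ} (hf : IsClassical T f)
    {k : E d} {t : ℝ} (ht : t ∈ Icc 0 τ) (x : E d) : advected τ ε k f t x = advected T ε k f t x := by
  have hs : Icc 0 τ ⊆ Icc 0 T := Icc_subset_Icc_right h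
  have : dt τ f t x = dt T f t x :=
    ((hf.differentiable t (hs ht) x).hasDerivWithinAt.mono hs).derivWithin
      (uniqueDiffOn_Icc hτ t ht)
  rw [advected, advected, this]

section solvesA

variable {M : ℕ} {T ε lam : ℝ} {κ : Fin M → E d} {K : Finset (E d)} {a0 : Fin M → E d → ℂ}

lemma SolvesA.mono {τ : ℝ} (hτ : 0 < τ) (h : τ ≤ T) {a : E d → ℝ → E d → ℂ}
    (ha : SolvesA T ε lam κ K a0 a) : SolvesA τ ε lam κ K a0 a := fun r hr =>
  ⟨(ha r hr).1.mono h, fun t ht x => by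
    rw [advected_mono hτ h (ha r hr).1 ht]
    exact (ha r hr).2.1 t (Icc_subset_Icc_right h ht) x, (ha r hr).2.2⟩

lemma SolvesA.eq_pev {a : E d → ℝ → E d → ℂ} (ha : SolvesA T ε lam κ K a0 a) (i : K) {t : ℝ}
    (ht : t ∈ Icc 0 T) (x : E d) :
    advected T ε (i : E d) (a i) t x = pev (aPol lam K i) (ε : ℂ) fun j : K => a j t x := by
  rw [(ha i i.2).2.1 t ht x, pev_aPol, ← rhsA_eq_aRHS]
  exact rhsA_congr (fun e he => by rw [extz_of_mem _ he]) _ _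

lemma SolvesA.unique (hT : 0 < T) {a a' : E d → ℝ → E d → ℂ} (ha : SolvesA T ε lam κ K a0 a)
    (ha' : SolvesA T ε lam κ K a0 a') : ∀ r ∈ K, ∀ t ∈ Icc 0 T, ∀ x, a' r t x = a r t x := by
  intro r hr
  exact unique_of_pev hT (fun i : K => (i : E d)) (aPol lam K) (h := fun _ _ => (ε : ℂ))
    (fun t _ => continuous_const) (fun t _ x => le_rfl)
    (fun i => (ha' i i.2).1) (fun i => (ha i i.2).1)
    (fun i t ht x => ha'.eq_pev i ht x) (fun i t ht x => ha.eq_pev i ht x)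
    (fun i x => by rw [(ha' i i.2).2.2, (ha i i.2).2.2]) ⟨r, hr⟩

/-- The frequencies of the free evolution of the modulation functions. -/
def aSym (K : Finset (E d)) (ε : ℝ) (i : K) : (Fin d → ℤ) → ℝ := advs ε (i : E d) 0

/-- The modulation functions with given coefficients. -/
def aFun (K : Finset (E d)) (ε : ℝ) (ψ : ℝ → K → W d) (e : E d) (t : ℝ) (x : E d) : ℂ :=
  W.val x (extz K (fun i => orig (aSym K ε) ψ i t) e)

lemma solvesA_of_sol {R : ℝ} (hT : 0 < T) {ψ : ℝ → K → W d}
    (hψ : Sol T (aSym K ε) (aPol lam K) (fun _ => algebraMap ℂ (W d) ε) ψ)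
    (hR : ∀ t ∈ Icc 0 T, ‖ψ t‖ ≤ R) (h0 : ∀ i, Rap (ψ 0 i))
    (hi : ∀ i x, W.val x (ψ 0 i) = initMod κ a0 i x) :
    SolvesA T ε lam κ K a0 (aFun K ε ψ) := by
  intro r hr
  obtain ⟨h1, h2⟩ := advected_orig (ε := ε) (k := fun i : K => (i : E d)) (σ := fun _ => 0) hT hψ hR
    (fun k => DC.const (URap.algebraMap _)) h0 ⟨r, hr⟩
  have e1 : aFun K ε ψ r = fun t x => W.val x (orig (aSym K ε) ψ ⟨r, hr⟩ t) := by
    funext t x; rw [aFun, extz_of_mem _ hr]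
  rw [e1]
  refine ⟨h1, fun t ht x => ?_, fun x => ?_⟩
  · refine (h2 t ht x).trans ?_
    rw [pev_aPol, ← rhsA_eq_aRHS, Complex.ofReal_zero, mul_zero, zero_mul, sub_zero]
    have e2 : W.val x (algebraMap ℂ (W d) ε) = (ε : ℂ) := by
      rw [Algebra.algebraMap_eq_smul_one, W.val_smul, W.val_one, mul_one]
    rw [e2]
    exact rhsA_congr (fun e he => by rw [aFun, extz_of_mem _ he, extz_of_mem _ he]; rfl) _ _
  · change W.val x (orig (aSym K ε) ψ ⟨r, hr⟩ 0) = _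
    rw [orig_zero]; exact hi _ x

end solvesA

/-! ### Initial data -/

/-- Smooth profiles are represented by uniformly rapidly decaying coefficients. -/
lemma exists_initial_coeff {M : ℕ} {κ : Fin M → E d} {a0 : ℝ → Fin M → E d → ℂ}
    (ha0 : SmoothProfiles κ a0) :
    ∃ c : {ε : ℝ // Admissible κ ε ∧ ε ≤ 1} → Fin M → W d, (∀ m, URap fun e => c e m) ∧
      ∀ e m x, W.val x (c e m) = a0 e m x := by
  have h : ∀ m, ∃ c : {ε : ℝ // Admissible κ ε ∧ ε ≤ 1} → W d, URap c ∧
      ∀ e x, W.val x (c e) = a0 e m x := fun m =>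
    exists_coeff (f := fun e : {ε : ℝ // Admissible κ ε ∧ ε ≤ 1} => a0 e m)
      (fun e => (ha0.1 e e.2.1 e.2.2 m).1) (fun e => (ha0.1 e e.2.1 e.2.2 m).2) fun n => by
        obtain ⟨B, hB⟩ := ha0.2 n
        exact ⟨B, fun e x => hB e e.2.1 e.2.2 m x⟩
  choose c h1 h2 using h
  exact ⟨fun e m => c m e, h1, fun e m x => h2 m e x⟩

open Classical in
/-- The initial values of the modulation functions. -/
def initW {M : ℕ} (κ : Fin M → E d) (c : Fin M → W d) (r : E d) : W d :=
  ∑ m, if κ m = r then c m else 0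

lemma val_initW {M : ℕ} {κ : Fin M → E d} {c : Fin M → W d} {a : Fin M → E d → ℂ} (x : E d)
    (h : ∀ m, W.val x (c m) = a m x) (r : E d) : W.val x (initW κ c r) = initMod κ a r x := by
  rw [initW, initMod, W.val_sum]
  refine Finset.sum_congr rfl fun m _ => ?_
  split_ifs <;> simp [h, W.val_zero]

lemma urap_initW {M : ℕ} {α : Type*} {κ : Fin M → E d} {c : α → Fin M → W d}
    (hc : ∀ m, URap fun a => c a m) (r : E d) : URap fun a => initW κ (c a) r := by
  refine URap.sum _ fun m _ => ?_
  split_ifs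
  · exact hc m
  · exact URap.zero

/-! ### Sup-norm estimates of pure derivatives -/

lemma pd_zero (j : Fin d) : pd j (0 : W d) = 0 := by
  ext n; rw [pd_apply (URap.zero)]; simp

lemma pd_add {f g : W d} (hf : Rap f) (hg : Rap g) (j : Fin d) : pd j (f + g) = pd j f + pd j g := by
  ext n
  rw [pd_apply (hf.add hg), W.add_apply, W.add_apply, pd_apply hf, pd_apply hg]; ring

lemma pd_star {f : W d} (hf : Rap f) (j : Fin d) : pd j (star f) = star (pd j f) := by
  ext n
  rw [pd_apply hf.star, W.star_apply, W.star_apply, pd_apply hf]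
  simp

lemma pd_algebraMap (z : ℂ) (j : Fin d) : pd j (algebraMap ℂ (W d) z) = 0 := by
  ext n
  rw [pd_apply (URap.algebraMap z), Algebra.algebraMap_eq_smul_one, W.smul_apply, W.one_def,
    W.mono_apply, W.zero_apply]
  split_ifs with h <;> simp [h]

lemma pd_mul {f g : W d} (hf : Rap f) (hg : Rap g) (j : Fin d) :
    pd j (f * g) = pd j f * g + f * pd j g := by
  refine W.ext_val fun x => ?_
  rw [W.val_add, W.val_mul, W.val_mul, ← Rap.fderiv_val_single (URap.mul hf hg),
    ← hf.fderiv_val_single, ← hg.fderiv_val_single]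
  have e : (fun y => W.val y (f * g)) = fun y => W.val y f * W.val y g :=
    funext fun y => W.val_mul y f g
  rw [e, fderiv_fun_mul (hf.hasFDerivAt_val x).differentiableAt
    (hg.hasFDerivAt_val x).differentiableAt]
  simp only [add_apply, smul_apply, smul_eq_mul]
  ring

/-- Iterated partial derivatives. -/
def pdn (j : Fin d) (n : ℕ) (c : W d) : W d := (pd j)^[n] c

lemma pdn_zero_right (j : Fin d) (n : ℕ) : pdn j n (0 : W d) = 0 := by
  induction n with
  | zero => rfl
  | succ n ih => rw [pdn, Function.iterate_succ_apply, pd_zero]; exact ih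

lemma pdn_succ (j : Fin d) (n : ℕ) (c : W d) : pdn j (n + 1) c = pdn j n (pd j c) :=
  Function.iterate_succ_apply _ _ _

lemma pdn_succ' (j : Fin d) (n : ℕ) (c : W d) : pdn j (n + 1) c = pd j (pdn j n c) :=
  Function.iterate_succ_apply' _ _ _

lemma urap_pdn {α : Type*} {c : α → W d} (hc : URap c) (j : Fin d) (n : ℕ) :
    URap fun a => pdn j n (c a) := by
  induction n with
  | zero => exact hc
  | succ n ih =>
    simp only [pdn_succ']
    exact ih.sy (Gr1.gr (gr_coord j))

lemma pdn_add (j : Fin d) (n : ℕ) : ∀ {f g : W d}, Rap f → Rap g →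
    pdn j n (f + g) = pdn j n f + pdn j n g := by
  induction n with
  | zero => exact fun _ _ => rfl
  | succ n ih =>
    intro f g hf hg
    rw [pdn_succ, pdn_succ, pdn_succ, pd_add hf hg, ih (rap_pd hf j) (rap_pd hg j)]

lemma pdn_star (j : Fin d) (n : ℕ) : ∀ {f : W d}, Rap f → pdn j n (star f) = star (pdn j n f) := by
  induction n with
  | zero => exact fun _ => rfl
  | succ n ih =>
    intro f hf
    rw [pdn_succ, pdn_succ, pd_star hf, ih (rap_pd hf j)]

lemma pdn_apply {c : W d} (hc : Rap c) (j : Fin d) (s : ℕ) (n : Fin d → ℤ) :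
    pdn j s c n = (Complex.I * n j) ^ s * c n := by
  induction s with
  | zero => simp [pdn]
  | succ s ih => rw [pdn_succ', pd_apply (urap_pdn hc j s), ih]; ring

/-- A bound for iterated derivatives of products. -/
lemma norm_val_pdn_mul_le (j : Fin d) (n : ℕ) : ∀ {f g : W d} {A : ℝ}, Rap f → Rap g →
    (∀ k l, k + l = n → ∀ x, ‖W.val x (pdn j k f)‖ * ‖W.val x (pdn j l g)‖ ≤ A) →
    ∀ x, ‖W.val x (pdn j n (f * g))‖ ≤ 2 ^ n * A := by
  induction n with
  | zero =>
    intro f g A _ _ h x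
    rw [pow_zero, one_mul, pdn, Function.iterate_zero, id, W.val_mul, norm_mul]
    exact h 0 0 rfl x
  | succ n ih =>
    intro f g A hf hg h x
    have hf' := rap_pd hf j
    have hg' := rap_pd hg j
    rw [pdn_succ, pd_mul hf hg, pdn_add j n (URap.mul hf' hg) (URap.mul hf hg'), W.val_add]
    have h1 := ih hf' hg (A := A) (fun k l hkl x => by
      rw [← pdn_succ]; exact h (k + 1) l (by omega) x) x
    have h2 := ih hf hg' (A := A) (fun k l hkl x => by
      rw [← pdn_succ]; exact h k (l + 1) (by omega) x) x
    refine (norm_add_le _ _).trans ((add_le_add h1 h2).trans_eq ?_)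
    ring

/-- Affine bounds for the `n`-th derivative of a polynomial nonlinearity in terms of the `n`-th
derivatives of its arguments, given bounds for the lower derivatives. -/
lemma exists_pdn_pev_le {ι : Type*} (p : Pol ι) (j : Fin d) {n : ℕ} (hn : 0 < n) (M : ℝ) :
    ∃ L : ℝ, 0 ≤ L ∧ ∀ (c : ι → W d) (Y : ℝ), 0 ≤ Y → (∀ i, Rap (c i)) →
      (∀ i, ∀ m < n, ∀ x, ‖W.val x (pdn j m (c i))‖ ≤ M) →
      (∀ i x, ‖W.val x (pdn j n (c i))‖ ≤ Y) →
      Rap (pev p 0 c) ∧ (∀ m < n, ∀ x, ‖W.val x (pdn j m (pev p 0 c))‖ ≤ L) ∧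
        ∀ x, ‖W.val x (pdn j n (pev p 0 c))‖ ≤ L * (1 + Y) := by
  have hprod : ∀ (L L' Y : ℝ) (f g : W d), 0 ≤ L → 0 ≤ L' → 0 ≤ Y → Rap f → Rap g →
      (∀ m < n, ∀ x, ‖W.val x (pdn j m f)‖ ≤ L) → (∀ x, ‖W.val x (pdn j n f)‖ ≤ L * (1 + Y)) →
      (∀ m < n, ∀ x, ‖W.val x (pdn j m g)‖ ≤ L') → (∀ x, ‖W.val x (pdn j n g)‖ ≤ L' * (1 + Y)) →
      (∀ m < n, ∀ x, ‖W.val x (pdn j m (f * g))‖ ≤ 2 ^ n * (L * L')) ∧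
      ∀ x, ‖W.val x (pdn j n (f * g))‖ ≤ 2 ^ n * (L * L') * (1 + Y) := by
    intro L L' Y f g hL hL' hY hf hg h1 h2 h3 h4
    refine ⟨fun m hm x => ?_, fun x => ?_⟩
    · refine (norm_val_pdn_mul_le j m hf hg (A := L * L') (fun k l hkl x =>
        mul_le_mul (h1 k (by omega) x) (h3 l (by omega) x) (norm_nonneg _) hL) x).trans ?_
      gcongr
      exact one_le_two
    · refine (norm_val_pdn_mul_le j n hf hg (A := L * L' * (1 + Y)) (fun k l hkl x => ?_) x).trans_eq
        (by ring)
      -- As n > 0, at most one factor carries all n derivatives, and the other is then bounded a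
      -- priori. This keeps the bound affine in Y.
      rcases Nat.eq_or_lt_of_le (show k ≤ n by omega) with rfl | hk
      · calc _ ≤ (L * (1 + Y)) * L' :=
            mul_le_mul (h2 x) (h3 l (by omega) x) (norm_nonneg _) (by positivity)
          _ = _ := by ring
      · have hg' : ‖W.val x (pdn j l g)‖ ≤ L' * (1 + Y) := by
          rcases Nat.eq_or_lt_of_le (show l ≤ n by omega) with rfl | hl
          · exact h4 x
          · exact (h3 l hl x).trans (le_mul_of_one_le_right hL' (by linarith))
        calc _ ≤ L * (L' * (1 + Y)) := mul_le_mul (h1 k hk x) hg' (norm_nonneg _) hL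
          _ = _ := by ring
  induction p using MvPolynomial.induction_on with
  | C z =>
    refine ⟨‖z‖, norm_nonneg _, fun c Y hY _ _ _ => ?_⟩
    have e : pev (MvPolynomial.C z) (0 : W d) c = algebraMap ℂ (W d) z := by simp [pev]
    have hv : ∀ x : E d, W.val x (algebraMap ℂ (W d) z) = z := fun x => by
      rw [Algebra.algebraMap_eq_smul_one, W.val_smul, W.val_one, mul_one]
    have hm : ∀ m, ∀ x, ‖W.val x (pdn j m (algebraMap ℂ (W d) z))‖ ≤ ‖z‖ := fun m x => by
      rcases m with _ | m
      · exact (congrArg norm (hv x)).le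
      · rw [pdn_succ, pd_algebraMap, pdn_zero_right, W.val_zero, norm_zero]; exact norm_nonneg _
    rw [e]
    exact ⟨URap.algebraMap z, fun m _ => hm m, fun x =>
      (hm n x).trans (le_mul_of_one_le_right (norm_nonneg _) (by linarith))⟩
  | add p q hp hq =>
    obtain ⟨L, hL, h⟩ := hp
    obtain ⟨L', hL', h'⟩ := hq
    refine ⟨L + L', by positivity, fun c Y hY hc h1 h2 => ?_⟩
    obtain ⟨r, b1, b2⟩ := h c Y hY hc h1 h2
    obtain ⟨r', b1', b2'⟩ := h' c Y hY hc h1 h2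
    rw [pev_add]
    refine ⟨r.add r', fun m hm x => ?_, fun x => ?_⟩
    · rw [pdn_add j m r r', W.val_add]
      exact (norm_add_le _ _).trans (add_le_add (b1 m hm x) (b1' m hm x))
    · rw [pdn_add j n r r', W.val_add, add_mul]
      exact (norm_add_le _ _).trans (add_le_add (b2 x) (b2' x))
  | mul_X p s hp =>
    obtain ⟨L, hL, h⟩ := hp
    refine ⟨2 ^ n * (L * (|M| + 1)), by positivity, fun c Y hY hc h1 h2 => ?_⟩
    obtain ⟨r, b1, b2⟩ := h c Y hY hc h1 h2
    have e : pev (p * MvPolynomial.X s) (0 : W d) c = pev p 0 c * vals 0 c s := by simp [pev]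
    have hM : M ≤ |M| + 1 := by linarith [le_abs_self M]
    have hY' : Y ≤ (|M| + 1) * (1 + Y) := by nlinarith [abs_nonneg M]
    have key : Rap (vals 0 c s) ∧ (∀ m < n, ∀ x, ‖W.val x (pdn j m (vals 0 c s))‖ ≤ |M| + 1) ∧
        ∀ x, ‖W.val x (pdn j n (vals 0 c s))‖ ≤ (|M| + 1) * (1 + Y) := by
      have hz : Rap (0 : W d) ∧ (∀ m < n, ∀ x, ‖W.val x (pdn j m (0 : W d))‖ ≤ |M| + 1) ∧
          ∀ x, ‖W.val x (pdn j n (0 : W d))‖ ≤ (|M| + 1) * (1 + Y) := by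
        simp only [pdn_zero_right, W.val_zero, norm_zero]
        exact ⟨URap.zero, fun _ _ _ => by positivity, fun _ => by positivity⟩
      rcases s with ⟨_ | i, _ | _⟩
      · simpa [vals] using hz
      · simpa [vals] using hz
      · exact ⟨hc i, fun m hm x => (h1 i m hm x).trans hM, fun x => (h2 i x).trans hY'⟩
      · have e : vals 0 c (some i, true) = star (c i) := rfl
        rw [e]
        refine ⟨(hc i).star, fun m hm x => ?_, fun x => ?_⟩
        · rw [pdn_star j m (hc i), W.val_star, norm_star]; exact (h1 i m hm x).trans hM
        · rw [pdn_star j n (hc i), W.val_star, norm_star]; exact (h2 i x).trans hY'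
    obtain ⟨k1, k2, k3⟩ := key
    rw [e]
    have := hprod L (|M| + 1) Y _ _ hL (by positivity) hY r k1 b1 b2 k2 k3
    exact ⟨URap.mul r k1, this.1, this.2⟩

lemma W.continuous_val (c : W d) : Continuous fun x : E d => W.val x c :=
  continuous_tsum (fun n => continuous_const.mul (contDiff_ex n (k := 0)).continuous) c.summable_norm
    fun n x => by rw [norm_mul, norm_ex, mul_one]

/-- The bounded continuous function with given coefficients. -/
def bcf : W d →L[ℝ] BoundedContinuousFunction (E d) ℂ :=
  LinearMap.mkContinuous
    { toFun := fun c => BoundedContinuousFunction.ofNormedAddCommGroup (fun x => W.val x c)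
        c.continuous_val ‖c‖ fun x => W.norm_val_le x c
      map_add' := fun c e => by ext x; exact W.val_add x c e
      map_smul' := fun r c => by ext x; exact W.val_smul x (r : ℂ) c } 1 fun c => by
    rw [one_mul]
    exact BoundedContinuousFunction.norm_ofNormedAddCommGroup_le c.continuous_val (norm_nonneg _)
      fun x => W.norm_val_le x c

lemma norm_bcf_le {c : W d} {Y : ℝ} (hY : 0 ≤ Y) : ‖bcf c‖ ≤ Y ↔ ∀ x, ‖W.val x c‖ ≤ Y :=
  BoundedContinuousFunction.norm_le hY

lemma norm_val_le_bcf (c : W d) (x : E d) : ‖W.val x c‖ ≤ ‖bcf c‖ := (bcf c).norm_coe_le_norm x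

/-- The free transport is a translation. -/
lemma val_rot_transport (k : E d) (t : ℝ) (c : W d) (x : E d) :
    W.val x (rot (advs 0 k 0) t c) = W.val (x + t • k) c := by
  unfold W.val
  refine tsum_congr fun n => ?_
  rw [rot_apply, ex_add_right, show ex n (t • k) = Complex.exp (iform n (t • k)) by rw [ex_eq_exp_iform],
    iform_apply]
  have : ((advs 0 k 0 n * t : ℝ) : ℂ) * Complex.I
      = Complex.I * ∑ j, (n j : ℂ) * ((t • k) j : ℂ) := by
    unfold advs adv
    push_cast
    rw [add_zero, Finset.sum_mul, Finset.sum_mul, Finset.mul_sum]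
    refine Finset.sum_congr rfl fun j _ => ?_
    simp only [PiLp.smul_apply, smul_eq_mul, Complex.ofReal_mul]
    ring
  rw [this]; ring

/-- For ε = 0 the free evolution is a translation, hence a sup-norm isometry. This is what makes the
limiting transport system useful when only sup bounds are known. -/
lemma norm_bcf_rot (k : E d) (t : ℝ) (c : W d) : ‖bcf (rot (advs 0 k 0) t c)‖ = ‖bcf c‖ := by
  refine le_antisymm ((norm_bcf_le (norm_nonneg _)).2 fun x => ?_)
    ((norm_bcf_le (norm_nonneg _)).2 fun x => ?_)
  · rw [val_rot_transport]; exact norm_val_le_bcf _ _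
  · have := val_rot_transport k t c (x - t • k)
    rw [sub_add_cancel] at this
    rw [← this]; exact norm_val_le_bcf _ _

lemma URap.rot {α : Type*} {c : α → W d} (hc : URap c) (θ : α → (Fin d → ℤ) → ℝ) (t : α → ℝ) :
    URap fun a => rot (θ a) (t a) (c a) := fun s => by
  obtain ⟨C, hC⟩ := hc s
  exact ⟨C, fun a n => by rw [norm_rot_apply]; exact hC a n⟩

lemma pdn_rot {c : W d} (hc : Rap c) (θ : (Fin d → ℤ) → ℝ) (t : ℝ) (j : Fin d) (s : ℕ) :
    pdn j s (rot θ t c) = rot θ t (pdn j s c) := by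
  ext n
  rw [pdn_apply (URap.rot hc (fun _ => θ) fun _ => t), rot_apply, rot_apply, pdn_apply hc]; ring

lemma hasDerivWithinAt_pdn {T : ℝ} {c c' : ℝ → W d} (hc : URap fun t : Icc 0 T => c t)
    (hc' : URap fun t : Icc 0 T => c' t)
    (h : ∀ t ∈ Icc 0 T, HasDerivWithinAt c (c' t) (Icc 0 T) t) (j : Fin d) (s : ℕ) :
    ∀ t ∈ Icc 0 T, HasDerivWithinAt (fun t => pdn j s (c t)) (pdn j s (c' t)) (Icc 0 T) t := by
  induction s with
  | zero => exact h
  | succ s ih =>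
    simp only [pdn_succ']
    exact DC.hasDerivWithinAt_sy (gr_coord j)
      (fun t ht => (urap_pdn hc j s).rap ⟨t, ht⟩) (urap_pdn hc' j s)
      fun n t ht => DC.hasDerivWithinAt_coord (ih t ht) n

/-- Sup-norm bounds of solutions of semilinear transport systems imply sup-norm bounds of all pure
derivatives. -/
lemma exists_pdn_sol_le {ι : Type*} [Fintype ι] (P : ι → Pol ι) (k : ι → E d) (B T : ℝ) (D : ℕ → ℝ)
    (j : Fin d) (n : ℕ) : ∃ M : ℝ, 0 ≤ M ∧ ∀ τ ≤ T, ∀ ψ : ℝ → ι → W d, ∀ R : ℝ,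
      Sol τ (fun i => advs 0 (k i) 0) P (fun _ => 0) ψ → (∀ i, Rap (ψ 0 i)) →
      (∀ t ∈ Icc 0 τ, ‖ψ t‖ ≤ R) → (∀ i m x, ‖W.val x (pdn j m (ψ 0 i))‖ ≤ D m) →
      (∀ i, ∀ t ∈ Icc 0 τ, ∀ x, ‖W.val x (ψ t i)‖ ≤ B) →
      ∀ m ≤ n, ∀ i, ∀ t ∈ Icc 0 τ, ∀ x, ‖W.val x (pdn j m (ψ t i))‖ ≤ M := by
  induction n with
  | zero =>
    refine ⟨|B|, abs_nonneg _, fun τ _ ψ R _ _ _ _ hB m hm i t ht x => ?_⟩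
    obtain rfl : m = 0 := by omega
    exact (hB i t ht x).trans (le_abs_self _)
  | succ n ih =>
    obtain ⟨M, hM0, hM⟩ := ih
    choose L hL0 hL using fun i => exists_pdn_pev_le (P i) j (Nat.succ_pos n) M
    set L' := ∑ i, L i
    have hL'0 : 0 ≤ L' := Finset.sum_nonneg fun i _ => hL0 i
    have hLL' : ∀ i, L i ≤ L' := fun i => Finset.single_le_sum (fun i _ => hL0 i) (Finset.mem_univ i)
    -- Gronwall constant for the derivative of order n + 1, which enters its own equation affinely
    -- once the lower ones are bounded. The Wiener bound R does not occur in it: R serves only to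
    -- justify the calculus.
    set M' := (|D (n + 1)| + L' * |T|) * Real.exp (L' * |T|)
    have hM'0 : 0 ≤ M' := by positivity
    refine ⟨max M M', le_max_of_le_left hM0, fun τ hτ ψ R hψ h0 hR hD hB m hm i t ht x => ?_⟩
    have hlow := hM τ hτ ψ R hψ h0 hR hD hB
    rcases Nat.lt_or_eq_of_le hm with hm | rfl
    · exact (hlow m (by omega) i t ht x).trans (le_max_left _ _)
    refine le_trans ?_ (le_max_right _ _)
    have hur : ∀ i, URap fun t : Icc 0 τ => ψ t i := fun i =>
      (urap_of_sol (α := Unit) (fun _ => hψ) (fun _ => hR) URap.zero (fun i => h0 i) i).comp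
        fun t => ((), t)
    have hback : ∀ i, URap fun t : Icc 0 τ => rotv (fun i => advs 0 (k i) 0) (-(t : ℝ)) (ψ t) i :=
      fun i => (hur i).rot (fun _ => advs 0 (k i) 0) fun t => -(t : ℝ)
    have hur' : ∀ i, URap fun t : Icc 0 τ =>
        vf (fun i => advs 0 (k i) 0) P (fun _ => 0) (t : ℝ) (ψ t) i := fun i =>
      (URap.pev (P i) URap.zero hback).rot (fun _ => advs 0 (k i) 0) fun t => (t : ℝ)
    set f : ℝ → ι → BoundedContinuousFunction (E d) ℂ := fun t i => bcf (pdn j (n + 1) (ψ t i))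
    have hf : ∀ t ∈ Icc 0 τ, HasDerivWithinAt f (fun i => bcf (pdn j (n + 1)
        (vf (fun i => advs 0 (k i) 0) P (fun _ => 0) t (ψ t) i))) (Icc 0 τ) t := fun t ht =>
      hasDerivWithinAt_pi.2 fun i => bcf.hasFDerivAt.comp_hasDerivWithinAt t
        (hasDerivWithinAt_pdn (hur i) (hur' i)
          (fun t ht => hasDerivWithinAt_pi.1 (hψ t ht) i) j (n + 1) t ht)
    have key := norm_le_of_deriv (K := L') (ε := L') (δ := |D (n + 1)|) hL'0 hL'0 hf ?_ ?_ t ht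
    · refine (norm_val_le_bcf _ x).trans ((norm_le_pi_norm (f t) i).trans (key.trans ?_))
      have h1 : t ≤ |T| := (ht.2.trans hτ).trans (le_abs_self _)
      have h2 := ht.1
      simp only [M']
      gcongr
    · exact (pi_norm_le_iff_of_nonneg (abs_nonneg _)).2 fun i =>
        (norm_bcf_le (abs_nonneg _)).2 fun x => (hD i _ x).trans (le_abs_self _)
    · intro s hs
      have hfs : 0 ≤ ‖f s‖ := norm_nonneg _
      refine (pi_norm_le_iff_of_nonneg (by positivity)).2 fun i => ?_
      have hrp : Rap (pev (P i) 0 (rotv (fun i => advs 0 (k i) 0) (-s) (ψ s))) :=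
        (URap.pev (P i) URap.zero hback).rap (⟨s, hs⟩ : Icc 0 τ)
      rw [vf_apply, pdn_rot hrp, norm_bcf_rot]
      have hsup : ∀ i m Y, 0 ≤ Y → (∀ x, ‖W.val x (pdn j m (ψ s i))‖ ≤ Y) → ∀ x,
          ‖W.val x (pdn j m (rotv (fun i => advs 0 (k i) 0) (-s) (ψ s) i))‖ ≤ Y := by
        intro i m Y hY h x
        rw [rotv_apply, pdn_rot ((hur i).rap ⟨s, hs⟩), val_rot_transport]
        exact h _
      have h3 := (hL i (rotv (fun i => advs 0 (k i) 0) (-s) (ψ s)) ‖f s‖ hfs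
        (fun i => (hback i).rap ⟨s, hs⟩)
        (fun i m hm => hsup i m M hM0 (hlow m (by omega) i s hs))
        (fun i => hsup i (n + 1) _ hfs fun x =>
          (norm_val_le_bcf _ x).trans (norm_le_pi_norm (f s) i))).2.2
      have h4 : ‖bcf (pdn j (n + 1) (pev (P i) 0 (rotv (fun i => advs 0 (k i) 0) (-s) (ψ s))))‖
          ≤ L i * (1 + ‖f s‖) := (norm_bcf_le (by have := hL0 i; positivity)).2 h3
      refine h4.trans ?_
      have := mul_le_mul_of_nonneg_right (hLL' i) (by positivity : 0 ≤ 1 + ‖f s‖)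
      linarith

/-- The Wiener norm is controlled by sup norms of pure derivatives. -/
lemma norm_le_of_pdn {c : W d} (hc : Rap c) {B M : ℝ} (hB : ∀ x, ‖W.val x c‖ ≤ B)
    (hM : ∀ j x, ‖W.val x (pdn j (2 * d) c)‖ ≤ M) :
    ‖c‖ ≤ ∑' n : Fin d → ℤ, 2 ^ (2 * d) * (B + d * M) * (wt n ^ (2 * d))⁻¹ := by
  refine W.norm_le_of_le (summable_wt.mul_left _) fun n => le_of_wt_pow ?_
  calc wt n ^ (2 * d) * ‖c n‖
      ≤ 2 ^ (2 * d) * (1 + ∑ j, |(n j : ℝ)| ^ (2 * d)) * ‖c n‖ := by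
        gcongr; exact wt_pow_le n _
    _ = 2 ^ (2 * d) * (‖c n‖ + ∑ j, ‖pdn j (2 * d) c n‖) := by
        rw [mul_assoc, add_mul, one_mul, Finset.sum_mul]
        congr 2
        refine Finset.sum_congr rfl fun j _ => ?_
        rw [pdn_apply hc, norm_mul, norm_pow, norm_mul, Complex.norm_I, one_mul,
          Complex.norm_intCast]
    _ ≤ 2 ^ (2 * d) * (B + ∑ _j : Fin d, M) := by
        gcongr with j
        · exact W.norm_apply_le_of_val hB n
        · exact W.norm_apply_le_of_val (hM j) n
    _ = _ := by simp

/-! ### Uniform existence for the system of modulation functions -/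

/-- Continuous induction. -/
lemma le_of_bootstrap {T R : ℝ} {g : ℝ → ℝ} (hg : ContinuousOn g (Icc 0 T)) (h0 : g 0 ≤ R)
    (h : ∀ τ, 0 < τ → τ ≤ T → (∀ s ∈ Icc 0 τ, g s ≤ R + 1) → ∀ s ∈ Icc 0 τ, g s ≤ R) :
    ∀ s ∈ Icc 0 T, g s ≤ R := by
  by_cases hC : ∃ s ∈ Icc 0 T, R + 1 ≤ g s
  · exfalso
    have hcl : IsClosed (Icc 0 T ∩ g ⁻¹' Ici (R + 1)) := hg.preimage_isClosed_of_isClosed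
      isClosed_Icc isClosed_Ici
    have hcp : IsCompact (Icc 0 T ∩ g ⁻¹' Ici (R + 1)) :=
      isCompact_Icc.of_isClosed_subset hcl inter_subset_left
    obtain ⟨s0, hs0, hs0'⟩ := hC
    -- At the first time τ where g reaches R + 1, the improved bound R holds on all earlier times,
    -- and continuity contradicts the jump by 1.
    obtain ⟨τ, ⟨hτ, hτ'⟩, hmin⟩ := hcp.exists_isLeast ⟨s0, hs0, hs0'⟩
    have hτ'' : R + 1 ≤ g τ := hτ'
    have hlt : ∀ s ∈ Icc 0 T, s < τ → g s < R + 1 := fun s hs hsτ => by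
      by_contra! hge
      exact absurd (hmin ⟨hs, hge⟩) (not_le.2 hsτ)
    have hpos : 0 < τ := by
      rcases hτ.1.lt_or_eq with h | h
      · exact h
      · rw [← h] at hτ''; linarith
    have hle : ∀ s ∈ Ico 0 τ, g s ≤ R := fun s hs => by
      rcases hs.1.lt_or_eq with hs0 | hs0
      · exact h s hs0 (hs.2.le.trans hτ.2) (fun r hr => (hlt r ⟨hr.1, hr.2.trans
          (hs.2.le.trans hτ.2)⟩ (hr.2.trans_lt hs.2)).le) s ⟨hs.1, le_rfl⟩
      · rw [← hs0]; exact h0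
    have hcw : ContinuousWithinAt g (Ico 0 τ) τ :=
      (hg τ hτ).mono fun s hs => ⟨hs.1, hs.2.le.trans hτ.2⟩
    have hmem : τ ∈ closure (Ico 0 τ) := by
      rw [closure_Ico hpos.ne]; exact ⟨hpos.le, le_rfl⟩
    have := hcw.closure_le hmem continuousWithinAt_const hle
    linarith
  · push Not at hC
    intro s hs
    rcases (hs.1.trans hs.2).lt_or_eq with hT | hT
    · exact h T hT le_rfl (fun r hr => (hC r hr).le) s hs
    · obtain rfl : s = 0 := le_antisymm (hs.2.trans hT.ge) hs.1
      exact h0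

lemma norm_algebraMap_real {ε : ℝ} (h : 0 ≤ ε) : ‖algebraMap ℂ (W d) (ε : ℂ)‖ = ε := by
  rw [norm_algebraMap', Complex.norm_real, Real.norm_of_nonneg h]

lemma gr1_aSym (K : Finset (E d)) (ε : ℝ) (i : K) :
    Gr1 fun n => (Complex.I * (aSym K ε i n : ℂ)) :=
  gr_advs (i : E d) (fun _ => 0) (fun _ => le_rfl) fun _ => le_rfl

section apriori

variable {M : ℕ} {lam : ℝ} {κ : Fin M → E d} {K : Finset (E d)} {a0 : ℝ → Fin M → E d → ℂ}
  {α : Type*} {ε : α → ℝ} {X : α → K → W d}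

/-- The system of modulation functions has solutions on an `ε`-independent time interval. -/
theorem exists_existenceTime (hε : ∀ e, 0 < ε e ∧ ε e ≤ 1) (hX : ∀ i, URap fun e => X e i) :
    ∃ T > 0, ∃ R, ∀ e, ∃ ψ, Sol T (aSym K (ε e)) (aPol lam K)
      (fun _ => algebraMap ℂ (W d) (ε e)) ψ ∧ ψ 0 = X e ∧ ∀ t ∈ Icc 0 T, ‖ψ t‖ ≤ R := by
  have hh : URap fun e => algebraMap ℂ (W d) (ε e : ℂ) := by
    have := (URap.algebraMap (d := d) (α := α) 1).smul (z := fun e => (ε e : ℂ)) (B := 1)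
      fun e => by rw [Complex.norm_real, Real.norm_of_nonneg (hε e).1.le]; exact (hε e).2
    simpa [Algebra.algebraMap_eq_smul_one] using this
  choose R hR0 hR using fun i => (hX i).norm_le
  have hS : ∀ i : K, URap fun e => sy (fun n => Complex.I * (aSym K (ε e) i n : ℂ)) (X e i)
      - pev (aPol lam K i) (algebraMap ℂ (W d) (ε e)) (X e) := fun i =>
    ((hX i).sy (gr_advs (i : E d) (fun _ => 0) (R := 1) (S := 0)
      (fun e => by rw [abs_of_pos (hε e).1]; exact (hε e).2) fun _ => by simp)).sub
      (URap.pev _ hh hX)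
  choose S hS0 hS' using fun i => (hS i).norm_le
  set R' := ∑ i, R i
  set S' := ∑ i, S i
  have hRR : ∀ i, R i ≤ R' := fun i => Finset.single_le_sum (fun i _ => hR0 i) (Finset.mem_univ i)
  have hSS : ∀ i, S i ≤ S' := fun i => Finset.single_le_sum (fun i _ => hS0 i) (Finset.mem_univ i)
  have hR'0 : 0 ≤ R' := Finset.sum_nonneg fun i _ => hR0 i
  have hS'0 : 0 ≤ S' := Finset.sum_nonneg fun i _ => hS0 i
  obtain ⟨Λ, hΛ0, hΛ⟩ := exists_lipschitz_nl (d := d) (aPol lam K) (R' + 1)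
  -- The time is short enough that the defect S' of the constant curve, amplified by Gronwall, stays
  -- below the margin ρ = 1.
  set T := min 1 (1 / ((S' + 1) * Real.exp (2 * Λ)))
  have hT : 0 < T := lt_min one_pos (by positivity)
  have hT1 : T ≤ 1 := min_le_left _ _
  refine ⟨T, hT, R' + 1, fun e => ?_⟩
  have hsmall : (0 + S' * T) * Real.exp (2 * Λ * T) ≤ 1 := by
    have h1 : Real.exp (2 * Λ * T) ≤ Real.exp (2 * Λ) :=
      Real.exp_le_exp.2 (mul_le_of_le_one_right (by positivity) hT1)
    have h2 : T ≤ 1 / ((S' + 1) * Real.exp (2 * Λ)) := min_le_right _ _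
    calc (0 + S' * T) * Real.exp (2 * Λ * T) ≤ (S' + 1) * T * Real.exp (2 * Λ) := by
          gcongr; linarith
      _ ≤ (S' + 1) * (1 / ((S' + 1) * Real.exp (2 * Λ))) * Real.exp (2 * Λ) := by gcongr
      _ = 1 := by field_simp
  have hnorm : ‖algebraMap ℂ (W d) (ε e : ℂ)‖ ≤ R' + 1 := by
    rw [norm_algebraMap_real (hε e).1.le]; linarith [(hε e).2]
  -- The approximate solution is the initial value, constant in time; its defect is bounded
  -- uniformly because the data decay rapidly.
  obtain ⟨ψ, h1, h2, h3⟩ := exists_sol_near (θ := aSym K (ε e)) (P := aPol lam K)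
    (h := fun _ => algebraMap ℂ (W d) (ε e)) (v := fun _ => X e) (v' := fun _ _ => 0) (x0 := X e)
    (R := R') (ρ := 1) (Λ := Λ) (δ := S') (δ₀ := 0) hT.le one_pos hΛ0 hS'0 le_rfl
    (gr1_aSym K (ε e)) (fun i => (hX i).comp fun _ => e) (fun i => URap.zero)
    (fun i t _ => hasDerivWithinAt_const _ _ _) continuousOn_const
    (fun i t _ => (hR i e).trans (hRR i)) hR'0
    (fun i t _ => by rw [zero_add]; exact (hS' i e).trans (hSS i))
    (fun i => by simp)
    (fun t _ x y hx hy => by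
      have := (hΛ _ _ x y hnorm hnorm hx hy).2
      simpa using this) hsmall
  refine ⟨ψ, h2, h1, fun t ht => ?_⟩
  have h4 := h3 t ht
  have h5 : (0 + S' * T) * Real.exp (2 * Λ * T) ≤ 1 := hsmall
  have h6 : ‖X e‖ ≤ R' := (pi_norm_le_iff_of_nonneg hR'0).2 fun i => (hR i e).trans (hRR i)
  have h7 : ‖rotv (aSym K (ε e)) (-t) (ψ t)‖ ≤ R' + 1 := by
    calc _ = ‖rotv (aSym K (ε e)) (-t) (ψ t) - X e + X e‖ := by rw [sub_add_cancel]
      _ ≤ _ := (norm_add_le _ _).trans (by linarith)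
  rwa [norm_rotv] at h7

/-- For small `ε`, the solutions of the system of modulation functions are close to the solutions of
the limiting transport system, as long as the latter are bounded. -/
theorem exists_sol_near_transport (hε : ∀ e, 0 < ε e ∧ ε e ≤ 1) (hX : ∀ i, URap fun e => X e i)
    {T : ℝ} (hT : 0 < T) {R : ℝ} (hR : 0 ≤ R) :
    ∃ C : ℝ, 0 ≤ C ∧ ∀ e τ φ, C * ε e ≤ 1 → 0 < τ → τ ≤ T →
      Sol τ (aSym K 0) (aPol lam K) (fun _ => 0) φ → φ 0 = X e → (∀ t ∈ Icc 0 τ, ‖φ t‖ ≤ R) →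
      ∃ ψ, Sol τ (aSym K (ε e)) (aPol lam K) (fun _ => algebraMap ℂ (W d) (ε e)) ψ ∧ ψ 0 = X e ∧
        ∀ i, ∀ t ∈ Icc 0 τ, ‖orig (aSym K (ε e)) ψ i t - orig (aSym K 0) φ i t‖ ≤ C * ε e := by
  -- All admissible transport solutions, with all their end times, are bundled into one index type
  -- so that decay holds with constants common to all of them. In particular C does not depend on τ.
  let β := {z : α × ℝ × (ℝ → K → W d) // z.2.1 ≤ T ∧ Sol z.2.1 (aSym K 0) (aPol lam K)
    (fun _ => 0) z.2.2 ∧ z.2.2 0 = X z.1 ∧ ∀ t ∈ Icc 0 z.2.1, ‖z.2.2 t‖ ≤ R}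
  have hφ : ∀ i, URap fun z : {z : β × ℝ // z.2 ∈ Icc 0 z.1.1.2.1} => z.1.1.1.2.2 z.1.2 i := fun i =>
    urap_of_sol_of_le (α := β) (Tf := fun b => b.1.2.1) (fun b => b.2.1) (fun b => b.2.2.1)
      (fun b => b.2.2.2.2) URap.zero
      (fun i => by
        have := (hX i).comp fun b : β => b.1.1
        convert this using 2 with b
        rw [b.2.2.2.1]) i
  have hv : ∀ i, URap fun z : {z : β × ℝ // z.2 ∈ Icc 0 z.1.1.2.1} =>
      orig (aSym K 0) z.1.1.1.2.2 i z.1.2 := fun i => (hφ i).rot (fun _ => aSym K 0 i) fun z => -z.1.2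
  have hlap : ∀ i, URap fun z : {z : β × ℝ // z.2 ∈ Icc 0 z.1.1.2.1} =>
      ∑ j, pd j (pd j (orig (aSym K 0) z.1.1.1.2.2 i z.1.2)) := fun i =>
    URap.sum _ fun j _ => ((hv i).sy (Gr1.gr (gr_coord j))).sy (Gr1.gr (gr_coord j))
  choose C1 hC10 hC1 using fun i => (hlap i).norm_le
  choose L hL0 hL using fun i => exists_lipschitz_pev (W d) (aPol lam K i) (R + 1)
  obtain ⟨Λ, hΛ0, hΛ⟩ := exists_lipschitz_nl (d := d) (aPol lam K) (R + 1)
  set D := ∑ i, (C1 i + L i)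
  have hD0 : 0 ≤ D := Finset.sum_nonneg fun i _ => add_nonneg (hC10 i) (hL0 i)
  have hD : ∀ i, C1 i + L i ≤ D := fun i =>
    Finset.single_le_sum (f := fun i => C1 i + L i) (fun i _ => add_nonneg (hC10 i) (hL0 i))
      (Finset.mem_univ i)
  refine ⟨D * T * Real.exp (2 * Λ * T), by positivity, fun e τ φ he hτ hτT hφS hφ0 hφR => ?_⟩
  let b : β := ⟨(e, τ, φ), hτT, hφS, hφ0, hφR⟩
  have hθ0 : ∀ i : K, Gr fun (_ : Unit) n => (Complex.I * (aSym K 0 i n : ℂ)) := gr1_aSym K 0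
  have hrap : ∀ i, ∀ t (ht : t ∈ Icc 0 τ), Rap (orig (aSym K 0) φ i t) := fun i t ht =>
    (hv i).rap ⟨(b, t), ht⟩
  have hvt : ∀ i, URap fun t : Icc 0 τ => orig (aSym K 0) φ i t := fun i =>
    (hv i).comp fun t : Icc 0 τ => ⟨(b, t), t.2⟩
  have hnorm : ‖algebraMap ℂ (W d) (ε e : ℂ)‖ ≤ R + 1 := by
    rw [norm_algebraMap_real (hε e).1.le]; linarith [(hε e).2]
  have hRorig : ∀ i, ∀ t ∈ Icc 0 τ, ‖orig (aSym K 0) φ i t‖ ≤ R := fun i t ht =>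
    norm_orig_le (hφR t ht) i
  have hle : (0 + D * ε e * τ) * Real.exp (2 * Λ * τ) ≤ D * T * Real.exp (2 * Λ * T) * ε e := by
    have := (hε e).1
    calc (0 + D * ε e * τ) * Real.exp (2 * Λ * τ) ≤ (D * ε e * T) * Real.exp (2 * Λ * T) := by
          rw [zero_add]; gcongr
      _ = _ := by ring
  -- The transport solution is inserted into the system with ε > 0. Its defect consists of the
  -- omitted (ε/2)Δ and of the terms with the factor ε in the nonlinearity, and is thus at most D ε.
  obtain ⟨ψ, h1, h2, h3⟩ := exists_sol_near (θ := aSym K (ε e)) (P := aPol lam K)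
    (h := fun _ => algebraMap ℂ (W d) (ε e)) (v := fun t i => orig (aSym K 0) φ i t)
    (v' := fun t i => pev (aPol lam K i) 0 (fun j => orig (aSym K 0) φ j t)
      - sy (fun n => Complex.I * (aSym K 0 i n : ℂ)) (orig (aSym K 0) φ i t)) (x0 := X e)
    (R := R) (ρ := 1) (Λ := Λ) (δ := D * ε e) (δ₀ := 0) hτ.le one_pos hΛ0
    (mul_nonneg hD0 (hε e).1.le) le_rfl
    (gr1_aSym K (ε e)) hvt
    (fun i => (URap.pev (aPol lam K i) URap.zero hvt).sub ((hvt i).sy (Gr1.gr (gr1_aSym K 0 i))))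
    (fun i t ht => hasDerivWithinAt_orig (fun _ : Unit => hφS) (fun _ => hφR)
      (fun k => DC.const URap.zero) (fun i => by rw [hφ0]; exact (hX i).comp fun _ => e) hθ0 () i ht)
    continuousOn_const hRorig hR
    (fun i t ht => by
      have e1 : sy (fun n => Complex.I * (aSym K (ε e) i n : ℂ)) (orig (aSym K 0) φ i t)
          = sy (fun n => Complex.I * (aSym K 0 i n : ℂ)) (orig (aSym K 0) φ i t)
            - (Complex.I * ε e / 2) • ∑ j, pd j (pd j (orig (aSym K 0) φ i t)) := by
        rw [aSym, aSym, sy_advs (hrap i t ht), sy_advs (hrap i t ht), sy_adv (hrap i t ht),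
          sy_adv (hrap i t ht)]
        simp
      rw [e1]
      have e2 : pev (aPol lam K i) 0 (fun j => orig (aSym K 0) φ j t)
          - sy (fun n => Complex.I * (aSym K 0 i n : ℂ)) (orig (aSym K 0) φ i t)
          + (sy (fun n => Complex.I * (aSym K 0 i n : ℂ)) (orig (aSym K 0) φ i t)
            - (Complex.I * ε e / 2) • ∑ j, pd j (pd j (orig (aSym K 0) φ i t)))
          - pev (aPol lam K i) (algebraMap ℂ (W d) (ε e)) (fun j => orig (aSym K 0) φ j t)
          = (pev (aPol lam K i) 0 (fun j => orig (aSym K 0) φ j t)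
            - pev (aPol lam K i) (algebraMap ℂ (W d) (ε e)) (fun j => orig (aSym K 0) φ j t))
            - (Complex.I * ε e / 2) • ∑ j, pd j (pd j (orig (aSym K 0) φ i t)) := by abel
      rw [e2]
      refine (norm_sub_le _ _).trans ?_
      have e3 := (hL i 0 (algebraMap ℂ (W d) (ε e)) (fun j => orig (aSym K 0) φ j t)
        (fun j => orig (aSym K 0) φ j t) (by rw [norm_zero]; linarith) hnorm
        (fun j => (hRorig j t ht).trans (by linarith))
        (fun j => (hRorig j t ht).trans (by linarith))).2 (ε e)
        (by rw [zero_sub, norm_neg, norm_algebraMap_real (hε e).1.le])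
        (fun j => by rw [sub_self, norm_zero]; exact (hε e).1.le)
      have e4 : ‖(Complex.I * ε e / 2) • ∑ j, pd j (pd j (orig (aSym K 0) φ i t))‖
          ≤ C1 i * ε e := by
        rw [norm_smul]
        have : ‖Complex.I * (ε e : ℂ) / 2‖ = ε e / 2 := by
          simp [abs_of_pos (hε e).1]
        rw [this]
        have h5 := hC1 i ⟨(b, t), ht⟩
        have := (hε e).1
        calc ε e / 2 * ‖∑ j, pd j (pd j (orig (aSym K 0) φ i t))‖ ≤ ε e * C1 i := by
              exact mul_le_mul (by linarith) h5 (norm_nonneg _) this.le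
          _ = _ := mul_comm _ _
      have e5 := mul_le_mul_of_nonneg_right (hD i) (hε e).1.le
      linarith)
    (fun i => by rw [orig_zero, hφ0]; simp)
    (fun t _ x y hx hy => by
      have := (hΛ _ _ x y hnorm hnorm hx hy).2
      simpa using this) (hle.trans he)
  refine ⟨ψ, h2, h1, fun i t ht => ?_⟩
  have h4 := (norm_le_pi_norm _ i).trans ((h3 t ht).trans hle)
  exact h4

/-- On an existence time interval, the coefficients of the modulation functions are uniformly bounded
in the Wiener algebra. -/
theorem exists_uniform_sol (hε : ∀ e, 0 < ε e ∧ ε e ≤ 1) (hX : ∀ i, URap fun e => X e i)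
    (hXv : ∀ e i x, W.val x (X e i) = initMod κ (a0 (ε e)) i x) {T : ℝ} (hT : 0 < T) {ε₁ B : ℝ}
    (hε₁ : 0 < ε₁) (hex : ∀ e, ε e < ε₁ → ∃ a, SolvesA T (ε e) lam κ K (a0 (ε e)) a ∧
      ∀ r ∈ K, ∀ t ∈ Icc 0 T, ∀ x, ‖a r t x‖ ≤ B) :
    ∃ ε₀ > 0, ∃ R, ∀ e, ε e < ε₀ → ∃ ψ, Sol T (aSym K (ε e)) (aPol lam K)
      (fun _ => algebraMap ℂ (W d) (ε e)) ψ ∧ ψ 0 = X e ∧ ∀ t ∈ Icc 0 T, ‖ψ t‖ ≤ R := by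
  choose D hD0 hD using fun j m i => (urap_pdn (hX i) j m).norm_le
  have hDs : ∀ j m i, D j m i ≤ ∑ i, D j m i := fun j m i =>
    Finset.single_le_sum (fun i _ => hD0 j m i) (Finset.mem_univ i)
  choose N hN0 hN using fun j => exists_pdn_sol_le (aPol lam K) (fun i : K => (i : E d)) (B + 1) T
    (fun m => ∑ i, D j m i) j (2 * d)
  choose R hR0 hR using fun i => (hX i).norm_le
  set N' := ∑ j, N j
  have hNN : ∀ j, N j ≤ N' := fun j => Finset.single_le_sum (fun j _ => hN0 j) (Finset.mem_univ j)
  -- The bound that the bootstrap must reproduce: the Wiener norm resulting from the sup bound B + 1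
  -- and the derivative bounds N', plus the size of the data. It depends only on B, T, the data and
  -- the fixed system.
  set R₀ := |∑' n : Fin d → ℤ, 2 ^ (2 * d) * (B + 1 + d * N') * (wt n ^ (2 * d))⁻¹| + ∑ i, R i
  have hRs : 0 ≤ ∑ i, R i := Finset.sum_nonneg fun i _ => hR0 i
  have hR₀0 : 0 ≤ R₀ := by positivity
  have hXR : ∀ e, ‖X e‖ ≤ R₀ := fun e => (pi_norm_le_iff_of_nonneg hR₀0).2 fun i => by
    have h1 := Finset.single_le_sum (fun i _ => hR0 i) (Finset.mem_univ i)
    have h2 := abs_nonneg (∑' n : Fin d → ℤ, 2 ^ (2 * d) * (B + 1 + d * N') * (wt n ^ (2 * d))⁻¹)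
    linarith [hR i e]
  obtain ⟨C, hC0, hC⟩ := exists_sol_near_transport (lam := lam) (K := K) hε hX hT
    (R := R₀ + 1) (by linarith)
  refine ⟨min ε₁ (1 / (C + 1)), lt_min hε₁ (by positivity), R₀ + 1, fun e he => ?_⟩
  have he1 : ε e < ε₁ := he.trans_le (min_le_left _ _)
  have he2 : C * ε e ≤ 1 := by
    have h1 := (he.trans_le (min_le_right _ _)).le
    rw [le_div_iff₀ (by positivity)] at h1
    nlinarith [(hε e).1]
  obtain ⟨a, ha, haB⟩ := hex e he1
  obtain ⟨Λ, hΛ0, hΛ⟩ := exists_lipschitz_vf (d := d) (aPol lam K) (R₀ + 1)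
  -- Existence of the transport solution up to time T is not known beforehand; the cut-off solution
  -- exists anyway, and the bootstrap shows that the cutoff is never active.
  obtain ⟨u, hu0, hu⟩ := exists_cutoff_solution (f := vf (aSym K 0) (aPol lam K) fun _ => 0)
    (R := R₀ + 1) (Λ := Λ) hT.le (by linarith) (X e)
    (fun x => continuousOn_vf _ _ continuousOn_const continuousOn_const)
    (fun t _ x y hx hy => (hΛ _ _ t x y (by rw [norm_zero]; linarith) hx hy).2)
  have hsol : ∀ τ, τ ≤ T → (∀ s ∈ Icc 0 τ, ‖u s‖ ≤ R₀ + 1) →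
      Sol τ (aSym K 0) (aPol lam K) (fun _ => 0) u := fun τ hτ h t ht => by
    have h1 := hu t (Icc_subset_Icc_right hτ ht)
    rw [ret_eq (by linarith) (h t ht)] at h1
    exact h1.mono (Icc_subset_Icc_right hτ)
  have hbound : ∀ s ∈ Icc 0 T, ‖u s‖ ≤ R₀ := by
    refine le_of_bootstrap (fun t ht => (hu t ht).continuousWithinAt.norm) (by rw [hu0]; exact hXR e)
      fun τ hτ hτT h => ?_
    have hS := hsol τ hτT h
    obtain ⟨ψ, h1, h2, h3⟩ := hC e τ u he2 hτ hτT hS hu0 h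
    obtain ⟨Rψ, hRψ⟩ := isCompact_Icc.exists_bound_of_continuousOn h1.continuousOn
    have hsa := solvesA_of_sol (κ := κ) (a0 := a0 (ε e)) hτ h1 hRψ
      (fun i => by rw [h2]; exact (hX i).comp fun _ => e) (fun i x => by rw [h2]; exact hXv e i x)
    have huniq := SolvesA.unique hτ (ha.mono hτ hτT) hsa
    -- On [0,τ] the nearby solution for ε > 0 coincides by uniqueness with the given one, which is
    -- bounded by B; the distance Cε is at most 1.
    have hv : ∀ i, ∀ t ∈ Icc 0 τ, ∀ x, ‖W.val x (orig (aSym K 0) u i t)‖ ≤ B + 1 := by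
      intro i t ht x
      have e1 := huniq i i.2 t ht x
      rw [aFun, extz_of_mem _ i.2] at e1
      have e2 := haB i i.2 t (Icc_subset_Icc_right hτT ht) x
      have e3 := (W.norm_val_le x _).trans (h3 i t ht)
      rw [W.val_sub, e1, norm_sub_rev] at e3
      have e4 := norm_sub_norm_le (W.val x (orig (aSym K 0) u i t)) (a i t x)
      linarith
    have hv' : ∀ i, ∀ t ∈ Icc 0 τ, ∀ x, ‖W.val x (u t i)‖ ≤ B + 1 := by
      intro i t ht x
      -- Returning to the interaction picture is a translation in space, so the sup bound carries
      -- over.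
      have e1 := val_rot_transport (i : E d) (-t) (u t i) (x - (-t) • (i : E d))
      rw [sub_add_cancel] at e1
      rw [← e1]
      exact hv i t ht _
    have hrap0 : ∀ i, Rap (u 0 i) := fun i => by rw [hu0]; exact (hX i).comp fun _ => e
    intro s hs
    have hur : ∀ i, Rap (u s i) := fun i => (urap_of_sol (α := Unit) (fun _ => hS) (fun _ => h)
      URap.zero (fun i => hrap0 i) i).rap ((), (⟨s, hs⟩ : Icc 0 τ))
    refine (pi_norm_le_iff_of_nonneg hR₀0).2 fun i => ?_
    -- The sup bound B + 1 is upgraded to pure derivatives of order 2d and then to the Wiener norm,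
    -- with constants independent of the bootstrap bound R₀ + 1. This closes the loop.
    have key := norm_le_of_pdn (hur i) (hv' i s hs) (M := N') fun j x =>
      (hN j τ hτT u (R₀ + 1) hS hrap0 h (fun i m x => by
        rw [hu0]; exact (W.norm_val_le _ _).trans ((hD j m i e).trans (hDs j m i))) hv' (2 * d) le_rfl
        i s hs x).trans (hNN j)
    exact key.trans ((le_abs_self _).trans (by simp only [R₀]; linarith))
  obtain ⟨ψ, h1, h2, h3⟩ := hC e T u he2 hT le_rfl
    (hsol T le_rfl fun s hs => (hbound s hs).trans (by linarith)) hu0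
    fun s hs => (hbound s hs).trans (by linarith)
  refine ⟨ψ, h1, h2, fun t ht => (pi_norm_le_iff_of_nonneg (by linarith)).2 fun i => ?_⟩
  have e1 := h3 i t ht
  have e2 := norm_orig_le (θ := aSym K 0) (hbound t ht) i
  have e3 : ‖orig (aSym K (ε e)) ψ i t‖ = ‖ψ t i‖ := by rw [orig, rotv_apply, norm_rot]
  have e4 := norm_sub_norm_le (orig (aSym K (ε e)) ψ i t) (orig (aSym K 0) u i t)
  linarith

end apriori

/-! ### Oscillatory exponentials -/

/-- `k/ε` is a vector of integers. -/
def Lat (ε : ℝ) (k : E d) : Prop := ∀ j, ∃ n : ℤ, k j / ε = n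

/-- The integer vector `k/ε`. -/
def rnd (ε : ℝ) (k : E d) (j : Fin d) : ℤ := round (k j / ε)

section lattice

variable {ε : ℝ} {k l : E d}

lemma Lat.rnd_eq (h : Lat ε k) (j : Fin d) : (rnd ε k j : ℝ) = k j / ε := by
  obtain ⟨n, hn⟩ := h j
  rw [rnd, hn, round_intCast]

lemma Lat.eq_rnd (h : Lat ε k) (hε : ε ≠ 0) (j : Fin d) : k j = ε * rnd ε k j := by
  rw [h.rnd_eq]; field_simp

lemma Lat.add (h : Lat ε k) (h' : Lat ε l) : Lat ε (k + l) := fun j => by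
  obtain ⟨n, hn⟩ := h j
  obtain ⟨m, hm⟩ := h' j
  exact ⟨n + m, by rw [PiLp.add_apply, add_div, hn, hm]; push_cast; rfl⟩

lemma Lat.neg (h : Lat ε k) : Lat ε (-k) := fun j => by
  obtain ⟨n, hn⟩ := h j
  exact ⟨-n, by rw [PiLp.neg_apply, neg_div, hn]; push_cast; rfl⟩

lemma Lat.sub (h : Lat ε k) (h' : Lat ε l) : Lat ε (k - l) := by
  rw [sub_eq_add_neg]; exact h.add h'.neg

lemma rnd_add (h : Lat ε k) (h' : Lat ε l) : rnd ε (k + l) = rnd ε k + rnd ε l := by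
  funext j
  have : (rnd ε (k + l) j : ℝ) = ((rnd ε k + rnd ε l) j : ℤ) := by
    rw [(h.add h').rnd_eq, Pi.add_apply, Int.cast_add, h.rnd_eq, h'.rnd_eq, PiLp.add_apply, add_div]
  exact_mod_cast this

lemma rnd_neg (h : Lat ε k) : rnd ε (-k) = -rnd ε k := by
  funext j
  have : (rnd ε (-k) j : ℝ) = ((-rnd ε k) j : ℤ) := by
    rw [h.neg.rnd_eq, Pi.neg_apply, Int.cast_neg, h.rnd_eq, PiLp.neg_apply, neg_div]
  exact_mod_cast this

lemma Lat.kap {ν : E d × E d × E d} (h1 : Lat ε ν.1) (h2 : Lat ε ν.2.1) (h3 : Lat ε ν.2.2) :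
    Lat ε (kap ν) := (h1.sub h2).add h3

end lattice

lemma freq_eq (k : E d) : freq k = ∑ j, k j ^ 2 / 2 := by
  rw [freq, EuclideanSpace.norm_sq_eq, Finset.sum_div]
  simp

/-- The coefficients of the oscillatory exponential `exp(i (k·x - w t)/ε)`. -/
def em (ε : ℝ) (k : E d) (w t : ℝ) : W d :=
  Complex.exp (Complex.I * ((-(w * t) / ε : ℝ) : ℂ)) • W.mono (rnd ε k)

section em

variable {ε : ℝ} {k l : E d} {w w' t : ℝ}

lemma val_em (h : Lat ε k) (x : E d) : W.val x (em ε k w t) = osc ε k w t x := by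
  rw [em, W.val_smul, W.val_mono, osc, show ex (rnd ε k) x = Complex.exp (iform (rnd ε k) x) by
    rw [ex_eq_exp_iform], ← Complex.exp_add, iform_apply]
  congr 1
  have : (inner ℝ k x : ℝ) / ε = ∑ j, (rnd ε k j : ℝ) * x j := by
    rw [PiLp.inner_apply, Finset.sum_div]
    refine Finset.sum_congr rfl fun j _ => ?_
    rw [h.rnd_eq]; simp; ring
  rw [sub_div, this]
  push_cast
  ring

lemma em_mul (h : Lat ε k) (h' : Lat ε l) :
    em ε k w t * em ε l w' t = em ε (k + l) (w + w') t := by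
  rw [em, em, em, smul_mul_smul_comm, ← W.mono_add, rnd_add h h', ← Complex.exp_add]
  congr 2
  push_cast; ring

lemma star_em (h : Lat ε k) : star (em ε k w t) = em ε (-k) (-w) t := by
  rw [em, em, star_smul, W.star_mono, rnd_neg h]
  congr 1
  rw [Complex.star_def, ← Complex.exp_conj]
  congr 1
  simp
  ring

lemma norm_em : ‖em ε k w t‖ = 1 := by
  rw [em, norm_smul, W.norm_mono, mul_one, mul_comm, Complex.norm_exp_ofReal_mul_I]

lemma urap_em {α : Type*} (σ : α → ℝ) : URap fun a => em ε k w (σ a) :=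
  URap.smul (c := fun _ : α => W.mono (rnd ε k)) (fun s => by
    obtain ⟨C, hC⟩ := rap_mono (rnd ε k) s
    exact ⟨C, fun a n => hC () n⟩) (B := 1) fun a => by
      rw [mul_comm, Complex.norm_exp_ofReal_mul_I]

lemma hasDerivAt_em : HasDerivAt (em ε k w) ((-(Complex.I * w / ε)) • em ε k w t) t := by
  have h1 : HasDerivAt (fun t : ℝ => Complex.exp (Complex.I * ((-(w * t) / ε : ℝ) : ℂ)))
      (Complex.exp (Complex.I * ((-(w * t) / ε : ℝ) : ℂ)) * (Complex.I * ((-w / ε : ℝ) : ℂ))) t := by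
    have h2 : HasDerivAt (fun t : ℝ => -(w * t) / ε) (-w / ε) t := by
      simpa using (((hasDerivAt_id t).const_mul w).neg).div_const ε
    exact (h2.ofReal_comp.const_mul Complex.I).cexp
  have h3 := h1.smul_const (W.mono (rnd ε k))
  refine h3.congr_deriv ?_
  rw [em, smul_smul]
  congr 1
  push_cast; ring

/-- Conjugation of the free Schrödinger operator by an oscillatory exponential. -/
lemma sy_mul_em (hε : ε ≠ 0) (h : Lat ε k) {f : W d} (hf : Rap f) :
    sy (fun n => Complex.I * (adv ε 0 n : ℂ)) (f * em ε k w t)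
      = (sy (fun n => Complex.I * (adv ε k n : ℂ)) f + (Complex.I * freq k / ε) • f)
        * em ε k w t := by
  have hem : Rap (em ε k w t) := urap_em fun _ => t
  have g0 : ∀ l : E d, Gr1 fun n => Complex.I * (adv ε l n : ℂ) := fun l => gr_adv l fun _ => le_rfl
  ext n
  rw [Rap.sy_apply (URap.mul hf hem) (g0 0), em, mul_smul_comm, mul_smul_comm, W.smul_apply,
    W.smul_apply, W.mul_mono_apply, W.mul_mono_apply, W.add_apply, W.smul_apply,
    hf.sy_apply (g0 k)]
  -- Completing the square with n = m + k/ε: (ε/2)|n|² = (ε/2)|m|² + k·m + |k|²/(2ε).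
  have key : adv ε 0 n = adv ε k (n - rnd ε k) + freq k / ε := by
    rw [freq_eq, adv, adv, Finset.sum_div, ← Finset.sum_add_distrib]
    refine Finset.sum_congr rfl fun j _ => ?_
    rw [h.eq_rnd hε j, Pi.sub_apply]
    simp only [PiLp.zero_apply]
    push_cast
    field_simp
    ring
  rw [key]
  push_cast; ring

end em

/-! ### The linear part of the nonlinear Schrödinger equation -/

lemma sy_add {c e : W d} (hc : Rap c) (he : Rap e) {m : (Fin d → ℤ) → ℂ} (hm : Gr1 m) :
    sy m (c + e) = sy m c + sy m e := by
  ext n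
  rw [Rap.sy_apply (hc.add he) hm, W.add_apply, W.add_apply, hc.sy_apply hm, he.sy_apply hm]; ring

lemma sy_smul {c : W d} (hc : Rap c) {m : (Fin d → ℤ) → ℂ} (hm : Gr1 m) (z : ℂ) :
    sy m (z • c) = z • sy m c := by
  ext n
  rw [Rap.sy_apply (hc.const_smul z) hm, W.smul_apply, W.smul_apply, hc.sy_apply hm]; ring

section linear

variable {α : Type*} {T : ℝ} {ε : α → ℝ}

/-- `Lv` is the image of the curves `v` under `∂_t - (iε/2) Δ`. -/
def HasL (T : ℝ) (ε : α → ℝ) (v Lv : α → ℝ → W d) : Prop :=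
  ∃ v' : α → ℝ → W d, (∀ a, URap fun t : Icc 0 T => v a t) ∧ (∀ a, URap fun t : Icc 0 T => v' a t) ∧
    (∀ a, ∀ t ∈ Icc 0 T, HasDerivWithinAt (v a) (v' a t) (Icc 0 T) t) ∧
    ∀ a, ∀ t ∈ Icc 0 T,
      Lv a t = v' a t + sy (fun n => Complex.I * (adv (ε a) 0 n : ℂ)) (v a t)

lemma gr1_adv (ε : ℝ) (k : E d) : Gr1 fun n => Complex.I * (adv ε k n : ℂ) :=
  gr_adv k fun _ => le_rfl

lemma HasL.zero : HasL T ε (fun _ _ => (0 : W d)) fun _ _ => 0 :=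
  ⟨fun _ _ => 0, fun _ => URap.zero, fun _ => URap.zero, fun a t _ => hasDerivWithinAt_const _ _ _,
    fun a t _ => by
      rw [zero_add]
      ext n
      rw [Rap.sy_apply URap.zero (gr1_adv _ _)]; simp⟩

lemma HasL.add {v w Lv Lw : α → ℝ → W d} (hv : HasL T ε v Lv) (hw : HasL T ε w Lw) :
    HasL T ε (fun a t => v a t + w a t) fun a t => Lv a t + Lw a t := by
  obtain ⟨v', h1, h2, h3, h4⟩ := hv
  obtain ⟨w', g1, g2, g3, g4⟩ := hw
  refine ⟨fun a t => v' a t + w' a t, fun a => (h1 a).add (g1 a), fun a => (h2 a).add (g2 a),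
    fun a t ht => (h3 a t ht).add (g3 a t ht), fun a t ht => ?_⟩
  simp only
  rw [h4 a t ht, g4 a t ht, sy_add ((h1 a).rap ⟨t, ht⟩) ((g1 a).rap ⟨t, ht⟩) (gr1_adv _ _)]
  abel

lemma HasL.smul {v Lv : α → ℝ → W d} (hv : HasL T ε v Lv) (z : α → ℂ) :
    HasL T ε (fun a t => z a • v a t) fun a t => z a • Lv a t := by
  obtain ⟨v', h1, h2, h3, h4⟩ := hv
  refine ⟨fun a t => z a • v' a t, fun a => (h1 a).const_smul _, fun a => (h2 a).const_smul _,
    fun a t ht => (h3 a t ht).const_smul (z a), fun a t ht => ?_⟩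
  simp only
  rw [h4 a t ht, sy_smul ((h1 a).rap ⟨t, ht⟩) (gr1_adv _ _), smul_add]

lemma HasL.sum {ι : Type*} (s : Finset ι) {v Lv : ι → α → ℝ → W d}
    (h : ∀ i ∈ s, HasL T ε (v i) (Lv i)) :
    HasL T ε (fun a t => ∑ i ∈ s, v i a t) fun a t => ∑ i ∈ s, Lv i a t := by
  induction s using Finset.cons_induction with
  | empty => simpa using HasL.zero
  | cons i s hi ih =>
    simp only [Finset.sum_cons]
    exact (h i (Finset.mem_cons_self i s)).add (ih fun j hj => h j (Finset.mem_cons_of_mem hj))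

lemma HasL.congr {v Lv Lw : α → ℝ → W d} (hv : HasL T ε v Lv)
    (h : ∀ a, ∀ t ∈ Icc 0 T, Lw a t = Lv a t) : HasL T ε v Lw := by
  obtain ⟨v', h1, h2, h3, h4⟩ := hv
  exact ⟨v', h1, h2, h3, fun a t ht => (h a t ht).trans (h4 a t ht)⟩

/-- The linear part applied to a modulated exponential. -/
lemma hasL_mode {k : E d} (hε : ∀ a, ε a ≠ 0) (hk : ∀ a, Lat (ε a) k) (w : ℝ) {f f' : α → ℝ → W d}
    (hf : DCi T f) (hf' : DCi T f')
    (h : ∀ a, ∀ t ∈ Icc 0 T, HasDerivWithinAt (f a) (f' a t) (Icc 0 T) t) :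
    HasL T ε (fun a t => f a t * em (ε a) k w t) fun a t =>
      (f' a t + sy (fun n => Complex.I * (adv (ε a) k n : ℂ)) (f a t)
        + (Complex.I * (freq k - w) / ε a) • f a t) * em (ε a) k w t := by
  have u1 : ∀ a, URap fun t : Icc 0 T => f a t := fun a => (hf 0).urap.comp fun t => (a, t)
  have u2 : ∀ a, URap fun t : Icc 0 T => f' a t := fun a => (hf' 0).urap.comp fun t => (a, t)
  have u3 : ∀ a, URap fun t : Icc 0 T => em (ε a) k w t := fun a => urap_em fun t : Icc 0 T => (t : ℝ)
  refine ⟨fun a t => f' a t * em (ε a) k w t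
    + f a t * ((-(Complex.I * w / ε a)) • em (ε a) k w t), fun a => (u1 a).mul (u3 a),
    fun a => ((u2 a).mul (u3 a)).add ((u1 a).mul ((u3 a).const_smul _)),
    fun a t ht => (h a t ht).mul hasDerivAt_em.hasDerivWithinAt, fun a t ht => ?_⟩
  rw [sy_mul_em (hε a) (hk a) ((u1 a).rap ⟨t, ht⟩)]
  simp only [Algebra.smul_def, map_neg]
  have : Complex.I * (freq k - w) / ε a
    = Complex.I * freq k / ε a - Complex.I * w / ε a := by ring
  rw [this, map_sub]
  ring

/-- Residuals that can be removed by a correction of size `ε²`. -/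
def Rem (T : ℝ) (ε : α → ℝ) (ρ : α → ℝ → W d) : Prop :=
  ∃ (z Lz : α → ℝ → W d) (C : ℝ), 0 ≤ C ∧ HasL T ε z Lz ∧ ∀ a, ∀ t ∈ Icc 0 T,
    ‖z a t‖ ≤ C * ε a ^ 2 ∧ ‖Lz a t + ρ a t‖ ≤ C * ε a ^ 2

lemma Rem.of_le {ρ : α → ℝ → W d} {C : ℝ} (hC : 0 ≤ C)
    (h : ∀ a, ∀ t ∈ Icc 0 T, ‖ρ a t‖ ≤ C * ε a ^ 2) :
    Rem T ε ρ :=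
  ⟨_, _, C, hC, HasL.zero, fun a t ht => ⟨by rw [norm_zero]; positivity, by
    rw [zero_add]; exact h a t ht⟩⟩

lemma Rem.zero : Rem T ε fun _ _ => (0 : W d) :=
  Rem.of_le le_rfl fun a t _ => by simp

lemma Rem.add {ρ ρ' : α → ℝ → W d} (h : Rem T ε ρ) (h' : Rem T ε ρ') :
    Rem T ε fun a t => ρ a t + ρ' a t := by
  obtain ⟨z, Lz, C, hC, h1, h2⟩ := h
  obtain ⟨z', Lz', C', hC', h1', h2'⟩ := h'
  refine ⟨_, _, C + C', by positivity, h1.add h1', fun a t ht => ⟨?_, ?_⟩⟩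
  · rw [add_mul]; exact (norm_add_le _ _).trans (add_le_add (h2 a t ht).1 (h2' a t ht).1)
  · rw [add_mul, add_add_add_comm]
    exact (norm_add_le _ _).trans (add_le_add (h2 a t ht).2 (h2' a t ht).2)

lemma Rem.const_smul {ρ : α → ℝ → W d} (h : Rem T ε ρ) (y : ℂ) :
    Rem T ε fun a t => y • ρ a t := by
  obtain ⟨z, Lz, C, hC, h1, h2⟩ := h
  refine ⟨_, _, ‖y‖ * C, by positivity, h1.smul fun _ => y, fun a t ht => ⟨?_, ?_⟩⟩
  · rw [norm_smul, mul_assoc]; gcongr; exact (h2 a t ht).1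
  · rw [← smul_add, norm_smul, mul_assoc]; gcongr; exact (h2 a t ht).2

lemma Rem.sum {ι : Type*} (s : Finset ι) {ρ : ι → α → ℝ → W d} (h : ∀ i ∈ s, Rem T ε (ρ i)) :
    Rem T ε fun a t => ∑ i ∈ s, ρ i a t := by
  induction s using Finset.cons_induction with
  | empty => simpa using Rem.zero
  | cons i s hi ih =>
    simp only [Finset.sum_cons]
    exact (h i (Finset.mem_cons_self i s)).add (ih fun j hj => h j (Finset.mem_cons_of_mem hj))

lemma Rem.congr {ρ ρ' : α → ℝ → W d} (h : Rem T ε ρ)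
    (h' : ∀ a, ∀ t ∈ Icc 0 T, ρ' a t = ρ a t) : Rem T ε ρ' := by
  obtain ⟨z, Lz, C, hC, h1, h2⟩ := h
  exact ⟨z, Lz, C, hC, h1, fun a t ht => by rw [h' a t ht]; exact h2 a t ht⟩

/-- Nonresonant residuals of size `ε` can be removed. -/
lemma rem_mode (hT : 0 < T) {k : E d} (hε : ∀ a, 0 < ε a ∧ ε a ≤ 1) (hk : ∀ a, Lat (ε a) k) {w : ℝ}
    (hw : w ≠ freq k) {g : α → ℝ → W d} (hg : DCi T g) :
    Rem T ε fun a t => (ε a : ℂ) • (g a t * em (ε a) k w t) := by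
  obtain ⟨g', hg', hd⟩ := hg.exists_deriv hT
  have hm := hasL_mode (fun a => (hε a).1.ne') hk w hg hg' hd
  have hsy : DCi T fun a t => g' a t + sy (fun n => Complex.I * (adv (ε a) k n : ℂ)) (g a t) :=
    fun i => (hg' i).add ((hg i).sy (gr_adv k (R := 1) fun a => by
      rw [abs_of_pos (hε a).1]; exact (hε a).2))
  obtain ⟨C1, hC10, hC1⟩ := (hg 0).norm_le
  obtain ⟨C2, hC20, hC2⟩ := (hsy 0).norm_le
  have hw' : ((w : ℂ) - freq k) ≠ 0 := by
    rw [sub_ne_zero]; exact_mod_cast hw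
  -- On the mode (k, w) the linear operator has the large part i(|k|²/2 - w)/ε. Dividing by it gains
  -- a factor ε, and γ is normalised so that this part of the image of γ ε² g times the exponential
  -- equals minus the residual.
  set γ : ℂ := -Complex.I / (w - freq k)
  refine ⟨_, _, ‖γ‖ * (C1 + C2), by positivity, hm.smul fun a => γ * (ε a : ℂ) ^ 2,
    fun a t ht => ⟨?_, ?_⟩⟩
  · rw [norm_smul, norm_mul, norm_pow, Complex.norm_real, Real.norm_of_nonneg (hε a).1.le]
    have : ‖g a t * em (ε a) k w t‖ ≤ C1 + C2 := by
      refine (norm_mul_le _ _).trans ?_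
      rw [norm_em, mul_one]; linarith [hC1 a t ht]
    calc ‖γ‖ * ε a ^ 2 * ‖g a t * em (ε a) k w t‖ ≤ ‖γ‖ * ε a ^ 2 * (C1 + C2) := by gcongr
      _ = _ := by ring
  · have he : (ε a : ℂ) ≠ 0 := by exact_mod_cast (hε a).1.ne'
    have hγ : γ * (ε a : ℂ) ^ 2 * (Complex.I * (freq k - w) / ε a) = -ε a := by
      simp only [γ]
      field_simp
      linear_combination ((w : ℂ) - freq k) * Complex.I_sq
    have e1 : (γ * (ε a : ℂ) ^ 2) • ((g' a t + sy (fun n => Complex.I * (adv (ε a) k n : ℂ)) (g a t)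
        + (Complex.I * (freq k - w) / ε a) • g a t) * em (ε a) k w t)
        + (ε a : ℂ) • (g a t * em (ε a) k w t)
        = (γ * (ε a : ℂ) ^ 2) • ((g' a t + sy (fun n => Complex.I * (adv (ε a) k n : ℂ)) (g a t))
          * em (ε a) k w t) := by
      rw [add_mul _ (_ • _), smul_add, smul_mul_assoc, smul_smul, hγ, neg_smul,
        neg_add_cancel_right]
    rw [e1, norm_smul, norm_mul, norm_pow, Complex.norm_real, Real.norm_of_nonneg (hε a).1.le]
    have : ‖(g' a t + sy (fun n => Complex.I * (adv (ε a) k n : ℂ)) (g a t)) * em (ε a) k w t‖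
        ≤ C1 + C2 := by
      refine (norm_mul_le _ _).trans ?_
      rw [norm_em, mul_one]; linarith [hC2 a t ht]
    calc ‖γ‖ * ε a ^ 2 * _ ≤ ‖γ‖ * ε a ^ 2 * (C1 + C2) := by gcongr
      _ = _ := by ring

end linear

/-! ### The residual of the modulated Fourier expansion -/

/-- A nonresonant triple and two further wave vectors. -/
abbrev Quint (d : ℕ) := (E d × E d × E d) × E d × E d

/-- All nonresonant triples with two further wave vectors. -/
def quints (K : Finset (E d)) : Finset (Quint d) := nonres K ×ˢ K ×ˢ K

def qk (z : Quint d) : E d := kap z.1 - z.2.1 + z.2.2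
def qk' (z : Quint d) : E d := z.2.1 - kap z.1 + z.2.2
/-- The frequencies of quintuples, with the frequency `w` of the triple. -/
def qw (w : ℝ) (z : Quint d) : ℝ := w - freq z.2.1 + freq z.2.2
def qw' (w : ℝ) (z : Quint d) : ℝ := freq z.2.1 - w + freq z.2.2

/-! ### Algebra of the cubic nonlinearity on sums of modulated exponentials. -/

section algebra

variable {ε lam t : ℝ} {K : Finset (E d)} {c : E d → W d} {b bs g : E d × E d × E d → W d}

lemma mem_quints {z : Quint d} : z ∈ quints K ↔ z.1 ∈ nonres K ∧ z.2.1 ∈ K ∧ z.2.2 ∈ K := by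
  simp [quints]

lemma lat_kap (hK : ∀ k ∈ K, Lat ε k) {ν : E d × E d × E d} (hν : ν ∈ triples K) :
    Lat ε (kap ν) := by
  obtain ⟨h1, h2, h3⟩ := mem_triples.1 hν
  exact Lat.kap (hK _ h1) (hK _ h2) (hK _ h3)

lemma sum_quints {A : Type*} [AddCommMonoid A] (f : E d × E d × E d → E d → E d → A) :
    ∑ ν ∈ nonres K, ∑ p ∈ K, ∑ q ∈ K, f ν p q = ∑ z ∈ quints K, f z.1 z.2.1 z.2.2 := by
  rw [quints, Finset.sum_product]
  refine Finset.sum_congr rfl fun ν _ => ?_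
  rw [Finset.sum_product]

lemma sum_mul_sum_mul_sum {A ι ι' ι'' : Type*} [CommRing A] (s : Finset ι) (s' : Finset ι')
    (s'' : Finset ι'') (x : ι → A) (y : ι' → A) (z : ι'' → A) :
    (∑ i ∈ s, x i) * (∑ j ∈ s', y j) * (∑ k ∈ s'', z k)
      = ∑ i ∈ s, ∑ j ∈ s', ∑ k ∈ s'', x i * y j * z k := by
  rw [Finset.sum_mul_sum, Finset.sum_mul]
  refine Finset.sum_congr rfl fun i _ => ?_
  rw [Finset.sum_mul]
  refine Finset.sum_congr rfl fun j _ => ?_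
  rw [Finset.mul_sum]

/-- The leading part of the expansion. -/
def lead (ε : ℝ) (K : Finset (E d)) (c : E d → W d) (t : ℝ) : W d :=
  ∑ r ∈ K, c r * em ε r (freq r) t

/-- A sum of modulated exponentials with the wave vectors of nonresonant triples. -/
def corr (ε : ℝ) (K : Finset (E d)) (w : E d × E d × E d → ℝ) (b : E d × E d × E d → W d) (t : ℝ) :
    W d :=
  ∑ ν ∈ nonres K, b ν * em ε (kap ν) (w ν) t

lemma lead_mul (hK : ∀ k ∈ K, Lat ε k) :
    lead ε K c t * star (lead ε K c t) * lead ε K c t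
      = ∑ ν ∈ triples K, cub c ν * em ε (kap ν) (om ν) t := by
  unfold lead
  rw [star_sum, sum_mul_sum_mul_sum, triples, Finset.sum_product]
  refine Finset.sum_congr rfl fun i hi => ?_
  rw [Finset.sum_product]
  refine Finset.sum_congr rfl fun j hj => Finset.sum_congr rfl fun k hk => ?_
  rw [star_mul', star_em (hK j hj), kap, om, sub_eq_add_neg, sub_eq_add_neg,
    ← em_mul ((hK i hi).add (hK j hj).neg) (hK k hk), ← em_mul (hK i hi) (hK j hj).neg, cub]
  ring

lemma corr_mul (hK : ∀ k ∈ K, Lat ε k) (w : E d × E d × E d → ℝ) :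
    corr ε K w b t * star (lead ε K c t) * lead ε K c t
      = ∑ z ∈ quints K, b z.1 * star (c z.2.1) * c z.2.2 * em ε (qk z) (qw (w z.1) z) t := by
  rw [← sum_quints (K := K) (A := W d) fun ν p q => b ν * star (c p) * c q
    * em ε (qk (ν, p, q)) (qw (w ν) (ν, p, q)) t]
  unfold lead corr
  rw [star_sum, sum_mul_sum_mul_sum]
  refine Finset.sum_congr rfl fun ν hν => Finset.sum_congr rfl fun p hp =>
    Finset.sum_congr rfl fun q hq => ?_
  have hl := lat_kap hK (mem_nonres.1 hν).1
  simp only [qk, qw]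
  rw [star_mul', star_em (hK p hp), sub_eq_add_neg, sub_eq_add_neg,
    ← em_mul (hl.add (hK p hp).neg) (hK q hq), ← em_mul hl (hK p hp).neg]
  ring

lemma corr_mul' (hK : ∀ k ∈ K, Lat ε k) (w : E d × E d × E d → ℝ) :
    lead ε K c t * star (corr ε K w b t) * lead ε K c t
      = ∑ z ∈ quints K, c z.2.1 * star (b z.1) * c z.2.2 * em ε (qk' z) (qw' (w z.1) z) t := by
  rw [← sum_quints (K := K) (A := W d) fun ν p q => c p * star (b ν) * c q
    * em ε (qk' (ν, p, q)) (qw' (w ν) (ν, p, q)) t]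
  have h1 : lead ε K c t * star (corr ε K w b t) * lead ε K c t
      = star (corr ε K w b t) * lead ε K c t * lead ε K c t := by ring
  rw [h1]
  unfold lead corr
  rw [star_sum, sum_mul_sum_mul_sum]
  refine Finset.sum_congr rfl fun ν hν => Finset.sum_congr rfl fun p hp =>
    Finset.sum_congr rfl fun q hq => ?_
  have hl := lat_kap hK (mem_nonres.1 hν).1
  simp only [qk', qw']
  rw [star_mul', star_em hl, sub_eq_add_neg, sub_eq_add_neg,
    ← em_mul ((hK p hp).add hl.neg) (hK q hq), ← em_mul (hK p hp) hl.neg]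
  ring

open Classical in
/-- Collecting the resonant terms of a sum of modulated exponentials. -/
lemma sum_collect {ι : Type*} (s : Finset ι) (k : ι → E d) (w : ι → ℝ) (X : ι → W d)
    (h : ∀ i ∈ s, w i = freq (k i) → k i ∈ K) :
    ∑ r ∈ K, (∑ i ∈ s, if k i = r ∧ w i = freq r then X i else 0) * em ε r (freq r) t
      = ∑ i ∈ s, if w i = freq (k i) then X i * em ε (k i) (w i) t else 0 := by
  simp only [Finset.sum_mul]
  rw [Finset.sum_comm]
  refine Finset.sum_congr rfl fun i hi => ?_
  split_ifs with hw
  · rw [Finset.sum_eq_single_of_mem (k i) (h i hi hw)]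
    · rw [if_pos ⟨rfl, hw⟩, ← hw]
    · intro r _ hr
      rw [if_neg fun h => hr h.1.symm, zero_mul]
  · refine Finset.sum_eq_zero fun r _ => ?_
    rw [if_neg, zero_mul]
    rintro ⟨rfl, h2⟩
    exact hw h2

lemma sum_split {ι : Type*} (s : Finset ι) (P : ι → Prop) [DecidablePred P] (X : ι → W d) :
    ∑ i ∈ s, X i = ∑ i ∈ s, (if P i then X i else 0) + ∑ i ∈ s, (if P i then 0 else X i) := by
  rw [← Finset.sum_add_distrib]
  refine Finset.sum_congr rfl fun i _ => ?_
  split_ifs <;> simp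

open Classical in
lemma sum_triples (X : E d × E d × E d → W d) : ∑ ν ∈ triples K, X ν
    = ∑ ν ∈ triples K, (if om ν = freq (kap ν) then X ν else 0) + ∑ ν ∈ nonres K, X ν := by
  rw [sum_split (triples K) (fun ν => om ν = freq (kap ν)) X]
  congr 1
  rw [nonres, Finset.sum_filter]
  refine Finset.sum_congr rfl fun ν _ => ?_
  rw [← ite_not]
  rfl

/-- The structural properties of the set of wave vectors. -/
structure Sat (K : Finset (E d)) : Prop where
  res : ∀ ν ∈ triples K, om ν = freq (kap ν) → kap ν ∈ K
  nonres : ∀ ν ∈ triples K, kap ν ∈ K → om ν = freq (kap ν)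
  quint : ∀ z ∈ quints K, qw (om z.1) z = freq (qk z) → qk z ∈ K
  quint' : ∀ z ∈ quints K, qw' (om z.1) z = freq (qk' z) → qk' z ∈ K
  star : ∀ z ∈ quints K, z.2.1 ≠ z.2.2 → qw (omStar z.1) z ≠ freq (qk z)
  star' : ∀ z ∈ quints K, qw' (omStar z.1) z ≠ freq (qk' z)

open Classical in
/-- The terms with an exponential that is not a plane wave of the free equation. -/
def offRes (ε lam : ℝ) (K : Finset (E d)) (c : E d → W d) (bs g : E d × E d × E d → W d)
    (t : ℝ) : W d :=
  (2 * Complex.I * lam ^ 2) • (∑ z ∈ quints K, if qw (om z.1) z = freq (qk z) then 0 else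
      (ε : ℂ) • (cubd c z.1 * star (c z.2.1) * c z.2.2 * em ε (qk z) (qw (om z.1) z) t))
  + (Complex.I * lam ^ 2) • (∑ z ∈ quints K, if qw' (om z.1) z = freq (qk' z) then 0 else
      (ε : ℂ) • (c z.2.1 * star (cubd c z.1) * c z.2.2 * em ε (qk' z) (qw' (om z.1) z) t))
  + (2 * Complex.I * lam ^ 2) • (∑ z ∈ quints K, if z.2.1 = z.2.2 then 0 else
      (ε : ℂ) • (bs z.1 * star (c z.2.1) * c z.2.2 * em ε (qk z) (qw (omStar z.1) z) t))
  + (Complex.I * lam ^ 2) • (∑ z ∈ quints K,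
      (ε : ℂ) • (c z.2.1 * star (bs z.1) * c z.2.2 * em ε (qk' z) (qw' (omStar z.1) z) t))
  + (lam : ℂ) • ∑ ν ∈ nonres K, (ε : ℂ) • (g ν * em ε (kap ν) (om ν) t)

/-- The modulated Fourier expansion in terms of the coefficients. -/
def mfe (ε lam : ℝ) (K : Finset (E d)) (c : E d → W d) (bs : E d × E d × E d → W d) (t : ℝ) : W d :=
  lead ε K c t + (ε * lam : ℂ) • (corr ε K omStar bs t + corr ε K om (cubd c) t)

/-- The linear part of the equation applied to the modulated Fourier expansion. -/
def mfeL (ε lam : ℝ) (K : Finset (E d)) (c : E d → W d) (bs g : E d × E d × E d → W d) (t : ℝ) :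
    W d :=
  ∑ r ∈ K, rhsA lam K (algebraMap ℂ (W d) ε) c r * em ε r (freq r) t
  + (ε * lam : ℂ) • (corr ε K omStar
      (fun ν => (-2 * Complex.I * lam) • ((∑ p ∈ K, c p * star (c p)) * bs ν)) t
    + corr ε K om
      (fun ν => g ν + (Complex.I * (freq (kap ν) - om ν) / ε) • cubd c ν) t)

/-- The cubic and quartic remainder of the nonlinearity. -/
def cubRem (A Y : W d) : W d := 2 * (Y * star Y * A) + Y * star A * Y + Y * star Y * Y

lemma cub_expand (A Y : W d) : (A + Y) * star (A + Y) * (A + Y)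
    = A * star A * A + 2 * (Y * star A * A) + A * star Y * A + cubRem A Y := by
  rw [star_add, cubRem]; ring

-- Saturation ensures that every resonant wave vector lies in K, so collecting by r loses no
-- resonant term. The first sum of the system carries no frequency condition; for wave vectors in K
-- that condition is automatic by `Sat.nonres`.
open Classical in
lemma sum_rhsA (hS : Sat K) :
    ∑ r ∈ K, rhsA lam K (algebraMap ℂ (W d) ε) c r * em ε r (freq r) t
      = (- Complex.I * lam) • (∑ ν ∈ triples K,
          if om ν = freq (kap ν) then cub c ν * em ε (kap ν) (om ν) t else 0)
        - (2 * Complex.I * lam ^ 2 * ε) • (∑ z ∈ quints K, if qw (om z.1) z = freq (qk z) then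
          cubd c z.1 * star (c z.2.1) * c z.2.2 * em ε (qk z) (qw (om z.1) z) t else 0)
        - (Complex.I * lam ^ 2 * ε) • (∑ z ∈ quints K, if qw' (om z.1) z = freq (qk' z) then
          c z.2.1 * star (cubd c z.1) * c z.2.2 * em ε (qk' z) (qw' (om z.1) z) t else 0) := by
  rw [← sum_collect (ε := ε) (t := t) (triples K) kap om (cub c) hS.res,
    ← sum_collect (ε := ε) (t := t) (quints K) qk (fun z => qw (om z.1) z)
      (fun z => cubd c z.1 * star (c z.2.1) * c z.2.2) hS.quint,
    ← sum_collect (ε := ε) (t := t) (quints K) qk' (fun z => qw' (om z.1) z)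
      (fun z => c z.2.1 * star (cubd c z.1) * c z.2.2) hS.quint',
    Finset.smul_sum, Finset.smul_sum, Finset.smul_sum, ← Finset.sum_sub_distrib,
    ← Finset.sum_sub_distrib]
  refine Finset.sum_congr rfl fun r hr => ?_
  have e1 : (∑ ν ∈ triples K, if kap ν = r then cub c ν else 0)
      = ∑ ν ∈ triples K, if kap ν = r ∧ om ν = freq r then cub c ν else 0 := by
    refine Finset.sum_congr rfl fun ν hν => ?_
    by_cases h : kap ν = r
    · have : om ν = freq r := by rw [← h]; exact hS.nonres ν hν (h ▸ hr)
      rw [if_pos h, if_pos ⟨h, this⟩]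
    · rw [if_neg h, if_neg fun h' => h h'.1]
  rw [rhsA, e1, sum_quints, sum_quints, ← Algebra.smul_def, ← Algebra.smul_def, smul_smul, smul_smul]
  simp only [sub_mul, smul_mul_assoc]
  rfl

-- For p = q the added wave vectors and frequencies cancel, so these quintuples stay on the mode of
-- b_ν^⋆ itself and sum to the factor ∑|a_p|² of its equation. They are resonant for every K, which
-- is why q ≠ r is required in Assumption 2.
open Classical in
lemma sum_star :
    ∑ z ∈ quints K, bs z.1 * star (c z.2.1) * c z.2.2 * em ε (qk z) (qw (omStar z.1) z) t
    = corr ε K omStar (fun ν => (∑ p ∈ K, c p * star (c p)) * bs ν) t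
      + ∑ z ∈ quints K, (if z.2.1 = z.2.2 then 0 else
        bs z.1 * star (c z.2.1) * c z.2.2 * em ε (qk z) (qw (omStar z.1) z) t) := by
  rw [sum_split (quints K) (fun z => z.2.1 = z.2.2)]
  congr 1
  have h := sum_quints (K := K) (A := W d) fun ν p q => if p = q then bs ν * star (c p) * c q
    * em ε (qk (ν, p, q)) (qw (omStar ν) (ν, p, q)) t else 0
  refine h.symm.trans ?_
  rw [corr]
  refine Finset.sum_congr rfl fun ν hν => ?_
  rw [Finset.sum_mul, Finset.sum_mul]
  refine Finset.sum_congr rfl fun p hp => ?_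
  rw [Finset.sum_ite_eq, if_pos hp]
  simp only [qk, qw, sub_add_cancel]
  ring

/-- The residual of the modulated Fourier expansion consists of nonresonant terms and terms of
higher order. -/
theorem residual_eq (hε : ε ≠ 0) (hK : ∀ k ∈ K, Lat ε k) (hS : Sat K) :
    mfeL ε lam K c bs g t
      - (-Complex.I * lam) • (mfe ε lam K c bs t * star (mfe ε lam K c bs t) * mfe ε lam K c bs t)
      = offRes ε lam K c bs g t + (Complex.I * lam) • cubRem (lead ε K c t)
        ((ε * lam : ℂ) • (corr ε K omStar bs t + corr ε K om (cubd c) t)) := by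
  have hr : star (ε * lam : ℂ) = ε * lam := by simp
  have hε' : (ε : ℂ) ≠ 0 := by exact_mod_cast hε
  -- The frequency mismatch is -δ_ν, so the factor 1/δ_ν in b_ν cancels and leaves -(i/ε) times the
  -- cubic product. After multiplication by ελ this is exactly the nonresonant triple of the
  -- nonlinearity.
  have h1 : corr ε K om (fun ν => g ν + (Complex.I * (freq (kap ν) - om ν) / ε) • cubd c ν) t
      = corr ε K om g t - (Complex.I / ε) • ∑ ν ∈ nonres K, cub c ν * em ε (kap ν) (om ν) t := by
    rw [corr, corr, Finset.smul_sum, ← Finset.sum_sub_distrib]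
    refine Finset.sum_congr rfl fun ν hν => ?_
    have hδ : (delta ν : ℂ) ≠ 0 := by exact_mod_cast delta_ne_zero hν
    have : (Complex.I * (freq (kap ν) - om ν) / ε : ℂ) * (1 / (delta ν : ℂ)) = -(Complex.I / ε) := by
      have h2 : (freq (kap ν) - om ν : ℂ) = -(delta ν : ℂ) := by
        rw [delta, omStar]; push_cast; ring
      rw [h2]; field_simp
    rw [cubd, smul_smul, this, neg_smul, add_mul, neg_mul, smul_mul_assoc, sub_eq_add_neg]
  have h2 : corr ε K omStar
      (fun ν => (-2 * Complex.I * lam) • ((∑ p ∈ K, c p * star (c p)) * bs ν)) t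
      = (-2 * Complex.I * lam) • corr ε K omStar (fun ν => (∑ p ∈ K, c p * star (c p)) * bs ν) t := by
    rw [corr, corr, Finset.smul_sum]
    exact Finset.sum_congr rfl fun ν _ => smul_mul_assoc _ _ _
  have hlin : ∀ X Y : W d, ((ε * lam : ℂ) • (X + Y)) * star (lead ε K c t) * lead ε K c t
      = (ε * lam : ℂ) • (X * star (lead ε K c t) * lead ε K c t
        + Y * star (lead ε K c t) * lead ε K c t) := fun X Y => by
    rw [smul_mul_assoc, smul_mul_assoc, add_mul, add_mul]
  have hlin' : ∀ X Y : W d, lead ε K c t * star ((ε * lam : ℂ) • (X + Y)) * lead ε K c t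
      = (ε * lam : ℂ) • (lead ε K c t * star X * lead ε K c t
        + lead ε K c t * star Y * lead ε K c t) := fun X Y => by
    rw [star_smul, hr, mul_smul_comm, smul_mul_assoc, star_add, mul_add, add_mul]
  rw [mfeL, mfe, cub_expand, sum_rhsA hS, h1, h2, lead_mul hK, hlin, hlin', corr_mul hK, corr_mul hK,
    corr_mul' hK, corr_mul' hK,
    sum_triples fun ν => cub c ν * em ε (kap ν) (om ν) t, sum_star,
    sum_split (quints K) (fun z => qw (om z.1) z = freq (qk z)) (fun z =>
      cubd c z.1 * star (c z.2.1) * c z.2.2 * em ε (qk z) (qw (om z.1) z) t),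
    sum_split (quints K) (fun z => qw' (om z.1) z = freq (qk' z)) (fun z =>
      c z.2.1 * star (cubd c z.1) * c z.2.2 * em ε (qk' z) (qw' (om z.1) z) t), offRes]
  have hite : ∀ (P : Quint d → Prop) [DecidablePred P] (X : Quint d → W d),
      (∑ z ∈ quints K, if P z then 0 else (ε : ℂ) • X z)
        = (ε : ℂ) • ∑ z ∈ quints K, if P z then 0 else X z := fun P _ X => by
    rw [Finset.smul_sum]
    exact Finset.sum_congr rfl fun z _ => by split_ifs <;> simp
  have h4 : ∑ ν ∈ nonres K, g ν * em ε (kap ν) (om ν) t = corr ε K om g t := rfl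
  rw [hite, hite, hite, ← Finset.smul_sum, ← Finset.smul_sum, h4]
  have h3 : ∀ X : W d, (2 : W d) * X = (2 : ℂ) • X := fun X => by
    rw [two_mul, two_smul]
  rw [h3]
  beta_reduce
  match_scalars <;> field_simp <;> try ring_nf

end algebra

/-! ### Properties of the saturated set of wave vectors -/

/-- A triple with i = j is resonant, so a nonresonant one supplies two distinct wave vectors. They
serve to instantiate the condition q ≠ r in `Nonresonance`. -/
lemma exists_ne_of_nonres {K : Finset (E d)} {ν : E d × E d × E d} (hν : ν ∈ nonres K) :
    ∃ q ∈ K, ∃ r ∈ K, q ≠ r := by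
  obtain ⟨h1, h2⟩ := mem_nonres.1 hν
  obtain ⟨hi, hj, hk⟩ := mem_triples.1 h1
  by_cases h : ν.1 = ν.2.1
  · refine absurd ?_ h2
    rw [om, omStar, kap, h]; simp
  · exact ⟨_, hi, _, hj, h⟩

lemma subset_augment (K : Finset (E d)) : K ⊆ augment K := fun k hk => by
  simp [augment, hk]

/-- Closure under resonances is the fixed-point property of `augment`; the remaining fields come
from `Nonresonance` with suitable choices of its wave vectors. -/
lemma Sat.of_augment {K : Finset (E d)} (h : augment K = K) (hn : Nonresonance K) : Sat K where
  res ν hν hr := by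
    rw [← h]
    simp only [augment, Finset.mem_union, Finset.mem_image, Finset.mem_filter]
    exact Or.inl (Or.inl (Or.inr ⟨ν, ⟨hν, hr⟩, rfl⟩))
  nonres ν hν hk := by
    by_contra hne
    have hν' : ν ∈ MFE.nonres K := MFE.mem_nonres.2 ⟨hν, hne⟩
    obtain ⟨q, hq, r, hr, hqr⟩ := exists_ne_of_nonres hν'
    obtain ⟨s, hs, hs'⟩ : ∃ s ∈ K, kap ν ≠ s := by
      by_cases h : kap ν = q
      · exact ⟨r, hr, h ▸ hqr⟩
      · exact ⟨q, hq, h⟩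
    -- If a nonresonant triple had its wave vector in K, that wave vector could be subtracted and
    -- another one s added; the forbidden equality then reads |s|²/2 = |s|²/2.
    refine (hn ν hν' q hq (kap ν) hk s hs hs').1 ?_
    rw [omStar]; simp
  quint z hz hr := by
    rw [← h]
    simp only [augment, Finset.mem_union, Finset.mem_image, Finset.mem_filter]
    exact Or.inl (Or.inr ⟨z, ⟨hz, hr⟩, rfl⟩)
  quint' z hz hr := by
    rw [← h]
    simp only [augment, Finset.mem_union, Finset.mem_image, Finset.mem_filter]
    exact Or.inr ⟨z, ⟨hz, hr⟩, rfl⟩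
  star z hz hne := by
    obtain ⟨h1, h2, h3⟩ := mem_quints.1 hz
    exact (hn z.1 h1 z.2.1 h2 z.2.1 h2 z.2.2 h3 hne).1
  star' z hz := by
    obtain ⟨h1, h2, h3⟩ := mem_quints.1 hz
    obtain ⟨q, hq, r, hr, hqr⟩ := exists_ne_of_nonres h1
    -- The second half of `Nonresonance` does not involve q, but the hypothesis q ≠ r still needs a
    -- witness.
    obtain ⟨s, hs, hs'⟩ : ∃ s ∈ K, s ≠ z.2.2 := by
      by_cases h : q = z.2.2
      · exact ⟨r, hr, fun h' => hqr (h.trans h'.symm)⟩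
      · exact ⟨q, hq, h⟩
    exact (hn z.1 h1 z.2.1 h2 s hs z.2.2 h3 hs').2

lemma sat_waveSet {M : ℕ} {κ : Fin M → E d} {n : ℕ} (h : waveSet κ (n + 1) = waveSet κ n)
    (hn : Nonresonance (waveSet κ n)) : Sat (waveSet κ n) :=
  Sat.of_augment (by rw [waveSet, Function.iterate_succ_apply'] at h; exact h) hn

lemma lat_qk {ε : ℝ} {K : Finset (E d)} (hK : ∀ k ∈ K, Lat ε k) {z : Quint d} (hz : z ∈ quints K) :
    Lat ε (qk z) := by
  obtain ⟨h1, h2, h3⟩ := mem_quints.1 hz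
  exact ((lat_kap hK (mem_nonres.1 h1).1).sub (hK _ h2)).add (hK _ h3)

lemma lat_qk' {ε : ℝ} {K : Finset (E d)} (hK : ∀ k ∈ K, Lat ε k) {z : Quint d} (hz : z ∈ quints K) :
    Lat ε (qk' z) := by
  obtain ⟨h1, h2, h3⟩ := mem_quints.1 hz
  exact ((hK _ h2).sub (lat_kap hK (mem_nonres.1 h1).1)).add (hK _ h3)

lemma lat_augment {ε : ℝ} {K : Finset (E d)} (hK : ∀ k ∈ K, Lat ε k) : ∀ k ∈ augment K, Lat ε k := by
  intro k hk
  simp only [augment, Finset.mem_union, Finset.mem_image, Finset.mem_filter] at hk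
  rcases hk with ((hk | ⟨ν, hν, rfl⟩) | ⟨z, hz, rfl⟩) | ⟨z, hz, rfl⟩
  · exact hK k hk
  · exact lat_kap hK hν.1
  · exact lat_qk hK hz.1
  · exact lat_qk' hK hz.1

lemma lat_waveSet {M : ℕ} {κ : Fin M → E d} {ε : ℝ} (h : Admissible κ ε) (n : ℕ) :
    ∀ k ∈ waveSet κ n, Lat ε k := by
  induction n with
  | zero =>
    intro k hk
    simp only [waveSet, Function.iterate_zero, id, Finset.mem_image, Finset.mem_univ, true_and] at hk
    obtain ⟨m, rfl⟩ := hk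
    exact h.2 m
  | succ n ih =>
    rw [waveSet, Function.iterate_succ_apply']
    exact lat_augment ih

lemma mem_waveSet {M : ℕ} (κ : Fin M → E d) (m : Fin M) (n : ℕ) : κ m ∈ waveSet κ n := by
  induction n with
  | zero => simp [waveSet]
  | succ n ih =>
    rw [waveSet, Function.iterate_succ_apply']
    exact subset_augment _ ih

/-! ### The error of the modulated Fourier expansion -/

section family

variable {α : Type*} {T lam : ℝ} {ε : α → ℝ} {K : Finset (E d)}

/-- The linear part applied to a modulated exponential whose coefficient solves an advected
Schrödinger equation. -/
lemma hasL_mode_of_advected (hT : 0 < T) {k : E d} (hε : ∀ a, ε a ≠ 0) (hk : ∀ a, Lat (ε a) k)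
    (w : ℝ) {f F : α → ℝ → W d} (hf : DCi T f)
    (h : ∀ a, ∀ t ∈ Icc 0 T, HasDerivWithinAt (f a)
      (F a t - sy (fun n => Complex.I * (adv (ε a) k n : ℂ)) (f a t)) (Icc 0 T) t) :
    HasL T ε (fun a t => f a t * em (ε a) k w t) fun a t =>
      (F a t + (Complex.I * (freq k - w) / ε a) • f a t) * em (ε a) k w t := by
  obtain ⟨f', hf', hd⟩ := hf.exists_deriv hT
  have hF : ∀ a, ∀ t ∈ Icc 0 T,
      F a t - sy (fun n => Complex.I * (adv (ε a) k n : ℂ)) (f a t) = f' a t := fun a t ht =>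
    (uniqueDiffOn_Icc hT t ht).eq_deriv _ (h a t ht) (hd a t ht)
  refine (hasL_mode hε hk w hf hf' hd).congr fun a t ht => ?_
  rw [← hF a t ht, sub_add_cancel]

lemma exists_norm_modes_le {ι : Type*} (s : Finset ι) (k : ι → E d) (w : ι → ℝ)
    {f : ι → α → ℝ → W d} (hf : ∀ i ∈ s, DCi T (f i)) : ∃ C, 0 ≤ C ∧ ∀ a, ∀ t ∈ Icc 0 T,
      ‖∑ i ∈ s, f i a t * em (ε a) (k i) (w i) t‖ ≤ C := by
  induction s using Finset.cons_induction with
  | empty => exact ⟨0, le_rfl, fun a t _ => by simp⟩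
  | cons i s hi ih =>
    obtain ⟨C, hC0, hC⟩ := ih fun j hj => hf j (Finset.mem_cons_of_mem hj)
    obtain ⟨D, hD0, hD⟩ := (hf i (Finset.mem_cons_self i s) 0).norm_le
    refine ⟨D + C, by positivity, fun a t ht => ?_⟩
    rw [Finset.sum_cons]
    refine (norm_add_le _ _).trans (add_le_add ?_ (hC a t ht))
    refine (norm_mul_le _ _).trans ?_
    rw [norm_em, mul_one]; exact hD a t ht

lemma norm_cubRem_le {A Y : W d} {r s : ℝ} (hA : ‖A‖ ≤ r) (hY : ‖Y‖ ≤ s) :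
    ‖cubRem A Y‖ ≤ 3 * r * s ^ 2 + s ^ 3 := by
  have hr : 0 ≤ r := (norm_nonneg _).trans hA
  have hs : 0 ≤ s := (norm_nonneg _).trans hY
  have h1 : ‖Y * star Y * A‖ ≤ s * s * r := by
    refine (norm_mul_le _ _).trans (mul_le_mul ((norm_mul_le _ _).trans ?_) hA (norm_nonneg _)
      (by positivity))
    rw [norm_star]
    exact mul_le_mul hY hY (norm_nonneg _) hs
  have h2 : ‖Y * star A * Y‖ ≤ s * r * s := by
    refine (norm_mul_le _ _).trans (mul_le_mul ((norm_mul_le _ _).trans ?_) hY (norm_nonneg _)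
      (by positivity))
    rw [norm_star]
    exact mul_le_mul hY hA (norm_nonneg _) hs
  have h3 : ‖Y * star Y * Y‖ ≤ s * s * s := by
    refine (norm_mul_le _ _).trans (mul_le_mul ((norm_mul_le _ _).trans ?_) hY (norm_nonneg _)
      (by positivity))
    rw [norm_star]
    exact mul_le_mul hY hY (norm_nonneg _) hs
  have h4 := norm_add_le (Y * star Y * A + Y * star Y * A + Y * star A * Y) (Y * star Y * Y)
  have h5 := norm_add_le (Y * star Y * A + Y * star Y * A) (Y * star A * Y)
  have h6 := norm_add_le (Y * star Y * A) (Y * star Y * A)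
  rw [cubRem, two_mul]
  nlinarith

lemma dci_cub {c : α → ℝ → E d → W d} (hc : ∀ e ∈ K, DCi T fun a t => c a t e)
    {ν : E d × E d × E d} (hν : ν ∈ triples K) : DCi T fun a t => cub (c a t) ν := by
  obtain ⟨h1, h2, h3⟩ := mem_triples.1 hν
  exact fun i => ((hc _ h1 i).mul (hc _ h2 i).star).mul (hc _ h3 i)

lemma dci_cubd {c : α → ℝ → E d → W d} (hc : ∀ e ∈ K, DCi T fun a t => c a t e)
    {ν : E d × E d × E d} (hν : ν ∈ triples K) : DCi T fun a t => cubd (c a t) ν := fun i =>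
  (dci_cub hc hν i).const_smul _

/-- Each summand is either masked by its resonance condition or has a frequency off the dispersion
relation: the first two groups by their masks, the two groups with b_ν^⋆ by Assumption 2, the last
by nonresonance of ν. So `rem_mode` applies to each surviving term. -/
lemma rem_offRes (hT : 0 < T) (hε : ∀ a, 0 < ε a ∧ ε a ≤ 1) (hK : ∀ a, ∀ k ∈ K, Lat (ε a) k)
    (hS : Sat K) {c : α → ℝ → E d → W d} (hc : ∀ e ∈ K, DCi T fun a t => c a t e)
    {bs g : α → ℝ → E d × E d × E d → W d} (hb : ∀ ν ∈ nonres K, DCi T fun a t => bs a t ν)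
    (hg : ∀ ν ∈ nonres K, DCi T fun a t => g a t ν) :
    Rem T ε fun a t => offRes (ε a) lam K (c a t) (bs a t) (g a t) t := by
  unfold offRes
  refine ((((Rem.const_smul (Rem.sum _ fun z hz => ?_) _).add
    (Rem.const_smul (Rem.sum _ fun z hz => ?_) _)).add
    (Rem.const_smul (Rem.sum _ fun z hz => ?_) _)).add
    (Rem.const_smul (Rem.sum _ fun z hz => ?_) _)).add
    (Rem.const_smul (Rem.sum _ fun ν hν => ?_) _)
  · obtain ⟨h1, h2, h3⟩ := mem_quints.1 hz
    split_ifs with h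
    · exact Rem.zero
    · exact rem_mode hT hε (fun a => lat_qk (hK a) hz) h fun i =>
        ((dci_cubd hc (mem_nonres.1 h1).1 i).mul (hc _ h2 i).star).mul (hc _ h3 i)
  · obtain ⟨h1, h2, h3⟩ := mem_quints.1 hz
    split_ifs with h
    · exact Rem.zero
    · exact rem_mode hT hε (fun a => lat_qk' (hK a) hz) h fun i =>
        ((hc _ h2 i).mul (dci_cubd hc (mem_nonres.1 h1).1 i).star).mul (hc _ h3 i)
  · obtain ⟨h1, h2, h3⟩ := mem_quints.1 hz
    split_ifs with h
    · exact Rem.zero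
    · exact rem_mode hT hε (fun a => lat_qk (hK a) hz) (hS.star z hz h) fun i =>
        ((hb _ h1 i).mul (hc _ h2 i).star).mul (hc _ h3 i)
  · obtain ⟨h1, h2, h3⟩ := mem_quints.1 hz
    exact rem_mode hT hε (fun a => lat_qk' (hK a) hz) (hS.star' z hz) fun i =>
        ((hc _ h2 i).mul (hb _ h1 i).star).mul (hc _ h3 i)
  · exact rem_mode hT hε (fun a => lat_kap (hK a) (mem_nonres.1 hν).1) (mem_nonres.1 hν).2 (hg ν hν)

/-- The residual of the modulated Fourier expansion is removable. -/
lemma exists_hasL_mfe (hT : 0 < T) (hε : ∀ a, 0 < ε a ∧ ε a ≤ 1) (hK : ∀ a, ∀ k ∈ K, Lat (ε a) k)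
    (hS : Sat K) {c : α → ℝ → E d → W d} (hc : ∀ e ∈ K, DCi T fun a t => c a t e)
    {bs : α → ℝ → E d × E d × E d → W d} (hb : ∀ ν ∈ nonres K, DCi T fun a t => bs a t ν)
    (hcd : ∀ r ∈ K, ∀ a, ∀ t ∈ Icc 0 T, HasDerivWithinAt (fun t => c a t r)
      (rhsA lam K (algebraMap ℂ (W d) (ε a)) (c a t) r
        - sy (fun n => Complex.I * (adv (ε a) r n : ℂ)) (c a t r)) (Icc 0 T) t)
    (hbd : ∀ ν ∈ nonres K, ∀ a, ∀ t ∈ Icc 0 T, HasDerivWithinAt (fun t => bs a t ν)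
      ((-2 * Complex.I * lam) • ((∑ p ∈ K, c a t p * star (c a t p)) * bs a t ν)
        - sy (fun n => Complex.I * (adv (ε a) (kap ν) n : ℂ)) (bs a t ν)) (Icc 0 T) t) :
    ∃ Lv, HasL T ε (fun a t => mfe (ε a) lam K (c a t) (bs a t) t) Lv ∧
      Rem T ε (fun a t => Lv a t - (-Complex.I * lam) • (mfe (ε a) lam K (c a t) (bs a t) t
        * star (mfe (ε a) lam K (c a t) (bs a t) t) * mfe (ε a) lam K (c a t) (bs a t) t)) ∧
      ∃ R, 0 ≤ R ∧ ∀ a, ∀ t ∈ Icc 0 T, ‖mfe (ε a) lam K (c a t) (bs a t) t‖ ≤ R := by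
  have hε0 : ∀ a, ε a ≠ 0 := fun a => (hε a).1.ne'
  -- Since b_ν is given by a formula and not by an evolution equation, g is simply the advected
  -- operator applied to it. It is bounded uniformly in ε and contributes only a nonresonant term of
  -- size ε.
  have hex : ∀ ν : E d × E d × E d, ∃ g : α → ℝ → W d, ν ∈ nonres K → DCi T g ∧
      ∀ a, ∀ t ∈ Icc 0 T, HasDerivWithinAt (fun t => cubd (c a t) ν)
        (g a t - sy (fun n => Complex.I * (adv (ε a) (kap ν) n : ℂ)) (cubd (c a t) ν))
        (Icc 0 T) t := by
    intro ν
    by_cases hν : ν ∈ nonres K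
    · have h1 := dci_cubd hc (mem_nonres.1 hν).1
      obtain ⟨g', hg', hd⟩ := h1.exists_deriv hT
      refine ⟨fun a t => g' a t + sy (fun n => Complex.I * (adv (ε a) (kap ν) n : ℂ)) (cubd (c a t) ν),
        fun _ => ⟨fun i => (hg' i).add ((h1 i).sy (gr_adv (kap ν) (R := 1) fun a => by
          rw [abs_of_pos (hε a).1]; exact (hε a).2)), fun a t ht => ?_⟩⟩
      rw [add_sub_cancel_right]; exact hd a t ht
    · exact ⟨0, fun h => absurd h hν⟩
  choose g hg using hex
  have e1 : HasL T ε (fun a t => lead (ε a) K (c a t) t) _ := HasL.sum K fun r hr =>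
    hasL_mode_of_advected hT hε0 (fun a => hK a r hr) (freq r) (hc r hr) (hcd r hr)
  have e2 : HasL T ε (fun a t => corr (ε a) K omStar (bs a t) t) _ := HasL.sum (nonres K) fun ν hν =>
    hasL_mode_of_advected hT hε0 (fun a => lat_kap (hK a) (mem_nonres.1 hν).1) (omStar ν) (hb ν hν)
      (hbd ν hν)
  have e3 : HasL T ε (fun a t => corr (ε a) K om (cubd (c a t)) t) _ :=
    HasL.sum (nonres K) fun ν hν =>
      hasL_mode_of_advected hT hε0 (fun a => lat_kap (hK a) (mem_nonres.1 hν).1) (om ν)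
        (dci_cubd hc (mem_nonres.1 hν).1) (hg ν hν).2
  have hL : HasL T ε (fun a t => mfe (ε a) lam K (c a t) (bs a t) t) fun a t =>
      mfeL (ε a) lam K (c a t) (bs a t) (fun ν => g ν a t) t := by
    refine (e1.add ((e2.add e3).smul fun a => (ε a * lam : ℂ))).congr fun a t ht => ?_
    unfold mfeL corr
    -- The leading modes and those of b_ν^⋆ satisfy the dispersion relation, so the term of size 1/ε
    -- survives only for b_ν.
    simp only [sub_self, mul_zero, zero_div, zero_smul, add_zero, omStar]
  obtain ⟨RA, hRA0, hRA⟩ := exists_norm_modes_le (ε := ε) K (fun r => r) freq hc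
  obtain ⟨R1, hR10, hR1⟩ := exists_norm_modes_le (ε := ε) (nonres K) kap omStar hb
  obtain ⟨R2, hR20, hR2⟩ := exists_norm_modes_le (ε := ε) (nonres K) kap om
    (f := fun ν a t => cubd (c a t) ν) fun ν hν => dci_cubd hc (mem_nonres.1 hν).1
  have hY : ∀ a, ∀ t ∈ Icc 0 T, ‖(ε a * lam : ℂ) • (corr (ε a) K omStar (bs a t) t
      + corr (ε a) K om (cubd (c a t)) t)‖ ≤ |lam| * (R1 + R2) * ε a := by
    intro a t ht
    rw [norm_smul, norm_mul, Complex.norm_real, Complex.norm_real, Real.norm_of_nonneg (hε a).1.le,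
      Real.norm_eq_abs]
    have h1 := (norm_add_le _ _).trans (add_le_add (hR1 a t ht) (hR2 a t ht))
    calc ε a * |lam| * _ ≤ ε a * |lam| * (R1 + R2) :=
          mul_le_mul_of_nonneg_left h1 (mul_nonneg (hε a).1.le (abs_nonneg _))
      _ = _ := by ring
  set S := |lam| * (R1 + R2)
  have hS0 : 0 ≤ S := by positivity
  refine ⟨_, hL, ?_, RA + S, by positivity, fun a t ht => ?_⟩
  -- The correction is O(ε), and every term of `cubRem` contains it at least twice.
  · have hc2 : Rem T ε fun a t => cubRem (lead (ε a) K (c a t) t)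
        ((ε a * lam : ℂ) • (corr (ε a) K omStar (bs a t) t + corr (ε a) K om (cubd (c a t)) t)) := by
      refine Rem.of_le (C := 3 * RA * S ^ 2 + S ^ 3) (by positivity) fun a t ht => ?_
      refine (norm_cubRem_le (hRA a t ht) (hY a t ht)).trans ?_
      have h1 : S ^ 3 * ε a ^ 3 ≤ S ^ 3 * ε a ^ 2 := by
        refine mul_le_mul_of_nonneg_left ?_ (by positivity)
        exact pow_le_pow_of_le_one (hε a).1.le (hε a).2 (by norm_num)
      calc _ = 3 * RA * S ^ 2 * ε a ^ 2 + S ^ 3 * ε a ^ 3 := by ring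
        _ ≤ 3 * RA * S ^ 2 * ε a ^ 2 + S ^ 3 * ε a ^ 2 := by gcongr
        _ = _ := by ring
    refine ((rem_offRes (lam := lam) hT hε hK hS hc hb fun ν hν => (hg ν hν).1).add
      (hc2.const_smul (Complex.I * lam))).congr fun a t ht => ?_
    exact residual_eq (hε0 a) (hK a) hS
  · refine (norm_add_le _ _).trans (add_le_add (hRA a t ht) ((hY a t ht).trans ?_))
    exact mul_le_of_le_one_right hS0 (hε a).2

/-- The nonlinearity of the nonlinear Schrödinger equation. -/
def nlsPol (lam : ℝ) (_ : Unit) : Pol Unit := (-Complex.I * lam) • (pv () * pvc () * pv ())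

lemma pev_nlsPol {A : Type*} [CommRing A] [Algebra ℂ A] [Star A] (h : A) (x : Unit → A) (i : Unit) :
    pev (nlsPol lam i) h x = (-Complex.I * lam) • (x () * star (x ()) * x ()) := by
  simp [nlsPol]

/-- Stability of the nonlinear Schrödinger equation with respect to removable residuals. -/
lemma exists_nls_near (hT : 0 < T) (hε : ∀ a, 0 < ε a ∧ ε a ≤ 1) {v Lv : α → ℝ → W d}
    (hv : HasL T ε v Lv)
    (hr : Rem T ε fun a t => Lv a t - (-Complex.I * lam) • (v a t * star (v a t) * v a t))
    {R : ℝ} (hR0 : 0 ≤ R) (hR : ∀ a, ∀ t ∈ Icc 0 T, ‖v a t‖ ≤ R) :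
    ∃ ε₀ > 0, ∃ C, 0 ≤ C ∧ ∀ a, ε a < ε₀ → ∃ ψ, Sol T (fun _ : Unit => advs (ε a) (0 : E d) 0)
      (nlsPol lam) (fun _ => 0) ψ ∧ ψ 0 () = v a 0 ∧ (∃ S, ∀ t ∈ Icc 0 T, ‖ψ t‖ ≤ S) ∧
      ∀ t ∈ Icc 0 T, ‖orig (fun _ : Unit => advs (ε a) (0 : E d) 0) ψ () t - v a t‖ ≤ C * ε a ^ 2 := by
  obtain ⟨z, Lz, C, hC0, hz, hzC⟩ := hr
  have hvz := hv.add hz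
  obtain ⟨v', h1, h2, h3, h4⟩ := hvz
  obtain ⟨Λ, hΛ0, hΛ⟩ := exists_lipschitz_nl (d := d) (nlsPol lam) (R + C + 1)
  have hzle : ∀ a, ∀ t ∈ Icc 0 T, ‖z a t‖ ≤ C := fun a t ht => ((hzC a t ht).1).trans
    (mul_le_of_le_one_right hC0 (pow_le_one₀ (hε a).1.le (hε a).2))
  -- The three contributions before the Gronwall factor: C for the mismatch of initial values, C for
  -- the corrected residual, ΛC for the effect of z in the nonlinearity.
  set D := (C + (C + Λ * C) * T) * Real.exp (2 * Λ * T)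
  have hD0 : 0 ≤ D := by positivity
  refine ⟨1 / (D + 1), by positivity, D + C, by positivity, fun a ha => ?_⟩
  have ha2 : D * ε a ^ 2 ≤ 1 := by
    have h5 := ha.le
    rw [le_div_iff₀ (by positivity)] at h5
    have h6 : ε a ^ 2 ≤ ε a := by nlinarith [hε a]
    nlinarith [(hε a).1, mul_le_mul_of_nonneg_left h6 hD0]
  have hpos := (hε a).1
  have hDe : (C * ε a ^ 2 + (C + Λ * C) * ε a ^ 2 * T) * Real.exp (2 * Λ * T) = D * ε a ^ 2 := by
    simp only [D]; ring
  have hsy : ∀ t ∈ Icc 0 T, sy (fun n => Complex.I * (advs (ε a) (0 : E d) 0 n : ℂ)) (v a t + z a t)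
      = sy (fun n => Complex.I * (adv (ε a) (0 : E d) n : ℂ)) (v a t + z a t) := fun t ht => by
    rw [sy_advs ((h1 a).rap ⟨t, ht⟩), Complex.ofReal_zero, mul_zero, zero_smul, add_zero]
  -- The approximate solution is v + z, whose residual is O(ε²), whereas the exact solution starts
  -- from v(0). The correction z is an auxiliary term, removed at the end by the triangle
  -- inequality.
  obtain ⟨ψ, p1, p2, p3⟩ := exists_sol_near (ι := Unit) (T := T) (R := R + C) (ρ := 1) (Λ := Λ)
    (δ := (C + Λ * C) * ε a ^ 2) (δ₀ := C * ε a ^ 2) (θ := fun _ => advs (ε a) (0 : E d) 0)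
    (P := nlsPol lam) (h := fun _ => 0) (v := fun t _ => v a t + z a t) (v' := fun t _ => v' a t)
    (x0 := fun _ => v a 0) hT.le one_pos hΛ0 (by positivity) (by positivity)
    (fun _ => gr_advs (α := Unit) (0 : E d) (fun _ => 0) (fun _ => le_rfl) fun _ => le_rfl)
    (fun _ => h1 a) (fun _ => h2 a) (fun _ => h3 a) continuousOn_const
    (fun _ t ht => (norm_add_le _ _).trans (add_le_add (hR a t ht) (hzle a t ht))) (by positivity)
    (fun i t ht => by
      rw [hsy t ht, ← h4 a t ht, pev_nlsPol]
      have k1 := (hΛ 0 0 (fun _ => v a t + z a t) (fun _ => v a t) (by rw [norm_zero]; positivity)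
        (by rw [norm_zero]; positivity)
        ((pi_norm_le_iff_of_nonneg (by positivity)).2 fun _ => (norm_add_le _ _).trans
          (by linarith [hR a t ht, hzle a t ht]))
        ((pi_norm_le_iff_of_nonneg (by positivity)).2 fun _ => by linarith [hR a t ht])).2
      have k2 : ‖(fun _ : Unit => v a t + z a t) - fun _ : Unit => v a t‖ ≤ C * ε a ^ 2 :=
        (pi_norm_le_iff_of_nonneg (by positivity)).2 fun _ => by
          simpa using (hzC a t ht).1
      rw [sub_self, norm_zero, zero_add] at k1
      have k3 := (norm_le_pi_norm _ ()).trans (k1.trans (mul_le_mul_of_nonneg_left k2 hΛ0))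
      rw [Pi.sub_apply, nl, nl, pev_nlsPol, pev_nlsPol] at k3
      have k4 := (hzC a t ht).2
      have k5 : ∀ A B X Y : W d, A + B - X = (B + (A - Y)) - (X - Y) := fun A B X Y => by abel
      rw [k5 _ _ _ ((-Complex.I * lam) • (v a t * star (v a t) * v a t))]
      refine (norm_sub_le _ _).trans ((add_le_add k4 k3).trans (le_of_eq ?_))
      ring)
    (fun _ => by
      rw [sub_add_cancel_left, norm_neg]
      exact (hzC a 0 (left_mem_Icc.2 hT.le)).1)
    (fun t _ x y hx hy => by
      have := (hΛ 0 0 x y (by rw [norm_zero]; positivity) (by rw [norm_zero]; positivity) hx hy).2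
      simpa using this)
    (by rw [hDe]; exact ha2)
  obtain ⟨S, hS⟩ := isCompact_Icc.exists_bound_of_continuousOn p2.continuousOn
  refine ⟨ψ, p2, by rw [p1], ⟨S, hS⟩, fun t ht => ?_⟩
  have q1 := (norm_le_pi_norm _ ()).trans ((p3 t ht).trans hDe.le)
  have q2 := (hzC a t ht).1
  have q3 : orig (fun _ : Unit => advs (ε a) (0 : E d) 0) ψ () t - v a t
    = (orig (fun _ : Unit => advs (ε a) (0 : E d) 0) ψ () t - (v a t + z a t)) + z a t := by abel
  rw [q3, add_mul]
  exact (norm_add_le _ _).trans (add_le_add q1 q2)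

end family

/-! ### Scalar equations -/

section scalar

variable {T ε lam : ℝ} {k : E d}

/-- Uniqueness for scalar semilinear equations. -/
lemma isUniqueOn_of_pev (hT : 0 < T) {P : Unit → Pol Unit} {H : ℝ → W d}
    (hH : DCi T fun _ : Unit => H) {h : ℝ → E d → ℂ}
    (hh : ∀ t ∈ Icc 0 T, ∀ x, h t x = W.val x (H t)) {Q : (ℝ → E d → ℂ) → Prop} {f0 : E d → ℂ}
    (hQ : ∀ f, Q f → IsClassical T f ∧
      (∀ t ∈ Icc 0 T, ∀ x, advected T ε k f t x = pev (P ()) (h t x) fun _ => f t x) ∧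
      ∀ x, f 0 x = f0 x)
    {f : ℝ → E d → ℂ} (hf : Q f) : IsUniqueOn T Q f := by
  refine ⟨hf, fun g hg t ht x => ?_⟩
  obtain ⟨C, _, hC⟩ := (hH 0).norm_le
  exact unique_of_pev (w := fun _ => g) (w' := fun _ => f) hT (fun _ : Unit => k) P
    (fun t ht => by
      have : h t = fun x => W.val x (H t) := funext fun x => hh t ht x
      rw [this]
      exact ((hH 0).rap () ht).continuous_val)
    (fun t ht x => by rw [hh t ht]; exact (W.norm_val_le x _).trans (hC () t ht))
    (fun _ => (hQ g hg).1) (fun _ => (hQ f hf).1) (fun _ => (hQ g hg).2.1) (fun _ => (hQ f hf).2.1)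
    (fun _ x => by rw [(hQ g hg).2.2, (hQ f hf).2.2]) () t ht x

lemma classical_of_dci (hT : 0 < T) {f F : ℝ → W d} (hf : DCi T fun _ : Unit => f)
    (hd : ∀ t ∈ Icc 0 T, HasDerivWithinAt f
      (F t - sy (fun n => Complex.I * (adv ε k n : ℂ)) (f t)) (Icc 0 T) t) :
    IsClassical T (fun t x => W.val x (f t)) ∧
    ∀ t ∈ Icc 0 T, ∀ x, advected T ε k (fun t x => W.val x (f t)) t x = W.val x (F t) :=
  ⟨hf.isClassical hT, fun t ht x => by
    rw [advected_val hT ht ((hf 0).rap () ht) (hd t ht), sub_add_cancel]⟩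

/-- Division by iε, which is nonzero, brings the equation to the form of an advected equation with
zero velocity and polynomial right-hand side. -/
lemma solvesNLS_iff {M : ℕ} (hε : ε ≠ 0) {κ : Fin M → E d} {a0 : Fin M → E d → ℂ}
    (u : ℝ → E d → ℂ) : SolvesNLS T ε lam κ a0 u ↔ IsClassical T u ∧
      (∀ t ∈ Icc 0 T, ∀ x, advected T ε (0 : E d) u t x
        = pev (nlsPol lam ()) (0 : ℂ) fun _ => u t x) ∧
      ∀ x, u 0 x = ∑ m, a0 m x * osc ε (κ m) 0 0 x := by
  have hε' : (ε : ℂ) ≠ 0 := by exact_mod_cast hε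
  have key : ∀ t x, (Complex.I * ε * dt T u t x + (ε : ℂ) ^ 2 / 2 * lap u t x
      = ε * lam * (‖u t x‖ : ℂ) ^ 2 * u t x) ↔
      advected T ε (0 : E d) u t x = pev (nlsPol lam ()) (0 : ℂ) fun _ => u t x := by
    intro t x
    rw [pev_nlsPol, advected, map_zero, add_zero, smul_eq_mul, Complex.star_def, Complex.mul_conj']
    have h1 : Complex.I * ε * dt T u t x + (ε : ℂ) ^ 2 / 2 * lap u t x
        = (Complex.I * ε) * (dt T u t x - Complex.I * ε / 2 * lap u t x) := by
      linear_combination ((ε : ℂ) ^ 2 / 2 * lap u t x) * Complex.I_sq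
    have h2 : ε * lam * (‖u t x‖ : ℂ) ^ 2 * u t x
        = (Complex.I * ε) * (-Complex.I * lam * ((‖u t x‖ : ℂ) ^ 2 * u t x)) := by
      linear_combination (ε * lam * (‖u t x‖ : ℂ) ^ 2 * u t x) * Complex.I_sq
    rw [h1, h2]
    exact mul_right_inj' (mul_ne_zero Complex.I_ne_zero hε')
  simp only [SolvesNLS, key]

lemma solvesBStar_iff {K : Finset (E d)} {a : E d → ℝ → E d → ℂ} {ν : E d × E d × E d}
    (f : ℝ → E d → ℂ) : SolvesBStar T ε lam K a ν f ↔ IsClassical T f ∧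
      (∀ t ∈ Icc 0 T, ∀ x, advected T ε (kap ν) f t x = pev (ph * pv ())
        (-2 * Complex.I * lam * ∑ r ∈ K, a r t x * star (a r t x)) fun _ => f t x) ∧
      ∀ x, f 0 x = -bMod a ν 0 x := by
  have key : ∀ t x, - Complex.I * lam * (2 * ∑ r ∈ K, (‖a r t x‖ : ℂ) ^ 2) * f t x
      = pev (ph * pv ()) (-2 * Complex.I * lam * ∑ r ∈ K, a r t x * star (a r t x))
        fun _ : Unit => f t x := by
    intro t x
    simp only [pev_mul, pev_ph, pev_pv, Complex.star_def, Complex.mul_conj']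
    ring
  simp only [SolvesBStar, key]

lemma solvesB_iff {a : E d → ℝ → E d → ℂ} {ν : E d × E d × E d}
    (f : ℝ → E d → ℂ) : SolvesB T ε a ν f ↔ IsClassical T f ∧
      (∀ t ∈ Icc 0 T, ∀ x, advected T ε (kap ν) f t x
        = pev (ph + (Complex.I * delta ν / ε : ℂ) • pv ()) (-(Complex.I / ε) * cubic a ν t x)
          fun _ => f t x) ∧
      ∀ x, f 0 x = 1 / (delta ν : ℂ) * cubic a ν 0 x := by
  simp only [SolvesB, pev_add, pev_ph, pev_smul, pev_pv, smul_eq_mul, sub_eq_iff_eq_add]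

end scalar

/-! ### Uniform solutions of linear advected equations. -/

section family

variable {α : Type*} {T : ℝ} {ε : α → ℝ}

/-- Uniformly smooth solutions of linear advected Schrödinger equations. -/
lemma exists_linear_sol (hT : 0 < T) (hε : ∀ a, 0 < ε a ∧ ε a ≤ 1) (k : E d) {h : α → ℝ → W d}
    (hh : DCi T h) {x0 : α → W d} (hx : URap x0) :
    ∃ f : α → ℝ → W d, DCi T f ∧ (∀ a, f a 0 = x0 a) ∧ ∀ a, ∀ t ∈ Icc 0 T,
      HasDerivWithinAt (f a) (h a t * f a t
        - sy (fun n => Complex.I * (adv (ε a) k n : ℂ)) (f a t)) (Icc 0 T) t := by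
  obtain ⟨H, hH0, hH⟩ := (hh 0).norm_le
  obtain ⟨X, hX0, hX⟩ := hx.norm_le
  have hex : ∀ a, ∃ ψ : ℝ → Unit → W d, ψ 0 = (fun _ => x0 a) ∧
      Sol T (fun _ : Unit => advs (ε a) k 0) (fun _ => ph * pv ()) (h a) ψ ∧
      ∀ t ∈ Icc 0 T, ‖ψ t‖ ≤ X * Real.exp (2 * H * T) := by
    intro a
    -- The zero function is an exact solution with initial error at most X. Because the equation is
    -- linear, the Lipschitz constant H is global and ρ may be taken as large as Gronwall requires.
    obtain ⟨ψ, p1, p2, p3⟩ := exists_sol_near (ι := Unit) (T := T) (R := 0)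
      (ρ := X * Real.exp (2 * H * T) + 1) (Λ := H) (δ := 0) (δ₀ := X) (θ := fun _ => advs (ε a) k 0)
      (P := fun _ => ph * pv ()) (h := h a) (v := fun _ _ => 0) (v' := fun _ _ => 0)
      (x0 := fun _ => x0 a) hT.le (by positivity) hH0 le_rfl hX0
      (fun _ => gr_advs (α := Unit) k (fun _ => 0) (fun _ => le_rfl) fun _ => le_rfl)
      (fun _ => URap.zero) (fun _ => URap.zero) (fun _ t _ => hasDerivWithinAt_const _ _ _)
      ((hh 0).continuousOn a) (fun _ t _ => by simp) le_rfl
      (fun _ t ht => by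
        have e1 : Gr1 fun n => Complex.I * (advs (ε a) k 0 n : ℂ) :=
          gr_advs (α := Unit) k (fun _ => 0) (fun _ => le_rfl) fun _ => le_rfl
        have : sy (fun n => Complex.I * (advs (ε a) k 0 n : ℂ)) (0 : W d) = 0 := by
          ext n
          rw [Rap.sy_apply URap.zero e1]; simp
        rw [this]; simp)
      (fun _ => by rw [sub_zero]; exact hX a)
      (fun t ht x y _ _ => by
        refine (pi_norm_le_iff_of_nonneg (by positivity)).2 fun i => ?_
        simp only [Pi.sub_apply, nl, pev_mul, pev_ph, pev_pv]
        rw [← mul_sub]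
        exact (norm_mul_le _ _).trans (mul_le_mul (hH a t ht) (norm_le_pi_norm (x - y) ())
          (norm_nonneg _) hH0))
      (by simp)
    refine ⟨ψ, p1, p2, fun t ht => ?_⟩
    have := p3 t ht
    rw [show (fun _ : Unit => (0 : W d)) = 0 from rfl, sub_zero, norm_rotv] at this
    simpa using this
  choose ψ hψ0 hψS hψR using hex
  have hθ : ∀ i : Unit, Gr fun a n => (Complex.I * (advs (ε a) k 0 n : ℂ)) := fun _ =>
    gr_advs k (fun _ => 0) (R := 1) (fun a => by
      rw [abs_of_pos (hε a).1]; exact (hε a).2) fun _ => le_rfl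
  have h0 : ∀ i : Unit, URap fun a => ψ a 0 i := fun i => by
    have : (fun a => ψ a 0 i) = x0 := funext fun a => by rw [hψ0]
    rw [this]; exact hx
  refine ⟨fun a t => orig (fun _ => advs (ε a) k 0) (ψ a) () t, dci_orig hψS hψR hh h0 hθ (),
    fun a => (orig_zero _ _ _).trans (by rw [hψ0]), fun a t ht => ?_⟩
  refine (hasDerivWithinAt_orig hψS hψR hh h0 hθ a () ht).congr_deriv ?_
  rw [sy_advs ((dci_orig hψS hψR hh h0 hθ () 0).rap a ht)]
  simp

/-- Solutions of linear equations with a fast rotation stay close to the quasi-stationary state. -/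
lemma exists_quasistationary (hT : 0 < T) (hε : ∀ a, 0 < ε a ∧ ε a ≤ 1) (k : E d) {δ : ℝ}
    (hδ : δ ≠ 0) {f : α → ℝ → W d} (hf : DCi T f) :
    ∃ C, 0 ≤ C ∧ ∀ a, ∃ β : ℝ → W d, DCi T (fun _ : Unit => β) ∧ β 0 = (1 / (δ : ℂ)) • f a 0 ∧
      (∀ t ∈ Icc 0 T, HasDerivWithinAt β (((-(Complex.I / ε a)) • f a t
        + (Complex.I * δ / ε a) • β t)
        - sy (fun n => Complex.I * (adv (ε a) k n : ℂ)) (β t)) (Icc 0 T) t) ∧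
      ∀ t ∈ Icc 0 T, ‖(1 / (δ : ℂ)) • f a t - β t‖ ≤ C * ε a := by
  have hδ' : (δ : ℂ) ≠ 0 := by exact_mod_cast hδ
  have hgr : Gr fun a n => (Complex.I * (adv (ε a) k n : ℂ)) := gr_adv k (R := 1) fun a => by
    rw [abs_of_pos (hε a).1]; exact (hε a).2
  set b : α → ℝ → W d := fun a t => (1 / (δ : ℂ)) • f a t
  have hb : DCi T b := fun i => (hf i).const_smul _
  obtain ⟨b', hb', hbd⟩ := hb.exists_deriv hT
  set G : α → ℝ → W d := fun a t => b' a t + sy (fun n => Complex.I * (adv (ε a) k n : ℂ)) (b a t)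
  have hG : DCi T G := fun i => (hb' i).add ((hb i).sy hgr)
  obtain ⟨G', hG', hGd⟩ := hG.exists_deriv hT
  obtain ⟨C1, hC10, hC1⟩ := (hG 0).norm_le
  obtain ⟨C2, hC20, hC2⟩ := ((hG' 0).add ((hG 0).sy hgr)).norm_le
  obtain ⟨C3, hC30, hC3⟩ := (hb 0).norm_le
  have ub : ∀ {e : α → ℝ → W d}, DCi T e → ∀ a, URap fun t : Icc 0 T => e a t := fun he a =>
    (he 0).urap.comp fun t => (a, t)
  refine ⟨‖(Complex.I / δ : ℂ)‖ * C1 + ‖(Complex.I / δ : ℂ)‖ * C2 * T + ‖(Complex.I / δ : ℂ)‖ * C1,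
    by positivity, fun a => ?_⟩
  have hpos := (hε a).1
  have he : (ε a : ℂ) ≠ 0 := by exact_mod_cast hpos.ne'
  -- The second term of the expansion of β: with this y the rotation applied to yG is -G, which
  -- cancels the defect of b itself and leaves a residual of size ε.
  set y : ℂ := -(Complex.I / δ) * ε a
  have hy : ‖y‖ = ‖(Complex.I / δ : ℂ)‖ * ε a := by
    rw [norm_mul, norm_neg, Complex.norm_real, Real.norm_of_nonneg hpos.le]
  -- The fast rotation δ/ε is absorbed into the isometric free evolution. The remaining nonlinearity
  -- is the source alone, with Lipschitz constant 0, so no exponential of 1/ε arises.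
  set θ : Unit → (Fin d → ℤ) → ℝ := fun _ => advs (ε a) k (-δ / ε a)
  have hθ : ∀ i : Unit, Gr1 fun n => (Complex.I * (θ i n : ℂ)) := fun _ =>
    gr_advs (α := Unit) k (fun _ => -δ / ε a) (fun _ => le_rfl) fun _ => le_rfl
  have hh : DCi T fun _ : Unit => fun t => (-(Complex.I / ε a)) • f a t := fun i =>
    ((hf i).comp fun _ => a).const_smul _
  have hyG : ∀ t ∈ Icc 0 T, ‖y • G a t‖ ≤ ‖(Complex.I / δ : ℂ)‖ * C1 * ε a := fun t ht => by
    rw [norm_smul, hy]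
    calc _ ≤ ‖(Complex.I / δ : ℂ)‖ * ε a * C1 := by gcongr; exact hC1 a t ht
      _ = _ := by ring
  obtain ⟨ψ, p1, p2, p3⟩ := exists_sol_near (ι := Unit) (T := T)
    (R := C3 + ‖(Complex.I / δ : ℂ)‖ * C1 * ε a)
    (ρ := (‖(Complex.I / δ : ℂ)‖ * C1 * ε a + ‖(Complex.I / δ : ℂ)‖ * C2 * ε a * T) + 1) (Λ := 0)
    (δ := ‖(Complex.I / δ : ℂ)‖ * C2 * ε a)
    (δ₀ := ‖(Complex.I / δ : ℂ)‖ * C1 * ε a) (θ := θ)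
    (P := fun _ => ph) (h := fun t => (-(Complex.I / ε a)) • f a t)
    (v := fun t _ => b a t + y • G a t) (v' := fun t _ => b' a t + y • G' a t)
    (x0 := fun _ => b a 0) hT.le (by positivity) le_rfl (by positivity) (by positivity)
    hθ (fun _ => (ub hb a).add ((ub hG a).const_smul y))
    (fun _ => (ub hb' a).add ((ub hG' a).const_smul y))
    (fun _ t ht => (hbd a t ht).add ((hGd a t ht).const_smul y))
    ((hh 0).continuousOn ())
    (fun _ t ht => (norm_add_le _ _).trans (add_le_add (hC3 a t ht) (hyG t ht))) (by positivity)
    (fun _ t ht => by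
      have r1 := (hb 0).rap a ht
      have r2 := (hG 0).rap a ht
      have e1 : b' a t + y • G' a t + sy (fun n => Complex.I * (θ () n : ℂ)) (b a t + y • G a t)
          - pev (ph : Pol Unit) ((-(Complex.I / ε a)) • f a t) (fun _ => b a t + y • G a t)
          = y • (G' a t + sy (fun n => Complex.I * (adv (ε a) k n : ℂ)) (G a t)) := by
        rw [sy_advs (r1.add (r2.const_smul y)), sy_add r1 (r2.const_smul y) (gr1_adv _ _),
          sy_smul r2 (gr1_adv _ _), pev_ph]
        have e2 : sy (fun n => Complex.I * (adv (ε a) k n : ℂ)) (b a t) = G a t - b' a t := by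
          simp only [G]; abel
        have e3 : f a t = (δ : ℂ) • b a t := by
          simp only [b]
          rw [smul_smul, mul_one_div_cancel hδ', one_smul]
        have e4 : Complex.I * ((-δ / ε a : ℝ) : ℂ) * y = -1 := by
          simp only [y]; push_cast; field_simp
          exact Complex.I_sq
        rw [e2, e3, smul_add (Complex.I * _), smul_smul, smul_smul, e4]
        push_cast
        match_scalars <;> field_simp <;> ring
      rw [e1, norm_smul, hy]
      calc _ ≤ ‖(Complex.I / δ : ℂ)‖ * ε a * C2 := by gcongr; exact hC2 a t ht
        _ = _ := by ring)
    (fun _ => by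
      rw [sub_add_cancel_left, norm_neg]
      exact hyG 0 (left_mem_Icc.2 hT.le))
    (fun t _ x y _ _ => by
      refine (pi_norm_le_iff_of_nonneg (by positivity)).2 fun i => ?_
      simp [nl])
    (by simp)
  obtain ⟨S, hS⟩ := isCompact_Icc.exists_bound_of_continuousOn p2.continuousOn
  have h0 : ∀ i : Unit, URap fun _ : Unit => ψ 0 i := fun i => by
    rw [p1]
    exact (hb 0).urap.comp fun _ => (a, ⟨0, left_mem_Icc.2 hT.le⟩)
  have hD := dci_orig (fun _ : Unit => p2) (fun _ => hS) hh h0 hθ ()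
  refine ⟨fun t => orig θ ψ () t, hD, (orig_zero _ _ _).trans (by rw [p1]), fun t ht => ?_, fun t ht => ?_⟩
  · refine (hasDerivWithinAt_orig (fun _ : Unit => p2) (fun _ => hS) hh h0 hθ () () ht).congr_deriv ?_
    rw [sy_advs ((hD 0).rap () ht), pev_ph]
    push_cast
    module
  · have q1 := (norm_le_pi_norm _ ()).trans (p3 t ht)
    rw [mul_zero, zero_mul, Real.exp_zero, mul_one] at q1
    have q2 := hyG t ht
    have q3 : b a t - orig θ ψ () t
        = -(orig θ ψ () t - (b a t + y • G a t)) - y • G a t := by abel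
    change ‖b a t - _‖ ≤ _
    rw [q3]
    refine (norm_sub_le _ _).trans ?_
    rw [norm_neg]
    refine (add_le_add q1 q2).trans (le_of_eq ?_)
    ring

end family

/-! ### The modulated Fourier expansion in physical space -/

lemma SmoothBound.mono {T : ℝ} {B B' : ℕ → ℝ} {f : ℝ → E d → ℂ} (h : SmoothBound T B f)
    (hB : ∀ n, B n ≤ B' n) : SmoothBound T B' f :=
  ⟨h.1, fun n z hz => (h.2 n z hz).trans (hB n)⟩

lemma bMod_eq_val (c : ℝ → E d → W d) (ν : E d × E d × E d) (t : ℝ) (x : E d) :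
    bMod (fun e t x => W.val x (c t e)) ν t x = W.val x (cubd (c t) ν) := by
  rw [val_cubd]; rfl

lemma cubic_eq_val (c : ℝ → E d → W d) (ν : E d × E d × E d) (t : ℝ) (x : E d) :
    cubic (fun e t x => W.val x (c t e)) ν t x = W.val x (cub (c t) ν) := by
  rw [val_cub]; rfl

lemma val_mfe {ε lam : ℝ} {K : Finset (E d)} (hK : ∀ k ∈ K, Lat ε k) (c : ℝ → E d → W d)
    (bs : ℝ → E d × E d × E d → W d) (t : ℝ) (x : E d) :
    W.val x (mfe ε lam K (c t) (bs t) t) = uMFE ε lam K (fun e t x => W.val x (c t e))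
      (fun ν t x => W.val x (bs t ν)) t x := by
  have h1 : W.val x (lead ε K (c t) t) = ∑ r ∈ K, W.val x (c t r) * osc ε r (freq r) t x := by
    rw [lead, W.val_sum]
    exact Finset.sum_congr rfl fun r hr => by rw [W.val_mul, val_em (hK r hr)]
  have h2 : ∀ (w : E d × E d × E d → ℝ) (b : E d × E d × E d → W d), W.val x (corr ε K w b t)
      = ∑ ν ∈ nonres K, W.val x (b ν) * osc ε (kap ν) (w ν) t x := fun w b => by
    rw [corr, W.val_sum]
    exact Finset.sum_congr rfl fun ν hν => by
      rw [W.val_mul, val_em (lat_kap hK (mem_nonres.1 hν).1)]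
  rw [mfe, W.val_add, W.val_smul, W.val_add, h1, h2, h2, uMFE]
  simp only [bMod_eq_val]
  ring

lemma em_zero_time (ε : ℝ) (k : E d) (w w' : ℝ) : em ε k w 0 = em ε k w' 0 := by
  simp [em]

lemma osc_zero_time (ε : ℝ) (k : E d) (w w' : ℝ) (x : E d) : osc ε k w 0 x = osc ε k w' 0 x := by
  simp [osc]

/-- The modulated Fourier expansion has the initial value of the solution. -/
lemma val_mfe_zero {M : ℕ} {κ : Fin M → E d} {a : Fin M → E d → ℂ} {ε lam : ℝ} {K : Finset (E d)}
    (hκ : ∀ m, κ m ∈ K) (hK : ∀ k ∈ K, Lat ε k) {c : E d → W d} {bs : E d × E d × E d → W d}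
    (hb : ∀ ν ∈ nonres K, bs ν = -cubd c ν) (hc : ∀ r ∈ K, ∀ x, W.val x (c r) = initMod κ a r x)
    (x : E d) : W.val x (mfe ε lam K c bs 0) = ∑ m, a m x * osc ε (κ m) 0 0 x := by
  -- At time 0 the exponentials with frequencies ω_ν and ω_ν^⋆ coincide and b_ν^⋆ = -b_ν, so the
  -- corrections cancel exactly.
  have h1 : corr ε K omStar bs 0 + corr ε K om (cubd c) 0 = 0 := by
    rw [corr, corr, ← Finset.sum_add_distrib]
    refine Finset.sum_eq_zero fun ν hν => ?_
    rw [hb ν hν, em_zero_time ε (kap ν) (omStar ν) (om ν)]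
    ring
  rw [mfe, h1, smul_zero, add_zero, lead, W.val_sum]
  have h2 : ∀ r ∈ K, W.val x (c r * em ε r (freq r) 0)
      = ∑ m, if κ m = r then a m x * osc ε (κ m) 0 0 x else 0 := fun r hr => by
    rw [W.val_mul, val_em (hK r hr), hc r hr, initMod, Finset.sum_mul]
    refine Finset.sum_congr rfl fun m _ => ?_
    split_ifs with h
    · rw [h, osc_zero_time ε r (freq r) 0]
    · rw [zero_mul]
  rw [Finset.sum_congr rfl h2, Finset.sum_comm]
  refine Finset.sum_congr rfl fun m _ => ?_
  rw [Finset.sum_ite_eq, if_pos (hκ m)]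

/-- The modulated Fourier expansion for uniformly bounded modulation functions. -/
theorem exists_expansion {α : Type*} {M : ℕ} {κ : Fin M → E d} {a0 : α → Fin M → E d → ℂ}
    {T lam R : ℝ} {ε : α → ℝ} {K : Finset (E d)}
    (hT : 0 < T) (hε : ∀ a, 0 < ε a ∧ ε a ≤ 1) (hK : ∀ a, ∀ k ∈ K, Lat (ε a) k) (hS : Sat K)
    (hκ : ∀ m, κ m ∈ K) {ψ : α → ℝ → K → W d}
    (hψ : ∀ a, Sol T (aSym K (ε a)) (aPol lam K) (fun _ => algebraMap ℂ (W d) (ε a)) (ψ a))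
    (hR : ∀ a, ∀ t ∈ Icc 0 T, ‖ψ a t‖ ≤ R) (h0 : ∀ i, URap fun a => ψ a 0 i)
    (hi : ∀ a i x, W.val x (ψ a 0 i) = initMod κ (a0 a) i x) :
    ∃ ε₀ > 0, ∃ (B : ℕ → ℝ) (C : ℝ), ∀ a, ε a < ε₀ →
      ∃ (u : ℝ → E d → ℂ) (bs : E d × E d × E d → ℝ → E d → ℂ),
        IsUniqueOn T (SolvesNLS T (ε a) lam κ (a0 a)) u ∧
        (∀ ν ∈ nonres K, IsUniqueOn T (SolvesBStar T (ε a) lam K (aFun K (ε a) (ψ a)) ν) (bs ν)) ∧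
        (∀ r ∈ K, SmoothBound T B (aFun K (ε a) (ψ a) r)) ∧
        (∀ ν ∈ nonres K, SmoothBound T B (bMod (aFun K (ε a) (ψ a)) ν)) ∧
        (∀ ν ∈ nonres K, SmoothBound T B (bs ν)) ∧
        (∀ ν ∈ nonres K, ∃ β : ℝ → E d → ℂ,
          IsUniqueOn T (SolvesB T (ε a) (aFun K (ε a) (ψ a)) ν) β ∧
          ∀ t ∈ Icc 0 T, ∀ x, ‖bMod (aFun K (ε a) (ψ a)) ν t x - β t x‖ ≤ C * ε a) ∧
        ∀ t ∈ Icc 0 T, ∀ x, ‖u t x - uMFE (ε a) lam K (aFun K (ε a) (ψ a)) bs t x‖ ≤ C * ε a ^ 2 := by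
  have hεabs : ∀ a, |ε a| ≤ 1 := fun a => by rw [abs_of_pos (hε a).1]; exact (hε a).2
  have hl : 0 ∈ Icc 0 T := left_mem_Icc.2 hT.le
  set c : α → ℝ → E d → W d := fun a t => extz K fun i => orig (aSym K (ε a)) (ψ a) i t
  have haF : ∀ a, aFun K (ε a) (ψ a) = fun e t x => W.val x (c a t e) := fun a => rfl
  have hcK : ∀ r (hr : r ∈ K) a t, c a t r = orig (aSym K (ε a)) (ψ a) ⟨r, hr⟩ t :=
    fun r hr a t => extz_of_mem _ hr
  have hh : DCi T fun a (_ : ℝ) => algebraMap ℂ (W d) (ε a) := fun k => DC.const (by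
    have h1 : URap fun a => (ε a : ℂ) • algebraMap ℂ (W d) 1 :=
      URap.smul (URap.algebraMap 1) (B := 1) fun a => by rw [Complex.norm_real]; exact hεabs a
    simpa only [Algebra.algebraMap_eq_smul_one, one_smul] using h1)
  have hθ : ∀ i : K, Gr fun a n => (Complex.I * (aSym K (ε a) i n : ℂ)) := fun i =>
    gr_advs (i : E d) (fun _ => 0) hεabs fun _ => le_rfl
  have hc : ∀ e ∈ K, DCi T fun a t => c a t e := fun e he i =>
    (dci_orig hψ hR hh h0 hθ ⟨e, he⟩ i).congr fun a t _ => hcK e he a t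
  have hcd : ∀ r ∈ K, ∀ a, ∀ t ∈ Icc 0 T, HasDerivWithinAt (fun t => c a t r)
      (rhsA lam K (algebraMap ℂ (W d) (ε a)) (c a t) r
        - sy (fun n => Complex.I * (adv (ε a) r n : ℂ)) (c a t r)) (Icc 0 T) t := by
    intro r hr a t ht
    have h1 := hasDerivWithinAt_orig hψ hR hh h0 hθ a ⟨r, hr⟩ ht
    have h2 : (fun t => c a t r) = orig (aSym K (ε a)) (ψ a) ⟨r, hr⟩ := funext (hcK r hr a)
    rw [h2]
    refine h1.congr_deriv ?_
    have h3 : (fun n => Complex.I * (aSym K (ε a) ⟨r, hr⟩ n : ℂ))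
        = fun n => Complex.I * (advs (ε a) r 0 n : ℂ) := rfl
    rw [pev_aPol, h3, sy_advs ((dci_orig hψ hR hh h0 hθ ⟨r, hr⟩ 0).rap a ht), Complex.ofReal_zero,
      mul_zero, zero_smul, add_zero, hcK r hr]
  have hc0 : ∀ a, ∀ r ∈ K, ∀ x, W.val x (c a 0 r) = initMod κ (a0 a) r x := fun a r hr x => by
    rw [hcK r hr, orig_zero]; exact hi a _ x
  set H : α → ℝ → W d := fun a t => (-2 * Complex.I * lam : ℂ) • ∑ p ∈ K, c a t p * star (c a t p)
  have hH : DCi T H := fun i =>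
    (DC.sum K fun p hp => (hc p hp i).mul (hc p hp i).star).const_smul _
  have hbex : ∀ ν, ∃ f : α → ℝ → W d, ν ∈ nonres K → DCi T f ∧ (∀ a, f a 0 = -cubd (c a 0) ν) ∧
      ∀ a, ∀ t ∈ Icc 0 T, HasDerivWithinAt (f a) (H a t * f a t
        - sy (fun n => Complex.I * (adv (ε a) (kap ν) n : ℂ)) (f a t)) (Icc 0 T) t := by
    intro ν
    by_cases hν : ν ∈ nonres K
    · have h1 : URap fun a => -cubd (c a 0) ν :=
        ((dci_cubd hc (mem_nonres.1 hν).1 0).urap.comp fun a => (a, ⟨0, hl⟩)).neg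
      obtain ⟨f, hf⟩ := exists_linear_sol hT hε (kap ν) hH h1
      exact ⟨f, fun _ => hf⟩
    · exact ⟨0, fun h => absurd h hν⟩
  choose f hf using hbex
  set bs : α → ℝ → E d × E d × E d → W d := fun a t ν => f ν a t
  have hbd : ∀ ν ∈ nonres K, ∀ a, ∀ t ∈ Icc 0 T, HasDerivWithinAt (fun t => bs a t ν)
      ((-2 * Complex.I * lam) • ((∑ p ∈ K, c a t p * star (c a t p)) * bs a t ν)
        - sy (fun n => Complex.I * (adv (ε a) (kap ν) n : ℂ)) (bs a t ν)) (Icc 0 T) t := by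
    intro ν hν a t ht
    refine ((hf ν hν).2.2 a t ht).congr_deriv ?_
    simp only [H, bs]
    rw [smul_mul_assoc]
  obtain ⟨Lv, hLv, hrem, Rm, hRm0, hRm⟩ := exists_hasL_mfe (lam := lam) hT hε hK hS hc
    (fun ν hν => (hf ν hν).1) hcd hbd
  obtain ⟨ε₀, hε₀, Cu, hCu0, hu⟩ := exists_nls_near hT hε hLv hrem hRm0 hRm
  have hBa : ∀ r, ∃ B : ℕ → ℝ, r ∈ K → ∀ a, SmoothBound T B fun t x => W.val x (c a t r) := fun r => by
    by_cases hr : r ∈ K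
    · obtain ⟨B, hB⟩ := (hc r hr).exists_smoothBound hT
      exact ⟨B, fun _ => hB⟩
    · exact ⟨0, fun h => absurd h hr⟩
  have hBb : ∀ ν, ∃ B : ℕ → ℝ, ν ∈ nonres K → ∀ a,
      (SmoothBound T B fun t x => W.val x (cubd (c a t) ν)) ∧
      SmoothBound T B fun t x => W.val x (bs a t ν) := fun ν => by
    by_cases hν : ν ∈ nonres K
    · obtain ⟨B, hB⟩ := (dci_cubd hc (mem_nonres.1 hν).1).exists_smoothBound hT
      obtain ⟨B', hB'⟩ := (hf ν hν).1.exists_smoothBound hT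
      exact ⟨fun n => max (B n) (B' n), fun _ a => ⟨(hB a).mono fun n => le_max_left _ _,
        (hB' a).mono fun n => le_max_right _ _⟩⟩
    · exact ⟨0, fun h => absurd h hν⟩
  have hCb : ∀ ν, ∃ C, 0 ≤ C ∧ (ν ∈ nonres K → ∀ a, ∃ β : ℝ → W d, DCi T (fun _ : Unit => β) ∧
      β 0 = cubd (c a 0) ν ∧
      (∀ t ∈ Icc 0 T, HasDerivWithinAt β (((-(Complex.I / ε a)) • cub (c a t) ν
        + (Complex.I * delta ν / ε a) • β t)
        - sy (fun n => Complex.I * (adv (ε a) (kap ν) n : ℂ)) (β t)) (Icc 0 T) t) ∧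
      ∀ t ∈ Icc 0 T, ‖cubd (c a t) ν - β t‖ ≤ C * ε a) := fun ν => by
    by_cases hν : ν ∈ nonres K
    · obtain ⟨C, hC0, hC⟩ := exists_quasistationary hT hε (kap ν) (delta_ne_zero hν)
        (dci_cub hc (mem_nonres.1 hν).1)
      exact ⟨C, hC0, fun _ => hC⟩
    · exact ⟨0, le_rfl, fun h => absurd h hν⟩
  choose Ba hBa using hBa
  choose Bb hBb using hBb
  choose Cb hCb0 hCb using hCb
  -- A sum over finitely many indices dominates all individual bounds and gives one sequence for all
  -- functions.
  set B : ℕ → ℝ := fun n => ∑ r ∈ K, |Ba r n| + ∑ ν ∈ nonres K, |Bb ν n|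
  have hB1 : ∀ r ∈ K, ∀ n, Ba r n ≤ B n := fun r hr n => by
    have h1 := Finset.single_le_sum (f := fun r => |Ba r n|) (fun _ _ => abs_nonneg _) hr
    have h2 : 0 ≤ ∑ ν ∈ nonres K, |Bb ν n| := Finset.sum_nonneg fun _ _ => abs_nonneg _
    have h3 := le_abs_self (Ba r n)
    simp only [B] at h1 ⊢
    linarith
  have hB2 : ∀ ν ∈ nonres K, ∀ n, Bb ν n ≤ B n := fun ν hν n => by
    have h1 := Finset.single_le_sum (f := fun ν => |Bb ν n|) (fun _ _ => abs_nonneg _) hν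
    have h2 : 0 ≤ ∑ r ∈ K, |Ba r n| := Finset.sum_nonneg fun _ _ => abs_nonneg _
    have h3 := le_abs_self (Bb ν n)
    simp only [B] at h1 ⊢
    linarith
  have hCs : ∀ ν ∈ nonres K, Cb ν ≤ ∑ ν ∈ nonres K, Cb ν := fun ν hν =>
    Finset.single_le_sum (fun ν _ => hCb0 ν) hν
  have hCs0 : 0 ≤ ∑ ν ∈ nonres K, Cb ν := Finset.sum_nonneg fun ν _ => hCb0 ν
  refine ⟨ε₀, hε₀, B, ∑ ν ∈ nonres K, Cb ν + Cu, fun a ha => ?_⟩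
  obtain ⟨φ, hφ, hφ0, ⟨S, hφS⟩, hφu⟩ := hu a ha
  have hu1 : DCi T fun _ : Unit => fun _ : ℝ => (0 : W d) := fun k => DC.const URap.zero
  have hb0 : ∀ ν ∈ nonres K, bs a 0 ν = -cubd (c a 0) ν := fun ν hν => (hf ν hν).2.1 a
  have hLa := hK a
  have hpos := (hε a).1
  rw [haF a]
  refine ⟨fun t x => W.val x (orig (fun _ : Unit => advs (ε a) (0 : E d) 0) φ () t),
    fun ν t x => W.val x (bs a t ν), ?_, fun ν hν => ?_, fun r hr => (hBa r hr a).mono (hB1 r hr),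
    fun ν hν => ?_, fun ν hν => (hBb ν hν a).2.mono (hB2 ν hν), fun ν hν => ?_, fun t ht x => ?_⟩
  · refine isUniqueOn_of_pev hT (P := nlsPol lam) hu1 (h := fun _ _ => 0)
      (fun t _ x => (W.val_zero x).symm) (fun f hf => (solvesNLS_iff hpos.ne' f).1 hf) ?_
    refine (solvesNLS_iff hpos.ne' _).2 ?_
    have h1 : Rap (φ 0 ()) := by
      rw [hφ0]
      obtain ⟨_, g1, _⟩ := hLv
      exact (g1 a).rap ⟨0, hl⟩
    obtain ⟨p1, p2⟩ := advected_orig (k := fun _ : Unit => (0 : E d)) (σ := fun _ => 0) hT hφ hφS hu1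
      (fun _ => h1) ()
    refine ⟨p1, fun t ht x => ?_, fun x => ?_⟩
    · rw [p2 t ht x, Complex.ofReal_zero, mul_zero, zero_mul, sub_zero, W.val_zero]
    · rw [orig_zero, hφ0]
      exact val_mfe_zero hκ hLa hb0 (hc0 a) x
  · refine isUniqueOn_of_pev hT (P := fun _ => ph * pv ()) (H := H a)
      (fun i => (hH i).comp fun _ => a) (fun t _ x => ?_) (fun f hf => (solvesBStar_iff f).1 hf) ?_
    · simp only [H]
      simp only [W.val_smul, W.val_sum, W.val_mul, W.val_star]
    refine (solvesBStar_iff _).2 ?_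
    obtain ⟨p1, p2⟩ := classical_of_dci hT (fun i => ((hf ν hν).1 i).comp fun _ : Unit => a)
      ((hf ν hν).2.2 a)
    refine ⟨p1, fun t ht x => (p2 t ht x).trans ?_, fun x => ?_⟩
    · simp only [H, pev_mul, pev_ph, pev_pv, W.val_mul, W.val_smul, W.val_sum, W.val_star, bs]
    · change W.val x (bs a 0 ν) = _
      rw [hb0 ν hν, bMod_eq_val, W.val_neg]
  · have h1 : bMod (fun e t x => W.val x (c a t e)) ν = fun t x => W.val x (cubd (c a t) ν) :=
      funext fun t => funext fun x => bMod_eq_val _ ν t x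
    rw [h1]
    exact (hBb ν hν a).1.mono (hB2 ν hν)
  · obtain ⟨β, q1, q2, q3, q4⟩ := hCb ν hν a
    refine ⟨fun t x => W.val x (β t), ?_, fun t ht x => ?_⟩
    · refine isUniqueOn_of_pev hT (P := fun _ => ph + (Complex.I * delta ν / ε a : ℂ) • pv ())
        (H := fun t => (-(Complex.I / ε a)) • cub (c a t) ν)
        (fun i => ((dci_cub hc (mem_nonres.1 hν).1 i).comp fun _ => a).const_smul _) (fun t _ x => ?_)
        (fun f hf => (solvesB_iff f).1 hf) ?_
      · rw [cubic_eq_val, W.val_smul]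
      refine (solvesB_iff _).2 ?_
      obtain ⟨p1, p2⟩ := classical_of_dci hT q1 q3
      refine ⟨p1, fun t ht x => (p2 t ht x).trans ?_, fun x => ?_⟩
      · rw [pev_add, pev_smul, pev_ph, pev_pv, cubic_eq_val, W.val_add, W.val_smul, W.val_smul,
          smul_eq_mul]
      · rw [q2, cubic_eq_val, cubd, W.val_smul]
    · rw [bMod_eq_val, ← W.val_sub]
      refine (W.norm_val_le _ _).trans ((q4 t ht).trans ?_)
      exact mul_le_mul_of_nonneg_right (by linarith [hCs ν hν]) hpos.le
  · rw [← val_mfe hLa, ← W.val_sub]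
    refine (W.norm_val_le _ _).trans ((hφu t ht).trans ?_)
    exact mul_le_mul_of_nonneg_right (by linarith) (by positivity)

end

end MFE

/-! ### Assembly of the theorem. -/

theorem theorem7p1 {d M : ℕ} (lam : ℝ) (κ : Fin M → E d) (hκ : Function.Injective κ)
    (kstar : ℕ) (hsat : waveSet κ (kstar + 1) = waveSet κ kstar)
    (hnonres : Nonresonance (waveSet κ kstar))
    (a0 : ℝ → Fin M → E d → ℂ) (ha0 : SmoothProfiles κ a0) :
    (∃ T > 0, ExistenceTime lam κ (waveSet κ kstar) a0 T) ∧
    ∀ T > 0, ExistenceTime lam κ (waveSet κ kstar) a0 T →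
      ∃ ε₀ > 0, ∃ (B : ℕ → ℝ) (C : ℝ), ∀ ε, Admissible κ ε → ε < ε₀ →
        ∃ (u : ℝ → E d → ℂ) (a : E d → ℝ → E d → ℂ) (bs : E d × E d × E d → ℝ → E d → ℂ),
          IsUniqueOn T (SolvesNLS T ε lam κ (a0 ε)) u ∧
          SolvesA T ε lam κ (waveSet κ kstar) (a0 ε) a ∧
          (∀ a', SolvesA T ε lam κ (waveSet κ kstar) (a0 ε) a' →
            ∀ r ∈ waveSet κ kstar, ∀ t ∈ Set.Icc 0 T, ∀ x, a' r t x = a r t x) ∧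
          (∀ ν ∈ nonres (waveSet κ kstar),
            IsUniqueOn T (SolvesBStar T ε lam (waveSet κ kstar) a ν) (bs ν)) ∧
          (∀ r ∈ waveSet κ kstar, SmoothBound T B (a r)) ∧
          (∀ ν ∈ nonres (waveSet κ kstar), SmoothBound T B (bMod a ν)) ∧
          (∀ ν ∈ nonres (waveSet κ kstar), SmoothBound T B (bs ν)) ∧
          (∀ ν ∈ nonres (waveSet κ kstar), ∃ β : ℝ → E d → ℂ,
            IsUniqueOn T (SolvesB T ε a ν) β ∧
            ∀ t ∈ Set.Icc 0 T, ∀ x, ‖bMod a ν t x - β t x‖ ≤ C * ε) ∧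
          ∀ t ∈ Set.Icc 0 T, ∀ x,
            ‖u t x - uMFE ε lam (waveSet κ kstar) a bs t x‖ ≤ C * ε ^ 2 := by
  obtain ⟨c, hc, hcv⟩ := exists_initial_coeff ha0
  set K := waveSet κ kstar
  have hε : ∀ e : {ε : ℝ // Admissible κ ε ∧ ε ≤ 1}, 0 < e.1 ∧ e.1 ≤ 1 := fun e =>
    ⟨e.2.1.1, e.2.2⟩
  have hX : ∀ i : K, URap fun e => initW κ (c e) (i : E d) := fun i => urap_initW hc i
  have hXv : ∀ e (i : K) x, W.val x (initW κ (c e) (i : E d)) = initMod κ (a0 e) i x := fun e i x =>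
    val_initW x (fun m => hcv e m x) i
  refine ⟨?_, fun T hT hex => ?_⟩
  · obtain ⟨T, hT, R, h⟩ := exists_existenceTime (lam := lam) (K := K)
      (X := fun e (i : K) => initW κ (c e) (i : E d)) hε hX
    -- The threshold 1 enters because the initial profiles are controlled only for ε ≤ 1.
    refine ⟨T, hT, 1, one_pos, R, fun ε hadm hε1 => ?_⟩
    obtain ⟨ψ, h1, h2, h3⟩ := h ⟨ε, hadm, hε1.le⟩
    refine ⟨aFun K ε ψ, solvesA_of_sol hT h1 h3 (fun i => ?_) (fun i x => ?_), fun r hr t ht x => ?_⟩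
    · rw [h2]; exact (hX i).comp fun _ : Unit => _
    · rw [h2]; exact hXv ⟨ε, hadm, hε1.le⟩ i x
    · rw [aFun, extz_of_mem _ hr]
      exact (W.norm_val_le _ _).trans (norm_orig_le (h3 t ht) _)
  · obtain ⟨ε₁, hε₁, B, hB⟩ := hex
    obtain ⟨ε₀, hε₀, R, h⟩ := exists_uniform_sol (lam := lam) (κ := κ) (K := K) (a0 := a0)
      (X := fun e (i : K) => initW κ (c e) (i : E d)) hε hX hXv hT hε₁ fun e he =>
        hB e.1 e.2.1 he
    -- The small admissible ε become the index set of one family of solutions, so that all later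
    -- constants are uniform in ε by construction.
    choose ψ h1 h2 h3 using fun e : {e : {ε : ℝ // Admissible κ ε ∧ ε ≤ 1} // e.1 < ε₀} => h e.1 e.2
    have h0 : ∀ i : K, URap fun e => ψ e 0 i := fun i => by
      have := (hX i).comp fun e : {e : {ε : ℝ // Admissible κ ε ∧ ε ≤ 1} // e.1 < ε₀} => e.1
      simpa only [h2] using this
    have hi : ∀ e (i : K) x, W.val x (ψ e 0 i) = initMod κ (a0 e.1) i x := fun e i x => by
      rw [h2]; exact hXv e.1 i x
    obtain ⟨ε₂, hε₂, B, C, hmain⟩ := exists_expansion (a0 := fun e => a0 e.1.1) hT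
      (fun e => hε e.1) (fun e => lat_waveSet e.1.2.1 kstar) (sat_waveSet hsat hnonres)
      (fun m => mem_waveSet κ m kstar) h1 h3 h0 hi
    refine ⟨min (min ε₀ ε₂) 1, by positivity, B, C, fun ε hadm hlt => ?_⟩
    have l1 : ε < ε₀ := hlt.trans_le ((min_le_left _ _).trans (min_le_left _ _))
    have l2 : ε < ε₂ := hlt.trans_le ((min_le_left _ _).trans (min_le_right _ _))
    have l3 : ε ≤ 1 := (hlt.trans_le (min_le_right _ _)).le
    obtain ⟨u, bs, g1, g2⟩ := hmain ⟨⟨ε, hadm, l3⟩, l1⟩ l2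
    have hA := solvesA_of_sol hT (h1 ⟨⟨ε, hadm, l3⟩, l1⟩) (h3 ⟨⟨ε, hadm, l3⟩, l1⟩)
      (fun i => (h0 i).comp fun _ : Unit => _) (hi _)
    exact ⟨u, _, bs, g1, hA, fun a' ha' => hA.unique hT ha', g2⟩
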